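/- **Setting.** Let $c\in C^4(\mathbb R^n\times\mathbb R^n)$ and let $\Omega,\Omega^*\subset\mathbb R^n$ be bounded domains with $C^4$ boundaries. Subscripts before (after) a comma denote derivatives of $c$ in $x$ (in $y$), and $[c^{i,j}]$ is the inverse matrix of $[c_{i,j}]$. Assume: * (A1) for every $x$ in some open neighbourhood of $\overline\Omega$ and every $p\in\mathbb R^n$ there is a unique $y=Y(x,p)\in\mathbb R^n$ with $c_x(x,y)=p$; for every $y\in\overline{\Omega}^*$ and every $q\in\mathbb R^n$ there is a unique $x=X(q,y)\in\mathbb R^n$ with $c_y(x,y)=q$; * (A2) $\det c_{x,y}(x,y)\ne0$ for all $x\in\overline\Omega$, $y\in\overline\Omega^*$; * (A3w) with $A(x,p)=c_{xx}(x,Y(x,p))$, $D_{p_ip_j}A_{kl}(x,p)\,\xi_i\xi_j\eta_k\eta_l\ge0$ for all $x\in\Omega$, $p\in c_x(x,\cdot)(\Omega^*)$ and $\xi\perp\eta$ in $\mathbb R^n$; * $\Omega$ is uniformly $c$-convex with respect to $\Omega^*$, that is, $\partial\Omega\in C^2$, $c_y(\cdot,y)(\Omega)$ is convex for each $y\in\Omega^*$,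 and for some constant $\delta_0>0$ $$[D_i\gamma_j(x)-c^{l,k}c_{ij,l}(x,y)\gamma_k(x)]\tau_i\tau_j\ge\delta_0\qquad(1)$$ for all $x\in\partial\Omega$, $y\in\Omega^*$ and unit tangent vectors $\tau$ at $x$, where $\gamma$ is the outer unit normal; and $\Omega^*$ is uniformly $c^*$-convex with respect to $\Omega$, that is, the same holds with the roles of $\Omega,\Omega^*$ exchanged and $c$ replaced by $c^*(y,x)=c(x,y)$. **Notions.** A continuous function $u$ on a set $D$ is $c$-convex in $D$ if for each $x_0\in D$ there is $y_0\in\mathbb R^n$ with $u(x)\ge u(x_0)+c(x,y_0)-c(x_0,y_0)$ for all $x\in D$; the set of all such $y_0$ is $\chi_u(x_0)$, and the $c$-normal image of $u$ is $\bigcup_{x_0\in D}\chi_u(x_0)$. A function $u$ is elliptic on a set if $D^2u-A(\cdot,Du)$ is positive definite there; $Tu=Y(\cdot,Du)$. The $c$-segment with respect to $y$ joining $x$ to $x'$ is the set of all $z$ for which $c_y(z,y)$ lies on the straight segment from $c_y(x,y)$ to $c_y(x',y)$. A $c$-function is a function $h=c(\cdot,y)+a$ with $y\in\mathbb R^n$,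 $a\in\mathbb R$. For $\delta>0$ put $\Omega^\delta=\{x:\operatorname{dist}(x,\Omega)<\delta\}$. **(I)** Let $u_0\in C^\infty(\overline\Omega)$ be $c$-convex and elliptic in $\Omega$, such that $\omega^*=Tu_0(\Omega)$ is $c^*$-convex with respect to $\Omega$ (that is, $c_x(x,\cdot)(\omega^*)$ is convex for each $x\in\Omega$) and $\overline{\omega^*}\subset\Omega^*$. Let $\mathcal S$ be the set of $c$-functions $h$ with $h\le u_0$ in $\Omega$ and $Th(\Omega)\subset\Omega^*$, and let $u_1(x)$ be the supremum of the values $h(x)$, $h\in\mathcal S$, together with $u_0(x)$ if $x\in\Omega$. Then there is a $\delta_1>0$ such that for every $0<\delta\le\delta_1$: 1. on $\Omega^\delta$ this supremum is finite, $u_1$ is $c$-convex in $\Omega^\delta$, and $u_1=u_0$ on $\overline\Omega$; 2. the $c$-normal image of $u_1$ as a function on $\Omega^\delta$ is $\overline\Omega^*$; 3. for every $x\in\Omega^\delta\setminus\overline\Omega$ there is a unique pair of points $x_b\in\partial\Omega$, $y_b\in\partial\Omega^*$ such that the $c$-segment with respect to $y_b$ joining $x$ to $x_b$ lies in $\Omega^\delta$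 and $\chi_{u_1}(z)=\{y_b\}$ for each of its points $z\ne x_b$; 4. for every $0<r<\delta$ the maps $x\mapsto x_b$ and $x\mapsto y_b$ are $C^2$ diffeomorphisms of $\partial\Omega^r$ onto $\partial\Omega$ and onto $\partial\Omega^*$, respectively. **(II)** There is a constant $\delta_2>0$ such that for every $\varepsilon>0$ there exist a bounded domain $\Omega^*_\varepsilon$ and a function $u\in C^\infty(\overline\Omega)$ such that $\Omega^*_\varepsilon$ is uniformly $c^*$-convex with respect to $\Omega$, with constant $\delta_2$ in the condition corresponding to (1); each of $\Omega^*_\varepsilon,\Omega^*$ lies in the $\varepsilon$-neighbourhood of the other; $u$ is $c$-convex in $\Omega$ and elliptic on $\overline\Omega$; and $Tu(\Omega)=\Omega^*_\varepsilon$. -/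

import Mathlib

open Set Filter Topology
open scoped ContDiff

namespace OptTrans

noncomputable section

/-- Euclidean `n`-space. -/
abbrev E (n : ℕ) : Type := EuclideanSpace ℝ (Fin n)

/-! ### Derivatives of the cost function -/

/-- The cost with its two arguments interchanged, `c*(y, x) = c(x, y)`. -/
def swapCost {n : ℕ} (c : E n → E n → ℝ) : E n → E n → ℝ := fun y x => c x y

/-- `c_x(x, y)`. -/
def cX {n : ℕ} (c : E n → E n → ℝ) (x y : E n) : E n := gradient (fun z => c z y) x

/-- `c_y(x, y)`. -/
def cY {n : ℕ} (c : E n → E n → ℝ) (x y : E n) : E n := gradient (fun z => c x z) y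

/-- The Hessian `D²f(x)` as an operator. -/
def hess {n : ℕ} (f : E n → ℝ) (x : E n) : E n →L[ℝ] E n := fderiv ℝ (gradient f) x

/-- The matrix `c_{xx}(x, y) = [c_{ij}]`. -/
def cXX {n : ℕ} (c : E n → E n → ℝ) (x y : E n) : E n →L[ℝ] E n := hess (fun z => c z y) x

/-- The matrix `c_{x,y}(x, y) = [c_{i,j}]`: the derivative of `c_x(x, ·)` at `y`. -/
def cXY {n : ℕ} (c : E n → E n → ℝ) (x y : E n) : E n →L[ℝ] E n := fderiv ℝ (fun z => cX c x z) y

/-- The inverse matrix `[c^{i,j}]` of `[c_{i,j}]`. -/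
def cInv {n : ℕ} (c : E n → E n → ℝ) (x y : E n) : E n →L[ℝ] E n := (cXY c x y).inverse

/-- `Y(x, p)`: the solution `y` of `c_x(x, y) = p`. -/
def Ymap {n : ℕ} (c : E n → E n → ℝ) (x p : E n) : E n := Function.invFun (fun y => cX c x y) p

/-- `A(x, p) = c_{xx}(x, Y(x, p))`. -/
def Amat {n : ℕ} (c : E n → E n → ℝ) (x p : E n) : E n →L[ℝ] E n := cXX c x (Ymap c x p)

/-- `Tu(x) = Y(x, Du(x))`. -/
def Tmap {n : ℕ} (c : E n → E n → ℝ) (u : E n → ℝ) (x : E n) : E n := Ymap c x (gradient u x)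

/-! ### Conditions on the cost -/

/-- A1 for `x ∈ U` and `y ∈ V`. -/
def CondA1 {n : ℕ} (c : E n → E n → ℝ) (U V : Set (E n)) : Prop :=
  (∀ x ∈ U, ∀ p : E n, ∃! y : E n, cX c x y = p) ∧
    (∀ y ∈ V, ∀ q : E n, ∃! x : E n, cY c x y = q)

/-- A2: `det c_{x,y} ≠ 0` on the product of the closures. -/
def CondA2 {n : ℕ} (c : E n → E n → ℝ) (Ω Ωs : Set (E n)) : Prop :=
  ∀ x ∈ closure Ω, ∀ y ∈ closure Ωs, (cXY c x y).det ≠ 0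

/-- A3w: `D_{p_i p_j} A_{kl}(x, p) ξ_i ξ_j η_k η_l ≥ 0` for `ξ ⊥ η`, where `x ∈ Ω` and `p` ranges
over `c_x(x, Ω*)`. -/
def CondA3w {n : ℕ} (c : E n → E n → ℝ) (Ω Ωs : Set (E n)) : Prop :=
  ∀ x ∈ Ω, ∀ p ∈ (fun y => cX c x y) '' Ωs, ∀ ξ η : E n, inner ℝ ξ η = 0 →
    0 ≤ iteratedFDeriv ℝ 2 (fun p' : E n => inner ℝ (Amat c x p' η) η) p ![ξ, ξ]

/-! ### Domains -/

/-- A bounded domain. -/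
def IsBddDomain {n : ℕ} (Ω : Set (E n)) : Prop :=
  IsOpen Ω ∧ IsConnected Ω ∧ Bornology.IsBounded Ω

/-- `∂Ω ∈ C^k`: near every boundary point, `Ω` is a sublevel set of a `C^k` function with
non-vanishing differential. -/
def HasBoundaryOfClass {n : ℕ} (k : ℕ∞) (Ω : Set (E n)) : Prop :=
  ∀ x ∈ frontier Ω, ∃ φ : E n → ℝ, ContDiff ℝ k φ ∧ fderiv ℝ φ x ≠ 0 ∧
    ∀ᶠ z in 𝓝 x, (z ∈ Ω ↔ φ z < 0)

/-- `ν` is the outer unit normal of `Ω` at the boundary point `x`. -/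
def IsOuterUnitNormal {n : ℕ} (Ω : Set (E n)) (x ν : E n) : Prop :=
  ‖ν‖ = 1 ∧ ∀ v : E n,
    (inner ℝ v ν < 0 → ∀ᶠ t : ℝ in 𝓝[>] 0, x + t • v ∈ Ω) ∧
    (0 < inner ℝ v ν → ∀ᶠ t : ℝ in 𝓝[>] 0, x + t • v ∉ closure Ω)

/-- `Ω` is `c`-convex with respect to `Ω*`: `c_y(·, y)(Ω)` is convex for every `y ∈ Ω*`. -/
def IsCConvexDomain {n : ℕ} (c : E n → E n → ℝ) (Ω Ωs : Set (E n)) : Prop :=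
  ∀ y ∈ Ωs, Convex ℝ ((fun x => cY c x y) '' Ω)

/-- `Ω` is uniformly `c`-convex with respect to `Ω*`, with constant `δ₀`: it is `c`-convex, its
boundary is `C²`, and `[D_i γ_j(x) - c^{l,k} c_{ij,l}(x, y) γ_k(x)] τ_i τ_j ≥ δ₀` for
`x ∈ ∂Ω`, `y ∈ Ω*` and unit tangent vectors `τ` at `x`. The outer unit normal field is taken as
the restriction to `∂Ω` of a `C¹` field `γ` (only tangential derivatives of it occur), and
`c_{ij,l} τ_i τ_j w_l` is the derivative of `c_{ij}(x, ·) τ_i τ_j` along `w = [c^{l,k} γ_k]`. -/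
def IsUnifCConvexDomainWith {n : ℕ} (δ₀ : ℝ) (c : E n → E n → ℝ) (Ω Ωs : Set (E n)) : Prop :=
  IsCConvexDomain c Ω Ωs ∧ HasBoundaryOfClass 2 Ω ∧
    ∃ γ : E n → E n, ContDiff ℝ 1 γ ∧ (∀ x ∈ frontier Ω, IsOuterUnitNormal Ω x (γ x)) ∧
      ∀ x ∈ frontier Ω, ∀ y ∈ Ωs, ∀ τ : E n, ‖τ‖ = 1 → inner ℝ τ (γ x) = 0 →
        δ₀ ≤ inner ℝ (fderiv ℝ γ x τ) τ -
          fderiv ℝ (fun y' => inner ℝ (cXX c x y' τ) τ) y (cInv c x y (γ x))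

/-- `Ω` is uniformly `c`-convex with respect to `Ω*`. Uniform `c*`-convexity is this notion for
`swapCost c`. -/
def IsUnifCConvexDomain {n : ℕ} (c : E n → E n → ℝ) (Ω Ωs : Set (E n)) : Prop :=
  ∃ δ₀ : ℝ, 0 < δ₀ ∧ IsUnifCConvexDomainWith δ₀ c Ω Ωs

/-- The `c`-segment with respect to `y` joining `x₀` and `x₁`: the preimage under `c_y(·, y)` of
the straight segment joining the images of `x₀` and `x₁`. -/
def cSegment {n : ℕ} (c : E n → E n → ℝ) (y x₀ x₁ : E n) : Set (E n) :=
  {z | cY c z y ∈ segment ℝ (cY c x₀ y) (cY c x₁ y)}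

/-! ### `c`-convex functions -/

/-- `u` is `c`-convex in `D`. -/
def IsCConvexOn {n : ℕ} (c : E n → E n → ℝ) (D : Set (E n)) (u : E n → ℝ) : Prop :=
  ContinuousOn u D ∧ ∀ x₀ ∈ D, ∃ y₀ : E n, ∀ x ∈ D, u x₀ + c x y₀ - c x₀ y₀ ≤ u x

/-- The `c`-normal mapping `χ_u` of a function `u` on `D`. -/
def cNormal {n : ℕ} (c : E n → E n → ℝ) (D : Set (E n)) (u : E n → ℝ) (x₀ : E n) : Set (E n) :=
  {y₀ | ∀ x ∈ D, u x₀ + c x y₀ - c x₀ y₀ ≤ u x}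

/-- Ellipticity on `S`: `D²u - A(·, Du) > 0`. -/
def IsEllipticOn {n : ℕ} (c : E n → E n → ℝ) (S : Set (E n)) (u : E n → ℝ) : Prop :=
  ∀ x ∈ S, ∀ ξ : E n, ξ ≠ 0 → 0 < inner ℝ ((hess u x - Amat c x (gradient u x)) ξ) ξ

/-- A function `u₀` from which the construction starts: `u₀ ∈ C^∞(closure Ω)` (given through a
smooth extension, of which only the values on the closure of `Ω` matter) is `c`-convex and elliptic
in `Ω`, and `Tu₀` maps `Ω` onto a `c*`-convex set `ω*` whose closure lies in `Ω*`. -/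
structure IsStartFunction {n : ℕ} (c : E n → E n → ℝ) (Ω Ωs : Set (E n)) (u₀ : E n → ℝ) :
    Prop where
  smooth : ContDiff ℝ ∞ u₀
  cConvex : IsCConvexOn c Ω u₀
  elliptic : IsEllipticOn c Ω u₀
  image_cConvex : IsCConvexDomain (swapCost c) (Tmap c u₀ '' Ω) Ω
  image_closure_subset : closure (Tmap c u₀ '' Ω) ⊆ Ωs

/-- A `c`-function `h = c(·, y) + a`. -/
def IsCFunction {n : ℕ} (c : E n → E n → ℝ) (h : E n → ℝ) : Prop :=
  ∃ (y : E n) (a : ℝ), h = fun x => c x y + a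

/-- The set of admissible `c`-functions: those with `h ≤ u₀` in `Ω` and `Th(Ω) ⊆ Ω*`. -/
def admissible {n : ℕ} (c : E n → E n → ℝ) (Ω Ωs : Set (E n)) (u₀ : E n → ℝ) :
    Set (E n → ℝ) :=
  {h | IsCFunction c h ∧ (∀ x ∈ Ω, h x ≤ u₀ x) ∧ Tmap c h '' Ω ⊆ Ωs}

/-- The values at `x` of the admissible `c`-functions and (where it is defined, that is, for
`x ∈ Ω`) of `u₀`. -/
def envelopeValues {n : ℕ} (c : E n → E n → ℝ) (Ω Ωs : Set (E n)) (u₀ : E n → ℝ) (x : E n) :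
    Set ℝ :=
  {s | x ∈ Ω ∧ s = u₀ x} ∪ {s | ∃ h ∈ admissible c Ω Ωs u₀, s = h x}

/-- `u₁ = sup {u₀, h}`. -/
def envelope {n : ℕ} (c : E n → E n → ℝ) (Ω Ωs : Set (E n)) (u₀ : E n → ℝ) (x : E n) : ℝ :=
  sSup (envelopeValues c Ω Ωs u₀ x)

/-- On the `c`-segment with respect to `yb` joining `x` to `xb`, the endpoint `xb` excepted, the
`c`-normal mapping of the function `u` on `D` takes the single value `yb`. -/
def IsRayTo {n : ℕ} (c : E n → E n → ℝ) (D : Set (E n)) (u : E n → ℝ) (x xb yb : E n) : Prop :=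
  cSegment c yb x xb ⊆ D ∧ ∀ z ∈ cSegment c yb x xb, z ≠ xb → cNormal c D u z = {yb}

/-- `f` is a `C^k` diffeomorphism of the compact hypersurface `M` onto `N`: a bijection such that
it and its inverse are restrictions of `C^k` maps. -/
def IsDiffeoOn {n : ℕ} (k : ℕ∞) (f : E n → E n) (M N : Set (E n)) : Prop :=
  BijOn f M N ∧ (∃ F : E n → E n, ContDiff ℝ k F ∧ EqOn F f M) ∧
    ∃ G : E n → E n, ContDiff ℝ k G ∧ ∀ x ∈ M, G (f x) = x

end

end OptTrans

/-!
The cost is normalised first: `exists_setup` replaces the hypotheses by globally defined `C³` maps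
`X`, `Y` inverting `c_y(·, y)` and `c_x(x, ·)`, by global defining functions `φ`, `φs` of the two
domains, and by closed forms, valid up to the boundaries, of A3w and of uniform `c`-convexity. All
of this is symmetric in the two domains (`Setup.swap`), and every lemma is used in both directions.

The analytic core is the quantitative form of A3w, `A_{ww}ξξ ≥ -K |w·ξ| |w| |ξ|` for all `w` and `ξ`
(`exists_Aform_lower_bound`). In the coordinates `q = c_y(x, y)` it gives, for a subsolution `u`, a
lower bound of the second derivative of `u - c(·, y)` by the modulus of its first derivative, hence
monotonicity of `u - c(·, y)` along `c`-segments (`monotoneOn_cSegment`): a critical point is a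
global minimum, and, by uniform convexity of the domain, a focus `y` outside the image of `Tu` has a
single contact point, which lies on `∂Ω` (`isMinimizer_unique`). It depends smoothly on `y`, by the
inverse function theorem for `(x, s) ↦ (Y(x, Du + s∇φ), φ)` (`exists_contact_map`).

*The envelope.* By duality `u₁(x)` is the maximum over `y` in the closure of `Ω*` of
`c(x, y) + m(y)`, where `m(y)` is the minimum of `u₀ - c(·, y)`. For `x` outside `Ω` a maximising
`y` must lie on `∂Ω*`, and Danskin's argument shows that `c_y(x, y) - c_y(x_b, y)` is a positive
multiple of `∇φs(y)`, where `x_b` is the contact point of `y` (`exists_normal_ray`). So the points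
outside `Ω` with focus `y` lie on the ray `Z(y, t) = X(y, c_y(x_b, y) + t ∇φs(y))`. The rays are
transversal to `∂Ω` and distinct foci have distinct contact points (`focus_unique`), so that
`(y, t) ↦ Z(y, t)` is a `C³` coordinate system in an outer collar of `Ω`, in which `t` may be
replaced by the distance to `Ω` (`exists_ray_coordinates`). All properties of `u₁` are read off in
these coordinates (`envelope_properties`).

*The approximation.* The `c`-cone with vertex `x₀ ∈ Ω`, the maximum over `y` of
`c(·, y) - c(x₀, y)`, is the same construction with the roles of the domains exchanged, and it
sends `∂Ω` onto points of `∂Ω*`. It is degenerate in the radial direction and singular at `x₀`. It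
is therefore joined to `c(·, y₀)` near `x₀`: if `σ` is its excess over `c(·, y₀)`, less a small
constant, one takes `c(·, y₀) + F(σ)` with `F' = 1 - exp(-Λ σ₊²)`. The gradient then stays on the
segments of `c_x(x, Ω*)`, and semiconvexity of `A` along them (A3w) is beaten by `F''` for large
`Λ` (`ellipticity_of_profile`); a small bump at `x₀` and a mollification make the function smooth
and strictly elliptic (`exists_joined_family`). Near `∂Ω` the resulting maps form a `C²` family in
the parameters `1/Λ` and the radius of mollification, up to the value zero of the parameters, where
they take `∂Ω` into `∂Ω*`. Hence the images of `∂Ω` have defining functions `C²`-close to `φs`, and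
the curvature condition with half the constant (`exists_perturbed_defining`). A strictly elliptic
function whose gradients lie in `c_x(x, Ω*)` is `c`-convex, and its map `Tu` is a diffeomorphism of
the closure of `Ω` onto its image, a domain with the transported boundary (`image_T_properties`);
`c`-convexity of that domain follows from its curvature by a continuity argument
(`convex_image_of_curv`).
-/

namespace OptTrans

/-! ### Inverse functions and extensions of smooth maps -/

section Inverse

variable {V W : Type*} [NormedAddCommGroup V] [NormedSpace ℝ V] [FiniteDimensional ℝ V]
  [NormedAddCommGroup W] [NormedSpace ℝ W] [FiniteDimensional ℝ W]

omit [FiniteDimensional ℝ W] in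
/-- A function that is `C^k` near a compact set agrees near that set with a `C^k` function on the
whole space. -/
theorem exists_contDiff_eqOn_nhds {k : ℕ} {K O : Set V} (hK : IsCompact K) (hO : IsOpen O)
    (hKO : K ⊆ O) {f : V → W} (hf : ∀ x ∈ O, ContDiffAt ℝ k f x) :
    ∃ g : V → W, ContDiff ℝ k g ∧ ∃ O', IsOpen O' ∧ K ⊆ O' ∧ O' ⊆ O ∧ EqOn g f O' := by
  obtain ⟨χ, h0, h1, -⟩ := exists_contMDiffMap_zero_one_nhds_of_isClosed (n := (k : ℕ∞))
    (modelWithCornersSelf ℝ V)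
    hO.isClosed_compl hK.isClosed (disjoint_left.mpr fun x hx hxK => hx (hKO hxK))
  have hχ : ContDiff ℝ k χ := χ.contMDiff.contDiff
  refine ⟨fun x => χ x • f x, ?_, interior {x | χ x = 1} ∩ O, isOpen_interior.inter hO, ?_,
    inter_subset_right, ?_⟩
  · rw [contDiff_iff_contDiffAt]
    intro x
    by_cases hx : x ∈ O
    · exact hχ.contDiffAt.smul (hf x hx)
    · have : (fun x => χ x • f x) =ᶠ[𝓝 x] fun _ => 0 := by
        filter_upwards [(Filter.Eventually.filter_mono (nhds_le_nhdsSet hx) h0)] with z hz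
        simp [hz]
      exact contDiffAt_const.congr_of_eventuallyEq this
  · intro x hx
    refine ⟨?_, hKO hx⟩
    rw [mem_interior_iff_mem_nhds]
    exact Filter.Eventually.filter_mono (nhds_le_nhdsSet hx) h1
  · intro x hx
    have : χ x = 1 := interior_subset (s := {x | χ x = 1}) hx.1
    simp [this]

/-- Inverse function theorem around a compact set. -/
theorem exists_contDiff_leftInverse {k : ℕ} (hk : k ≠ 0) {F : V → W} (hF : ContDiff ℝ k F)
    {K : Set V} (hK : IsCompact K) (hinj : InjOn F K)
    (hder : ∀ x ∈ K, ∀ v, fderiv ℝ F x v = 0 → v = 0)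
    (hdim : Module.finrank ℝ V = Module.finrank ℝ W) :
    ∃ G : W → V, ContDiff ℝ k G ∧ ∃ O, IsOpen O ∧ K ⊆ O ∧ (∀ x ∈ O, G (F x) = x) ∧
      IsOpen (F '' O) := by
  have hk' : ((k : ℕ) : WithTop ℕ∞) ≠ 0 := by exact_mod_cast hk
  have hk1 : (1 : WithTop ℕ∞) ≤ (k : ℕ) := by
    exact_mod_cast Nat.one_le_iff_ne_zero.mpr hk
  have hcd : Continuous (fderiv ℝ F) := hF.continuous_fderiv hk'
  -- an invertible derivative at a point gives a local inverse
  have key : ∀ x, (∀ v, fderiv ℝ F x v = 0 → v = 0) →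
      ∃ f' : V ≃L[ℝ] W, HasFDerivAt F (f' : V →L[ℝ] W) x := by
    intro x hx
    have hi : Function.Injective (fderiv ℝ F x : V →ₗ[ℝ] W) := by
      rw [← LinearMap.ker_eq_bot, LinearMap.ker_eq_bot']
      exact hx
    refine ⟨(LinearMap.linearEquivOfInjective (fderiv ℝ F x : V →ₗ[ℝ] W) hi hdim
      ).toContinuousLinearEquiv, ?_⟩
    have h2 := (hF.differentiable hk').differentiableAt (x := x) |>.hasFDerivAt
    convert h2 using 1
    ext v
    simp [LinearMap.linearEquivOfInjective_apply]
  let R : Set V := {x | ∀ v, fderiv ℝ F x v = 0 → v = 0}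
  have hRo : IsOpen R := by
    rw [isOpen_iff_mem_nhds]
    intro x hx
    obtain ⟨f', hf'⟩ := key x hx
    have hmem : range ((↑) : (V ≃L[ℝ] W) → V →L[ℝ] W) ∈ 𝓝 (fderiv ℝ F x) := by
      rw [hf'.fderiv]; exact ContinuousLinearEquiv.nhds f'
    filter_upwards [hcd.continuousAt.preimage_mem_nhds hmem] with z hz
    obtain ⟨e, he⟩ := hz
    intro v hv
    rw [← he] at hv
    simpa using hv
  have hloc : ∀ x ∈ R, ∃ u ∈ 𝓝 x, InjOn F u := by
    intro x hx
    obtain ⟨f', hf'⟩ := key x hx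
    have hs := hF.contDiffAt.hasStrictFDerivAt' (x := x) hf' hk'
    exact ⟨_, (hs.toOpenPartialHomeomorph F).open_source.mem_nhds
      hs.mem_toOpenPartialHomeomorph_source, (hs.toOpenPartialHomeomorph F).injOn⟩
  obtain ⟨t, hto, hKt, htinj⟩ := hinj.exists_isOpen_superset hK
    (fun x _ => hF.continuous.continuousAt) (fun x hx => hloc x (hder x hx))
  have hopen : ∀ s : Set V, IsOpen s → s ⊆ R → IsOpen (F '' s) := by
    intro s hs hsR
    rw [isOpen_iff_mem_nhds]
    rintro _ ⟨x, hx, rfl⟩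
    obtain ⟨f', hf'⟩ := key x (hsR hx)
    have hst := hF.contDiffAt.hasStrictFDerivAt' (x := x) hf' hk'
    rw [← hst.map_nhds_eq_of_equiv]
    exact image_mem_map (hs.mem_nhds hx)
  let O : Set V := t ∩ R
  have hOo : IsOpen O := hto.inter hRo
  have hOinj : InjOn F O := htinj.mono inter_subset_left
  rcases isEmpty_or_nonempty V with hV | hV
  · exact (hV.false 0).elim
  let G0 : W → V := Function.invFunOn F O
  have hG0 : ∀ x ∈ O, G0 (F x) = x := fun x hx => hOinj.leftInvOn_invFunOn hx
  have hG0d : ∀ w ∈ F '' O, ContDiffAt ℝ k G0 w := by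
    rintro _ ⟨x, hx, rfl⟩
    obtain ⟨f', hf'⟩ := key x hx.2
    have hst := hF.contDiffAt (x := x)
    have hl := hst.to_localInverse hf' hk'
    refine hl.congr_of_eventuallyEq ?_
    have hs := hst.hasStrictFDerivAt' hf' hk'
    have e1 := hs.eventually_right_inverse
    have hcont : ContinuousAt (hst.localInverse hf' hk') (F x) := hl.continuousAt
    have e2 : ∀ᶠ w in 𝓝 (F x), hst.localInverse hf' hk' w ∈ O := by
      apply hcont.eventually_mem
      rw [hst.localInverse_apply_image hf' hk']
      exact hOo.mem_nhds hx
    filter_upwards [e1, e2] with w h1 h2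
    have h3 : F (hst.localInverse hf' hk' w) = w := h1
    conv_lhs => rw [← h3]
    exact hG0 _ h2
  obtain ⟨G, hG, O', hO'o, hKO', hO'O, hGe⟩ := exists_contDiff_eqOn_nhds
    (hK.image hF.continuous) (hopen O hOo inter_subset_right)
    (image_mono (fun x hx => ⟨hKt hx, hder x hx⟩)) hG0d
  refine ⟨G, hG, O ∩ F ⁻¹' O', hOo.inter (hO'o.preimage hF.continuous),
    fun x hx => ⟨⟨hKt hx, hder x hx⟩, hKO' (mem_image_of_mem F hx)⟩, ?_,
    hopen _ (hOo.inter (hO'o.preimage hF.continuous)) fun x hx => hx.1.2⟩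
  intro x hx
  rw [hGe hx.2, hG0 x hx.1]

omit [FiniteDimensional ℝ V] in
/-- Two linear functionals, the second nonnegative where the first is negative, are
proportional. -/
theorem exists_eq_neg_smul_of_nonneg {l m : V →L[ℝ] ℝ} (hl : l ≠ 0)
    (h : ∀ v, l v < 0 → 0 ≤ m v) : ∃ s : ℝ, 0 ≤ s ∧ m = -s • l := by
  obtain ⟨e, he⟩ : ∃ e, l e = -1 := by
    obtain ⟨v, hv⟩ : ∃ v, l v ≠ 0 := by
      by_contra! hc
      exact hl (ContinuousLinearMap.ext hc)
    exact ⟨(-(l v)⁻¹) • v, by simp [hv]⟩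
  have hker : ∀ v, l v = 0 → 0 ≤ m v := by
    intro v hv
    by_contra! hneg
    have h1 := h (e + ((m e + 1) / (-(m v))) • v) (by simp [hv, he])
    simp only [map_add, map_smul, smul_eq_mul] at h1
    rw [div_mul_eq_mul_div, div_neg, mul_div_assoc, div_self hneg.ne] at h1
    linarith
  have hker' : ∀ v, l v = 0 → m v = 0 := fun v hv => le_antisymm
    (by have := hker (-v) (by simp [hv]); simpa using this) (hker v hv)
  refine ⟨m e, h e (by rw [he]; norm_num), ?_⟩
  ext v
  have := hker' (v + l v • e) (by simp [he])
  simp only [map_add, map_smul, smul_eq_mul] at this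
  simp
  linarith

end Inverse

/-! ### Second derivatives along curves, one-dimensional lemmas, maxima of families -/

section SndDeriv

variable {U V W P : Type*} [NormedAddCommGroup U] [NormedSpace ℝ U]
  [NormedAddCommGroup V] [NormedSpace ℝ V] [NormedAddCommGroup W] [NormedSpace ℝ W]
  [NormedAddCommGroup P] [NormedSpace ℝ P]

/-- The second derivative `D²f(x)[v, v]`. -/
noncomputable def sndDeriv (f : V → W) (x v : V) : W := fderiv ℝ (fderiv ℝ f) x v v

theorem sndDeriv_congr {f g : V → W} {x : V} (h : f =ᶠ[𝓝 x] g) (v : V) :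
    sndDeriv f x v = sndDeriv g x v := by
  unfold sndDeriv
  rw [Filter.EventuallyEq.fderiv_eq (h.fderiv)]

theorem contDiff_one_fderiv {f : V → W} (hf : ContDiff ℝ 2 f) : ContDiff ℝ 1 (fderiv ℝ f) :=
  hf.fderiv_right (m := 1) (by norm_num)

theorem differentiable_fderiv {f : V → W} (hf : ContDiff ℝ 2 f) :
    Differentiable ℝ (fderiv ℝ f) :=
  (contDiff_one_fderiv hf).differentiable (by norm_num)

theorem sndDeriv_add {f g : V → W} (hf : ContDiff ℝ 2 f) (hg : ContDiff ℝ 2 g) (x v : V) :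
    sndDeriv (fun z => f z + g z) x v = sndDeriv f x v + sndDeriv g x v := by
  unfold sndDeriv
  have : fderiv ℝ (fun z => f z + g z) = fun z => fderiv ℝ f z + fderiv ℝ g z := by
    ext1 z
    exact fderiv_fun_add (hf.differentiable (by norm_num) z) (hg.differentiable (by norm_num) z)
  rw [this, fderiv_fun_add (differentiable_fderiv hf x) (differentiable_fderiv hg x)]
  rfl

theorem sndDeriv_const_smul {f : V → W} (hf : ContDiff ℝ 2 f) (r : ℝ) (x v : V) :
    sndDeriv (fun z => r • f z) x v = r • sndDeriv f x v := by
  unfold sndDeriv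
  have : fderiv ℝ (fun z => r • f z) = fun z => r • fderiv ℝ f z := by
    ext1 z
    exact fderiv_fun_const_smul (hf.differentiable (by norm_num) z) r
  rw [this, fderiv_fun_const_smul (differentiable_fderiv hf x)]
  rfl

theorem sndDeriv_sub {f g : V → W} (hf : ContDiff ℝ 2 f) (hg : ContDiff ℝ 2 g) (x v : V) :
    sndDeriv (fun z => f z - g z) x v = sndDeriv f x v - sndDeriv g x v := by
  unfold sndDeriv
  have : fderiv ℝ (fun z => f z - g z) = fun z => fderiv ℝ f z - fderiv ℝ g z := by
    ext1 z
    exact fderiv_fun_sub (hf.differentiable (by norm_num) z) (hg.differentiable (by norm_num) z)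
  rw [this, fderiv_fun_sub (differentiable_fderiv hf x) (differentiable_fderiv hg x)]
  rfl

theorem sndDeriv_const (w : W) (x v : V) : sndDeriv (fun _ => w) x v = 0 := by
  unfold sndDeriv
  have : fderiv ℝ (fun _ : V => w) = fun _ => 0 := by ext1 z; simp
  rw [this]; simp

theorem sndDeriv_clm (L : V →L[ℝ] W) (x v : V) : sndDeriv L x v = 0 := by
  unfold sndDeriv
  have : fderiv ℝ L = fun _ => L := by ext1 z; simp
  rw [this]; simp

/-- The chain rule for second derivatives. -/
theorem sndDeriv_comp {f : V → W} {g : U → V} (hf : ContDiff ℝ 2 f) (hg : ContDiff ℝ 2 g)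
    (q v : U) : sndDeriv (fun z => f (g z)) q v =
      sndDeriv f (g q) (fderiv ℝ g q v) + fderiv ℝ f (g q) (sndDeriv g q v) := by
  unfold sndDeriv
  have : fderiv ℝ (fun z => f (g z)) = fun z => (fderiv ℝ f (g z)).comp (fderiv ℝ g z) := by
    ext1 z
    exact fderiv_fun_comp z (hf.differentiable (by norm_num) _) (hg.differentiable (by norm_num) z)
  rw [this]
  have h1 : HasFDerivAt (fun z => fderiv ℝ f (g z))
      ((fderiv ℝ (fderiv ℝ f) (g q)).comp (fderiv ℝ g q)) q :=
    (differentiable_fderiv hf (g q)).hasFDerivAt.comp q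
      (hg.differentiable (by norm_num) q).hasFDerivAt
  have h2 := (differentiable_fderiv hg q).hasFDerivAt
  rw [(h1.clm_comp h2).fderiv]
  simp [add_comm]

theorem contDiff_mk_left (p : P) {k : WithTop ℕ∞} : ContDiff ℝ k (fun x : V => (x, p)) :=
  contDiff_id.prodMk contDiff_const

theorem contDiff_mk_right (x : V) {k : WithTop ℕ∞} : ContDiff ℝ k (fun p : P => (x, p)) :=
  contDiff_const.prodMk contDiff_id

theorem fderiv_mk_left (p : P) (x v : V) : fderiv ℝ (fun x : V => (x, p)) x v = (v, 0) := by
  have h : HasFDerivAt (𝕜 := ℝ) (fun x : V => (x, p)) _ x :=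
    (hasFDerivAt_id x).prodMk (hasFDerivAt_const p x)
  rw [h.fderiv]; simp

theorem fderiv_mk_right (x : V) (p w : P) : fderiv ℝ (fun p : P => (x, p)) p w = (0, w) := by
  have h : HasFDerivAt (𝕜 := ℝ) (fun p : P => (x, p)) _ p :=
    (hasFDerivAt_const x p).prodMk (hasFDerivAt_id p)
  rw [h.fderiv]; simp

theorem sndDeriv_mk_left (p : P) (x v : V) : sndDeriv (fun x : V => (x, p)) x v = 0 := by
  unfold sndDeriv
  have : fderiv ℝ (fun x : V => (x, p)) = fun _ => ContinuousLinearMap.inl ℝ V P := by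
    ext1 z
    ext w <;> simp [fderiv_mk_left]
  rw [this]; simp

theorem sndDeriv_mk_right (x : V) (p w : P) : sndDeriv (fun p : P => (x, p)) p w = 0 := by
  unfold sndDeriv
  have : fderiv ℝ (fun p : P => (x, p)) = fun _ => ContinuousLinearMap.inr ℝ V P := by
    ext1 z
    ext w <;> simp [fderiv_mk_right]
  rw [this]; simp

theorem fderiv_slice_left {F : V × P → W} (hF : Differentiable ℝ F) (x v : V) (p : P) :
    fderiv ℝ (fun x => F (x, p)) x v = fderiv ℝ F (x, p) (v, 0) := by
  rw [fderiv_fun_comp (g := F) x (hF _) ((contDiff_mk_left (k := 1) p).differentiable (by norm_num) x)]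
  simp [fderiv_mk_left]

theorem fderiv_slice_right {F : V × P → W} (hF : Differentiable ℝ F) (x : V) (p w : P) :
    fderiv ℝ (fun p => F (x, p)) p w = fderiv ℝ F (x, p) (0, w) := by
  rw [fderiv_fun_comp (g := F) p (hF _)
    ((contDiff_mk_right (k := 1) x).differentiable (by norm_num) p)]
  simp [fderiv_mk_right]

theorem sndDeriv_slice_left {F : V × P → W} (hF : ContDiff ℝ 2 F) (x v : V) (p : P) :
    sndDeriv (fun x => F (x, p)) x v = sndDeriv F (x, p) (v, 0) := by
  rw [sndDeriv_comp hF (contDiff_mk_left p), sndDeriv_mk_left, fderiv_mk_left]; simp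

theorem sndDeriv_slice_right {F : V × P → W} (hF : ContDiff ℝ 2 F) (x : V) (p w : P) :
    sndDeriv (fun p => F (x, p)) p w = sndDeriv F (x, p) (0, w) := by
  rw [sndDeriv_comp hF (contDiff_mk_right x), sndDeriv_mk_right, fderiv_mk_right]; simp

theorem continuous_sndDeriv {f : V → W} (hf : ContDiff ℝ 2 f) :
    Continuous (fun z : V × V => sndDeriv f z.1 z.2) := by
  unfold sndDeriv
  have := (contDiff_one_fderiv hf).continuous_fderiv (by norm_num)
  exact (((this.comp continuous_fst).clm_apply continuous_snd).clm_apply continuous_snd)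

theorem sndDeriv_smul (f : V → W) (x v : V) (r : ℝ) :
    sndDeriv f x (r • v) = r ^ 2 • sndDeriv f x v := by
  unfold sndDeriv; simp [smul_smul, pow_two]

theorem sndDeriv_zero (f : V → W) (x : V) : sndDeriv f x 0 = 0 := by
  unfold sndDeriv; simp

theorem hasDerivAt_line (f : V → W) (hf : Differentiable ℝ f) (q v : V) (t : ℝ) :
    HasDerivAt (fun t : ℝ => f (q + t • v)) (fderiv ℝ f (q + t • v) v) t := by
  have h1 : HasDerivAt (fun t : ℝ => q + t • v) v t := by
    simpa using ((hasDerivAt_id t).smul_const v).const_add q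
  exact (hf (q + t • v)).hasFDerivAt.comp_hasDerivAt t h1

theorem hasDerivAt_fderiv_line {f : V → W} (hf : ContDiff ℝ 2 f) (q v : V) (t : ℝ) :
    HasDerivAt (fun t : ℝ => fderiv ℝ f (q + t • v) v) (sndDeriv f (q + t • v) v) t := by
  have h1 : HasDerivAt (fun t : ℝ => q + t • v) v t := by
    simpa using ((hasDerivAt_id t).smul_const v).const_add q
  have h2 := (differentiable_fderiv hf (q + t • v)).hasFDerivAt.comp_hasDerivAt t h1
  exact ((ContinuousLinearMap.apply ℝ W v).hasFDerivAt.comp_hasDerivAt t h2)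

theorem fderiv_fderiv_apply {f : V → W} (hf : ContDiff ℝ 2 f) (z u v : V) :
    fderiv ℝ (fun z => fderiv ℝ f z u) z v = fderiv ℝ (fderiv ℝ f) z v u := by
  have h2 := (differentiable_fderiv hf z).hasFDerivAt
  have h3 : HasFDerivAt (fun z => fderiv ℝ f z u) _ z :=
    (ContinuousLinearMap.apply ℝ W u).hasFDerivAt.comp z h2
  rw [h3.fderiv]
  rfl

theorem fderiv_fderiv_comm {f : V → W} (hf : ContDiff ℝ 2 f) (z u v : V) :
    fderiv ℝ (fderiv ℝ f) z u v = fderiv ℝ (fderiv ℝ f) z v u :=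
  (hf.contDiffAt.isSymmSndFDerivAt (by simp)).eq u v

/-- Directional derivatives commute. -/
theorem fderiv_apply_comm {f : V → W} (hf : ContDiff ℝ 2 f) (z u v : V) :
    fderiv ℝ (fun z => fderiv ℝ f z u) z v = fderiv ℝ (fun z => fderiv ℝ f z v) z u := by
  rw [fderiv_fderiv_apply hf, fderiv_fderiv_apply hf, fderiv_fderiv_comm hf]

theorem sndDeriv_eq_fderiv {f : V → W} (hf : ContDiff ℝ 2 f) (z v : V) :
    sndDeriv f z v = fderiv ℝ (fun z => fderiv ℝ f z v) z v := by
  rw [fderiv_fderiv_apply hf]; rfl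

theorem contDiff_fderiv_apply {f : V → W} {k : ℕ} (hf : ContDiff ℝ (k + 1 : ℕ) f) (u : V) :
    ContDiff ℝ k (fun z => fderiv ℝ f z u) :=
  (hf.fderiv_right (m := k) (by norm_cast)).clm_apply contDiff_const

theorem contDiff_sndDeriv {f : V → W} {k : ℕ} (hf : ContDiff ℝ (k + 2 : ℕ) f) :
    ContDiff ℝ k (fun z : V × V => sndDeriv f z.1 z.2) := by
  have h1 : ContDiff ℝ (k + 1 : ℕ) (fderiv ℝ f) := hf.fderiv_right (by norm_cast)
  have h2 : ContDiff ℝ k (fderiv ℝ (fderiv ℝ f)) := h1.fderiv_right (by norm_cast)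
  exact ((h2.comp contDiff_fst).clm_apply contDiff_snd).clm_apply contDiff_snd

end SndDeriv

section OneDim

/-- If `g'' ≥ -K |g'|` and `g'` is nonnegative at the initial point, it stays nonnegative. -/
theorem nonneg_of_deriv_ge_neg_abs {f f' : ℝ → ℝ} {K : ℝ}
    (hf : ∀ t ∈ Icc (0 : ℝ) 1, HasDerivAt f (f' t) t)
    (hf' : ∀ t ∈ Icc (0 : ℝ) 1, -K * |f t| ≤ f' t) (h0 : 0 ≤ f 0) :
    ∀ t ∈ Icc (0 : ℝ) 1, 0 ≤ f t := by
  have key : ∀ ε > 0, ∀ t ∈ Icc (0 : ℝ) 1, -f t ≤ ε * Real.exp ((K + 1) * t) := by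
    intro ε hε t ht
    have hB : ∀ t, HasDerivAt (fun t => ε * Real.exp ((K + 1) * t))
        (ε * (Real.exp ((K + 1) * t) * (K + 1))) t := by
      intro t
      have := ((hasDerivAt_id t).const_mul (K + 1)).exp.const_mul ε
      simpa using this
    refine image_le_of_deriv_right_lt_deriv_boundary' (f := fun t => -f t) (f' := fun t => -f' t)
      (a := 0) (b := 1) ?_ ?_ (B := fun t => ε * Real.exp ((K + 1) * t)) ?_
      (B' := fun t => ε * (Real.exp ((K + 1) * t) * (K + 1))) ?_ ?_ ?_ ht
    · exact fun t ht => (hf t ht).continuousAt.continuousWithinAt.neg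
    · exact fun t ht => (hf t (Ico_subset_Icc_self ht)).neg.hasDerivWithinAt
    · simp; linarith
    · exact fun t _ => (hB t).continuousAt.continuousWithinAt
    · exact fun t _ => (hB t).hasDerivWithinAt
    · intro t ht he
      have h1 := hf' t (Ico_subset_Icc_self ht)
      have hp : 0 < ε * Real.exp ((K + 1) * t) := by positivity
      have h2 : |f t| = ε * Real.exp ((K + 1) * t) := by
        rw [abs_of_neg (by linarith [he]), he]
      rw [h2] at h1
      nlinarith
  intro t ht
  by_contra! hneg
  have hp := Real.exp_pos ((K + 1) * t)
  have h1 := key (-f t / (2 * Real.exp ((K + 1) * t))) (by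
    apply div_pos <;> linarith) t ht
  rw [div_mul_eq_mul_div, div_eq_mul_inv, mul_inv] at h1
  have h2 : Real.exp ((K + 1) * t) * (Real.exp ((K + 1) * t))⁻¹ = 1 := mul_inv_cancel₀ hp.ne'
  nlinarith

theorem convexOn_of_second_deriv_ge {j j' j'' : ℝ → ℝ} {m : ℝ}
    (h1 : ∀ t, HasDerivAt j (j' t) t) (h2 : ∀ t, HasDerivAt j' (j'' t) t)
    (h : ∀ t ∈ Icc (0 : ℝ) 1, -m ≤ j'' t) :
    ConvexOn ℝ (Icc (0 : ℝ) 1) (fun t => j t + m / 2 * t ^ 2) := by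
  have hd1 : ∀ t, HasDerivAt (fun t => j t + m / 2 * t ^ 2) (j' t + m * t) t := by
    intro t
    have := (h1 t).fun_add ((hasDerivAt_pow 2 t).const_mul (m / 2))
    refine this.congr_deriv ?_
    push_cast; ring
  have hd2 : ∀ t, HasDerivAt (fun t => j' t + m * t) (j'' t + m) t := by
    intro t
    exact ((h2 t).fun_add ((hasDerivAt_id t).const_mul m)).congr_deriv (by ring)
  refine convexOn_of_hasDerivWithinAt2_nonneg (convex_Icc 0 1)
    (fun t _ => (hd1 t).continuousAt.continuousWithinAt)
    (fun t _ => (hd1 t).hasDerivWithinAt) (fun t _ => (hd2 t).hasDerivWithinAt) ?_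
  intro t ht
  have := h t (interior_subset ht)
  linarith

/-- Taylor's formula with a lower bound for the second derivative. -/
theorem taylor_lower_bound {j j' j'' : ℝ → ℝ} {m : ℝ}
    (h1 : ∀ t, HasDerivAt j (j' t) t) (h2 : ∀ t, HasDerivAt j' (j'' t) t)
    (h : ∀ t ∈ Icc (0 : ℝ) 1, -m ≤ j'' t) : j 0 + j' 0 - m / 2 ≤ j 1 := by
  have hc := convexOn_of_second_deriv_ge h1 h2 h
  have hd : HasDerivAt (fun t => j t + m / 2 * t ^ 2) (j' 0) 0 := by
    exact ((h1 0).fun_add ((hasDerivAt_pow 2 (0 : ℝ)).const_mul (m / 2))).congr_deriv (by simp)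
  have := hc.le_slope_of_hasDerivAt (by simp) (by simp) zero_lt_one hd
  simp [slope_def_field] at this
  linarith

/-- Semiconvexity from a lower bound for the second derivative. -/
theorem semiconvex_lower_bound {j j' j'' : ℝ → ℝ} {m : ℝ}
    (h1 : ∀ t, HasDerivAt j (j' t) t) (h2 : ∀ t, HasDerivAt j' (j'' t) t)
    (h : ∀ t ∈ Icc (0 : ℝ) 1, -m ≤ j'' t) {θ : ℝ} (hθ : θ ∈ Icc (0 : ℝ) 1) :
    -(m / 2 * (θ * (1 - θ))) ≤ (1 - θ) * j 0 + θ * j 1 - j θ := by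
  have hc := convexOn_of_second_deriv_ge h1 h2 h
  have := hc.2 (left_mem_Icc.2 zero_le_one) (right_mem_Icc.2 zero_le_one)
    (sub_nonneg.2 hθ.2) hθ.1 (by ring)
  simp at this
  nlinarith

end OneDim

section Danskin

variable {V W : Type*} [NormedAddCommGroup V] [NormedSpace ℝ V] [TopologicalSpace W]
  [FirstCountableTopology W]

/-- A one-sided Danskin theorem: if `h` touches the maximum function
`f z = max_{y ∈ M} (k z y + w y)` from below at `z` along the direction `e`, then the derivative of
`h` in that direction is at most that of `k · y` for some maximizer `y`. -/
theorem exists_maximizer_fderiv_le {M : Set W} (hM : IsCompact M) {k : V → W → ℝ}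
    {k' : V → W → V →L[ℝ] ℝ} (hk : Continuous (Function.uncurry k))
    (hk' : Continuous (Function.uncurry k')) (hkd : ∀ z y, HasFDerivAt (k · y) (k' z y) z)
    {w : W → ℝ} (hw : ContinuousOn w M) {f : V → ℝ}
    (hf : ∀ z, ∀ y ∈ M, k z y + w y ≤ f z) (hf' : ∀ z, ∃ y ∈ M, f z = k z y + w y)
    (z e : V) {h : V → ℝ} {h' : V →L[ℝ] ℝ} (hh : HasFDerivAt h h' z)
    (hle : ∀ᶠ ε : ℝ in 𝓝[>] 0, h (z + ε • e) - h z ≤ f (z + ε • e) - f z) :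
    ∃ y ∈ M, f z = k z y + w y ∧ h' e ≤ k' z y e := by
  obtain ⟨ε, hε, hεlim⟩ : ∃ ε : ℕ → ℝ, (∀ i, 0 < ε i) ∧ Tendsto ε atTop (𝓝 0) :=
    ⟨fun i => 1 / (i + 1), fun i => by positivity, tendsto_one_div_add_atTop_nhds_zero_nat⟩
  have hεw : Tendsto ε atTop (𝓝[>] 0) :=
    tendsto_nhdsWithin_iff.2 ⟨hεlim, Eventually.of_forall hε⟩
  -- take maximizers `y i` at points `z + ε i • e` approaching `z`; a limit of them is the required
  -- `y`
  choose y hyM hy using fun i => hf' (z + ε i • e)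
  obtain ⟨yl, hyl, φ, hφ, hlim⟩ := hM.tendsto_subseq hyM
  have hεφ : Tendsto (fun i => ε (φ i)) atTop (𝓝 0) := hεlim.comp hφ.tendsto_atTop
  have hzφ : Tendsto (fun i => z + ε (φ i) • e) atTop (𝓝 z) := by
    simpa using tendsto_const_nhds.add (hεφ.smul_const e)
  have hwl : Tendsto (fun i => w (y (φ i))) atTop (𝓝 (w yl)) :=
    (hw yl hyl).tendsto.comp (tendsto_nhdsWithin_iff.2
      ⟨hlim, Eventually.of_forall fun i => hyM _⟩)
  have hlower : ∀ᶠ i in atTop, h (z + ε (φ i) • e) - h z ≤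
      k (z + ε (φ i) • e) (y (φ i)) - k z (y (φ i)) := by
    have := (hεw.comp hφ.tendsto_atTop).eventually hle
    filter_upwards [this] with i hi
    have h1 := hy (φ i)
    have h2 := hf z (y (φ i)) (hyM _)
    simp only [Function.comp] at hi
    linarith
  refine ⟨yl, hyl, le_antisymm ?_ (hf z yl hyl), ?_⟩
  · obtain ⟨y0, hy0, hfy0⟩ := hf' z
    rw [hfy0]
    have hl : Tendsto (fun i => k (z + ε (φ i) • e) y0 + w y0) atTop (𝓝 (k z y0 + w y0)) := by
      refine Tendsto.add_const _ ?_
      exact (hk.tendsto (z, y0)).comp (hzφ.prodMk_nhds tendsto_const_nhds)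
    have hr : Tendsto (fun i => k (z + ε (φ i) • e) (y (φ i)) + w (y (φ i))) atTop
        (𝓝 (k z yl + w yl)) :=
      ((hk.tendsto (z, yl)).comp (hzφ.prodMk_nhds hlim)).add hwl
    refine le_of_tendsto_of_tendsto' hl hr fun i => ?_
    have := hy (φ i)
    rw [← this]
    exact hf _ _ hy0
  -- the mean value theorem turns the bounds for the difference quotients of `h` into derivatives of
  -- `k`
  · have hmv : ∀ i, ∃ s ∈ Ioo (0 : ℝ) (ε (φ i)),
        k' (z + s • e) (y (φ i)) e = (k (z + ε (φ i) • e) (y (φ i)) - k z (y (φ i))) / ε (φ i) := by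
      intro i
      have hd : ∀ t : ℝ, HasDerivAt (fun t : ℝ => k (z + t • e) (y (φ i)))
          (k' (z + t • e) (y (φ i)) e) t := by
        intro t
        have h1 : HasDerivAt (fun t : ℝ => z + t • e) e t := by
          simpa using ((hasDerivAt_id t).smul_const e).const_add z
        exact (hkd (z + t • e) (y (φ i))).comp_hasDerivAt t h1
      obtain ⟨s, hs, he⟩ := exists_hasDerivAt_eq_slope (fun t : ℝ => k (z + t • e) (y (φ i)))
        (fun t => k' (z + t • e) (y (φ i)) e) (hε (φ i))
        (fun t _ => (hd t).continuousAt.continuousWithinAt) (fun t _ => hd t)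
      exact ⟨s, hs, by simpa using he⟩
    choose s hs hse using hmv
    have hs0 : Tendsto s atTop (𝓝 0) :=
      squeeze_zero (fun i => (hs i).1.le) (fun i => (hs i).2.le) hεφ
    have hr : Tendsto (fun i => k' (z + s i • e) (y (φ i)) e) atTop (𝓝 (k' z yl e)) := by
      have hzs : Tendsto (fun i => z + s i • e) atTop (𝓝 z) := by
        simpa using tendsto_const_nhds.add (hs0.smul_const e)
      have := (hk'.tendsto (z, yl)).comp (hzs.prodMk_nhds hlim)
      exact ((ContinuousLinearMap.apply ℝ ℝ e).continuous.tendsto _).comp this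
    have hl : Tendsto (fun i => (ε (φ i))⁻¹ • (h (z + ε (φ i) • e) - h z)) atTop (𝓝 (h' e)) := by
      have h1 : HasDerivAt (fun t : ℝ => h (z + t • e)) (h' e) 0 := by
        have h1 : HasDerivAt (fun t : ℝ => z + t • e) e 0 := by
          simpa using ((hasDerivAt_id (0 : ℝ)).smul_const e).const_add z
        have hh0 : HasFDerivAt h h' (z + (0 : ℝ) • e) := by simpa using hh
        exact hh0.comp_hasDerivAt 0 h1
      have h2 := h1.tendsto_slope_zero_right.comp (hεw.comp hφ.tendsto_atTop)
      simpa [Function.comp_def] using h2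
    refine le_of_tendsto_of_tendsto hl hr ?_
    filter_upwards [hlower] with i hi
    rw [hse, smul_eq_mul, div_eq_inv_mul]
    exact mul_le_mul_of_nonneg_left hi (inv_nonneg.2 (hε _).le)

end Danskin

/-! ### Derivatives of the cost, and the data of the problem -/

section Cost

variable {n : ℕ}

theorem inner_gradient {f : E n → ℝ} (x v : E n) : inner ℝ (gradient f x) v = fderiv ℝ f x v := by
  unfold gradient
  rw [InnerProductSpace.toDual_symm_apply]

theorem eq_gradient_iff {f : E n → ℝ} {x p : E n} :
    gradient f x = p ↔ ∀ v, fderiv ℝ f x v = inner ℝ p v := by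
  constructor
  · rintro rfl v; rw [inner_gradient]
  · intro h
    refine ext_inner_right ℝ fun v => ?_
    rw [inner_gradient, h]

theorem contDiff_gradient {f : E n → ℝ} {k : ℕ} (hf : ContDiff ℝ (k + 1 : ℕ) f) :
    ContDiff ℝ k (gradient f) := by
  have h1 : ContDiff ℝ k (fderiv ℝ f) := hf.fderiv_right (by norm_cast)
  exact (InnerProductSpace.toDual ℝ (E n)).symm.contDiff.comp h1

theorem inner_hess {f : E n → ℝ} (hf : ContDiff ℝ 2 f) (x ξ η : E n) :
    inner ℝ (hess f x ξ) η = fderiv ℝ (fderiv ℝ f) x ξ η := by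
  have h1 := (((contDiff_gradient (k := 1) hf).differentiable (by norm_num)) x).hasFDerivAt
  have h2 := h1.inner ℝ (hasFDerivAt_const η x)
  have h3 : (fun z => inner ℝ (gradient f z) η) = fun z => fderiv ℝ f z η := by
    ext z; rw [inner_gradient]
  rw [← fderiv_fderiv_apply hf, ← h3, h2.fderiv]
  simp [hess]

theorem inner_hess_self {f : E n → ℝ} (hf : ContDiff ℝ 2 f) (x ξ : E n) :
    inner ℝ (hess f x ξ) ξ = sndDeriv f x ξ := inner_hess hf x ξ ξ

variable {c : E n → E n → ℝ}

theorem contDiff_slice {k : WithTop ℕ∞} (hc : ContDiff ℝ k (Function.uncurry c)) (y : E n) :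
    ContDiff ℝ k (fun x => c x y) :=
  hc.comp (contDiff_mk_left y)

theorem contDiff_swapCost {k : WithTop ℕ∞} (hc : ContDiff ℝ k (Function.uncurry c)) :
    ContDiff ℝ k (Function.uncurry (swapCost c)) :=
  hc.comp (contDiff_snd.prodMk contDiff_fst)

theorem cX_swapCost (x y : E n) : cX (swapCost c) y x = cY c x y := rfl

theorem inner_cX (hc : ContDiff ℝ 4 (Function.uncurry c)) (x y v : E n) :
    inner ℝ (cX c x y) v = fderiv ℝ (Function.uncurry c) (x, y) (v, 0) := by
  unfold cX
  rw [inner_gradient, ← fderiv_slice_left (hc.differentiable (by norm_num))]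
  rfl

theorem inner_cX' (x y v : E n) :
    inner ℝ (cX c x y) v = fderiv ℝ (fun z => c z y) x v := by
  unfold cX
  rw [inner_gradient]

theorem inner_cY (hc : ContDiff ℝ 4 (Function.uncurry c)) (x y v : E n) :
    inner ℝ (cY c x y) v = fderiv ℝ (Function.uncurry c) (x, y) (0, v) := by
  unfold cY
  rw [inner_gradient, ← fderiv_slice_right (hc.differentiable (by norm_num))]
  rfl

theorem contDiff_cX (hc : ContDiff ℝ 4 (Function.uncurry c)) :
    ContDiff ℝ 3 (fun z : E n × E n => cX c z.1 z.2) := by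
  have h1 : ContDiff ℝ 3 (fderiv ℝ (Function.uncurry c)) := hc.fderiv_right (by norm_num)
  have h2 : ContDiff ℝ 3 (fun z => (InnerProductSpace.toDual ℝ (E n)).symm
      ((fderiv ℝ (Function.uncurry c) z).comp (ContinuousLinearMap.inl ℝ (E n) (E n)))) :=
    (InnerProductSpace.toDual ℝ (E n)).symm.contDiff.comp (h1.clm_comp contDiff_const)
  convert h2 using 2 with z
  refine ext_inner_right ℝ fun v => ?_
  rw [inner_cX hc, InnerProductSpace.toDual_symm_apply]
  simp

theorem contDiff_cY (hc : ContDiff ℝ 4 (Function.uncurry c)) :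
    ContDiff ℝ 3 (fun z : E n × E n => cY c z.1 z.2) :=
  (contDiff_cX (contDiff_swapCost hc)).comp (contDiff_snd.prodMk contDiff_fst)

theorem continuous_cX (hc : ContDiff ℝ 4 (Function.uncurry c)) :
    Continuous (fun z : E n × E n => cX c z.1 z.2) := (contDiff_cX hc).continuous

theorem continuous_cY (hc : ContDiff ℝ 4 (Function.uncurry c)) :
    Continuous (fun z : E n × E n => cY c z.1 z.2) := (contDiff_cY hc).continuous

theorem cXY_eq (hc : ContDiff ℝ 4 (Function.uncurry c)) (x y η : E n) :
    cXY c x y η = fderiv ℝ (fun z : E n × E n => cX c z.1 z.2) (x, y) (0, η) := by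
  unfold cXY
  rw [← fderiv_slice_right ((contDiff_cX hc).differentiable (by norm_num))]

theorem inner_cXY (hc : ContDiff ℝ 4 (Function.uncurry c)) (x y η v : E n) :
    inner ℝ (cXY c x y η) v =
      fderiv ℝ (fun z => fderiv ℝ (Function.uncurry c) z (v, 0)) (x, y) (0, η) := by
  rw [cXY_eq hc]
  have h1 := ((contDiff_cX hc).differentiable (by norm_num) (x, y)).hasFDerivAt
  have h2 := h1.inner ℝ (hasFDerivAt_const v (x, y))
  have h3 : (fun z => fderiv ℝ (Function.uncurry c) z (v, 0)) =
      fun z : E n × E n => inner ℝ (cX c z.1 z.2) v := by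
    ext z; rw [inner_cX hc]
  rw [h3, h2.fderiv]
  simp

theorem two_le_four : (2 : WithTop ℕ∞) ≤ 4 := by norm_num

/-- `c_{y,x}` is the transpose of `c_{x,y}`. -/
theorem inner_cXY_swapCost (hc : ContDiff ℝ 4 (Function.uncurry c)) (x y ξ η : E n) :
    inner ℝ (cXY (swapCost c) y x ξ) η = inner ℝ (cXY c x y η) ξ := by
  rw [inner_cXY hc, fderiv_apply_comm (hc.of_le two_le_four)]
  have h1 : cXY (swapCost c) y x ξ = fderiv ℝ (fun z : E n × E n => cY c z.1 z.2) (x, y) (ξ, 0) := by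
    unfold cXY
    rw [← fderiv_slice_left ((contDiff_cY hc).differentiable (by norm_num))]
    rfl
  rw [h1]
  have h1 := ((contDiff_cY hc).differentiable (by norm_num) (x, y)).hasFDerivAt
  have h2 := h1.inner ℝ (hasFDerivAt_const η (x, y))
  have h3 : (fun z => fderiv ℝ (Function.uncurry c) z (0, η)) =
      fun z : E n × E n => inner ℝ (cY c z.1 z.2) η := by
    ext z; rw [inner_cY hc]
  rw [h3, h2.fderiv]
  simp

theorem sndDeriv_cost (hc : ContDiff ℝ 4 (Function.uncurry c)) (x y ξ : E n) :
    sndDeriv (fun z => c z y) x ξ = sndDeriv (Function.uncurry c) (x, y) (ξ, 0) :=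
  sndDeriv_slice_left (F := Function.uncurry c) (hc.of_le two_le_four) x ξ y

/-- The function `y ↦ c_{xx}(x, y)ξξ`, jointly in all variables, is `C²`. -/
theorem contDiff_sndDeriv_cost (hc : ContDiff ℝ 4 (Function.uncurry c)) :
    ContDiff ℝ 2 (fun z : E n × E n × E n => sndDeriv (fun x => c x z.2.2) z.2.1 z.1) := by
  have h := contDiff_sndDeriv (k := 2) (f := Function.uncurry c) hc
  have h2 : ContDiff ℝ 2 (fun z : E n × E n × E n => ((z.2.1, z.2.2), (z.1, (0 : E n)))) :=
    (contDiff_snd.fst.prodMk contDiff_snd.snd).prodMk (contDiff_fst.prodMk contDiff_const)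
  have h3 : (fun z : E n × E n × E n => sndDeriv (fun x => c x z.2.2) z.2.1 z.1) =
      fun z => sndDeriv (Function.uncurry c) (z.2.1, z.2.2) (z.1, 0) :=
    funext fun z => sndDeriv_cost hc _ _ _
  rw [h3]
  exact h.comp h2

/-- `D_y (c_{xx} ξ ξ) ζ = D²_x (c_y ζ)(ξ, ξ)`. -/
theorem fderiv_sndDeriv_cost (hc : ContDiff ℝ 4 (Function.uncurry c)) (x y ξ ζ : E n) :
    fderiv ℝ (fun y' => sndDeriv (fun z => c z y') x ξ) y ζ =
      sndDeriv (fun z => inner ℝ (cY c z y) ζ) x ξ := by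
  set C := Function.uncurry c with hC
  have hc2 : ContDiff ℝ 2 C := hc.of_le two_le_four
  have hζ : ContDiff ℝ 3 (fun z => fderiv ℝ C z (0, ζ)) := contDiff_fderiv_apply (k := 3) hc _
  have hξ : ContDiff ℝ 3 (fun z => fderiv ℝ C z (ξ, 0)) := contDiff_fderiv_apply (k := 3) hc _
  have hξξ : ContDiff ℝ 2 (fun z => fderiv ℝ (fun z => fderiv ℝ C z (ξ, 0)) z (ξ, 0)) :=
    contDiff_fderiv_apply (k := 2) hξ _
  have h1 : (fun y' => sndDeriv (fun z => c z y') x ξ) =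
      fun y' => fderiv ℝ (fun z => fderiv ℝ C z (ξ, 0)) (x, y') (ξ, 0) := by
    ext y'
    rw [sndDeriv_cost hc, sndDeriv_eq_fderiv hc2]
  have h2 : (fun z => inner ℝ (cY c z y) ζ) = fun z => fderiv ℝ C (z, y) (0, ζ) := by
    ext z; rw [inner_cY hc]
  rw [h1, h2, fderiv_slice_right (hξξ.differentiable (by norm_num)),
    sndDeriv_slice_left (F := fun z => fderiv ℝ C z (0, ζ)) (hζ.of_le (by norm_num)),
    sndDeriv_eq_fderiv (hζ.of_le (by norm_num)), fderiv_apply_comm (hξ.of_le (by norm_num))]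
  congr 2
  ext z
  rw [fderiv_apply_comm hc2]

end Cost

section Structure

variable {n : ℕ}

/-- `φ` is a `C⁴` defining function of `Ω` near the boundary of `Ω`. -/
structure IsDefining (Ω : Set (E n)) (φ : E n → ℝ) : Prop where
  smooth : ContDiff ℝ 4 φ
  eventually : ∀ x ∈ frontier Ω, ∀ᶠ z in 𝓝 x, (z ∈ Ω ↔ φ z < 0)
  fderiv_ne : ∀ x ∈ frontier Ω, fderiv ℝ φ x ≠ 0

/-- The velocity at `q` of the curve `t ↦ X(y, q + t v)`. -/
noncomputable def vel (X : E n × E n → E n) (y q v : E n) : E n := fderiv ℝ (fun q => X (y, q)) q v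

/-- The acceleration at `q` of the curve `t ↦ X(y, q + t v)`. -/
noncomputable def acc (X : E n × E n → E n) (y q v : E n) : E n := sndDeriv (fun q => X (y, q)) q v

theorem vel_smul (Y : E n × E n → E n) (x p v : E n) (r : ℝ) : vel Y x p (r • v) = r • vel Y x p v := by
  unfold vel; rw [map_smul]

theorem acc_smul (Y : E n × E n → E n) (x p v : E n) (r : ℝ) : acc Y x p (r • v) = r ^ 2 • acc Y x p v := by
  unfold acc; rw [sndDeriv_smul]

/-- The function `p ↦ A(x, p)ξξ`, with `Y` in the place of the solution map of `c_x(x, y) = p`. -/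
noncomputable def Aform (c : E n → E n → ℝ) (Y : E n × E n → E n) (x ξ p : E n) : ℝ :=
  sndDeriv (fun z => c z (Y (x, p))) x ξ

theorem Aform_smul (c : E n → E n → ℝ) (Y : E n × E n → E n) (x ξ : E n) (r : ℝ) :
    Aform c Y x (r • ξ) = fun p => r ^ 2 • Aform c Y x ξ p := by
  ext p
  unfold Aform
  rw [sndDeriv_smul]

/-- The regularity and nondegeneracy conditions on the cost and on the first domain, up to the
boundary. The map `Y` is a globally defined `C³` map which near the relevant compact set solves
`c_x(x, y) = p` for `y`. -/
structure HalfBase (c : E n → E n → ℝ) (Ω Ωs : Set (E n)) (φ : E n → ℝ)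
    (Y : E n × E n → E n) : Prop where
  hc : ContDiff ℝ 4 (Function.uncurry c)
  isOpen : IsOpen Ω
  isConnected : IsConnected Ω
  isBounded : Bornology.IsBounded Ω
  defining : IsDefining Ω φ
  inj : ∀ x ∈ closure Ω, Function.Injective (cX c x)
  nondeg : ∀ x ∈ closure Ω, ∀ y ∈ closure Ωs, ∀ η, cXY c x y η = 0 → η = 0
  smoothY : ContDiff ℝ 3 Y
  leftInv : ∀ x ∈ closure Ω, ∀ y ∈ closure Ωs, ∀ᶠ z in 𝓝 (x, y), Y (z.1, cX c z.1 z.2) = z.2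
  rightInv : ∀ x ∈ closure Ω, ∀ y ∈ closure Ωs, ∀ᶠ z in 𝓝 (x, cX c x y), cX c z.1 (Y z) = z.2

/-- The symmetric set of regularity conditions. -/
structure Base (c : E n → E n → ℝ) (Ω Ωs : Set (E n)) (φ φs : E n → ℝ)
    (X Y : E n × E n → E n) : Prop where
  fst : HalfBase c Ω Ωs φ Y
  snd : HalfBase (swapCost c) Ωs Ω φs X

/-- The convexity conditions, up to the boundary: A3w, the `c`-convexity of `Ω`, and its uniform
`c`-convexity, expressed through the defining function `φ` in the coordinates `q = c_y(x, y)`. -/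
structure HalfConvex (c : E n → E n → ℝ) (Ω Ωs : Set (E n)) (φ : E n → ℝ)
    (X Y : E n × E n → E n) : Prop where
  mtw : ∀ x ∈ closure Ω, ∀ y ∈ closure Ωs, ∀ ξ w : E n, inner ℝ w ξ = 0 →
    0 ≤ sndDeriv (Aform c Y x ξ) (cX c x y) w
  conv : ∀ y ∈ closure Ωs, Convex ℝ ((fun x => cY c x y) '' closure Ω)
  curv : ∃ κ : ℝ, 0 < κ ∧ ∀ x ∈ frontier Ω, ∀ y ∈ closure Ωs, ∀ v : E n,
    fderiv ℝ (fun q => φ (X (y, q))) (cY c x y) v = 0 →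
      κ * ‖v‖ ^ 2 ≤ sndDeriv (fun q => φ (X (y, q))) (cY c x y) v

/-- The symmetric set of hypotheses used throughout. -/
structure Setup (c : E n → E n → ℝ) (Ω Ωs : Set (E n)) (φ φs : E n → ℝ)
    (X Y : E n × E n → E n) : Prop extends Base c Ω Ωs φ φs X Y where
  convFst : HalfConvex c Ω Ωs φ X Y
  convSnd : HalfConvex (swapCost c) Ωs Ω φs Y X

theorem inverse_apply_eq {V W : Type*} [NormedAddCommGroup V] [NormedSpace ℝ V]
    [NormedAddCommGroup W] [NormedSpace ℝ W] {f : V →L[ℝ] W} {g : W →L[ℝ] V}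
    (h1 : ∀ v, g (f v) = v) (h2 : ∀ w, f (g w) = w) (w : W) : f.inverse w = g w := by
  have h3 : f = (ContinuousLinearEquiv.equivOfInverse f g h1 h2 : V →L[ℝ] W) := rfl
  rw [h3, ContinuousLinearMap.inverse_equiv]
  rfl

end Structure

namespace Base

variable {n : ℕ} {c : E n → E n → ℝ} {Ω Ωs : Set (E n)} {φ φs : E n → ℝ}
  {X Y : E n × E n → E n} (S : Base c Ω Ωs φ φs X Y)

include S

theorem swap : Base (swapCost c) Ωs Ω φs φ Y X := ⟨S.snd, S.fst⟩

theorem hc : ContDiff ℝ 4 (Function.uncurry c) := S.fst.hc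

theorem isCompact_fst : IsCompact (closure Ω) := S.fst.isBounded.isCompact_closure

theorem isCompact_snd : IsCompact (closure Ωs) := S.snd.isBounded.isCompact_closure

theorem Y_cX {x y : E n} (hx : x ∈ closure Ω) (hy : y ∈ closure Ωs) : Y (x, cX c x y) = y :=
  (S.fst.leftInv x hx y hy).self_of_nhds

theorem X_cY {x y : E n} (hx : x ∈ closure Ω) (hy : y ∈ closure Ωs) : X (y, cY c x y) = x :=
  (S.snd.leftInv y hy x hx).self_of_nhds

theorem contDiff_Y_slice (x : E n) : ContDiff ℝ 3 (fun p => Y (x, p)) :=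
  S.fst.smoothY.comp (contDiff_mk_right x)

theorem contDiff_X_slice (y : E n) : ContDiff ℝ 3 (fun q => X (y, q)) :=
  S.snd.smoothY.comp (contDiff_mk_right y)

theorem eventually_cX_Y {x y : E n} (hx : x ∈ closure Ω) (hy : y ∈ closure Ωs) :
    ∀ᶠ p in 𝓝 (cX c x y), cX c x (Y (x, p)) = p :=
  (((contDiff_mk_right (k := 0) x).continuous.tendsto (cX c x y))).eventually
    (S.fst.rightInv x hx y hy)

theorem eventually_cY_X {x y : E n} (hx : x ∈ closure Ω) (hy : y ∈ closure Ωs) :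
    ∀ᶠ q in 𝓝 (cY c x y), cY c (X (y, q)) y = q :=
  S.swap.eventually_cX_Y hy hx

/-- The derivative of `Y(x, ·)` is the inverse of `c_{x,y}`. -/
theorem cXY_vel {x y : E n} (hx : x ∈ closure Ω) (hy : y ∈ closure Ωs) (w : E n) :
    cXY c x y (vel Y x (cX c x y) w) = w := by
  have h0 : (fun p => cX c x (Y (x, p))) =ᶠ[𝓝 (cX c x y)] fun p => p := S.eventually_cX_Y hx hy
  have h1 := h0.fderiv_eq (𝕜 := ℝ)
  have h2 : Differentiable ℝ (fun y => cX c x y) :=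
    ((contDiff_cX S.hc).comp (contDiff_mk_right x)).differentiable (by norm_num)
  rw [fderiv_fun_comp (g := fun y => cX c x y) _ (h2 _)
    ((S.contDiff_Y_slice x).differentiable (by norm_num) _), S.Y_cX hx hy] at h1
  have h3 := congrArg (fun L : E n →L[ℝ] E n => L w) h1
  simpa [vel, cXY] using h3

theorem vel_cXY {x y : E n} (hx : x ∈ closure Ω) (hy : y ∈ closure Ωs) (η : E n) :
    vel Y x (cX c x y) (cXY c x y η) = η := by
  have h := S.cXY_vel hx hy (cXY c x y η)
  have := S.fst.nondeg x hx y hy (vel Y x (cX c x y) (cXY c x y η) - η) (by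
    rw [map_sub, h, sub_self])
  exact sub_eq_zero.1 this

theorem vel_eq_zero {x y : E n} (hx : x ∈ closure Ω) (hy : y ∈ closure Ωs) {w : E n}
    (h : vel Y x (cX c x y) w = 0) : w = 0 := by
  rw [← S.cXY_vel hx hy w, h, map_zero]

/-- Differentiating `c_y(X(y, q), y) = q` twice: the acceleration of a `c`-segment. -/
theorem fderiv_sndDeriv_add_inner_acc {x y : E n} (hx : x ∈ closure Ω) (hy : y ∈ closure Ωs)
    (v ζ : E n) :
    fderiv ℝ (fun y' => sndDeriv (fun z => c z y') x (vel X y (cY c x y) v)) y ζ +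
      inner ℝ (cXY c x y ζ) (acc X y (cY c x y) v) = 0 := by
  rw [fderiv_sndDeriv_cost S.hc]
  have hb : ContDiff ℝ 3 (fun z => inner ℝ (cY c z y) ζ) :=
    (((contDiff_cY S.hc).comp (contDiff_mk_left y)).inner ℝ contDiff_const)
  have h0 : (fun q => inner ℝ (cY c (X (y, q)) y) ζ) =ᶠ[𝓝 (cY c x y)] fun q => inner ℝ q ζ := by
    filter_upwards [S.eventually_cY_X hx hy] with q hq
    rw [hq]
  have h1 := sndDeriv_congr h0 v
  have h2 : sndDeriv (fun q : E n => inner ℝ q ζ) (cY c x y) v = 0 := by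
    have : (fun q : E n => inner ℝ q ζ) = innerSL ℝ ζ := by
      ext q; simp [real_inner_comm]
    rw [this, sndDeriv_clm]
  rw [h2, sndDeriv_comp (f := fun z => inner ℝ (cY c z y) ζ) (hb.of_le (by norm_num))
    ((S.contDiff_X_slice y).of_le (by norm_num)), S.X_cY hx hy] at h1
  rw [← inner_cXY_swapCost S.hc]
  have h3 : fderiv ℝ (fun z => inner ℝ (cY c z y) ζ) x (acc X y (cY c x y) v) =
      inner ℝ (cXY (swapCost c) y x (acc X y (cY c x y) v)) ζ := by
    have h4 : HasFDerivAt (fun z => cY c z y) (cXY (swapCost c) y x) x :=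
      ((((contDiff_cY S.hc).comp (contDiff_mk_left y)).differentiable (by norm_num) x)).hasFDerivAt
    rw [(h4.inner ℝ (hasFDerivAt_const ζ x)).fderiv]
    simp
  rw [← h3]
  exact h1

theorem contDiff_Aform : ContDiff ℝ 2 (fun z : E n × E n × E n => Aform c Y z.2.1 z.1 z.2.2) := by
  unfold Aform
  refine (contDiff_sndDeriv_cost S.hc).comp (contDiff_fst.prodMk (contDiff_snd.fst.prodMk ?_))
  exact (S.fst.smoothY.of_le (by norm_num)).comp (contDiff_snd.fst.prodMk contDiff_snd.snd)

theorem contDiff_Aform_slice (x ξ : E n) : ContDiff ℝ 2 (Aform c Y x ξ) :=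
  S.contDiff_Aform.comp (contDiff_const.prodMk (contDiff_const.prodMk contDiff_id))

theorem vel_eq (x p v : E n) : vel Y x p v = fderiv ℝ Y (x, p) (0, v) :=
  fderiv_slice_right (S.fst.smoothY.differentiable (by norm_num)) x p v

theorem acc_eq (x p v : E n) : acc Y x p v = sndDeriv Y (x, p) (0, v) :=
  sndDeriv_slice_right (S.fst.smoothY.of_le (by norm_num)) x p v

theorem continuous_vel : Continuous fun z : E n × E n × E n => vel Y z.1 z.2.1 z.2.2 := by
  simp only [S.vel_eq]
  exact ((S.fst.smoothY.continuous_fderiv (by norm_num)).comp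
    (continuous_fst.prodMk continuous_snd.fst)).clm_apply
    (continuous_const.prodMk continuous_snd.snd)

theorem continuous_acc : Continuous fun z : E n × E n × E n => acc Y z.1 z.2.1 z.2.2 := by
  simp only [S.acc_eq]
  exact (continuous_sndDeriv (S.fst.smoothY.of_le (by norm_num))).comp
    ((continuous_fst.prodMk continuous_snd.fst).prodMk
      (continuous_const.prodMk continuous_snd.snd))

theorem fderiv_Aform_add_inner_acc {x y : E n} (hx : x ∈ closure Ω) (hy : y ∈ closure Ωs)
    (v w : E n) :
    fderiv ℝ (Aform c Y x (vel X y (cY c x y) v)) (cX c x y) w +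
      inner ℝ w (acc X y (cY c x y) v) = 0 := by
  have h := S.fderiv_sndDeriv_add_inner_acc hx hy v (vel Y x (cX c x y) w)
  rw [S.cXY_vel hx hy] at h
  rw [← h]
  congr 1
  unfold Aform
  have hd : Differentiable ℝ (fun y' => sndDeriv (fun z => c z y') x (vel X y (cY c x y) v)) :=
    ((contDiff_sndDeriv_cost S.hc).comp
      (contDiff_const.prodMk (contDiff_const.prodMk contDiff_id))).differentiable (by norm_num)
  rw [fderiv_fun_comp (g := fun y' => sndDeriv (fun z => c z y') x (vel X y (cY c x y) v)) _ (hd _)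
    ((S.contDiff_Y_slice x).differentiable (by norm_num) _), S.Y_cX hx hy]
  rfl

theorem isCompact_image_cX : IsCompact ((fun z : E n × E n => (z.1, cX c z.1 z.2)) ''
    (closure Ω ×ˢ closure Ωs)) :=
  (S.isCompact_fst.prod S.isCompact_snd).image (continuous_fst.prodMk (continuous_cX S.hc))

theorem fderiv_comp_X {f : E n → ℝ} (hf : ContDiff ℝ 2 f) {x y : E n} (hx : x ∈ closure Ω)
    (hy : y ∈ closure Ωs) (v : E n) :
    fderiv ℝ (fun q => f (X (y, q))) (cY c x y) v = fderiv ℝ f x (vel X y (cY c x y) v) := by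
  rw [fderiv_fun_comp _ (hf.differentiable (by norm_num) _)
    ((S.contDiff_X_slice y).differentiable (by norm_num) _), S.X_cY hx hy]
  rfl

theorem sndDeriv_comp_X {f : E n → ℝ} (hf : ContDiff ℝ 2 f) {x y : E n} (hx : x ∈ closure Ω)
    (hy : y ∈ closure Ωs) (v : E n) :
    sndDeriv (fun q => f (X (y, q))) (cY c x y) v = sndDeriv f x (vel X y (cY c x y) v) +
      fderiv ℝ f x (acc X y (cY c x y) v) := by
  rw [sndDeriv_comp hf ((S.contDiff_X_slice y).of_le (by norm_num)), S.X_cY hx hy]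
  rfl

theorem contDiff_comp_X {f : E n → ℝ} (hf : ContDiff ℝ 2 f) (y : E n) :
    ContDiff ℝ 2 (fun q => f (X (y, q))) :=
  hf.comp ((S.contDiff_X_slice y).of_le (by norm_num))

/-- The two inverse maps `Y(x, ·)` and `X(y, ·)` have transposed derivatives. -/
theorem inner_vel_vel {x y : E n} (hx : x ∈ closure Ω) (hy : y ∈ closure Ωs) (w w' : E n) :
    inner ℝ (vel X y (cY c x y) w) w' = inner ℝ w (vel Y x (cX c x y) w') := by
  have h1 := inner_cXY_swapCost S.hc x y (vel X y (cY c x y) w) (vel Y x (cX c x y) w')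
  rw [S.cXY_vel hx hy] at h1
  have h2 : cXY (swapCost c) y x (vel X y (cY c x y) w) = w := S.swap.cXY_vel hy hx w
  rw [h2] at h1
  rw [h1, real_inner_comm]

theorem cInv_eq {x y : E n} (hx : x ∈ closure Ω) (hy : y ∈ closure Ωs) (w : E n) :
    cInv c x y w = vel Y x (cX c x y) w := by
  unfold cInv
  exact inverse_apply_eq (f := cXY c x y) (g := fderiv ℝ (fun q => Y (x, q)) (cX c x y))
    (S.vel_cXY hx hy) (S.cXY_vel hx hy) w

/-- The second fundamental form in the condition of uniform `c`-convexity is the Hessian, in the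
coordinates `c_y(x, y)`, of a defining function. -/
theorem curvature_eq {x y : E n} (hx : x ∈ closure Ω) (hy : y ∈ closure Ωs) {ψ : E n → ℝ}
    {γ : E n → E n} (hγ : γ x = ‖gradient ψ x‖⁻¹ • gradient ψ x) {v : E n}
    (hγ' : inner ℝ (fderiv ℝ γ x (vel X y (cY c x y) v)) (vel X y (cY c x y) v) =
      ‖gradient ψ x‖⁻¹ * sndDeriv ψ x (vel X y (cY c x y) v)) :
    inner ℝ (fderiv ℝ γ x (vel X y (cY c x y) v)) (vel X y (cY c x y) v) -
      fderiv ℝ (fun y' => inner ℝ (cXX c x y' (vel X y (cY c x y) v)) (vel X y (cY c x y) v)) y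
        (cInv c x y (γ x)) =
    ‖gradient ψ x‖⁻¹ * (sndDeriv ψ x (vel X y (cY c x y) v) +
      fderiv ℝ ψ x (acc X y (cY c x y) v)) := by
  have h1 : (fun y' => inner ℝ (cXX c x y' (vel X y (cY c x y) v)) (vel X y (cY c x y) v)) =
      fun y' => sndDeriv (fun z => c z y') x (vel X y (cY c x y) v) := by
    ext y'
    exact inner_hess_self ((contDiff_slice S.hc y').of_le two_le_four) x _
  have h2 := S.fderiv_sndDeriv_add_inner_acc hx hy v (vel Y x (cX c x y) (γ x))
  rw [S.cXY_vel hx hy, hγ, inner_smul_left, inner_gradient] at h2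
  rw [h1, S.cInv_eq hx hy, hγ', hγ]
  simp only [RCLike.conj_to_real] at h2
  linarith

end Base

namespace Setup

variable {n : ℕ} {c : E n → E n → ℝ} {Ω Ωs : Set (E n)} {φ φs : E n → ℝ}
  {X Y : E n × E n → E n} (S : Setup c Ω Ωs φ φs X Y)

include S

theorem swap : Setup (swapCost c) Ωs Ω φs φ Y X := ⟨S.toBase.swap, S.convSnd, S.convFst⟩

/-- The quantitative form of the condition A3w, without orthogonality. -/
theorem exists_Aform_lower_bound : ∃ K : ℝ, 0 ≤ K ∧ ∀ x ∈ closure Ω, ∀ y ∈ closure Ωs,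
    ∀ ξ w : E n, -(K * |inner ℝ w ξ| * ‖ξ‖ * ‖w‖) ≤ sndDeriv (Aform c Y x ξ) (cX c x y) w := by
  set B : E n × E n × E n → ℝ := fun z => Aform c Y z.2.1 z.1 z.2.2 with hB
  have hBc := S.contDiff_Aform
  have hcomp : IsCompact (Metric.closedBall (0 : E n) 1 ×ˢ
      ((fun z : E n × E n => (z.1, cX c z.1 z.2)) '' (closure Ω ×ˢ closure Ωs))) :=
    (isCompact_closedBall _ _).prod S.isCompact_image_cX
  obtain ⟨M, hM⟩ := hcomp.exists_bound_of_continuousOn (f := fderiv ℝ (fderiv ℝ B))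
    ((contDiff_one_fderiv hBc).continuous_fderiv (by norm_num)).continuousOn
  have hunit : ∀ x ∈ closure Ω, ∀ y ∈ closure Ωs, ∀ ξ w : E n, ‖ξ‖ = 1 →
      -(3 * |M| * |inner ℝ w ξ| * ‖w‖) ≤ sndDeriv (Aform c Y x ξ) (cX c x y) w := by
    intro x hx y hy ξ w hξ
    set D : E n → E n → ℝ := fun w w' =>
      fderiv ℝ (fderiv ℝ B) (ξ, x, cX c x y) (0, 0, w) (0, 0, w') with hD
    have hsl : ∀ w, sndDeriv (Aform c Y x ξ) (cX c x y) w = D w w := by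
      intro w
      have h1 := sndDeriv_slice_right (F := B) hBc ξ (x, cX c x y) (0, w)
      have h2 := sndDeriv_slice_right (F := fun z => B (ξ, z))
        (hBc.comp (contDiff_mk_right ξ)) x (cX c x y) w
      exact h2.trans h1
    have hbd : ∀ w w', |D w w'| ≤ |M| * ‖w‖ * ‖w'‖ := by
      intro w w'
      have h0 := hM (ξ, x, cX c x y) ⟨by simp [hξ], ⟨(x, y), ⟨hx, hy⟩, rfl⟩⟩
      have h1 := (fderiv ℝ (fderiv ℝ B) (ξ, x, cX c x y)).le_opNorm₂ (0, 0, w) (0, 0, w')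
      have n1 : ∀ w : E n, ‖((0 : E n), (0 : E n), w)‖ = ‖w‖ := by
        intro w; simp [Prod.norm_def]
      rw [n1, n1, Real.norm_eq_abs] at h1
      refine h1.trans ?_
      gcongr
      exact h0.trans (le_abs_self M)
    have hadd : ∀ a b, D (a + b) (a + b) = D a a + D a b + D b a + D b b := by
      intro a b
      have : ((0 : E n), (0 : E n), a + b) = (0, 0, a) + (0, 0, b) := by simp
      simp only [hD, this, map_add, add_apply]
      ring
    have hsm1 : ∀ (r : ℝ) a b, D (r • a) b = r * D a b := by
      intro r a b
      have : ((0 : E n), (0 : E n), r • a) = r • (0, 0, a) := by simp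
      simp only [hD, this, map_smul, smul_apply, smul_eq_mul]
    have hsm2 : ∀ (r : ℝ) a b, D a (r • b) = r * D a b := by
      intro r a b
      have : ((0 : E n), (0 : E n), r • b) = r • (0, 0, b) := by simp
      simp only [hD, this, map_smul, smul_eq_mul]
    -- decompose `w` into its parts orthogonal and parallel to `ξ`; the hypothesis covers the first
    -- one
    set α : ℝ := inner ℝ w ξ with hα
    set w0 := w - α • ξ with hw0
    have horth : inner ℝ w0 ξ = 0 := by
      rw [hw0, inner_sub_left, inner_smul_left, real_inner_self_eq_norm_sq, hξ]
      simp [hα]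
    have h1 := S.convFst.mtw x hx y hy ξ w0 horth
    have hw : w = w0 + α • ξ := by simp [hw0]
    have hαw : |α| ≤ ‖w‖ := by
      have := abs_real_inner_le_norm w ξ
      rwa [hξ, mul_one] at this
    have hw0n : ‖w0‖ ≤ ‖w‖ := by
      have : ‖w‖ ^ 2 = ‖w0‖ ^ 2 + ‖α • ξ‖ ^ 2 := by
        conv_lhs => rw [hw]
        rw [norm_add_sq_real, inner_smul_right, horth]; ring
      have h2 : 0 ≤ ‖α • ξ‖ ^ 2 := by positivity
      exact le_of_sq_le_sq (by linarith) (norm_nonneg _)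
    rw [hsl] at h1 ⊢
    have hexp : D w w = D w0 w0 + α * D w0 ξ + α * D ξ w0 + α * α * D ξ ξ := by
      conv_lhs => rw [hw]
      rw [hadd, hsm1, hsm2, hsm1, hsm2]; ring
    have b1 := hbd w0 ξ
    have b2 := hbd ξ w0
    have b3 := hbd ξ ξ
    rw [hξ] at b1 b2 b3
    have e1 : |α * D w0 ξ| ≤ |α| * (|M| * ‖w‖) := by
      rw [abs_mul]; gcongr
      calc _ ≤ _ := b1
        _ ≤ _ := by rw [mul_one]; gcongr
    have e2 : |α * D ξ w0| ≤ |α| * (|M| * ‖w‖) := by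
      rw [abs_mul]; gcongr
      calc _ ≤ _ := b2
        _ ≤ _ := by rw [mul_one]; gcongr
    have e3 : |α * α * D ξ ξ| ≤ |α| * (|M| * ‖w‖) := by
      rw [abs_mul, abs_mul, mul_assoc]
      refine mul_le_mul_of_nonneg_left ?_ (abs_nonneg _)
      calc |α| * |D ξ ξ| ≤ ‖w‖ * (|M| * 1 * 1) := by gcongr
        _ = _ := by ring
    rw [hexp]
    have := neg_abs_le (α * D w0 ξ)
    have := neg_abs_le (α * D ξ w0)
    have := neg_abs_le (α * α * D ξ ξ)
    nlinarith
  refine ⟨3 * |M|, by positivity, fun x hx y hy ξ w => ?_⟩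
  rcases eq_or_ne ξ 0 with rfl | hξ
  · have h0 : Aform c Y x 0 = fun _ => 0 := by
      ext p; unfold Aform; rw [sndDeriv_zero]
    simp [h0, sndDeriv_const]
  · have hn : 0 < ‖ξ‖ := norm_pos_iff.2 hξ
    have h1 := hunit x hx y hy (‖ξ‖⁻¹ • ξ) w (by rw [norm_smul]; simp [hn.ne'])
    have h2 : ξ = ‖ξ‖ • (‖ξ‖⁻¹ • ξ) := by rw [smul_smul, mul_inv_cancel₀ hn.ne', one_smul]
    have h3 : sndDeriv (Aform c Y x ξ) (cX c x y) w =
        ‖ξ‖ ^ 2 * sndDeriv (Aform c Y x (‖ξ‖⁻¹ • ξ)) (cX c x y) w := by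
      conv_lhs => rw [h2, Aform_smul, sndDeriv_const_smul (S.contDiff_Aform_slice _ _)]
      rfl
    rw [h3]
    rw [inner_smul_right, abs_mul, abs_of_pos (inv_pos.2 hn)] at h1
    have h4 : -(3 * |M| * |inner ℝ w ξ| * ‖ξ‖ * ‖w‖) =
        ‖ξ‖ ^ 2 * -(3 * |M| * (‖ξ‖⁻¹ * |inner ℝ w ξ|) * ‖w‖) := by
      field_simp
    rw [h4]
    exact mul_le_mul_of_nonneg_left h1 (by positivity)

end Setup

/-! ### Subsolutions and monotonicity along c-segments -/

section OneSided

theorem eventually_lt_of_deriv_neg {g : ℝ → ℝ} {g' : ℝ} (hg : HasDerivAt g g' 0) (h : g' < 0) :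
    ∀ᶠ t in 𝓝[>] (0 : ℝ), g t < g 0 := by
  filter_upwards [hg.tendsto_slope_zero_right.eventually (eventually_lt_nhds h),
    self_mem_nhdsWithin] with t ht ht0
  have ht0' : (0 : ℝ) < t := ht0
  simp only [zero_add, smul_eq_mul] at ht
  have := mul_neg_of_pos_of_neg ht0' ht
  rw [← mul_assoc, mul_inv_cancel₀ ht0'.ne', one_mul] at this
  linarith

theorem deriv_nonneg_of_eventually {g : ℝ → ℝ} {g' : ℝ} (hg : HasDerivAt g g' 0)
    (h : ∀ᶠ t in 𝓝[>] (0 : ℝ), g 0 ≤ g t) : 0 ≤ g' := by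
  by_contra! hneg
  obtain ⟨t, h1, h2⟩ := (h.and (eventually_lt_of_deriv_neg hg hneg)).exists
  linarith

theorem Icc_mem_nhdsGT : ∀ᶠ t : ℝ in 𝓝[>] 0, t ∈ Icc (0 : ℝ) 1 :=
  Icc_mem_nhdsGT_of_mem (by simp)

end OneSided

section Defining

variable {n : ℕ} {Ω : Set (E n)} {φ : E n → ℝ}

theorem IsDefining.eq_zero (hφ : IsDefining Ω φ) (hΩ : IsOpen Ω) {x : E n}
    (hx : x ∈ frontier Ω) : φ x = 0 := by
  have h1 := hφ.eventually x hx
  refine le_antisymm ?_ ?_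
  · have h2 : ∃ᶠ z in 𝓝 x, z ∈ Ω := mem_closure_iff_frequently.1 (frontier_subset_closure hx)
    by_contra! hpos
    have h3 := hφ.smooth.continuous.continuousAt.eventually (eventually_gt_nhds hpos)
    obtain ⟨z, hz, hz1, hz3⟩ := (h2.and_eventually (h1.and h3)).exists
    exact absurd (hz1.1 hz) (not_lt.2 hz3.le)
  · by_contra! hneg
    have := h1.self_of_nhds.2 hneg
    rw [hΩ.frontier_eq] at hx
    exact hx.2 this

theorem IsDefining.eventually_nonpos (hφ : IsDefining Ω φ) {x : E n}
    (hx : x ∈ frontier Ω) : ∀ᶠ z in 𝓝 x, z ∈ closure Ω → φ z ≤ 0 := by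
  filter_upwards [(hφ.eventually x hx).eventually_nhds] with z hz hzc
  by_contra! hpos
  have h3 := hφ.smooth.continuous.continuousAt.eventually (eventually_gt_nhds hpos)
  obtain ⟨w, hw, hw1, hw3⟩ := ((mem_closure_iff_frequently.1 hzc).and_eventually (hz.and h3)).exists
  exact absurd (hw1.1 hw) (not_lt.2 hw3.le)

theorem IsDefining.differentiable (hφ : IsDefining Ω φ) : Differentiable ℝ φ :=
  hφ.smooth.differentiable (by norm_num)

/-- Directions along which the defining function decreases point into the domain. -/
theorem IsDefining.eventually_mem (hφ : IsDefining Ω φ) (hΩ : IsOpen Ω) {x v : E n}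
    (hx : x ∈ frontier Ω) (hv : fderiv ℝ φ x v < 0) : ∀ᶠ t : ℝ in 𝓝[>] 0, x + t • v ∈ Ω := by
  have h1 := hasDerivAt_line φ hφ.differentiable x v 0
  rw [zero_smul, add_zero] at h1
  have h2 := eventually_lt_of_deriv_neg h1 hv
  have h3 : Tendsto (fun t : ℝ => x + t • v) (𝓝[>] 0) (𝓝 x) := by
    have : Continuous fun t : ℝ => x + t • v := by fun_prop
    simpa using (this.tendsto 0).mono_left nhdsWithin_le_nhds
  filter_upwards [h2, h3.eventually (hφ.eventually x hx)] with t ht ht'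
  simp only [zero_smul, add_zero, hφ.eq_zero hΩ hx] at ht
  exact ht'.2 ht

end Defining

/-- A smooth function `u` whose `c`-normal image of the closure of `Ω` stays inside `Ω*`, and which
is degenerate elliptic: `D²u ≥ A(·, Du)`. -/
structure IsSubsolution {n : ℕ} (c : E n → E n → ℝ) (Ω Ωs : Set (E n)) (u : E n → ℝ) : Prop where
  smooth : ContDiff ℝ 4 u
  touch : ∀ x ∈ closure Ω, ∃ y ∈ Ωs, gradient u x = cX c x y ∧
    ∀ ξ, sndDeriv (fun z => c z y) x ξ ≤ sndDeriv u x ξ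

/-- `x` minimizes `u - c(·, y)` over `D`. -/
def IsMinimizer {n : ℕ} (c : E n → E n → ℝ) (D : Set (E n)) (u : E n → ℝ) (y x : E n) : Prop :=
  x ∈ D ∧ ∀ z ∈ D, u x - c x y ≤ u z - c z y

namespace Setup

variable {n : ℕ} {c : E n → E n → ℝ} {Ω Ωs : Set (E n)} {φ φs : E n → ℝ}
  {X Y : E n × E n → E n} (S : Setup c Ω Ωs φ φs X Y)

include S

omit S in
theorem Aform_of_eq {x y p : E n} (h : Y (x, p) = y) (ξ : E n) :
    Aform c Y x ξ p = sndDeriv (fun z => c z y) x ξ := by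
  unfold Aform; rw [h]

theorem exists_cX_segment {x y₀ y₁ : E n} (hx : x ∈ closure Ω) (h0 : y₀ ∈ closure Ωs)
    (h1 : y₁ ∈ closure Ωs) {t : ℝ} (ht : t ∈ Icc (0 : ℝ) 1) :
    ∃ y ∈ closure Ωs, cX c x y = cX c x y₀ + t • (cX c x y₁ - cX c x y₀) := by
  have hc : Convex ℝ ((fun y => cX c x y) '' closure Ωs) := S.convSnd.conv x hx
  exact hc.add_smul_sub_mem (mem_image_of_mem _ h0) (mem_image_of_mem _ h1) ht

theorem exists_cY_segment {y x₀ x₁ : E n} (hy : y ∈ closure Ωs) (h0 : x₀ ∈ closure Ω)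
    (h1 : x₁ ∈ closure Ω) {t : ℝ} (ht : t ∈ Icc (0 : ℝ) 1) :
    ∃ x ∈ closure Ω, cY c x y = cY c x₀ y + t • (cY c x₁ y - cY c x₀ y) :=
  S.swap.exists_cX_segment hy h0 h1 ht

/-- The lower bound for the second derivative of `A` along segments of the convex set
`c_x(x, Ω*)`. -/
theorem exists_Aform_line_bound : ∃ K : ℝ, 0 ≤ K ∧ ∀ x ∈ closure Ω, ∀ y ∈ closure Ωs,
    ∀ y' ∈ closure Ωs, ∀ ξ : E n, ∀ t ∈ Icc (0 : ℝ) 1,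
      -(K * |inner ℝ (cX c x y' - cX c x y) ξ| * ‖ξ‖) ≤
        sndDeriv (Aform c Y x ξ) (cX c x y + t • (cX c x y' - cX c x y))
          (cX c x y' - cX c x y) := by
  obtain ⟨K, hK, h⟩ := S.exists_Aform_lower_bound
  obtain ⟨R, hR⟩ := ((S.isCompact_fst.prod S.isCompact_snd).exists_bound_of_continuousOn
    (continuous_cX S.hc).continuousOn)
  refine ⟨K * (|R| + |R|), by positivity, fun x hx y hy y' hy' ξ t ht => ?_⟩
  obtain ⟨z, hz, hze⟩ := S.exists_cX_segment hx hy hy' ht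
  have h1 := h x hx z hz ξ (cX c x y' - cX c x y)
  rw [← hze]
  refine le_trans ?_ h1
  have h2 : ‖cX c x y' - cX c x y‖ ≤ |R| + |R| :=
    (norm_sub_le _ _).trans (add_le_add ((hR (x, y') ⟨hx, hy'⟩).trans (le_abs_self R))
      ((hR (x, y) ⟨hx, hy⟩).trans (le_abs_self R)))
  rw [neg_le_neg_iff]
  calc _ ≤ K * |inner ℝ (cX c x y' - cX c x y) ξ| * ‖ξ‖ * (|R| + |R|) := by gcongr
    _ = _ := by ring

/-- Semiconvexity of `A` along segments. -/
theorem exists_Aform_semiconvex : ∃ K : ℝ, 0 ≤ K ∧ ∀ x ∈ closure Ω, ∀ y ∈ closure Ωs,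
    ∀ y' ∈ closure Ωs, ∀ z ∈ closure Ωs, ∀ ξ : E n, ∀ t ∈ Icc (0 : ℝ) 1,
      cX c x z = cX c x y + t • (cX c x y' - cX c x y) →
      -(K * |inner ℝ (cX c x y' - cX c x y) ξ| * ‖ξ‖ * (t * (1 - t))) ≤
        (1 - t) * sndDeriv (fun w => c w y) x ξ + t * sndDeriv (fun w => c w y') x ξ -
          sndDeriv (fun w => c w z) x ξ := by
  obtain ⟨K, hK, h⟩ := S.exists_Aform_line_bound
  refine ⟨K / 2, by positivity, fun x hx y hy y' hy' z hz ξ t ht he => ?_⟩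
  have h1 := semiconvex_lower_bound
    (fun t => hasDerivAt_line (Aform c Y x ξ) ((S.contDiff_Aform_slice x ξ).differentiable
      (by norm_num)) (cX c x y) (cX c x y' - cX c x y) t)
    (fun t => hasDerivAt_fderiv_line (S.contDiff_Aform_slice x ξ) (cX c x y)
      (cX c x y' - cX c x y) t) (h x hx y hy y' hy' ξ) ht
  rw [← he] at h1
  simp only [zero_smul, add_zero, one_smul, add_sub_cancel] at h1
  rw [Aform_of_eq (S.Y_cX hx hy), Aform_of_eq (S.Y_cX hx hy'), Aform_of_eq (S.Y_cX hx hz)] at h1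
  linarith

theorem exists_vel_bound : ∃ K : ℝ, 0 ≤ K ∧ ∀ x ∈ closure Ω, ∀ y ∈ closure Ωs, ∀ v : E n,
    ‖vel X y (cY c x y) v‖ ≤ K * ‖v‖ := by
  obtain ⟨M, hM⟩ := S.swap.isCompact_image_cX.exists_bound_of_continuousOn (f := fderiv ℝ X)
    (S.snd.smoothY.continuous_fderiv (by norm_num)).continuousOn
  refine ⟨|M|, by positivity, fun x hx y hy v => ?_⟩
  unfold vel
  rw [fderiv_slice_right (S.snd.smoothY.differentiable (by norm_num))]
  refine (ContinuousLinearMap.le_opNorm _ _).trans ?_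
  have : ‖((0 : E n), v)‖ = ‖v‖ := by simp [Prod.norm_def]
  rw [this]
  gcongr
  exact (hM (y, cY c x y) ⟨(y, x), ⟨hy, hx⟩, rfl⟩).trans (le_abs_self M)

/-- The second-order inequality for the difference of two cost functions along `c`-segments. -/
theorem exists_cost_lower_bound : ∃ K : ℝ, 0 ≤ K ∧ ∀ x ∈ closure Ω, ∀ y ∈ closure Ωs,
    ∀ y' ∈ closure Ωs, ∀ v : E n,
      -(K * ‖v‖ * |inner ℝ (cX c x y' - cX c x y) (vel X y (cY c x y) v)|) ≤
        sndDeriv (fun z => c z y') x (vel X y (cY c x y) v) -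
          sndDeriv (fun z => c z y) x (vel X y (cY c x y) v) +
          inner ℝ (cX c x y' - cX c x y) (acc X y (cY c x y) v) := by
  obtain ⟨K, hK, h⟩ := S.exists_Aform_line_bound
  obtain ⟨K', hK', h'⟩ := S.exists_vel_bound
  refine ⟨K / 2 * K', by positivity, fun x hx y hy y' hy' v => ?_⟩
  set ξ := vel X y (cY c x y) v with hξ
  have h1 := taylor_lower_bound
    (fun t => hasDerivAt_line (Aform c Y x ξ) ((S.contDiff_Aform_slice x ξ).differentiable
      (by norm_num)) (cX c x y) (cX c x y' - cX c x y) t)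
    (fun t => hasDerivAt_fderiv_line (S.contDiff_Aform_slice x ξ) (cX c x y)
      (cX c x y' - cX c x y) t) (h x hx y hy y' hy' ξ)
  simp only [zero_smul, add_zero, one_smul, add_sub_cancel] at h1
  rw [Aform_of_eq (S.Y_cX hx hy), Aform_of_eq (S.Y_cX hx hy')] at h1
  have h2 := S.fderiv_Aform_add_inner_acc hx hy v (cX c x y' - cX c x y)
  rw [← hξ] at h2
  have h3 : K * |inner ℝ (cX c x y' - cX c x y) ξ| * ‖ξ‖ ≤
      K * |inner ℝ (cX c x y' - cX c x y) ξ| * (K' * ‖v‖) := by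
    gcongr; exact h' x hx y hy v
  linarith

omit S in
theorem contDiff_sub_cost (hc : ContDiff ℝ 4 (Function.uncurry c)) {u : E n → ℝ}
    (hu : ContDiff ℝ 4 u) (y : E n) : ContDiff ℝ 2 (fun x => u x - c x y) :=
  (hu.sub (contDiff_slice hc y)).of_le two_le_four

omit S in
theorem fderiv_sub_cost (hc : ContDiff ℝ 4 (Function.uncurry c)) {u : E n → ℝ}
    (hu : ContDiff ℝ 4 u) (x y v : E n) :
    fderiv ℝ (fun x => u x - c x y) x v = inner ℝ (gradient u x - cX c x y) v := by
  rw [fderiv_fun_sub (hu.differentiable (by norm_num) x)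
    ((contDiff_slice hc y).differentiable (by norm_num) x), inner_sub_left, inner_gradient,
    inner_cX']
  rfl

omit S in
theorem sndDeriv_sub_cost (hc : ContDiff ℝ 4 (Function.uncurry c)) {u : E n → ℝ}
    (hu : ContDiff ℝ 4 u) (x y v : E n) :
    sndDeriv (fun x => u x - c x y) x v = sndDeriv u x v - sndDeriv (fun z => c z y) x v :=
  sndDeriv_sub (hu.of_le two_le_four) ((contDiff_slice hc y).of_le two_le_four) x v

variable {u : E n → ℝ} (hu : IsSubsolution c Ω Ωs u)

include hu

/-- Along a `c`-segment with respect to `y`, the function `g = u - c(·, y)` satisfies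
`g'' ≥ -K |g'|`. -/
theorem exists_sndDeriv_lower_bound : ∃ K : ℝ, 0 ≤ K ∧ ∀ x ∈ closure Ω, ∀ y ∈ closure Ωs,
    ∀ v : E n, -(K * ‖v‖ * |fderiv ℝ (fun q => u (X (y, q)) - c (X (y, q)) y) (cY c x y) v|) ≤
      sndDeriv (fun q => u (X (y, q)) - c (X (y, q)) y) (cY c x y) v := by
  obtain ⟨K, hK, h⟩ := S.exists_cost_lower_bound
  refine ⟨K, hK, fun x hx y hy v => ?_⟩
  have hd := contDiff_sub_cost S.hc hu.smooth y
  rw [S.fderiv_comp_X (f := fun x => u x - c x y) hd hx hy,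
    S.sndDeriv_comp_X (f := fun x => u x - c x y) hd hx hy, fderiv_sub_cost S.hc hu.smooth,
    fderiv_sub_cost S.hc hu.smooth, sndDeriv_sub_cost S.hc hu.smooth]
  obtain ⟨y', hy', hg, hs⟩ := hu.touch x hx
  rw [hg]
  have h1 := h x hx y hy y' (subset_closure hy') v
  have h2 := hs (vel X y (cY c x y) v)
  linarith

/-- If `u - c(·, y)` does not decrease initially along a `c`-segment with respect to `y`, it does
not decrease along the whole of it. -/
theorem monotoneOn_cSegment {x₀ x₁ y : E n} (hx₀ : x₀ ∈ closure Ω) (hx₁ : x₁ ∈ closure Ω)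
    (hy : y ∈ closure Ωs)
    (h0 : 0 ≤ fderiv ℝ (fun q => u (X (y, q)) - c (X (y, q)) y) (cY c x₀ y)
      (cY c x₁ y - cY c x₀ y)) :
    MonotoneOn (fun t : ℝ => u (X (y, cY c x₀ y + t • (cY c x₁ y - cY c x₀ y))) -
      c (X (y, cY c x₀ y + t • (cY c x₁ y - cY c x₀ y))) y) (Icc 0 1) := by
  obtain ⟨K, hK, h⟩ := S.exists_sndDeriv_lower_bound hu
  set F := fun q => u (X (y, q)) - c (X (y, q)) y with hF
  have hFc : ContDiff ℝ 2 F := S.contDiff_comp_X (contDiff_sub_cost S.hc hu.smooth y) y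
  set q₀ := cY c x₀ y
  set v := cY c x₁ y - cY c x₀ y
  have h1 : ∀ t, HasDerivAt (fun t : ℝ => F (q₀ + t • v)) (fderiv ℝ F (q₀ + t • v) v) t :=
    fun t => hasDerivAt_line F (hFc.differentiable (by norm_num)) q₀ v t
  have h2 := nonneg_of_deriv_ge_neg_abs (K := K * ‖v‖)
    (fun t _ => hasDerivAt_fderiv_line hFc q₀ v t)
    (by
      intro t ht
      obtain ⟨x, hx, hxe⟩ := S.exists_cY_segment hy hx₀ hx₁ ht
      have h3 := h x hx y hy v
      rw [hxe] at h3
      simpa using h3) (by simpa using h0)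
  exact monotoneOn_of_deriv_nonneg (convex_Icc 0 1)
    (fun t _ => (h1 t).continuousAt.continuousWithinAt)
    (fun t _ => (h1 t).differentiableAt.differentiableWithinAt)
    (fun t ht => by rw [(h1 t).deriv]; exact h2 t (interior_subset ht))

/-- First-order conditions are sufficient for a minimum. -/
theorem isMinimizer_of_fderiv_nonneg {x₀ y : E n} (hx₀ : x₀ ∈ closure Ω) (hy : y ∈ closure Ωs)
    (h0 : ∀ x₁ ∈ closure Ω, 0 ≤ fderiv ℝ (fun q => u (X (y, q)) - c (X (y, q)) y) (cY c x₀ y)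
      (cY c x₁ y - cY c x₀ y)) : IsMinimizer c (closure Ω) u y x₀ := by
  refine ⟨hx₀, fun x₁ hx₁ => ?_⟩
  have h := S.monotoneOn_cSegment hu hx₀ hx₁ hy (h0 x₁ hx₁) (left_mem_Icc.2 zero_le_one)
    (right_mem_Icc.2 zero_le_one) zero_le_one
  simpa [S.X_cY hx₀ hy, S.X_cY hx₁ hy] using h

theorem isMinimizer_of_gradient_eq {x₀ y : E n} (hx₀ : x₀ ∈ closure Ω) (hy : y ∈ closure Ωs)
    (h : gradient u x₀ = cX c x₀ y) : IsMinimizer c (closure Ω) u y x₀ := by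
  refine S.isMinimizer_of_fderiv_nonneg hu hx₀ hy fun x₁ hx₁ => ?_
  rw [S.fderiv_comp_X (f := fun x => u x - c x y) (contDiff_sub_cost S.hc hu.smooth y) hx₀ hy,
    fderiv_sub_cost S.hc hu.smooth, h]
  simp

omit hu in
/-- The image of the closure of `Ω` lies in the half space supporting it at a boundary point. -/
theorem fderiv_comp_X_nonpos {x₀ x₁ y : E n} (hx₀ : x₀ ∈ frontier Ω) (hx₁ : x₁ ∈ closure Ω)
    (hy : y ∈ closure Ωs) :
    fderiv ℝ (fun q => φ (X (y, q))) (cY c x₀ y) (cY c x₁ y - cY c x₀ y) ≤ 0 := by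
  have hx₀' := frontier_subset_closure hx₀
  have hφ2 : ContDiff ℝ 2 φ := S.fst.defining.smooth.of_le two_le_four
  set v := cY c x₁ y - cY c x₀ y with hv
  have hd := hasDerivAt_line (fun q => -φ (X (y, q)))
    ((S.contDiff_comp_X hφ2 y).neg.differentiable (by norm_num)) (cY c x₀ y) v 0
  have hnn : 0 ≤ fderiv ℝ (fun q => -φ (X (y, q))) (cY c x₀ y + (0 : ℝ) • v) v := by
    refine deriv_nonneg_of_eventually hd ?_
    have hcont : Tendsto (fun t : ℝ => X (y, cY c x₀ y + t • v)) (𝓝[>] 0) (𝓝 x₀) := by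
      have : Continuous fun t : ℝ => X (y, cY c x₀ y + t • v) :=
        (S.contDiff_X_slice y).continuous.comp (by fun_prop)
      have h2 := (this.tendsto 0).mono_left (nhdsWithin_le_nhds (s := Ioi 0))
      simpa [S.X_cY hx₀' hy] using h2
    filter_upwards [hcont.eventually (S.fst.defining.eventually_nonpos hx₀), Icc_mem_nhdsGT]
      with t ht ht1
    obtain ⟨x, hx, hxe⟩ := S.exists_cY_segment hy hx₀' hx₁ ht1
    rw [zero_smul, add_zero, S.X_cY hx₀' hy, S.fst.defining.eq_zero S.fst.isOpen hx₀]
    have := ht (by rw [← hxe, S.X_cY hx hy]; exact hx)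
    linarith
  rw [zero_smul, add_zero, fderiv_fun_neg] at hnn
  simpa using hnn

/-- The points of the ray `Du + s∇φ` over a boundary point have this point as contact point. -/
theorem isMinimizer_of_gradient_eq_sub {x₀ y : E n} (hx₀ : x₀ ∈ frontier Ω) (hy : y ∈ closure Ωs)
    {s : ℝ} (hs : 0 ≤ s) (h : cX c x₀ y = gradient u x₀ + s • gradient φ x₀) :
    IsMinimizer c (closure Ω) u y x₀ := by
  have hx₀' := frontier_subset_closure hx₀
  refine S.isMinimizer_of_fderiv_nonneg hu hx₀' hy fun x₁ hx₁ => ?_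
  have hφ2 : ContDiff ℝ 2 φ := S.fst.defining.smooth.of_le two_le_four
  have h1 := S.fderiv_comp_X_nonpos hx₀ hx₁ hy
  rw [S.fderiv_comp_X hφ2 hx₀' hy] at h1
  rw [S.fderiv_comp_X (f := fun x => u x - c x y) (contDiff_sub_cost S.hc hu.smooth y) hx₀' hy,
    fderiv_sub_cost S.hc hu.smooth, h, sub_add_cancel_left, inner_neg_left, inner_smul_left,
    inner_gradient]
  simp only [RCLike.conj_to_real]
  nlinarith

omit S in
omit hu in
theorem exists_isMinimizer (hc : ContDiff ℝ 4 (Function.uncurry c)) {D : Set (E n)}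
    (hD : IsCompact D) (hne : D.Nonempty) {u : E n → ℝ} (hu : ContinuousOn u D) (y : E n) :
    ∃ x, IsMinimizer c D u y x := by
  obtain ⟨x, hx, hm⟩ := hD.exists_isMinOn hne (f := fun x => u x - c x y)
    (hu.sub (contDiff_slice hc y).continuous.continuousOn)
  exact ⟨x, hx, fun z hz => hm hz⟩

omit hu in
/-- First-order necessary conditions for a minimum. -/
theorem exists_cX_eq_of_isMinimizer {u : E n → ℝ} (hu : ContDiff ℝ 4 u) {x₀ y : E n}
    (h : IsMinimizer c (closure Ω) u y x₀) (hx₀ : x₀ ∈ frontier Ω) :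
    ∃ s : ℝ, 0 ≤ s ∧ cX c x₀ y = gradient u x₀ + s • gradient φ x₀ := by
  have hd := contDiff_sub_cost S.hc hu y
  obtain ⟨s, hs, he⟩ := exists_eq_neg_smul_of_nonneg (l := fderiv ℝ φ x₀)
    (m := fderiv ℝ (fun x => u x - c x y) x₀) (S.fst.defining.fderiv_ne x₀ hx₀) (by
      intro v hv
      have h1 := hasDerivAt_line _ (hd.differentiable (by norm_num)) x₀ v 0
      rw [zero_smul, add_zero] at h1
      refine deriv_nonneg_of_eventually h1 ?_
      filter_upwards [S.fst.defining.eventually_mem S.fst.isOpen hx₀ hv] with t ht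
      simpa using h.2 _ (subset_closure ht))
  refine ⟨s, hs, ext_inner_right ℝ fun v => ?_⟩
  have h2 := congrArg (fun L : E n →L[ℝ] ℝ => L v) he
  simp only [fderiv_sub_cost S.hc hu, inner_sub_left, smul_apply, smul_eq_mul] at h2
  rw [inner_add_left, inner_smul_left, inner_gradient (f := φ)]
  simp only [RCLike.conj_to_real]
  linarith

omit hu in
/-- A contact point which is not critical is on the boundary. -/
theorem isMinimizer_mem_frontier {u : E n → ℝ} (hu : ContDiff ℝ 4 u) {x₀ y : E n}
    (h : IsMinimizer c (closure Ω) u y x₀) (hne : gradient u x₀ ≠ cX c x₀ y) :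
    x₀ ∈ frontier Ω := by
  rw [S.fst.isOpen.frontier_eq]
  refine ⟨h.1, fun hx => hne ?_⟩
  have hmin : IsLocalMin (fun x => u x - c x y) x₀ := by
    filter_upwards [S.fst.isOpen.mem_nhds hx] with z hz
    exact h.2 z (subset_closure hz)
  have h1 := hmin.fderiv_eq_zero
  refine sub_eq_zero.1 (ext_inner_right ℝ fun v => ?_)
  rw [← fderiv_sub_cost S.hc hu, h1]
  simp

/-- A point `y` of the closure of `Ω*` outside the image of `Tu` has a single contact point: two of
them would be joined by a `c`-segment of contact points, contained in the boundary of `Ω`. -/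
theorem isMinimizer_unique {x₀ x₁ y : E n} (hy : y ∈ closure Ωs)
    (hne : ∀ x ∈ closure Ω, gradient u x ≠ cX c x y)
    (h₀ : IsMinimizer c (closure Ω) u y x₀) (h₁ : IsMinimizer c (closure Ω) u y x₁) :
    x₀ = x₁ := by
  set F := fun q => u (X (y, q)) - c (X (y, q)) y with hF
  have hFc : ContDiff ℝ 2 F := S.contDiff_comp_X (contDiff_sub_cost S.hc hu.smooth y) y
  set q₀ := cY c x₀ y with hq₀
  set v := cY c x₁ y - cY c x₀ y with hv
  have hmin : ∀ t ∈ Icc (0 : ℝ) 1, F q₀ ≤ F (q₀ + t • v) := by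
    intro t ht
    obtain ⟨x, hx, hxe⟩ := S.exists_cY_segment hy h₀.1 h₁.1 ht
    rw [← hxe, hF]
    simp only [hq₀, S.X_cY hx hy, S.X_cY h₀.1 hy]
    exact h₀.2 x hx
  have hd := hasDerivAt_line F (hFc.differentiable (by norm_num)) q₀ v 0
  have hnn : 0 ≤ fderiv ℝ F (q₀ + (0 : ℝ) • v) v := by
    refine deriv_nonneg_of_eventually hd ?_
    filter_upwards [Icc_mem_nhdsGT] with t ht
    simpa using hmin t ht
  rw [zero_smul, add_zero] at hnn
  -- `F` is monotone along the segment joining two of its minimum points, hence constant on it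
  have hmono := S.monotoneOn_cSegment hu h₀.1 h₁.1 hy hnn
  have h01 : F (q₀ + (1 : ℝ) • v) = F q₀ := by
    simp only [hF, hq₀, hv, one_smul, add_sub_cancel, S.X_cY h₁.1 hy, S.X_cY h₀.1 hy]
    exact le_antisymm (h₁.2 _ h₀.1) (h₀.2 _ h₁.1)
  have hconst : ∀ t ∈ Icc (0 : ℝ) 1, F (q₀ + t • v) = F q₀ := by
    intro t ht
    refine le_antisymm ?_ (hmin t ht)
    rw [← h01]
    exact hmono ht (right_mem_Icc.2 zero_le_one) ht.2
  have hφ2 : ContDiff ℝ 2 φ := S.fst.defining.smooth.of_le two_le_four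
  -- all points of the segment are then contact points, and lie on the boundary
  have hzero : ∀ t ∈ Icc (0 : ℝ) 1, ∃ x ∈ frontier Ω, cY c x y = q₀ + t • v := by
    intro t ht
    obtain ⟨x, hx, hxe⟩ := S.exists_cY_segment hy h₀.1 h₁.1 ht
    refine ⟨x, S.isMinimizer_mem_frontier hu.smooth (y := y) ⟨hx, fun z hz => ?_⟩ (hne x hx), hxe⟩
    have := hconst t ht
    rw [← hxe, hF] at this
    simp only [hq₀, S.X_cY hx hy, S.X_cY h₀.1 hy] at this
    rw [this]
    exact h₀.2 z hz
  have hz : ∀ t ∈ Icc (0 : ℝ) 1, φ (X (y, q₀ + t • v)) = 0 := by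
    intro t ht
    obtain ⟨x, hx, hxe⟩ := hzero t ht
    rw [← hxe, S.X_cY (frontier_subset_closure hx) hy, S.fst.defining.eq_zero S.fst.isOpen hx]
  have hd1 : ∀ t ∈ Ioo (0 : ℝ) 1, fderiv ℝ (fun q => φ (X (y, q))) (q₀ + t • v) v = 0 := by
    intro t ht
    have h1 := hasDerivAt_line (fun q => φ (X (y, q)))
      ((S.contDiff_comp_X hφ2 y).differentiable (by norm_num)) q₀ v t
    have h2 : (fun t : ℝ => φ (X (y, q₀ + t • v))) =ᶠ[𝓝 t] fun _ => 0 := by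
      filter_upwards [Icc_mem_nhds ht.1 ht.2] with s hs using hz s hs
    exact h1.unique ((hasDerivAt_const t (0 : ℝ)).congr_of_eventuallyEq h2)
  have hhalf : (1 / 2 : ℝ) ∈ Ioo (0 : ℝ) 1 := by constructor <;> norm_num
  -- a segment in the boundary contradicts uniform convexity
  have hd2 : sndDeriv (fun q => φ (X (y, q))) (q₀ + (1 / 2 : ℝ) • v) v = 0 := by
    have h1 := hasDerivAt_fderiv_line (S.contDiff_comp_X hφ2 y) q₀ v (1 / 2)
    have h2 : (fun t : ℝ => fderiv ℝ (fun q => φ (X (y, q))) (q₀ + t • v) v) =ᶠ[𝓝 (1 / 2)]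
        fun _ => 0 := by
      filter_upwards [Ioo_mem_nhds hhalf.1 hhalf.2] with s hs using hd1 s hs
    exact h1.unique ((hasDerivAt_const _ (0 : ℝ)).congr_of_eventuallyEq h2)
  obtain ⟨κ, hκ, hcurv⟩ := S.convFst.curv
  obtain ⟨x, hx, hxe⟩ := hzero (1 / 2) (Ioo_subset_Icc_self hhalf)
  have h3 := hcurv x hx y hy v (by rw [hxe]; exact hd1 _ hhalf)
  rw [hxe, hd2] at h3
  have hv0 : v = 0 := by
    have : ‖v‖ ^ 2 ≤ 0 := by nlinarith [sq_nonneg ‖v‖]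
    simpa using this
  exact (S.snd.inj y hy (sub_eq_zero.1 hv0)).symm

/-- Nondegeneracy of boundary contact points: `u - c(·, y) + s φ` is, in the coordinates
`q = c_y(x, y)`, uniformly convex in tangential directions. -/
theorem exists_sndDeriv_lagrangian_lower_bound : ∃ κ : ℝ, 0 < κ ∧ ∀ x ∈ frontier Ω,
    ∀ y ∈ closure Ωs, ∀ s : ℝ, 0 ≤ s → cX c x y = gradient u x + s • gradient φ x →
      ∀ v : E n, fderiv ℝ (fun q => φ (X (y, q))) (cY c x y) v = 0 →
        s * κ * ‖v‖ ^ 2 ≤ sndDeriv u x (vel X y (cY c x y) v) -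
          sndDeriv (fun z => c z y) x (vel X y (cY c x y) v) +
            s * sndDeriv φ x (vel X y (cY c x y) v) := by
  obtain ⟨κ, hκ, hcurv⟩ := S.convFst.curv
  obtain ⟨K, hK, h⟩ := S.exists_sndDeriv_lower_bound hu
  refine ⟨κ, hκ, fun x hx y hy s hs he v hv => ?_⟩
  have hφ2 : ContDiff ℝ 2 φ := S.fst.defining.smooth.of_le two_le_four
  have hx' := frontier_subset_closure hx
  have h1 := hcurv x hx y hy v hv
  have h2 := h x hx' y hy v
  have hd := contDiff_sub_cost S.hc hu.smooth y
  have hg : ∀ w, fderiv ℝ (fun x => u x - c x y) x w = -s * fderiv ℝ φ x w := by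
    intro w
    rw [fderiv_sub_cost S.hc hu.smooth, he, sub_add_cancel_left, inner_neg_left, inner_smul_left,
      inner_gradient]
    simp
  rw [S.fderiv_comp_X hφ2 hx' hy] at hv
  rw [S.sndDeriv_comp_X hφ2 hx' hy] at h1
  rw [S.fderiv_comp_X (f := fun x => u x - c x y) hd hx' hy,
    S.sndDeriv_comp_X (f := fun x => u x - c x y) hd hx' hy, hg, hg,
    sndDeriv_sub_cost S.hc hu.smooth, hv] at h2
  simp only [mul_zero, abs_zero, neg_zero] at h2
  nlinarith

end Setup

/-! ### The boundary contact point -/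

namespace Setup

variable {n : ℕ} {c : E n → E n → ℝ} {Ω Ωs : Set (E n)} {φ φs : E n → ℝ}
  {X Y : E n × E n → E n} (S : Setup c Ω Ωs φ φs X Y)

include S

/-- The image of an interior point lies strictly inside the supporting half space. -/
theorem fderiv_comp_X_neg {x₀ x₁ y : E n} (hx₀ : x₀ ∈ frontier Ω) (hx₁ : x₁ ∈ Ω)
    (hy : y ∈ closure Ωs) :
    fderiv ℝ φ x₀ (vel X y (cY c x₀ y) (cY c x₁ y - cY c x₀ y)) < 0 := by
  have hφ2 : ContDiff ℝ 2 φ := S.fst.defining.smooth.of_le two_le_four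
  have hx₀' := frontier_subset_closure hx₀
  have hle : ∀ x ∈ closure Ω, fderiv ℝ (fun q => φ (X (y, q))) (cY c x₀ y)
      (cY c x y - cY c x₀ y) ≤ 0 := fun x hx => S.fderiv_comp_X_nonpos hx₀ hx hy
  rw [← S.fderiv_comp_X hφ2 hx₀' hy]
  refine lt_of_le_of_ne (hle x₁ (subset_closure hx₁)) fun h0 => ?_
  set l := fderiv ℝ (fun q => φ (X (y, q))) (cY c x₀ y) with hl
  -- a linear functional attaining its maximum at an interior point vanishes
  have hw : ∀ w, l w ≤ 0 := by
    intro w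
    have hcont : Tendsto (fun t : ℝ => cY c x₁ y + t • w) (𝓝[>] 0) (𝓝 (cY c x₁ y)) := by
      have : Continuous fun t : ℝ => cY c x₁ y + t • w := by fun_prop
      simpa using (this.tendsto 0).mono_left nhdsWithin_le_nhds
    have hcont2 : Tendsto (fun t : ℝ => X (y, cY c x₁ y + t • w)) (𝓝[>] 0) (𝓝 x₁) := by
      have := ((S.contDiff_X_slice y).continuous.tendsto (cY c x₁ y)).comp hcont
      rwa [S.X_cY (subset_closure hx₁) hy] at this
    obtain ⟨t, ht1, ht2, ht0⟩ := ((hcont.eventually (S.eventually_cY_X (subset_closure hx₁) hy)).and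
      ((hcont2.eventually (S.fst.isOpen.mem_nhds hx₁)).and self_mem_nhdsWithin)).exists
    have ht0' : (0 : ℝ) < t := ht0
    have h1 := hle _ (subset_closure ht2)
    simp only [ht1] at h1
    rw [add_sub_right_comm, map_add, h0, map_smul, zero_add, smul_eq_mul] at h1
    nlinarith
  refine S.fst.defining.fderiv_ne x₀ hx₀ (ContinuousLinearMap.ext fun ξ => ?_)
  have h2 : vel X y (cY c x₀ y) (cXY (swapCost c) y x₀ ξ) = ξ := S.swap.vel_cXY hy hx₀' ξ
  have h3 := hw (cXY (swapCost c) y x₀ ξ)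
  have h4 := hw (-(cXY (swapCost c) y x₀ ξ))
  rw [map_neg] at h4
  rw [hl, S.fderiv_comp_X hφ2 hx₀' hy, h2] at h3 h4
  simp only [zero_apply]
  linarith

theorem gradient_ne_zero {x : E n} (hx : x ∈ frontier Ω) : gradient φ x ≠ 0 := by
  intro h
  refine S.fst.defining.fderiv_ne x hx (ContinuousLinearMap.ext fun v => ?_)
  rw [← inner_gradient, h]; simp

theorem isCompact_frontier : IsCompact (frontier Ω) :=
  S.isCompact_fst.of_isClosed_subset isClosed_frontier frontier_subset_closure

variable {u : E n → ℝ} (hu : IsSubsolution c Ω Ωs u)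

omit S in
theorem fderiv_gradient {f : E n → ℝ} (x v : E n) : fderiv ℝ (gradient f) x v = hess f x v := rfl

omit S in
theorem inner_fderiv_cX (hc : ContDiff ℝ 4 (Function.uncurry c)) (x y v : E n) :
    inner ℝ (fderiv ℝ (fun z : E n × E n => cX c z.1 z.2) (x, y) (v, 0)) v =
      sndDeriv (fun z => c z y) x v := by
  rw [← fderiv_slice_left ((contDiff_cX hc).differentiable (by norm_num)),
    ← inner_hess_self ((contDiff_slice hc y).of_le two_le_four)]
  rfl

include hu

/-- The contact point of `u` and the `c`-function of focus `y`, as a smooth function of `y`. -/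
theorem exists_contact_map {M : Set (E n)} (hM : IsCompact M) (hMs : M ⊆ closure Ωs)
    (hMn : ∀ y ∈ M, ∀ x ∈ closure Ω, gradient u x ≠ cX c x y) :
    ∃ (G : E n → E n) (σ : E n → ℝ), ContDiff ℝ 3 G ∧ ContDiff ℝ 3 σ ∧
      (∀ y ∈ M, IsMinimizer c (closure Ω) u y (G y) ∧ G y ∈ frontier Ω ∧ 0 < σ y) ∧
      ∀ y ∈ M, ∀ᶠ z in 𝓝 y, φ (G z) = 0 ∧
        cX c (G z) z = gradient u (G z) + σ z • gradient φ (G z) := by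
  have hgu : ContDiff ℝ 3 (gradient u) := contDiff_gradient (k := 3) hu.smooth
  have hgφ : ContDiff ℝ 3 (gradient φ) := contDiff_gradient (k := 3) S.fst.defining.smooth
  have hφ3 : ContDiff ℝ 3 φ := S.fst.defining.smooth.of_le (by norm_num)
  set P : E n × ℝ → E n := fun z => gradient u z.1 + z.2 • gradient φ z.1 with hP
  have hPc : ContDiff ℝ 3 P :=
    (hgu.comp contDiff_fst).add (contDiff_snd.smul (hgφ.comp contDiff_fst))
  set F : E n × ℝ → E n := fun z => Y (z.1, P z) with hF
  have hFc : ContDiff ℝ 3 F := S.fst.smoothY.comp (contDiff_fst.prodMk hPc)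
  set H : E n × ℝ → E n × ℝ := fun z => (F z, φ z.1) with hH
  have hHc : ContDiff ℝ 3 H := hFc.prodMk (hφ3.comp contDiff_fst)
  -- the pairs of a contact point and its multiplier, for the foci in `M`
  set K : Set (E n × ℝ) := {z | z.1 ∈ frontier Ω ∧ 0 ≤ z.2 ∧ ∃ y ∈ M, cX c z.1 y = P z} with hK
  -- compactness: the multipliers are bounded, since `∇φ` does not vanish on `∂Ω`
  have hKc : IsCompact K := by
    obtain ⟨B, hB⟩ := S.isCompact_frontier.exists_bound_of_continuousOn
      (f := fun x => ‖gradient φ x‖⁻¹) (hgφ.continuous.continuousOn.norm.inv₀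
        fun x hx => norm_ne_zero_iff.2 (S.gradient_ne_zero hx))
    obtain ⟨R, hR⟩ := ((S.isCompact_frontier).prod hM).exists_bound_of_continuousOn
      (f := fun z : E n × E n => cX c z.1 z.2 - gradient u z.1)
      ((continuous_cX S.hc).sub (hgu.continuous.comp continuous_fst)).continuousOn
    have hcl : IsClosed {z : E n × E n × ℝ | cX c z.2.1 z.1 = P z.2} :=
      isClosed_eq ((continuous_cX S.hc).comp (continuous_snd.fst.prodMk continuous_fst))
        (hPc.continuous.comp continuous_snd)
    have hcomp := ((hM.prod (S.isCompact_frontier.prod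
      (isCompact_Icc (a := (0 : ℝ)) (b := |R| * |B|)))).inter_right hcl).image continuous_snd
    convert hcomp using 1
    ext ⟨x, s⟩
    constructor
    · rintro ⟨hx, hs, y, hy, he⟩
      refine ⟨(y, x, s), ⟨⟨hy, hx, hs, ?_⟩, he⟩, rfl⟩
      have h1 : s • gradient φ x = cX c x y - gradient u x := by
        simp only [hP] at he
        rw [he, add_sub_cancel_left]
      have h2 := hR (x, y) ⟨hx, hy⟩
      simp only [← h1] at h2
      have h3 := hB x hx
      rw [norm_inv, norm_norm] at h3
      have h4 : 0 < ‖gradient φ x‖ := norm_pos_iff.2 (S.gradient_ne_zero hx)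
      rw [norm_smul, Real.norm_eq_abs, abs_of_nonneg hs] at h2
      calc s = s * ‖gradient φ x‖ * ‖gradient φ x‖⁻¹ := by field_simp
        _ ≤ |R| * |B| := by
          gcongr
          · exact h2.trans (le_abs_self R)
          · exact h3.trans (le_abs_self B)
    · rintro ⟨⟨y, x', s'⟩, ⟨⟨hy, hx, hs⟩, he⟩, heq⟩
      simp only [Prod.mk.injEq] at heq
      obtain ⟨rfl, rfl⟩ := heq
      exact ⟨hx, hs.1, y, hy, he⟩
  have hKF : ∀ z ∈ K, F z ∈ M ∧ cX c z.1 (F z) = P z := by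
    rintro ⟨x, s⟩ ⟨hx, hs, y, hy, he⟩
    have : F (x, s) = y := by
      simp only [hF]
      rw [← he, S.Y_cX (frontier_subset_closure hx) (hMs hy)]
    rw [this]
    exact ⟨hy, he⟩
  have hKmin : ∀ z ∈ K, IsMinimizer c (closure Ω) u (F z) z.1 := by
    intro z hz
    exact S.isMinimizer_of_gradient_eq_sub hu hz.1 (hMs (hKF z hz).1) hz.2.1 (hKF z hz).2
  have hpos : ∀ z ∈ K, 0 < z.2 := by
    intro z hz
    refine lt_of_le_of_ne hz.2.1 fun h0 => ?_
    refine hMn _ (hKF z hz).1 z.1 (frontier_subset_closure hz.1) ?_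
    rw [(hKF z hz).2, hP]
    simp [← h0]
  have hinj : InjOn H K := by
    intro z hz z' hz' he
    have he1 : F z = F z' := congrArg Prod.fst he
    have hx : z.1 = z'.1 := S.isMinimizer_unique hu (hMs (hKF z hz).1) (hMn _ (hKF z hz).1)
      (hKmin z hz) (he1 ▸ hKmin z' hz')
    have h1 : P z = P z' := by rw [← (hKF z hz).2, ← (hKF z' hz').2, he1, hx]
    simp only [hP, hx, add_right_inj] at h1
    exact Prod.ext hx (smul_left_injective ℝ (S.gradient_ne_zero hz'.1) h1)
  obtain ⟨κ, hκ, hlag⟩ := S.exists_sndDeriv_lagrangian_lower_bound hu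
  have hright : ∀ z ∈ K, ∀ᶠ z' in 𝓝 z, cX c z'.1 (F z') = P z' := by
    intro z hz
    have hcont : Tendsto (fun z : E n × ℝ => (z.1, P z)) (𝓝 z) (𝓝 (z.1, cX c z.1 (F z))) := by
      rw [(hKF z hz).2]
      exact (continuous_fst.prodMk hPc.continuous).tendsto z
    exact hcont.eventually (S.fst.rightInv z.1 (frontier_subset_closure hz.1) (F z)
      (hMs (hKF z hz).1))
  have hder : ∀ z ∈ K, ∀ w, fderiv ℝ H z w = 0 → w = 0 := by
    rintro ⟨x, s⟩ hz ⟨v, τ⟩ hw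
    have hx : x ∈ frontier Ω := hz.1
    have hx' := frontier_subset_closure hx
    set y := F (x, s) with hy
    have hyM := (hKF _ hz).1
    have hHd : HasFDerivAt H ((fderiv ℝ F (x, s)).prod ((fderiv ℝ φ x).comp
        (ContinuousLinearMap.fst ℝ (E n) ℝ))) (x, s) :=
      (hFc.differentiable (by norm_num) _).hasFDerivAt.prodMk
        ((hφ3.differentiable (by norm_num) x).hasFDerivAt.comp (x, s) hasFDerivAt_fst)
    rw [hHd.fderiv] at hw
    have hw1 : fderiv ℝ F (x, s) (v, τ) = 0 := congrArg Prod.fst hw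
    have hw2 : fderiv ℝ φ x v = 0 := congrArg Prod.snd hw
    have hPd : HasFDerivAt P ((fderiv ℝ (gradient u) x).comp (ContinuousLinearMap.fst ℝ (E n) ℝ) +
        (s • ((fderiv ℝ (gradient φ) x).comp (ContinuousLinearMap.fst ℝ (E n) ℝ)) +
          (ContinuousLinearMap.snd ℝ (E n) ℝ).smulRight (gradient φ x))) (x, s) := by
      have hfst : HasFDerivAt (𝕜 := ℝ) (fun z : E n × ℝ => z.1) _ (x, s) := hasFDerivAt_fst
      have h1 := HasFDerivAt.comp (g := gradient u) (x, s)
        (hgu.differentiable (by norm_num) x).hasFDerivAt hfst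
      have h2 := HasFDerivAt.comp (g := gradient φ) (x, s)
        (hgφ.differentiable (by norm_num) x).hasFDerivAt hfst
      exact h1.add (HasFDerivAt.smul (hasFDerivAt_snd (𝕜 := ℝ)) h2)
    have had : HasFDerivAt (fun z : E n × E n => cX c z.1 z.2) _ (x, y) :=
      ((contDiff_cX S.hc).differentiable (by norm_num) (x, y)).hasFDerivAt
    have hfst : HasFDerivAt (𝕜 := ℝ) (fun z : E n × ℝ => z.1)
      (ContinuousLinearMap.fst ℝ (E n) ℝ) (x, s) := hasFDerivAt_fst
    have hpair : HasFDerivAt (fun z : E n × ℝ => (z.1, F z))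
        ((ContinuousLinearMap.fst ℝ (E n) ℝ).prod (fderiv ℝ F (x, s))) (x, s) :=
      hfst.prodMk (hFc.differentiable (by norm_num) (x, s)).hasFDerivAt
    have hcomp : HasFDerivAt (fun z : E n × ℝ => cX c z.1 (F z)) _ (x, s) :=
      HasFDerivAt.comp (g := fun z : E n × E n => cX c z.1 z.2)
        (f := fun z : E n × ℝ => (z.1, F z)) (x, s) had hpair
    have heq := hcomp.unique (hPd.congr_of_eventuallyEq (hright _ hz))
    have heq1 := congrArg (fun L : E n × ℝ →L[ℝ] E n => L (v, τ)) heq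
    simp only [ContinuousLinearMap.comp_apply, ContinuousLinearMap.prod_apply, hw1,
      ContinuousLinearMap.coe_fst', add_apply, smul_apply, ContinuousLinearMap.smulRight_apply,
      ContinuousLinearMap.coe_snd', fderiv_gradient] at heq1
    -- a tangential kernel vector contradicts the uniform convexity of the Lagrangian
    have hv : v = 0 := by
      have h1 := congrArg (fun p => inner ℝ p v) heq1
      simp only [inner_add_left, inner_smul_left, inner_fderiv_cX S.hc, inner_gradient, hw2,
        inner_hess_self (hu.smooth.of_le two_le_four),
        inner_hess_self (S.fst.defining.smooth.of_le two_le_four), RCLike.conj_to_real,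
        mul_zero, add_zero] at h1
      have h2 : vel X y (cY c x y) (cXY (swapCost c) y x v) = v := S.swap.vel_cXY (hMs hyM) hx' v
      have h3 := hlag x hx y (hMs hyM) s hz.2.1 (hKF _ hz).2 (cXY (swapCost c) y x v) (by
        rw [S.fderiv_comp_X (S.fst.defining.smooth.of_le two_le_four) hx' (hMs hyM), h2, hw2])
      rw [h2, h1] at h3
      have h4 : s * κ * ‖cXY (swapCost c) y x v‖ ^ 2 ≤ 0 := by linarith
      have h5 : 0 < s * κ := mul_pos (hpos _ hz) hκ
      have h6 : ‖cXY (swapCost c) y x v‖ ^ 2 ≤ 0 := by nlinarith [sq_nonneg ‖cXY (swapCost c) y x v‖]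
      refine S.snd.nondeg y (hMs hyM) x hx' v ?_
      simpa using h6
    subst hv
    have hτ : τ = 0 := by
      have : ((0 : E n), (0 : E n)) = 0 := rfl
      simp only [this, map_zero, smul_zero, zero_add] at heq1
      exact (smul_eq_zero.1 heq1.symm).resolve_right (S.gradient_ne_zero hx)
    rw [hτ]; rfl
  obtain ⟨G, hG, O, hO, hKO, hGl, hHO⟩ := exists_contDiff_leftInverse (k := 3) (by norm_num) hHc
    hKc hinj hder rfl
  have hmem : ∀ y ∈ M, ∃ z ∈ K, H z = (y, 0) := by
    intro y hy
    obtain ⟨x, hx⟩ := exists_isMinimizer S.hc S.isCompact_fst S.fst.isConnected.nonempty.closure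
      hu.smooth.continuous.continuousOn y
    have hxf := S.isMinimizer_mem_frontier hu.smooth hx (hMn y hy x hx.1)
    obtain ⟨s, hs, he⟩ := S.exists_cX_eq_of_isMinimizer hu.smooth hx hxf
    refine ⟨(x, s), ⟨hxf, hs, y, hy, he⟩, ?_⟩
    simp only [hH, hF, hP]
    rw [← he, S.Y_cX hx.1 (hMs hy), S.fst.defining.eq_zero S.fst.isOpen hxf]
  refine ⟨fun y => (G (y, 0)).1, fun y => (G (y, 0)).2,
    (hG.comp (contDiff_mk_left 0)).fst, (hG.comp (contDiff_mk_left 0)).snd, ?_, ?_⟩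
  · intro y hy
    obtain ⟨z, hz, hze⟩ := hmem y hy
    have h1 : G (y, 0) = z := by rw [← hze, hGl z (hKO hz)]
    have h2 : F z = y := congrArg Prod.fst hze
    simp only [h1]
    exact ⟨h2 ▸ hKmin z hz, hz.1, hpos z hz⟩
  · intro y hy
    obtain ⟨z, hz, hze⟩ := hmem y hy
    have h1 : G (y, 0) = z := by rw [← hze, hGl z (hKO hz)]
    have hcont : Tendsto (fun y' : E n => G (y', 0)) (𝓝 y) (𝓝 z) := by
      rw [← h1]
      exact (hG.continuous.comp (contDiff_mk_left (k := 0) (0 : ℝ)).continuous).tendsto y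
    have hopen : ∀ᶠ y' in 𝓝 y, (y', (0 : ℝ)) ∈ H '' O := by
      have h3 : (y, (0 : ℝ)) ∈ H '' O := ⟨z, hKO hz, hze⟩
      exact ((contDiff_mk_left (k := 0) (0 : ℝ)).continuous.tendsto y).eventually
        (hHO.mem_nhds h3)
    filter_upwards [hcont.eventually (hright z hz), hopen] with y' h3 h4
    obtain ⟨z', hz', hze'⟩ := h4
    have h5 : G (y', 0) = z' := by rw [← hze', hGl z' hz']
    have h6 : F z' = y' := congrArg Prod.fst hze'
    have h7 : φ z'.1 = 0 := congrArg Prod.snd hze'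
    rw [h5] at h3 ⊢
    rw [h6] at h3
    exact ⟨h7, h3⟩

end Setup

/-! ### The contact value and the envelope of the supporting cost functions -/

section Envelope

variable {n : ℕ}

/-- The largest `a` with `c(·, y) + a ≤ u` on `D`. -/
noncomputable def contactValue (c : E n → E n → ℝ) (D : Set (E n)) (u : E n → ℝ) (y : E n) : ℝ :=
  sInf ((fun x => u x - c x y) '' D)

/-- The supremum over `y ∈ D'` of the `c`-functions with focus `y` lying below `u` on `D`. -/
noncomputable def hullEnvelope (c : E n → E n → ℝ) (D D' : Set (E n)) (u : E n → ℝ) (x : E n) : ℝ :=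
  sSup ((fun y => c x y + contactValue c D u y) '' D')

variable {c : E n → E n → ℝ} {D D' : Set (E n)} {u : E n → ℝ}

theorem isGLB_contactValue (hc : Continuous (Function.uncurry c)) (hD : IsCompact D)
    (hne : D.Nonempty) (hu : Continuous u) (y : E n) :
    IsGLB ((fun x => u x - c x y) '' D) (contactValue c D u y) := by
  have hcont : Continuous (fun x => u x - c x y) := hu.sub (hc.comp (contDiff_mk_left (k := 0) y).continuous)
  exact isGLB_csInf (hne.image _) (hD.bddBelow_image hcont.continuousOn)

theorem contactValue_eq (hc : Continuous (Function.uncurry c)) (hD : IsCompact D)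
    (hne : D.Nonempty) (hu : Continuous u) {x y : E n} (h : IsMinimizer c D u y x) :
    contactValue c D u y = u x - c x y := by
  refine (isGLB_contactValue hc hD hne hu y).unique ⟨?_, fun b hb => hb (mem_image_of_mem _ h.1)⟩
  rintro _ ⟨z, hz, rfl⟩
  exact h.2 z hz

theorem contactValue_le (hc : Continuous (Function.uncurry c)) (hD : IsCompact D)
    (hne : D.Nonempty) (hu : Continuous u) {x : E n} (y : E n) (hx : x ∈ D) :
    contactValue c D u y ≤ u x - c x y :=
  (isGLB_contactValue hc hD hne hu y).1 (mem_image_of_mem _ hx)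

theorem continuous_contactValue (hc : Continuous (Function.uncurry c)) (hD : IsCompact D)
    (hu : Continuous u) : Continuous (contactValue c D u) := by
  unfold contactValue
  refine hD.continuous_sInf (f := fun y x => u x - c x y) ?_
  have : Continuous fun z : E n × E n => u z.2 - Function.uncurry c (z.2, z.1) := by fun_prop
  exact this

theorem isLUB_hullEnvelope (hc : Continuous (Function.uncurry c)) (hD : IsCompact D)
    (hD' : IsCompact D') (hne' : D'.Nonempty) (hu : Continuous u) (x : E n) :
    IsLUB ((fun y => c x y + contactValue c D u y) '' D') (hullEnvelope c D D' u x) := by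
  have hcont : Continuous (fun y => c x y + contactValue c D u y) :=
    (hc.comp (by fun_prop : Continuous fun y => (x, y))).add (continuous_contactValue hc hD hu)
  exact isLUB_csSup (hne'.image _) (hD'.bddAbove_image hcont.continuousOn)

theorem le_hullEnvelope (hc : Continuous (Function.uncurry c)) (hD : IsCompact D)
    (hD' : IsCompact D') (hne' : D'.Nonempty) (hu : Continuous u) (x : E n) {y : E n}
    (hy : y ∈ D') : c x y + contactValue c D u y ≤ hullEnvelope c D D' u x :=
  (isLUB_hullEnvelope hc hD hD' hne' hu x).1 (mem_image_of_mem _ hy)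

theorem exists_hullEnvelope_eq (hc : Continuous (Function.uncurry c)) (hD : IsCompact D)
    (hD' : IsCompact D') (hne' : D'.Nonempty) (hu : Continuous u) (x : E n) :
    ∃ y ∈ D', hullEnvelope c D D' u x = c x y + contactValue c D u y := by
  have hcont : Continuous (fun y => c x y + contactValue c D u y) :=
    (hc.comp (by fun_prop : Continuous fun y => (x, y))).add (continuous_contactValue hc hD hu)
  obtain ⟨y, hy, h⟩ := hD'.exists_sSup_image_eq hne' hcont.continuousOn
  exact ⟨y, hy, h⟩

theorem continuous_hullEnvelope (hc : Continuous (Function.uncurry c)) (hD : IsCompact D)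
    (hD' : IsCompact D') (hu : Continuous u) : Continuous (hullEnvelope c D D' u) := by
  unfold hullEnvelope
  refine hD'.continuous_sSup (f := fun x y => c x y + contactValue c D u y) ?_
  have hm := continuous_contactValue hc hD hu
  have : Continuous fun z : E n × E n => Function.uncurry c z + contactValue c D u z.2 := by fun_prop
  exact this

end Envelope

section Uniform

variable {V : Type*} [TopologicalSpace V]

/-- A condition that holds near `K × {0}` holds on `K × [-t, t]`. -/
theorem exists_forall_abs_le {K : Set V} (hK : IsCompact K) {P : V × ℝ → Prop}
    (h : ∀ y ∈ K, ∀ᶠ z in 𝓝 (y, (0 : ℝ)), P z) :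
    ∃ t > 0, ∀ y ∈ K, ∀ s : ℝ, |s| ≤ t → P (y, s) := by
  have h1 := hK.eventually_forall_of_forall_eventually (x₀ := (0 : ℝ)) (P := fun s y => P (y, s))
    (fun y hy => (continuous_swap.tendsto (0, y)).eventually (h y hy))
  obtain ⟨t, ht, h2⟩ := Metric.eventually_nhds_iff.1 h1
  refine ⟨t / 2, by positivity, fun y hy s hs => h2 (y := s) ?_ y hy⟩
  rw [Real.dist_eq, sub_zero]
  linarith

end Uniform

section Separation

variable {n : ℕ}

/-- A point whose every linear functional is dominated on a compact convex set belongs to it. -/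
theorem mem_of_forall_inner_le {C : Set (E n)} (hC : Convex ℝ C) (hcl : IsClosed C) {q : E n}
    (h : ∀ e : E n, ∃ p ∈ C, inner ℝ q e ≤ inner ℝ p e) : q ∈ C := by
  by_contra hq
  obtain ⟨f, r, h1, h2⟩ := geometric_hahn_banach_closed_point hC hcl hq
  obtain ⟨p, hp, hle⟩ := h ((InnerProductSpace.toDual ℝ (E n)).symm f)
  rw [real_inner_comm, real_inner_comm _ p, InnerProductSpace.toDual_symm_apply,
    InnerProductSpace.toDual_symm_apply] at hle
  linarith [h1 p hp]

end Separation

namespace Setup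

variable {n : ℕ} {c : E n → E n → ℝ} {Ω Ωs : Set (E n)} {φ φs : E n → ℝ}
  {X Y : E n × E n → E n} (S : Setup c Ω Ωs φ φs X Y)

include S

theorem continuous_cost : Continuous (Function.uncurry c) := S.hc.continuous

theorem nonempty_fst : (closure Ω).Nonempty := S.fst.isConnected.nonempty.closure

theorem nonempty_snd : (closure Ωs).Nonempty := S.snd.isConnected.nonempty.closure

/-- Variation of `z` in the envelope, by Danskin's argument. -/
theorem exists_maximizer_inner_cX_le {u : E n → ℝ} (hu : Continuous u) {D : Set (E n)} {z y₀ : E n}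
    (hD : D ∈ 𝓝 z) (h : y₀ ∈ cNormal c D (hullEnvelope c (closure Ω) (closure Ωs) u) z) (e : E n) :
    ∃ y ∈ closure Ωs, hullEnvelope c (closure Ω) (closure Ωs) u z =
      c z y + contactValue c (closure Ω) u y ∧ inner ℝ (cX c z y₀) e ≤ inner ℝ (cX c z y) e := by
  have hcd : Differentiable ℝ (Function.uncurry c) := S.hc.differentiable (by norm_num)
  obtain ⟨y, hy, h1, h2⟩ := exists_maximizer_fderiv_le S.isCompact_snd (k := c)
    (k' := fun z y => fderiv ℝ (fun z => c z y) z) S.continuous_cost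
    (by
      have h1 : Continuous (fun z : E n × E n => (fderiv ℝ (Function.uncurry c) z).comp
          (ContinuousLinearMap.inl ℝ (E n) (E n))) :=
        (S.hc.continuous_fderiv (by norm_num)).clm_comp continuous_const
      convert h1 using 2 with z
      ext v
      obtain ⟨x, y⟩ := z
      simp only [Function.uncurry_apply_pair, ContinuousLinearMap.comp_apply,
        ContinuousLinearMap.inl_apply]
      exact fderiv_slice_left (F := Function.uncurry c) hcd x v y)
    (fun z y => ((contDiff_slice S.hc y).differentiable (by norm_num) z).hasFDerivAt)
    (continuous_contactValue S.continuous_cost S.isCompact_fst hu).continuousOn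
    (fun z y hy => le_hullEnvelope S.continuous_cost S.isCompact_fst S.isCompact_snd S.nonempty_snd
      hu z hy)
    (fun z => exists_hullEnvelope_eq S.continuous_cost S.isCompact_fst S.isCompact_snd
      S.nonempty_snd hu z) z e
    (((contDiff_slice S.hc y₀).differentiable (by norm_num) z).hasFDerivAt)
    (by
      have hcont : Tendsto (fun t : ℝ => z + t • e) (𝓝[>] 0) (𝓝 z) := by
        have : Continuous fun t : ℝ => z + t • e := by fun_prop
        simpa using (this.tendsto 0).mono_left nhdsWithin_le_nhds
      filter_upwards [hcont.eventually hD] with t ht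
      have := h _ ht
      linarith)
  refine ⟨y, hy, h1, ?_⟩
  rw [inner_cX', inner_cX']
  exact h2

/-- Variation of the maximizing focus `y` in the direction `e`, by Danskin's argument. -/
theorem exists_minimizer_inner_cY_le {u : E n → ℝ} (hu : Continuous u) {z y e : E n}
    (hmax : hullEnvelope c (closure Ω) (closure Ωs) u z = c z y + contactValue c (closure Ω) u y)
    (he : ∀ᶠ t : ℝ in 𝓝[>] 0, y + t • e ∈ closure Ωs) :
    ∃ x, IsMinimizer c (closure Ω) u y x ∧ inner ℝ (cY c z y) e ≤ inner ℝ (cY c x y) e := by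
  have hcd : Differentiable ℝ (Function.uncurry c) := S.hc.differentiable (by norm_num)
  obtain ⟨x, hx, h1, h2⟩ := exists_maximizer_fderiv_le S.isCompact_fst (k := fun y x => c x y)
    (k' := fun y x => fderiv ℝ (fun y => c x y) y)
    (by
      have : Continuous fun z : E n × E n => Function.uncurry c (z.2, z.1) :=
        S.continuous_cost.comp (by fun_prop)
      exact this)
    (by
      have h1 : Continuous (fun z : E n × E n => (fderiv ℝ (Function.uncurry c) (z.2, z.1)).comp
          (ContinuousLinearMap.inr ℝ (E n) (E n))) :=
        ((S.hc.continuous_fderiv (by norm_num)).comp (by fun_prop)).clm_comp continuous_const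
      convert h1 using 2 with z
      ext v
      obtain ⟨y, x⟩ := z
      simp only [Function.uncurry_apply_pair, ContinuousLinearMap.comp_apply,
        ContinuousLinearMap.inr_apply]
      exact fderiv_slice_right (F := Function.uncurry c) hcd x y v)
    (fun y x => ((contDiff_slice (contDiff_swapCost S.hc) x).differentiable
      (by norm_num) y).hasFDerivAt)
    (w := fun x => -u x) hu.neg.continuousOn
    (f := fun y => -contactValue c (closure Ω) u y)
    (fun y x hx => by
      have := contactValue_le S.continuous_cost S.isCompact_fst S.nonempty_fst hu y hx
      linarith)
    (fun y => by
      obtain ⟨x, hx⟩ := exists_isMinimizer S.hc S.isCompact_fst S.nonempty_fst hu.continuousOn y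
      refine ⟨x, hx.1, ?_⟩
      rw [contactValue_eq S.continuous_cost S.isCompact_fst S.nonempty_fst hu hx]
      ring) y e
    (((contDiff_slice (contDiff_swapCost S.hc) z).differentiable (by norm_num) y).hasFDerivAt)
    (by
      filter_upwards [he] with t ht
      have := le_hullEnvelope S.continuous_cost S.isCompact_fst S.isCompact_snd S.nonempty_snd
        hu z ht
      simp only [swapCost]
      linarith)
  refine ⟨x, ⟨hx, fun w hw => ?_⟩, ?_⟩
  · have := contactValue_le S.continuous_cost S.isCompact_fst S.nonempty_fst hu y hw
    linarith
  · rw [← cX_swapCost, ← cX_swapCost, inner_cX', inner_cX']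
    exact h2

/-- A point where the envelope is attained at an interior focus belongs to the closure of `Ω`. -/
theorem mem_closure_of_maximizer_mem {u : E n → ℝ} (hu : Continuous u) {z y : E n} (hy : y ∈ Ωs)
    (hmax : hullEnvelope c (closure Ω) (closure Ωs) u z = c z y + contactValue c (closure Ω) u y) :
    z ∈ closure Ω := by
  have hy' := subset_closure hy
  have hcomp : IsCompact ((fun x => cY c x y) '' closure Ω) :=
    S.isCompact_fst.image ((continuous_cY S.hc).comp (contDiff_mk_left (k := 0) y).continuous)
  have hmem : cY c z y ∈ (fun x => cY c x y) '' closure Ω := by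
    refine mem_of_forall_inner_le (S.convFst.conv y hy') hcomp.isClosed fun e => ?_
    have hcont : Tendsto (fun t : ℝ => y + t • e) (𝓝[>] 0) (𝓝 y) := by
      have : Continuous fun t : ℝ => y + t • e := by fun_prop
      simpa using (this.tendsto 0).mono_left nhdsWithin_le_nhds
    obtain ⟨x, hx, hle⟩ := S.exists_minimizer_inner_cY_le hu hmax
      ((hcont.eventually (S.snd.isOpen.mem_nhds hy)).mono fun t ht => subset_closure ht)
    exact ⟨_, mem_image_of_mem _ hx.1, hle⟩
  obtain ⟨x, hx, hxe⟩ := hmem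
  rw [← S.snd.inj y hy' hxe]
  exact hx

/-- Over the closure of `Ω` the foci of the envelope stay in the closure of `Ω*`. -/
theorem cNormal_subset_of_mem_closure {u : E n → ℝ} (hu : Continuous u) {D : Set (E n)} {z : E n}
    (hz : z ∈ closure Ω) (hD : D ∈ 𝓝 z) :
    cNormal c D (hullEnvelope c (closure Ω) (closure Ωs) u) z ⊆ closure Ωs := by
  intro y₀ hy₀
  have hcomp : IsCompact ((fun y => cX c z y) '' closure Ωs) :=
    S.isCompact_snd.image ((continuous_cX S.hc).comp (contDiff_mk_right (k := 0) z).continuous)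
  have hmem : cX c z y₀ ∈ (fun y => cX c z y) '' closure Ωs := by
    refine mem_of_forall_inner_le (S.convSnd.conv z hz) hcomp.isClosed fun e => ?_
    obtain ⟨y, hy, -, hle⟩ := S.exists_maximizer_inner_cX_le hu hD hy₀ e
    exact ⟨_, mem_image_of_mem _ hy, hle⟩
  obtain ⟨y, hy, hye⟩ := hmem
  rw [← S.fst.inj z hz hye]
  exact hy

/-- Where the focus of the envelope is unique, so is the element of the `c`-normal mapping. -/
theorem cNormal_eq_singleton {u : E n → ℝ} (hu : Continuous u) {D : Set (E n)} {z y : E n}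
    (hD : D ∈ 𝓝 z) (hinj : Function.Injective (cX c z)) (hy : y ∈ closure Ωs)
    (hmax : ∀ y' ∈ closure Ωs, hullEnvelope c (closure Ω) (closure Ωs) u z =
      c z y' + contactValue c (closure Ω) u y' → y' = y) :
    cNormal c D (hullEnvelope c (closure Ω) (closure Ωs) u) z = {y} := by
  have hz : hullEnvelope c (closure Ω) (closure Ωs) u z =
      c z y + contactValue c (closure Ω) u y := by
    obtain ⟨y', hy', h⟩ := exists_hullEnvelope_eq S.continuous_cost S.isCompact_fst
      S.isCompact_snd S.nonempty_snd hu z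
    rw [← hmax y' hy' h]; exact h
  refine Subset.antisymm ?_ ?_
  · intro y₀ hy₀
    have hle : ∀ e, inner ℝ (cX c z y₀) e ≤ inner ℝ (cX c z y) e := by
      intro e
      obtain ⟨y', hy', he, hle⟩ := S.exists_maximizer_inner_cX_le hu hD hy₀ e
      rwa [hmax y' hy' he] at hle
    refine hinj (sub_eq_zero.1 (inner_self_eq_zero (𝕜 := ℝ).1 (le_antisymm ?_
      real_inner_self_nonneg)))
    have := hle (cX c z y₀ - cX c z y)
    rw [inner_sub_left]
    linarith
  · rintro _ rfl x hx
    have := le_hullEnvelope S.continuous_cost S.isCompact_fst S.isCompact_snd S.nonempty_snd hu x hy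
    linarith

variable {u : E n → ℝ} (hu : IsSubsolution c Ω Ωs u)

include hu

theorem gradient_ne_of_mem_frontier {y : E n} (hy : y ∈ frontier Ωs) :
    ∀ x ∈ closure Ω, gradient u x ≠ cX c x y := by
  intro x hx he
  obtain ⟨y', hy', h1, -⟩ := hu.touch x hx
  rw [h1] at he
  rw [S.snd.isOpen.frontier_eq] at hy
  exact hy.2 (S.fst.inj x hx he ▸ hy')

/-- The envelope extends `u`. -/
theorem hullEnvelope_eq {x : E n} (hx : x ∈ closure Ω) :
    hullEnvelope c (closure Ω) (closure Ωs) u x = u x := by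
  have hcont := hu.smooth.continuous
  refine (isLUB_hullEnvelope S.continuous_cost S.isCompact_fst S.isCompact_snd S.nonempty_snd
    hcont x).unique ⟨?_, fun b hb => ?_⟩
  · rintro _ ⟨y, hy, rfl⟩
    have := contactValue_le S.continuous_cost S.isCompact_fst S.nonempty_fst hcont y hx
    simp only
    linarith
  · obtain ⟨y, hy, he, -⟩ := hu.touch x hx
    have h1 := S.isMinimizer_of_gradient_eq hu hx (subset_closure hy) he
    have h2 := hb (mem_image_of_mem _ (subset_closure hy))
    simp only [contactValue_eq S.continuous_cost S.isCompact_fst S.nonempty_fst hcont h1] at h2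
    linarith

/-- Outside the closure of `Ω` the foci `y` of the envelope lie on the boundary of `Ω*`, and
`c_y(z, y)` lies on the normal ray of `Ω*` issuing from the contact point of `y`. -/
theorem exists_normal_ray {z y x : E n} (hz : z ∉ closure Ω) (hy : y ∈ closure Ωs)
    (hmax : hullEnvelope c (closure Ω) (closure Ωs) u z = c z y + contactValue c (closure Ω) u y)
    (hx : IsMinimizer c (closure Ω) u y x) :
    y ∈ frontier Ωs ∧ ∃ t : ℝ, 0 < t ∧ cY c z y = cY c x y + t • gradient φs y := by
  have hyf : y ∈ frontier Ωs := by
    rw [S.snd.isOpen.frontier_eq]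
    exact ⟨hy, fun hyo => hz (S.mem_closure_of_maximizer_mem hu.smooth.continuous hyo hmax)⟩
  refine ⟨hyf, ?_⟩
  -- the derivative of the maximised function in the directions pointing into `Ω*` has a sign
  obtain ⟨t, ht, he⟩ := exists_eq_neg_smul_of_nonneg (l := fderiv ℝ φs y)
    (m := innerSL ℝ (cY c x y - cY c z y)) (S.snd.defining.fderiv_ne y hyf) (by
      intro e he
      obtain ⟨x', hx', hle⟩ := S.exists_minimizer_inner_cY_le hu.smooth.continuous (e := e) hmax
        ((S.snd.defining.eventually_mem S.snd.isOpen hyf he).mono fun t ht => subset_closure ht)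
      rw [S.isMinimizer_unique hu hy (S.gradient_ne_of_mem_frontier hu hyf) hx' hx] at hle
      simp only [innerSL_apply_apply, inner_sub_left]
      linarith)
  have heq : cY c z y = cY c x y + t • gradient φs y := by
    refine ext_inner_right ℝ fun v => ?_
    have h1 := congrArg (fun L : E n →L[ℝ] ℝ => L v) he
    simp only [innerSL_apply_apply, inner_sub_left, smul_apply, smul_eq_mul] at h1
    rw [inner_add_left, inner_smul_left, inner_gradient (f := φs)]
    simp only [RCLike.conj_to_real]
    linarith
  refine ⟨t, lt_of_le_of_ne ht fun h0 => hz ?_, heq⟩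
  rw [← h0, zero_smul, add_zero] at heq
  rw [S.snd.inj y hy heq]
  exact hx.1

/-- The rays are transversal to the boundaries. -/
theorem fderiv_vel_gradient_pos {x y : E n} (hx : x ∈ closure Ω) (hy : y ∈ frontier Ωs) {s : ℝ}
    (hs : 0 < s) (he : cX c x y = gradient u x + s • gradient φ x) :
    0 < fderiv ℝ φs y (vel Y x (cX c x y) (gradient φ x)) := by
  obtain ⟨y', hy', h1, -⟩ := hu.touch x hx
  have h2 : fderiv ℝ φs y (vel Y x (cX c x y) (cX c x y' - cX c x y)) < 0 :=
    S.swap.fderiv_comp_X_neg hy hy' hx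
  have h3 : cX c x y' - cX c x y = (-s) • gradient φ x := by
    rw [← h1, he]; module
  rw [h3] at h2
  have h4 : vel Y x (cX c x y) ((-s) • gradient φ x) =
      (-s) • vel Y x (cX c x y) (gradient φ x) := by unfold vel; rw [map_smul]
  rw [h4, map_smul, smul_eq_mul] at h2
  nlinarith

theorem fderiv_vel_gradient_pos' {x y : E n} (hx : x ∈ closure Ω) (hy : y ∈ frontier Ωs) {s : ℝ}
    (hs : 0 < s) (he : cX c x y = gradient u x + s • gradient φ x) :
    0 < fderiv ℝ φ x (vel X y (cY c x y) (gradient φs y)) := by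
  have h := S.fderiv_vel_gradient_pos hu hx hy hs he
  rw [← inner_gradient, ← S.inner_vel_vel hx (frontier_subset_closure hy), real_inner_comm,
    inner_gradient] at h
  exact h

/-- Every boundary point of `Ω` is the contact point of a focus on the boundary of `Ω*`: the end
point of the ray `Du(x) + s ∇φ(x)` in `c_x(x, Ω*)`. -/
theorem exists_mem_frontier_isMinimizer {x : E n} (hx : x ∈ frontier Ω) :
    ∃ y ∈ frontier Ωs, IsMinimizer c (closure Ω) u y x := by
  have hx' := frontier_subset_closure hx
  set A : Set ℝ := {s | 0 ≤ s ∧ gradient u x + s • gradient φ x ∈ (fun y => cX c x y) '' closure Ωs}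
    with hA
  have hcomp : IsCompact ((fun y => cX c x y) '' closure Ωs) :=
    S.isCompact_snd.image ((continuous_cX S.hc).comp (contDiff_mk_right (k := 0) x).continuous)
  have hAcl : IsClosed A := isClosed_Ici.inter
    (hcomp.isClosed.preimage (by fun_prop : Continuous fun s : ℝ => gradient u x + s • gradient φ x))
  have hgpos : 0 < ‖gradient φ x‖ := norm_pos_iff.2 (S.gradient_ne_zero hx)
  have hAc : IsCompact A := by
    obtain ⟨R, hR⟩ := hcomp.isBounded.exists_norm_le
    refine isCompact_Icc.of_isClosed_subset hAcl (s := Icc 0 ((R + ‖gradient u x‖) /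
      ‖gradient φ x‖)) fun s hs => ⟨hs.1, ?_⟩
    rw [le_div_iff₀ hgpos]
    have h1 : s * ‖gradient φ x‖ = ‖s • gradient φ x‖ := by
      rw [norm_smul, Real.norm_eq_abs, abs_of_nonneg hs.1]
    rw [h1]
    calc ‖s • gradient φ x‖ = ‖(gradient u x + s • gradient φ x) - gradient u x‖ := by
          rw [add_sub_cancel_left]
      _ ≤ _ := (norm_sub_le _ _).trans (by gcongr; exact hR _ hs.2)
  have hAne : A.Nonempty := by
    obtain ⟨y, hy, h1, -⟩ := hu.touch x hx'
    exact ⟨0, le_rfl, y, subset_closure hy, by simp [h1]⟩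
  -- the last parameter on the ray for which it is in the compact set
  obtain ⟨s, hsA, hsmax⟩ := hAc.exists_isGreatest hAne
  obtain ⟨hs0, y, hy, hye⟩ := hsA
  have hye' : cX c x y = gradient u x + s • gradient φ x := hye
  refine ⟨y, ?_, S.isMinimizer_of_gradient_eq_sub hu hx hy hs0 hye'⟩
  rw [S.snd.isOpen.frontier_eq]
  refine ⟨hy, fun hyo => ?_⟩
  have hcont : Tendsto (fun t : ℝ => cX c x y + t • gradient φ x) (𝓝[>] 0) (𝓝 (cX c x y)) := by
    have : Continuous fun t : ℝ => cX c x y + t • gradient φ x := by fun_prop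
    simpa using (this.tendsto 0).mono_left nhdsWithin_le_nhds
  have hcont2 : Tendsto (fun t : ℝ => Y (x, cX c x y + t • gradient φ x)) (𝓝[>] 0) (𝓝 y) := by
    have := ((S.contDiff_Y_slice x).continuous.tendsto (cX c x y)).comp hcont
    rwa [S.Y_cX hx' hy] at this
  obtain ⟨t, ht1, ht2, ht0⟩ := ((hcont.eventually (S.eventually_cX_Y hx' hy)).and
    ((hcont2.eventually (S.snd.isOpen.mem_nhds hyo)).and self_mem_nhdsWithin)).exists
  have ht0' : (0 : ℝ) < t := ht0
  have : s + t ∈ A := by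
    refine ⟨by linarith, _, subset_closure ht2, ?_⟩
    change cX c x (Y (x, cX c x y + t • gradient φ x)) = _
    rw [ht1, hye']
    module
  linarith [hsmax this]

end Setup

/-! ### Collars and the distance to a smooth boundary -/

section Collar

variable {V W : Type*} [NormedAddCommGroup V] [NormedSpace ℝ V]
  [NormedAddCommGroup W] [NormedSpace ℝ W]

theorem fderiv_prod_real {Z : V × ℝ → W} (hZ : Differentiable ℝ Z) (y v : V) (t τ : ℝ) :
    fderiv ℝ Z (y, t) (v, τ) = fderiv ℝ (fun y => Z (y, t)) y v +
      τ • fderiv ℝ (fun t => Z (y, t)) t 1 := by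
  rw [fderiv_slice_left hZ, fderiv_slice_right hZ, ← map_smul, ← map_add]
  simp

theorem hasDerivAt_slice_right {Z : V × ℝ → W} (hZ : Differentiable ℝ Z) (y : V) (t : ℝ) :
    HasDerivAt (fun t => Z (y, t)) (fderiv ℝ Z (y, t) (0, 1)) t := by
  rw [← fderiv_slice_right hZ]
  have h : DifferentiableAt ℝ (fun t => Z (y, t)) t :=
    (hZ (y, t)).comp t ((contDiff_mk_right (k := 1) y).differentiable (by norm_num) t)
  exact h.hasDerivAt

end Collar

section Distance

variable {n : ℕ} {Ω : Set (E n)} {φ : E n → ℝ}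

/-- The nearest point of the closure of `Ω` to an outer point lies in the direction of the
normal. -/
theorem IsDefining.exists_nearest (hφ : IsDefining Ω φ) (hΩ : IsOpen Ω) (hb : IsCompact (closure Ω))
    (hne : Ω.Nonempty) {z : E n} (hz : z ∉ closure Ω) :
    ∃ x ∈ frontier Ω, ∃ s : ℝ, 0 < s ∧ z = x + s • gradient φ x ∧
      Metric.infDist z Ω = s * ‖gradient φ x‖ := by
  obtain ⟨x, hx, hd⟩ := hb.exists_infDist_eq_dist hne.closure z
  rw [Metric.infDist_closure] at hd
  have hzx : z ≠ x := fun h => hz (h ▸ hx)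
  -- the first-order condition for the nearest point `x`
  have hstep : ∀ v, (∀ᶠ t : ℝ in 𝓝[>] 0, x + t • v ∈ Ω) → inner ℝ (z - x) v ≤ 0 := by
    intro v hv
    have h1 : HasDerivAt (fun t : ℝ => ‖z - (x + t • v)‖ ^ 2)
        (2 * inner ℝ (z - (x + (0 : ℝ) • v)) (-v)) 0 := by
      have h2 : HasDerivAt (fun t : ℝ => z - (x + t • v)) (-v) 0 := by
        have := (((hasDerivAt_id (0 : ℝ)).smul_const v).const_add x).const_sub z
        simpa using this
      exact h2.norm_sq
    have h2 := deriv_nonneg_of_eventually h1 (by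
      filter_upwards [hv] with t ht
      have h3 : Metric.infDist z Ω ≤ dist z (x + t • v) := Metric.infDist_le_dist_of_mem ht
      rw [hd, dist_eq_norm, dist_eq_norm] at h3
      simp only [zero_smul, add_zero]
      gcongr)
    simp only [zero_smul, add_zero, inner_neg_right] at h2
    linarith
  have hxf : x ∈ frontier Ω := by
    rw [hΩ.frontier_eq]
    refine ⟨hx, fun hxo => hzx ?_⟩
    have h1 := hstep (z - x) (by
      have hcont : Tendsto (fun t : ℝ => x + t • (z - x)) (𝓝[>] 0) (𝓝 x) := by
        have : Continuous fun t : ℝ => x + t • (z - x) := by fun_prop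
        simpa using (this.tendsto 0).mono_left nhdsWithin_le_nhds
      exact hcont.eventually (hΩ.mem_nhds hxo))
    exact sub_eq_zero.1 (inner_self_eq_zero (𝕜 := ℝ).1 (le_antisymm h1 real_inner_self_nonneg))
  obtain ⟨s, hs, he⟩ := exists_eq_neg_smul_of_nonneg (l := fderiv ℝ φ x)
    (m := innerSL ℝ (x - z)) (hφ.fderiv_ne x hxf) (by
      intro v hv
      have := hstep v (hφ.eventually_mem hΩ hxf hv)
      simp only [innerSL_apply_apply]
      rw [← neg_sub, inner_neg_left]
      linarith)
  have heq : z - x = s • gradient φ x := by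
    refine ext_inner_right ℝ fun v => ?_
    have h1 := congrArg (fun L : E n →L[ℝ] ℝ => L v) he
    simp only [innerSL_apply_apply, smul_apply, smul_eq_mul] at h1
    rw [inner_smul_left, inner_gradient, ← neg_sub x z, inner_neg_left, h1]
    simp
  refine ⟨x, hxf, s, lt_of_le_of_ne hs fun h0 => hzx ?_, ?_, ?_⟩
  · rw [← h0, zero_smul] at heq
    exact sub_eq_zero.1 heq
  · rw [← heq]; abel
  · rw [hd, dist_eq_norm, heq, norm_smul, Real.norm_eq_abs, abs_of_nonneg hs]

theorem IsDefining.gradient_ne (hφ : IsDefining Ω φ) {x : E n} (hx : x ∈ frontier Ω) :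
    gradient φ x ≠ 0 := by
  intro h
  refine hφ.fderiv_ne x hx (ContinuousLinearMap.ext fun v => ?_)
  rw [← inner_gradient, h]; simp

/-- The distance to `Ω` agrees outside the closure of `Ω`, near the boundary, with a `C³` function
whose derivative at the boundary is a positive multiple of that of the defining function. -/
theorem IsDefining.exists_smooth_dist (hφ : IsDefining Ω φ) (hΩ : IsOpen Ω)
    (hb : IsCompact (closure Ω)) (hne : Ω.Nonempty) :
    ∃ d : E n → ℝ, ContDiff ℝ 3 d ∧ ∃ t₀ > 0,
      (∀ z, z ∉ closure Ω → Metric.infDist z Ω < t₀ → d z = Metric.infDist z Ω) ∧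
      ∀ x ∈ frontier Ω, d x = 0 ∧ ∀ v, 0 < fderiv ℝ φ x v → 0 < fderiv ℝ d x v := by
  have hgφ : ContDiff ℝ 3 (gradient φ) := contDiff_gradient (k := 3) hφ.smooth
  have hφ3 : ContDiff ℝ 3 φ := hφ.smooth.of_le (by norm_num)
  have hcf : IsCompact (frontier Ω) :=
    hb.of_isClosed_subset isClosed_frontier frontier_subset_closure
  -- a global extension of the normal field
  obtain ⟨ν, hν, O', hO'o, hKO', hO'O, hνe⟩ := exists_contDiff_eqOn_nhds (k := 3) (W := E n)
    (f := fun x => ‖gradient φ x‖⁻¹ • gradient φ x)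
    hcf (hgφ.continuous.isOpen_preimage {0}ᶜ isOpen_compl_singleton) (fun x hx => hφ.gradient_ne hx)
    (fun x hx => (((hgφ.contDiffAt (x := x)).norm ℝ hx).inv (norm_ne_zero_iff.2 hx)).smul
      hgφ.contDiffAt)
  have hνf : ∀ x ∈ frontier Ω, ν x = ‖gradient φ x‖⁻¹ • gradient φ x := fun x hx => hνe (hKO' hx)
  have hφν : ∀ x ∈ frontier Ω, 0 < fderiv ℝ φ x (ν x) := by
    intro x hx
    have h0 := norm_pos_iff.2 (hφ.gradient_ne hx)
    rw [hνf x hx, ← inner_gradient, inner_smul_right, real_inner_self_eq_norm_sq]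
    positivity
  set Z : E n × ℝ → E n := fun z => z.1 + z.2 • ν z.1 with hZ
  have hZc : ContDiff ℝ 3 Z := contDiff_fst.add (contDiff_snd.smul (hν.comp contDiff_fst))
  -- the second component of `H` makes it a local diffeomorphism at all `(x, 0)` with `x ∈ ∂Ω`; the
  -- points
  -- `x + t ν(x)` with `x ∈ ∂Ω` are those over the value `0` of it
  set H : E n × ℝ → E n × ℝ := fun z => (Z z, φ z.1) with hH
  have hHc : ContDiff ℝ 3 H := hZc.prodMk (hφ3.comp contDiff_fst)
  obtain ⟨G, hG, O, hO, hKO, hGl, -⟩ := exists_contDiff_leftInverse (k := 3) (by norm_num) hHc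
    (K := frontier Ω ×ˢ {0}) (hcf.prod isCompact_singleton)
    (by
      rintro ⟨x, s⟩ ⟨hx, hs⟩ ⟨x', s'⟩ ⟨hx', hs'⟩ he
      simp only [mem_singleton_iff] at hs hs'
      subst hs; subst hs'
      have := congrArg Prod.fst he
      simp only [hH, hZ, zero_smul, add_zero] at this
      rw [this])
    (by
      rintro ⟨x, s⟩ ⟨hx, hs⟩ ⟨v, τ⟩ hw
      simp only [mem_singleton_iff] at hs
      subst hs
      have hHd : HasFDerivAt H ((fderiv ℝ Z (x, 0)).prod ((fderiv ℝ φ x).comp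
          (ContinuousLinearMap.fst ℝ (E n) ℝ))) (x, 0) :=
        (hZc.differentiable (by norm_num) _).hasFDerivAt.prodMk
          ((hφ3.differentiable (by norm_num) x).hasFDerivAt.comp (x, (0 : ℝ)) hasFDerivAt_fst)
      rw [hHd.fderiv] at hw
      have hw1 : fderiv ℝ Z (x, 0) (v, τ) = 0 := congrArg Prod.fst hw
      have hw2 : fderiv ℝ φ x v = 0 := congrArg Prod.snd hw
      rw [fderiv_prod_real (hZc.differentiable (by norm_num))] at hw1
      have e1 : fderiv ℝ (fun y => Z (y, 0)) x v = v := by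
        have : (fun y => Z (y, 0)) = id := by ext1 y; simp [hZ]
        rw [this]; simp
      have e2 : fderiv ℝ (fun t => Z (x, t)) 0 1 = ν x := by
        have : HasDerivAt (fun t => Z (x, t)) (ν x) 0 := by
          have := ((hasDerivAt_id (0 : ℝ)).smul_const (ν x)).const_add x
          simpa [hZ] using this
        exact this.deriv
      rw [e1, e2] at hw1
      have h3 := congrArg (fderiv ℝ φ x) hw1
      rw [map_add, hw2, map_smul, zero_add, map_zero, smul_eq_mul] at h3
      have hτ : τ = 0 := (mul_eq_zero.1 h3).resolve_right (hφν x hx).ne'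
      rw [hτ, zero_smul, add_zero] at hw1
      rw [hw1, hτ]; rfl)
    rfl
  obtain ⟨t₀, ht₀, htO⟩ := exists_forall_abs_le hcf (P := fun z => z ∈ O)
    (fun x hx => hO.mem_nhds (hKO ⟨hx, rfl⟩))
  set d : E n → ℝ := fun z => (G (z, 0)).2 with hd
  have hdc : ContDiff ℝ 3 d := (hG.comp (contDiff_mk_left 0)).snd
  have hdZ : ∀ x ∈ frontier Ω, ∀ t : ℝ, |t| ≤ t₀ → d (x + t • ν x) = t := by
    intro x hx t ht
    have h1 := hGl (x, t) (htO x hx t ht)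
    have h2 : H (x, t) = (x + t • ν x, 0) := by simp [hH, hZ, hφ.eq_zero hΩ hx]
    rw [h2] at h1
    simp [hd, h1]
  have hdist : ∀ z, z ∉ closure Ω → Metric.infDist z Ω < t₀ → d z = Metric.infDist z Ω := by
    intro z hz hlt
    obtain ⟨x, hx, s, hs, hze, hdist⟩ := hφ.exists_nearest hΩ hb hne hz
    have h0 := norm_pos_iff.2 (hφ.gradient_ne hx)
    have h1 : z = x + (Metric.infDist z Ω) • ν x := by
      rw [hνf x hx, hdist, smul_smul, mul_assoc, mul_inv_cancel₀ h0.ne', mul_one]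
      exact hze
    conv_lhs => rw [h1]
    exact hdZ x hx _ (by rw [abs_of_nonneg Metric.infDist_nonneg]; exact hlt.le)
  have hd0 : ∀ x ∈ frontier Ω, d x = 0 := fun x hx => by
    simpa using hdZ x hx 0 (by simpa using ht₀.le)
  refine ⟨d, hdc, t₀, ht₀, hdist, fun x hx => ⟨hd0 x hx, ?_⟩⟩
  have hline : ∀ v, HasDerivAt (fun t : ℝ => d (x + t • v)) (fderiv ℝ d x v) 0 := by
    intro v
    simpa using hasDerivAt_line d (hdc.differentiable (by norm_num)) x v 0
  obtain ⟨s, hs, he⟩ := exists_eq_neg_smul_of_nonneg (l := -fderiv ℝ φ x) (m := fderiv ℝ d x)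
    (neg_ne_zero.2 (hφ.fderiv_ne x hx)) (by
      intro v hv
      have hv' : 0 < fderiv ℝ φ x v := by simpa using hv
      refine deriv_nonneg_of_eventually (hline v) ?_
      have hcont : Tendsto (fun t : ℝ => x + t • v) (𝓝[>] 0) (𝓝 x) := by
        have : Continuous fun t : ℝ => x + t • v := by fun_prop
        simpa using (this.tendsto 0).mono_left nhdsWithin_le_nhds
      have h1 : HasDerivAt (fun t : ℝ => -φ (x + t • v)) (-fderiv ℝ φ x v) 0 := by
        have h0 := hasDerivAt_line φ hφ.differentiable x v 0
        rw [zero_smul, add_zero] at h0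
        exact h0.fun_neg
      have h2 := eventually_lt_of_deriv_neg h1 hv
      have h3 : ∀ᶠ z in 𝓝 x, Metric.infDist z Ω < t₀ := by
        have : Tendsto (fun z => Metric.infDist z Ω) (𝓝 x) (𝓝 0) := by
          have h4 := (Metric.continuous_infDist_pt Ω).tendsto x
          rwa [(Metric.mem_closure_iff_infDist_zero hne).1 (frontier_subset_closure hx)] at h4
        exact this.eventually (eventually_lt_nhds ht₀)
      filter_upwards [h2, hcont.eventually (hφ.eventually_nonpos hx), hcont.eventually h3]
        with t ht1 ht2 ht3
      rw [zero_smul, add_zero, hφ.eq_zero hΩ hx] at ht1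
      have hnot : x + t • v ∉ closure Ω := fun hmem => by linarith [ht2 hmem]
      rw [zero_smul, add_zero, hd0 x hx, hdist _ hnot ht3]
      exact Metric.infDist_nonneg)
  have hν1 : fderiv ℝ d x (ν x) = 1 := by
    refine (hline (ν x)).unique ?_
    refine (hasDerivAt_id (0 : ℝ)).congr_of_eventuallyEq ?_
    filter_upwards [Metric.closedBall_mem_nhds (0 : ℝ) ht₀] with t ht
    rw [hdZ x hx t (by simpa using ht)]; rfl
  have h1 : ∀ v, fderiv ℝ d x v = s * fderiv ℝ φ x v := by
    intro v; rw [he]; simp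
  have hspos : 0 < s := by
    refine lt_of_le_of_ne hs fun h0 => ?_
    have := h1 (ν x)
    rw [hν1, ← h0, zero_mul] at this
    exact one_ne_zero this
  intro v hv
  rw [h1]
  positivity

end Distance

/-! ### Coordinates along the rays outside the domain -/

namespace Setup

variable {n : ℕ} {c : E n → E n → ℝ} {Ω Ωs : Set (E n)} {φ φs : E n → ℝ}
  {X Y : E n × E n → E n} (S : Setup c Ω Ωs φ φs X Y) {u : E n → ℝ}
  (hu : IsSubsolution c Ω Ωs u)

include S hu

/-- A point of `∂Ω` is the contact point of one focus on `∂Ω*` only. -/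
theorem focus_unique {x y y' : E n} (hx : x ∈ closure Ω) (hy : y ∈ frontier Ωs)
    (hy' : y' ∈ frontier Ωs) {s s' : ℝ} (hs : 0 < s) (hs' : 0 < s')
    (he : cX c x y = gradient u x + s • gradient φ x)
    (he' : cX c x y' = gradient u x + s' • gradient φ x) : y = y' := by
  have key : ∀ {y y' : E n} {s s' : ℝ}, y ∈ frontier Ωs → y' ∈ frontier Ωs → 0 < s →
      cX c x y = gradient u x + s • gradient φ x →
      cX c x y' = gradient u x + s' • gradient φ x → s' ≤ s := by
    intro y y' s s' hy hy' hs he he'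
    have h1 := S.swap.fderiv_comp_X_nonpos hy (frontier_subset_closure hy') hx
    rw [S.swap.fderiv_comp_X (S.snd.defining.smooth.of_le two_le_four)
      (frontier_subset_closure hy) hx] at h1
    have h2 := S.fderiv_vel_gradient_pos hu hx hy hs he
    change fderiv ℝ φs y (vel Y x (cX c x y) (cX c x y' - cX c x y)) ≤ 0 at h1
    have h3 : cX c x y' - cX c x y = (s' - s) • gradient φ x := by rw [he, he']; module
    rw [h3] at h1
    have h4 : vel Y x (cX c x y) ((s' - s) • gradient φ x) =
      (s' - s) • vel Y x (cX c x y) (gradient φ x) := by unfold vel; rw [map_smul]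
    rw [h4, map_smul, smul_eq_mul] at h1
    by_contra hlt
    have := mul_pos (sub_pos.2 (not_le.1 hlt)) h2
    linarith
  have hss : s = s' := le_antisymm (key hy' hy hs' he' he) (key hy hy' hs he he')
  exact S.fst.inj x hx (by rw [he, he', hss])

/-- The rays `Z(y, ·)` leaving the contact points: near `∂Ω` the focus is a smooth function of the
point. -/
theorem exists_ray_map : ∃ (G : E n → E n) (Z : E n × ℝ → E n) (yb : E n → E n),
    ContDiff ℝ 3 G ∧ ContDiff ℝ 3 Z ∧ ContDiff ℝ 3 yb ∧
    (∀ y ∈ frontier Ωs, IsMinimizer c (closure Ω) u y (G y) ∧ G y ∈ frontier Ω ∧ Z (y, 0) = G y ∧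
      0 < fderiv ℝ φ (G y) (fderiv ℝ Z (y, 0) (0, 1))) ∧
    ∃ t₁ > 0, ∀ y ∈ frontier Ωs, ∀ t : ℝ, |t| ≤ t₁ →
      cY c (Z (y, t)) y = cY c (G y) y + t • gradient φs y ∧ yb (Z (y, t)) = y := by
  obtain ⟨G, σ, hG, hσ, hGm, hGe⟩ := S.exists_contact_map hu S.swap.isCompact_frontier
    frontier_subset_closure fun y hy => S.gradient_ne_of_mem_frontier hu hy
  have hgu : ContDiff ℝ 3 (gradient u) := contDiff_gradient (k := 3) hu.smooth
  have hgφ : ContDiff ℝ 3 (gradient φ) := contDiff_gradient (k := 3) S.fst.defining.smooth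
  have hgφs : ContDiff ℝ 3 (gradient φs) := contDiff_gradient (k := 3) S.snd.defining.smooth
  have hφs3 : ContDiff ℝ 3 φs := S.snd.defining.smooth.of_le (by norm_num)
  have hGc : ∀ y ∈ frontier Ωs, cX c (G y) y = gradient u (G y) + σ y • gradient φ (G y) :=
    fun y hy => ((hGe y hy).self_of_nhds).2
  have hGcl : ∀ y ∈ frontier Ωs, G y ∈ closure Ω := fun y hy =>
    frontier_subset_closure (hGm y hy).2.1
  set Q : E n × ℝ → E n := fun z => cY c (G z.1) z.1 + z.2 • gradient φs z.1 with hQ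
  have hQc : ContDiff ℝ 3 Q :=
    ((contDiff_cY S.hc).comp ((hG.comp contDiff_fst).prodMk contDiff_fst)).add
      (contDiff_snd.smul (hgφs.comp contDiff_fst))
  set Z : E n × ℝ → E n := fun z => X (z.1, Q z) with hZ
  have hZc : ContDiff ℝ 3 Z := S.snd.smoothY.comp (contDiff_fst.prodMk hQc)
  have hZ0 : ∀ y ∈ frontier Ωs, ∀ᶠ z in 𝓝 y, Z (z, 0) = G z := by
    intro y hy
    have h1 := S.snd.leftInv y (frontier_subset_closure hy) (G y) (hGcl y hy)
    have hcont : Tendsto (fun z => (z, G z)) (𝓝 y) (𝓝 (y, G y)) :=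
      (continuous_id.prodMk hG.continuous).tendsto y
    filter_upwards [hcont.eventually h1] with z hz
    simp only [hZ, hQ, zero_smul, add_zero]
    exact hz
  have hZt : ∀ y ∈ frontier Ωs, fderiv ℝ (fun t => Z (y, t)) 0 1 =
      vel X y (cY c (G y) y) (gradient φs y) := by
    intro y hy
    have h1 := hasDerivAt_line (fun q => X (y, q))
      ((S.contDiff_X_slice y).differentiable (by norm_num)) (cY c (G y) y) (gradient φs y) 0
    rw [zero_smul, add_zero] at h1
    exact h1.deriv
  -- as `y` ranges over a hypersurface only, the equation `φs(y) = 0` is made the second component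
  set H : E n × ℝ → E n × ℝ := fun z => (Z z, φs z.1) with hH
  have hHc : ContDiff ℝ 3 H := hZc.prodMk (hφs3.comp contDiff_fst)
  have hpos' : ∀ y ∈ frontier Ωs, 0 < fderiv ℝ φ (G y)
      (vel X y (cY c (G y) y) (gradient φs y)) := fun y hy =>
    S.fderiv_vel_gradient_pos' hu (hGcl y hy) hy (hGm y hy).2.2 (hGc y hy)
  obtain ⟨W, hW, O, hO, hKO, hWl, -⟩ := exists_contDiff_leftInverse (k := 3) (by norm_num) hHc
    (K := frontier Ωs ×ˢ {0}) (S.swap.isCompact_frontier.prod isCompact_singleton)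
    (by
      rintro ⟨y, s⟩ ⟨hy, hs⟩ ⟨y', s'⟩ ⟨hy', hs'⟩ he
      simp only [mem_singleton_iff] at hs hs' hy hy'
      subst hs; subst hs'
      have h1 : Z (y, 0) = Z (y', 0) := congrArg Prod.fst he
      rw [(hZ0 y hy).self_of_nhds, (hZ0 y' hy').self_of_nhds] at h1
      have h2 := hGc y' hy'
      rw [← h1] at h2
      rw [S.focus_unique hu (hGcl y hy) hy hy' (hGm y hy).2.2 (hGm y' hy').2.2 (hGc y hy) h2])
    (by
      rintro ⟨y, s⟩ ⟨hy, hs⟩ ⟨η, τ⟩ hw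
      simp only [mem_singleton_iff] at hs hy
      subst hs
      have hy' := frontier_subset_closure hy
      have hHd : HasFDerivAt H ((fderiv ℝ Z (y, 0)).prod ((fderiv ℝ φs y).comp
          (ContinuousLinearMap.fst ℝ (E n) ℝ))) (y, 0) :=
        (hZc.differentiable (by norm_num) _).hasFDerivAt.prodMk
          ((hφs3.differentiable (by norm_num) y).hasFDerivAt.comp (y, (0 : ℝ)) hasFDerivAt_fst)
      rw [hHd.fderiv] at hw
      have hw1 : fderiv ℝ Z (y, 0) (η, τ) = 0 := congrArg Prod.fst hw
      have hw2 : fderiv ℝ φs y η = 0 := congrArg Prod.snd hw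
      rw [fderiv_prod_real (hZc.differentiable (by norm_num)), hZt y hy,
        Filter.EventuallyEq.fderiv_eq (hZ0 y hy)] at hw1
      have hGd := (hG.differentiable (by norm_num) y).hasFDerivAt
      have h1 : fderiv ℝ φ (G y) (fderiv ℝ G y η) = 0 := by
        have h2 : HasFDerivAt (fun z => φ (G z)) ((fderiv ℝ φ (G y)).comp (fderiv ℝ G y)) y :=
          (S.fst.defining.differentiable (G y)).hasFDerivAt.comp y hGd
        have h3 : (fun z => φ (G z)) =ᶠ[𝓝 y] fun _ => 0 := by
          filter_upwards [hGe y hy] with z hz using hz.1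
        have h4 := h2.unique ((hasFDerivAt_const (0 : ℝ) y).congr_of_eventuallyEq h3)
        exact congrArg (fun L : E n →L[ℝ] ℝ => L η) h4
      have h2 := congrArg (fderiv ℝ φ (G y)) hw1
      rw [map_add, h1, map_smul, zero_add, map_zero, smul_eq_mul] at h2
      have hτ : τ = 0 := (mul_eq_zero.1 h2).resolve_right (hpos' y hy).ne'
      rw [hτ, zero_smul, add_zero] at hw1
      have had : HasFDerivAt (fun z : E n × E n => cX c z.1 z.2) _ (G y, y) :=
        ((contDiff_cX S.hc).differentiable (by norm_num) (G y, y)).hasFDerivAt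
      have h3 : HasFDerivAt (fun z => cX c (G z) z) ((fderiv ℝ (fun z : E n × E n =>
          cX c z.1 z.2) (G y, y)).comp ((fderiv ℝ G y).prod (ContinuousLinearMap.id ℝ (E n)))) y :=
        HasFDerivAt.comp (g := fun z : E n × E n => cX c z.1 z.2) (f := fun z => (G z, z)) y had
          (hGd.prodMk (hasFDerivAt_id y))
      have h4 : HasFDerivAt (fun z => gradient u (G z)) ((fderiv ℝ (gradient u) (G y)).comp
          (fderiv ℝ G y)) y :=
        HasFDerivAt.comp (g := gradient u) y (hgu.differentiable (by norm_num) _).hasFDerivAt hGd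
      have h5 : HasFDerivAt (fun z => gradient φ (G z)) ((fderiv ℝ (gradient φ) (G y)).comp
          (fderiv ℝ G y)) y :=
        HasFDerivAt.comp (g := gradient φ) y (hgφ.differentiable (by norm_num) _).hasFDerivAt hGd
      have h6 := h4.add (HasFDerivAt.smul
        (hσ.differentiable (by norm_num) y).hasFDerivAt h5)
      have h7 := h3.unique (h6.congr_of_eventuallyEq (by
        filter_upwards [hGe y hy] with z hz using hz.2))
      have h8 := congrArg (fun L : E n →L[ℝ] E n => L η) h7
      simp only [ContinuousLinearMap.comp_apply, ContinuousLinearMap.prod_apply, hw1, map_zero,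
        add_apply, smul_apply, smul_zero, zero_add, ContinuousLinearMap.smulRight_apply,
        ContinuousLinearMap.id_apply] at h8
      rw [← cXY_eq S.hc] at h8
      have h9 := S.vel_cXY (hGcl y hy) hy' η
      rw [h8] at h9
      have h10 : vel Y (G y) (cX c (G y) y) ((fderiv ℝ σ y η) • gradient φ (G y)) =
        (fderiv ℝ σ y η) • vel Y (G y) (cX c (G y) y) (gradient φ (G y)) := by
          unfold vel; rw [map_smul]
      rw [h10] at h9
      rw [← h9, map_smul, smul_eq_mul] at hw2
      have h11 := (mul_eq_zero.1 hw2).resolve_right (S.fderiv_vel_gradient_pos hu (hGcl y hy) hy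
        (hGm y hy).2.2 (hGc y hy)).ne'
      rw [h11, zero_smul] at h9
      rw [← h9, hτ]; rfl)
    rfl
  have hev : ∀ y ∈ frontier Ωs, ∀ᶠ z in 𝓝 (y, (0 : ℝ)), z ∈ O ∧ cY c (Z z) z.1 = Q z := by
    intro y hy
    have hy' := frontier_subset_closure hy
    have hcont : Tendsto (fun z : E n × ℝ => (z.1, Q z)) (𝓝 (y, 0)) (𝓝 (y, cY c (G y) y)) := by
      have := (continuous_fst.prodMk hQc.continuous).tendsto (y, (0 : ℝ))
      simpa [hQ] using this
    exact (hO.eventually_mem (hKO (mk_mem_prod hy (mem_singleton _)))).and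
      (hcont.eventually (S.snd.rightInv y hy' (G y) (hGcl y hy)))
  obtain ⟨t₁, ht₁, hP⟩ := exists_forall_abs_le S.swap.isCompact_frontier hev
  refine ⟨G, Z, fun z => (W (z, 0)).1, hG, hZc, (hW.comp (contDiff_mk_left 0)).fst,
    fun y hy => ⟨(hGm y hy).1, (hGm y hy).2.1, (hZ0 y hy).self_of_nhds, ?_⟩,
    t₁, ht₁, fun y hy t ht => ⟨(hP y hy t ht).2, ?_⟩⟩
  · rw [← fderiv_slice_right (hZc.differentiable (by norm_num)), hZt y hy]
    exact hpos' y hy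
  · have h1 := hWl (y, t) (hP y hy t ht).1
    have h2 : H (y, t) = (Z (y, t), 0) := by simp [hH, S.snd.defining.eq_zero S.snd.isOpen hy]
    rw [h2] at h1
    simp [h1]

/-- Outside `Ω`, near its boundary, the rays are smooth coordinates; the distance to `Ω` can be
taken as the coordinate along a ray. -/
theorem exists_ray_coordinates : ∃ (G : E n → E n) (Z : E n × ℝ → E n) (yb : E n → E n)
    (τ : E n × ℝ → ℝ) (t₁ δ₀ : ℝ), ContDiff ℝ 3 G ∧ ContDiff ℝ 3 Z ∧ ContDiff ℝ 3 yb ∧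
    ContDiff ℝ 3 τ ∧ 0 < t₁ ∧ 0 < δ₀ ∧
    (∀ y ∈ frontier Ωs, IsMinimizer c (closure Ω) u y (G y) ∧ G y ∈ frontier Ω ∧ Z (y, 0) = G y ∧
      StrictMonoOn (fun t => Metric.infDist (Z (y, t)) Ω) (Icc 0 t₁) ∧
      δ₀ ≤ Metric.infDist (Z (y, t₁)) Ω ∧
      (∀ t ∈ Ioc 0 t₁, Z (y, t) ∉ closure Ω) ∧
      ∀ t ∈ Icc 0 t₁, cY c (Z (y, t)) y = cY c (G y) y + t • gradient φs y ∧ yb (Z (y, t)) = y ∧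
        τ (y, Metric.infDist (Z (y, t)) Ω) = t) ∧
    ∀ z, z ∉ closure Ω → Metric.infDist z Ω < δ₀ → ∀ y ∈ closure Ωs,
      hullEnvelope c (closure Ω) (closure Ωs) u z = c z y + contactValue c (closure Ω) u y →
      y ∈ frontier Ωs ∧ ∃ t ∈ Ioo 0 t₁, z = Z (y, t) := by
  obtain ⟨G, Z, yb, hG, hZ, hyb, hGZ, t₁, ht₁, hZt⟩ := S.exists_ray_map hu
  have hne := S.fst.isConnected.nonempty
  obtain ⟨d, hd, r₀, hr₀, hdd, hdf⟩ := S.fst.defining.exists_smooth_dist S.fst.isOpen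
    S.isCompact_fst hne
  have hucont : Continuous u := hu.smooth.continuous
  set D : E n × ℝ → ℝ := fun z => d (Z z) with hD
  have hDc : ContDiff ℝ 3 D := hd.comp hZ
  have hφZ : ContDiff ℝ 3 (fun z => φ (Z z)) :=
    (S.fst.defining.smooth.of_le (by norm_num)).comp hZ
  have hchain : ∀ {f : E n → ℝ}, Differentiable ℝ f → ∀ y ∈ frontier Ωs,
      fderiv ℝ (fun z => f (Z z)) (y, 0) (0, 1) =
        fderiv ℝ f (G y) (fderiv ℝ Z (y, 0) (0, 1)) := by
    intro f hf y hy
    have h1 : HasFDerivAt (fun z => f (Z z)) _ (y, (0 : ℝ)) :=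
      (hf _).hasFDerivAt.comp (y, (0 : ℝ)) (hZ.differentiable (by norm_num) _).hasFDerivAt
    rw [h1.fderiv, (hGZ y hy).2.2.1]
    rfl
  have hcontD : ∀ {f : E n × ℝ → ℝ}, ContDiff ℝ 3 f →
      Continuous (fun z => fderiv ℝ f z (0, 1)) := fun hf =>
    (hf.continuous_fderiv (by norm_num)).clm_apply continuous_const
  have hinf0 : ∀ x ∈ closure Ω, Metric.infDist x Ω = 0 := fun x hx =>
    (Metric.mem_closure_iff_infDist_zero hne).1 hx
  have hev : ∀ y ∈ frontier Ωs, ∀ᶠ z in 𝓝 (y, (0 : ℝ)), 0 < fderiv ℝ D z (0, 1) ∧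
      0 < fderiv ℝ (fun z => φ (Z z)) z (0, 1) ∧ (Z z ∈ closure Ω → φ (Z z) ≤ 0) ∧
      Metric.infDist (Z z) Ω < r₀ := by
    intro y hy
    obtain ⟨-, hGf, hZ0, hp⟩ := hGZ y hy
    have hZG : Tendsto Z (𝓝 (y, 0)) (𝓝 (G y)) := by
      rw [← hZ0]; exact hZ.continuous.tendsto _
    refine ((hcontD hDc).tendsto (y, (0 : ℝ)) |>.eventually (lt_mem_nhds ?_)).and
      (((hcontD hφZ).tendsto (y, (0 : ℝ)) |>.eventually (lt_mem_nhds ?_)).and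
      ((hZG.eventually (S.fst.defining.eventually_nonpos hGf)).and
        (hZG.eventually (p := fun x => Metric.infDist x Ω < r₀) ?_)))
    · rw [hchain (hd.differentiable (by norm_num)) y hy]
      exact (hdf _ hGf).2 _ hp
    · rw [hchain S.fst.defining.differentiable y hy]
      exact hp
    · have h4 := (Metric.continuous_infDist_pt Ω).tendsto (G y)
      rw [hinf0 _ (frontier_subset_closure hGf)] at h4
      exact h4.eventually (gt_mem_nhds hr₀)
  obtain ⟨t₂, ht₂, hP⟩ := exists_forall_abs_le S.swap.isCompact_frontier hev
  set t₃ := min t₁ t₂ with ht₃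
  have ht₃0 : 0 < t₃ := lt_min ht₁ ht₂
  have habs1 : ∀ t ∈ Icc 0 t₃, |t| ≤ t₁ := fun t ht => by
    rw [abs_of_nonneg ht.1]; exact ht.2.trans (min_le_left _ _)
  have habs2 : ∀ t ∈ Icc 0 t₃, |t| ≤ t₂ := fun t ht => by
    rw [abs_of_nonneg ht.1]; exact ht.2.trans (min_le_right _ _)
  have hmono : ∀ {f : E n × ℝ → ℝ}, ContDiff ℝ 3 f → (∀ y ∈ frontier Ωs, ∀ t : ℝ, |t| ≤ t₂ →
      0 < fderiv ℝ f (y, t) (0, 1)) → ∀ y ∈ frontier Ωs,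
      StrictMonoOn (fun t => f (y, t)) (Icc 0 t₃) := by
    intro f hf hpos y hy
    have hder := hasDerivAt_slice_right (hf.differentiable (by norm_num)) y
    refine strictMonoOn_of_deriv_pos (convex_Icc _ _)
      (fun t _ => (hder t).continuousAt.continuousWithinAt) fun t ht => ?_
    rw [(hder t).deriv]
    exact hpos y hy t (habs2 t (interior_subset ht))
  have hDm := hmono hDc fun y hy t ht => (hP y hy t ht).1
  have hφm := hmono hφZ fun y hy t ht => (hP y hy t ht).2.1
  have hnot : ∀ y ∈ frontier Ωs, ∀ t ∈ Ioc 0 t₃, Z (y, t) ∉ closure Ω := by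
    intro y hy t ht hmem
    have h1 := (hP y hy t (habs2 t ⟨ht.1.le, ht.2⟩)).2.2.1 hmem
    have h2 := hφm y hy (left_mem_Icc.2 ht₃0.le) ⟨ht.1.le, ht.2⟩ ht.1
    simp only [(hGZ y hy).2.2.1, S.fst.defining.eq_zero S.fst.isOpen (hGZ y hy).2.1] at h2
    linarith
  have hDd : ∀ y ∈ frontier Ωs, ∀ t ∈ Icc 0 t₃, D (y, t) = Metric.infDist (Z (y, t)) Ω := by
    intro y hy t ht
    rcases ht.1.eq_or_lt with h0 | h0
    · rw [← h0, hD]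
      simp only [(hGZ y hy).2.2.1, (hdf _ (hGZ y hy).2.1).1,
        hinf0 _ (frontier_subset_closure (hGZ y hy).2.1)]
    · exact hdd _ (hnot y hy t ⟨h0, ht.2⟩) (hP y hy t (habs2 t ht)).2.2.2
  have hDm' : ∀ y ∈ frontier Ωs,
      StrictMonoOn (fun t => Metric.infDist (Z (y, t)) Ω) (Icc 0 t₃) := fun y hy =>
    (hDm y hy).congr fun t ht => hDd y hy t ht
  -- the distance as coordinate on the rays
  set H : E n × ℝ → E n × ℝ := fun z => (z.1, D z) with hH
  have hHc : ContDiff ℝ 3 H := contDiff_fst.prodMk hDc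
  obtain ⟨W, hW, O, hO, hKO, hWl, -⟩ := exists_contDiff_leftInverse (k := 3) (by norm_num) hHc
    (K := frontier Ωs ×ˢ Icc 0 t₃) (S.swap.isCompact_frontier.prod isCompact_Icc)
    (by
      rintro ⟨y, s⟩ ⟨hy, hs⟩ ⟨y', s'⟩ ⟨hy', hs'⟩ he
      have h1 : y = y' := congrArg Prod.fst he
      subst h1
      have h2 : D (y, s) = D (y, s') := congrArg Prod.snd he
      exact Prod.ext rfl ((hDm y hy).injOn hs hs' h2))
    (by
      rintro ⟨y, s⟩ ⟨hy, hs⟩ ⟨η, τ⟩ hw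
      have hHd : HasFDerivAt H ((ContinuousLinearMap.fst ℝ (E n) ℝ).prod (fderiv ℝ D (y, s)))
          (y, s) := hasFDerivAt_fst.prodMk (hDc.differentiable (by norm_num) _).hasFDerivAt
      rw [hHd.fderiv] at hw
      have hw1 : η = 0 := congrArg Prod.fst hw
      have hw2 : fderiv ℝ D (y, s) (η, τ) = 0 := congrArg Prod.snd hw
      have h3 : ((η, τ) : E n × ℝ) = τ • ((0 : E n), (1 : ℝ)) := by rw [hw1]; simp
      rw [h3, map_smul, smul_eq_mul] at hw2
      have := (mul_eq_zero.1 hw2).resolve_right (hP y hy s (habs2 s hs)).1.ne'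
      rw [h3, this, zero_smul])
    rfl
  have hmin := fun y hy => (hGZ y hy).1
  -- points with a maximizer far out on its ray stay away from the boundary
  obtain ⟨δ₁, hδ₁, hδ₁'⟩ : ∃ δ₁ : ℝ, 0 < δ₁ ∧ ∀ y ∈ frontier Ωs,
      δ₁ ≤ Metric.infDist (Z (y, t₃)) Ω := by
    refine S.swap.isCompact_frontier.exists_forall_le' ?_ ?_
    · exact ((Metric.continuous_infDist_pt Ω).comp (hZ.continuous.comp
        (contDiff_mk_left (k := 0) t₃).continuous)).continuousOn
    · intro y hy
      have := hDm' y hy (left_mem_Icc.2 ht₃0.le) (right_mem_Icc.2 ht₃0.le) ht₃0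
      exact lt_of_le_of_lt Metric.infDist_nonneg this
  set hull := hullEnvelope c (closure Ω) (closure Ωs) u with hhull
  have hhc : Continuous hull := continuous_hullEnvelope S.continuous_cost S.isCompact_fst
    S.isCompact_snd hucont
  have hcc : Continuous (contactValue c (closure Ω) u) :=
    continuous_contactValue S.continuous_cost S.isCompact_fst hucont
  have hgφs : ContDiff ℝ 3 (gradient φs) := contDiff_gradient (k := 3) S.snd.defining.smooth
  -- the outer points with a maximizing focus, at a parameter at least `t₃` on its ray (tested by
  -- the
  -- inner product with `∇φs`); this set is compact
  set B : Set (E n × E n) := (Metric.cthickening 1 Ω ×ˢ frontier Ωs) ∩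
    ({z | hull z.1 = c z.1 z.2 + contactValue c (closure Ω) u z.2} ∩
      {z | t₃ * ‖gradient φs z.2‖ ^ 2 ≤
        inner ℝ (cY c z.1 z.2 - cY c (G z.2) z.2) (gradient φs z.2)}) with hB
  have hBc : IsCompact B := by
    refine IsCompact.inter_right ?_ (IsClosed.inter ?_ ?_)
    · exact (Metric.isCompact_of_isClosed_isBounded Metric.isClosed_cthickening
        S.fst.isBounded.cthickening).prod S.swap.isCompact_frontier
    · exact isClosed_eq (hhc.comp continuous_fst)
        (S.continuous_cost.add (hcc.comp continuous_snd))
    · refine isClosed_le (continuous_const.mul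
        ((hgφs.continuous.comp continuous_snd).norm.pow 2)) ?_
      refine Continuous.inner ?_ (hgφs.continuous.comp continuous_snd)
      exact (continuous_cY S.hc).sub ((continuous_cY S.hc).comp
        ((hG.continuous.comp continuous_snd).prodMk continuous_snd))
  obtain ⟨δ₂, hδ₂, hδ₂'⟩ : ∃ δ₂ : ℝ, 0 < δ₂ ∧ ∀ z ∈ B, δ₂ ≤ Metric.infDist z.1 Ω := by
    refine hBc.exists_forall_le' ?_ ?_
    · exact ((Metric.continuous_infDist_pt Ω).comp continuous_fst).continuousOn
    -- a point of the closure of `Ω` in this set would be the contact point, with parameter `0`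
    · rintro ⟨z, y⟩ ⟨⟨-, hy⟩, hmax, hge⟩
      refine lt_of_le_of_ne Metric.infDist_nonneg fun h0 => ?_
      have hz : z ∈ closure Ω := (Metric.mem_closure_iff_infDist_zero hne).2 h0.symm
      have h1 : IsMinimizer c (closure Ω) u y z := by
        refine ⟨hz, fun x hx => ?_⟩
        have h2 := contactValue_le S.continuous_cost S.isCompact_fst S.nonempty_fst hucont y hx
        have h3 : hull z = u z := S.hullEnvelope_eq hu hz
        simp only [mem_ofPred_eq, h3] at hmax
        linarith
      have h2 : G y = z := S.isMinimizer_unique hu (frontier_subset_closure hy)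
        (S.gradient_ne_of_mem_frontier hu hy) (hmin y hy) h1
      have hy0 : y ∈ frontier Ωs := hy
      simp only [mem_ofPred_eq, h2, sub_self, inner_zero_left] at hge
      have h3 := norm_pos_iff.2 (S.snd.defining.gradient_ne hy0)
      have : 0 < t₃ * ‖gradient φs y‖ ^ 2 := by positivity
      linarith
  refine ⟨G, Z, yb, fun z => (W z).2, t₃, min 1 (min δ₁ δ₂), hG, hZ, hyb, hW.snd, ht₃0,
    lt_min one_pos (lt_min hδ₁ hδ₂), fun y hy => ⟨hmin y hy, (hGZ y hy).2.1, (hGZ y hy).2.2.1,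
      hDm' y hy, ?_, hnot y hy, fun t ht => ⟨(hZt y hy t (habs1 t ht)).1,
        (hZt y hy t (habs1 t ht)).2, ?_⟩⟩, ?_⟩
  · exact ((min_le_right _ _).trans (min_le_left _ _)).trans (hδ₁' y hy)
  · have h1 := hWl (y, t) (hKO ⟨hy, ht⟩)
    have h2 : H (y, t) = (y, Metric.infDist (Z (y, t)) Ω) := by rw [hH, ← hDd y hy t ht]
    rw [h2] at h1
    simp [h1]
  · intro z hz hlt y hy hmax
    obtain ⟨x, hx⟩ := exists_isMinimizer S.hc S.isCompact_fst S.nonempty_fst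
      hucont.continuousOn y
    obtain ⟨hyf, t, ht, hte⟩ := S.exists_normal_ray hu hz hy hmax hx
    have h2 : G y = x := S.isMinimizer_unique hu hy
        (S.gradient_ne_of_mem_frontier hu hyf) (hmin y hyf) hx
    have htlt : t < t₃ := by
      by_contra hge
      have hmemB : (z, y) ∈ B := by
        refine ⟨⟨?_, hyf⟩, hmax, ?_⟩
        · exact Metric.thickening_subset_cthickening _ _
            ((Metric.mem_thickening_iff_infDist_lt hne).2 (hlt.trans_le (min_le_left _ _)))
        · simp only [mem_ofPred_eq, h2, hte, add_sub_cancel_left, inner_smul_left,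
            real_inner_self_eq_norm_sq, RCLike.conj_to_real]
          gcongr
          exact not_lt.1 hge
      have := hδ₂' _ hmemB
      have h3 : min 1 (min δ₁ δ₂) ≤ δ₂ := (min_le_right _ _).trans (min_le_right _ _)
      simp only at this
      linarith
    refine ⟨hyf, t, ⟨ht, htlt⟩, S.snd.inj y hy ?_⟩
    change cY c z y = cY c (Z (y, t)) y
    rw [(hZt y hyf t (habs1 t ⟨ht.le, htlt.le⟩)).1, hte, h2]

end Setup

/-! ### The envelope outside the domain -/

namespace Setup

variable {n : ℕ} {c : E n → E n → ℝ} {Ω Ωs : Set (E n)} {φ φs : E n → ℝ}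
  {X Y : E n × E n → E n} (S : Setup c Ω Ωs φ φs X Y) {u : E n → ℝ}
  (hu : IsSubsolution c Ω Ωs u)

include S hu

/-- The supremum over the admissible `c`-functions is the envelope over the closed set of foci. -/
theorem isLUB_envelopeValues (x : E n) : IsLUB (envelopeValues c Ω Ωs u x)
    (hullEnvelope c (closure Ω) (closure Ωs) u x) := by
  have hucont : Continuous u := hu.smooth.continuous
  have hcc : Continuous (contactValue c (closure Ω) u) :=
    continuous_contactValue S.continuous_cost S.isCompact_fst hucont
  have hT : ∀ (y : E n) (a : ℝ), ∀ z ∈ Ω, Tmap c (fun x => c x y + a) z = y := by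
    intro y a z hz
    have h1 : gradient (fun x => c x y + a) z = cX c z y := by
      unfold cX gradient
      rw [fderiv_add_const]
    rw [Tmap, h1]
    exact Function.leftInverse_invFun (S.fst.inj z (subset_closure hz)) y
  constructor
  · rintro s (⟨hx, rfl⟩ | ⟨h, ⟨⟨y, a, rfl⟩, hle, hTh⟩, rfl⟩)
    · exact (S.hullEnvelope_eq hu (subset_closure hx)).ge
    · obtain ⟨x₀, hx₀⟩ := S.fst.isConnected.nonempty
      have hy : y ∈ Ωs := hTh ⟨x₀, hx₀, hT y a x₀ hx₀⟩
      have hcl : closure Ω ⊆ {z | a ≤ u z - c z y} := by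
        refine closure_minimal (fun z hz => ?_) (isClosed_le continuous_const
          (hucont.sub (S.continuous_cost.comp (contDiff_mk_left (k := 0) y).continuous)))
        have := hle z hz
        change a ≤ u z - c z y
        simp only at this
        linarith
      have ha : a ≤ contactValue c (closure Ω) u y := by
        refine (isGLB_contactValue S.continuous_cost S.isCompact_fst S.nonempty_fst hucont y).2 ?_
        rintro _ ⟨z, hz, rfl⟩
        exact hcl hz
      have := le_hullEnvelope S.continuous_cost S.isCompact_fst S.isCompact_snd S.nonempty_snd
        hucont x (subset_closure hy)
      simp only
      linarith
  · intro b hb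
    obtain ⟨y, hy, he⟩ := exists_hullEnvelope_eq S.continuous_cost S.isCompact_fst
      S.isCompact_snd S.nonempty_snd hucont x
    rw [he]
    -- admissibility concerns foci in `Ω*` only; those of the closure are limits
    have hcl : closure Ωs ⊆ {y | c x y + contactValue c (closure Ω) u y ≤ b} := by
      refine closure_minimal (fun y hy => ?_) (isClosed_le
        ((S.continuous_cost.comp (contDiff_mk_right (k := 0) x).continuous).add hcc)
        continuous_const)
      refine hb (Or.inr ⟨fun x => c x y + contactValue c (closure Ω) u y,
        ⟨⟨y, _, rfl⟩, fun z hz => ?_, ?_⟩, rfl⟩)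
      · have := contactValue_le S.continuous_cost S.isCompact_fst S.nonempty_fst hucont y
          (subset_closure hz)
        simp only
        linarith
      · rintro _ ⟨z, hz, rfl⟩
        rw [hT y _ z hz]
        exact hy
    exact hcl hy

/-- The supremum defining the envelope is attained on the closure of `Ω*`, by the supporting
`c`-functions of `u`. -/
theorem envelope_eq (x : E n) :
    envelope c Ω Ωs u x = hullEnvelope c (closure Ω) (closure Ωs) u x := by
  refine (S.isLUB_envelopeValues hu x).csSup_eq ?_
  by_contra hne
  rw [not_nonempty_iff_eq_empty] at hne
  have h := S.isLUB_envelopeValues hu x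
  rw [hne] at h
  have : hullEnvelope c (closure Ω) (closure Ωs) u x ≤
      hullEnvelope c (closure Ω) (closure Ωs) u x - 1 := h.2 (by simp)
  linarith

/-- The multiplier at a contact point is positive for foci outside the image of `Tu`. -/
theorem exists_cX_eq_pos {x y : E n} (hx : x ∈ frontier Ω) (hy : y ∈ frontier Ωs)
    (h : IsMinimizer c (closure Ω) u y x) :
    ∃ s : ℝ, 0 < s ∧ cX c x y = gradient u x + s • gradient φ x := by
  obtain ⟨s, hs, he⟩ := S.exists_cX_eq_of_isMinimizer hu.smooth h hx
  refine ⟨s, lt_of_le_of_ne hs fun h0 => ?_, he⟩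
  refine S.gradient_ne_of_mem_frontier hu hy x h.1 ?_
  rw [he, ← h0, zero_smul, add_zero]

/-- The envelope `u₁` of `u` on the neighbourhoods of `Ω`: it is `c`-convex, its `c`-normal image
is the closure of `Ω*`, and its `c`-normal mapping is constant along the rays. -/
theorem envelope_properties {U : Set (E n)} (hU : IsOpen U) (hΩU : closure Ω ⊆ U)
    (hinj : ∀ x ∈ U, Function.Injective (cX c x)) :
    ∃ δ₀ : ℝ, 0 < δ₀ ∧ ∀ δ : ℝ, 0 < δ → δ ≤ δ₀ →
      (∀ x ∈ Metric.thickening δ Ω, IsLUB (envelopeValues c Ω Ωs u x) (envelope c Ω Ωs u x)) ∧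
      IsCConvexOn c (Metric.thickening δ Ω) (envelope c Ω Ωs u) ∧
      EqOn (envelope c Ω Ωs u) u (closure Ω) ∧
      (⋃ x ∈ Metric.thickening δ Ω, cNormal c (Metric.thickening δ Ω) (envelope c Ω Ωs u) x)
        = closure Ωs ∧
      ∃ xb yb : E n → E n,
        (∀ x ∈ Metric.thickening δ Ω \ closure Ω,
          xb x ∈ frontier Ω ∧ yb x ∈ frontier Ωs ∧
          IsRayTo c (Metric.thickening δ Ω) (envelope c Ω Ωs u) x (xb x) (yb x) ∧
          ∀ x' ∈ frontier Ω, ∀ y' ∈ frontier Ωs,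
            IsRayTo c (Metric.thickening δ Ω) (envelope c Ω Ωs u) x x' y' →
              x' = xb x ∧ y' = yb x) ∧
        ∀ r : ℝ, 0 < r → r < δ →
          IsDiffeoOn 2 xb (frontier (Metric.thickening r Ω)) (frontier Ω) ∧
          IsDiffeoOn 2 yb (frontier (Metric.thickening r Ω)) (frontier Ωs) := by
  have henv : envelope c Ω Ωs u = hullEnvelope c (closure Ω) (closure Ωs) u :=
    funext (S.envelope_eq hu)
  rw [henv]
  have hucont : Continuous u := hu.smooth.continuous
  have hne := S.fst.isConnected.nonempty
  obtain ⟨G, Z, yb, τ, t₁, δ₁, hG, hZ, hyb, hτ, ht₁, hδ₁, hray, hcov⟩ :=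
    S.exists_ray_coordinates hu
  obtain ⟨δ₂, hδ₂, hδU⟩ := S.isCompact_fst.exists_thickening_subset_open hU hΩU
  rw [Metric.thickening_closure] at hδU
  refine ⟨min δ₁ δ₂, lt_min hδ₁ hδ₂, fun δ hδ hδle => ?_⟩
  set w := hullEnvelope c (closure Ω) (closure Ωs) u with hw
  set D := Metric.thickening δ Ω with hD
  have hwc : Continuous w := continuous_hullEnvelope S.continuous_cost S.isCompact_fst
    S.isCompact_snd hucont
  have hDo : IsOpen D := Metric.isOpen_thickening
  have hmemD : ∀ {z}, z ∈ D ↔ Metric.infDist z Ω < δ :=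
    fun {z} => Metric.mem_thickening_iff_infDist_lt hne
  have hDU : D ⊆ U := (Metric.thickening_mono (hδle.trans (min_le_right _ _)) Ω).trans hδU
  have hinf0 : ∀ {x}, x ∈ closure Ω ↔ Metric.infDist x Ω = 0 :=
    Metric.mem_closure_iff_infDist_zero hne
  have hΩD : closure Ω ⊆ D := fun x hx => hmemD.2 (by rw [hinf0.1 hx]; exact hδ)
  have hle : ∀ z, ∀ y ∈ closure Ωs, c z y + contactValue c (closure Ω) u y ≤ w z :=
    fun z y hy => le_hullEnvelope S.continuous_cost S.isCompact_fst S.isCompact_snd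
      S.nonempty_snd hucont z hy
  have hmax : ∀ z, ∃ y ∈ closure Ωs, w z = c z y + contactValue c (closure Ω) u y := fun z =>
    exists_hullEnvelope_eq S.continuous_cost S.isCompact_fst S.isCompact_snd S.nonempty_snd
      hucont z
  -- outside the closure of `Ω` the focus is unique, and the point is on its ray
  have houter : ∀ z ∈ D \ closure Ω, yb z ∈ frontier Ωs ∧
      w z = c z (yb z) + contactValue c (closure Ω) u (yb z) ∧
      (∃ t ∈ Ioo 0 t₁, z = Z (yb z, t)) ∧ cNormal c D w z = {yb z} := by
    rintro z ⟨hzD, hz⟩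
    have hzδ : Metric.infDist z Ω < δ₁ := (hmemD.1 hzD).trans_le (hδle.trans (min_le_left _ _))
    have hall : ∀ y' ∈ closure Ωs, w z = c z y' + contactValue c (closure Ω) u y' →
        y' = yb z ∧ y' ∈ frontier Ωs ∧ ∃ t ∈ Ioo 0 t₁, z = Z (y', t) := by
      intro y' hy' he
      obtain ⟨hyf, t, ht, hzt⟩ := hcov z hz hzδ y' hy' he
      refine ⟨?_, hyf, t, ht, hzt⟩
      rw [hzt, ((hray y' hyf).2.2.2.2.2.2 t ⟨ht.1.le, ht.2.le⟩).2.1]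
    obtain ⟨y, hy, he⟩ := hmax z
    obtain ⟨h1, h2, h3⟩ := hall y hy he
    rw [← h1]
    exact ⟨h2, he, h3, S.cNormal_eq_singleton hucont (hDo.mem_nhds hzD) (hinj z (hDU hzD)) hy
      fun y' hy' he' => (hall y' hy' he').1.trans h1.symm⟩
  have hGinj : InjOn G (frontier Ωs) := by
    intro y hy y' hy' he
    obtain ⟨hm, hGf, -⟩ := hray y hy
    obtain ⟨hm', hGf', -⟩ := hray y' hy'
    rw [← he] at hm' hGf'
    obtain ⟨s, hs, hse⟩ := S.exists_cX_eq_pos hu hGf hy hm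
    obtain ⟨s', hs', hse'⟩ := S.exists_cX_eq_pos hu hGf hy' hm'
    exact S.focus_unique hu hm.1 hy hy' hs hs' hse hse'
  have hGbij : BijOn G (frontier Ωs) (frontier Ω) := by
    refine ⟨fun y hy => (hray y hy).2.1, hGinj, fun x hx => ?_⟩
    obtain ⟨y, hy, hm⟩ := S.exists_mem_frontier_isMinimizer hu hx
    exact ⟨y, hy, S.isMinimizer_unique hu (frontier_subset_closure hy)
      (S.gradient_ne_of_mem_frontier hu hy) (hray y hy).1 hm⟩
  refine ⟨fun x _ => S.isLUB_envelopeValues hu x, ⟨hwc.continuousOn, fun x₀ _ => ?_⟩,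
    fun x hx => S.hullEnvelope_eq hu hx, ?_, fun x => G (yb x), yb, ?_, ?_⟩
  · obtain ⟨y, hy, he⟩ := hmax x₀
    refine ⟨y, fun x _ => ?_⟩
    have := hle x y hy
    linarith
  · refine subset_antisymm (iUnion₂_subset fun x hx => ?_) fun y hy => ?_
    · by_cases hxc : x ∈ closure Ω
      · exact S.cNormal_subset_of_mem_closure hucont hxc (hDo.mem_nhds hx)
      · obtain ⟨h1, -, -, h2⟩ := houter x ⟨hx, hxc⟩
        rw [h2]
        exact singleton_subset_iff.2 (frontier_subset_closure h1)
    · obtain ⟨x, hx⟩ := exists_isMinimizer S.hc S.isCompact_fst S.nonempty_fst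
        hucont.continuousOn y
      refine mem_iUnion₂.2 ⟨x, hΩD hx.1, fun z _ => ?_⟩
      have h1 : w x = u x := S.hullEnvelope_eq hu hx.1
      have h2 := contactValue_eq S.continuous_cost S.isCompact_fst S.nonempty_fst hucont hx
      have h3 := hle z y hy
      rw [h1]
      linarith
  · intro x hx
    obtain ⟨hyf, hmx, ⟨t, ht, hxt⟩, hcn⟩ := houter x hx
    obtain ⟨hm, hGf, hZ0, hmono, -, hnot, hZt⟩ := hray (yb x) hyf
    have hyc := frontier_subset_closure hyf
    refine ⟨hGf, hyf, ?_, ?_⟩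
    · -- the points of the ray
      have hpts : ∀ z ∈ cSegment c (yb x) x (G (yb x)), ∃ s ∈ Icc 0 t, z = Z (yb x, s) := by
        intro z hz
        obtain ⟨a, b, ha, hb, hab, he⟩ := hz
        have h1 : cY c x (yb x) = cY c (G (yb x)) (yb x) + t • gradient φs (yb x) := by
          have := (hZt t ⟨ht.1.le, ht.2.le⟩).1
          rwa [← hxt] at this
        have hat : a * t ∈ Icc 0 t := ⟨by have := ht.1; positivity, by nlinarith [ht.1]⟩
        refine ⟨a * t, hat, S.snd.inj (yb x) hyc ?_⟩
        change cY c z (yb x) = cY c (Z (yb x, a * t)) (yb x)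
        rw [(hZt (a * t) ⟨hat.1, hat.2.trans ht.2.le⟩).1, ← he, h1]
        have : b = 1 - a := by linarith
        rw [this]
        module
      have hin : ∀ s ∈ Icc 0 t, Z (yb x, s) ∈ D := by
        intro s hs
        refine hmemD.2 (lt_of_le_of_lt ?_ (hmemD.1 hx.1))
        conv_rhs => rw [hxt]
        exact hmono.monotoneOn ⟨hs.1, hs.2.trans ht.2.le⟩ ⟨ht.1.le, ht.2.le⟩ hs.2
      refine ⟨fun z hz => ?_, fun z hz hzne => ?_⟩
      · obtain ⟨s, hs, rfl⟩ := hpts z hz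
        exact hin s hs
      · obtain ⟨s, hs, rfl⟩ := hpts z hz
        have hs0 : 0 < s := lt_of_le_of_ne hs.1 fun h0 => hzne (by rw [← h0, hZ0])
        have hs1 : s ≤ t₁ := hs.2.trans ht.2.le
        have := (houter _ ⟨hin s hs, hnot s ⟨hs0, hs1⟩⟩).2.2.2
        rw [this, (hZt s ⟨hs.1, hs1⟩).2.1]
    · intro x' hx' y' hy' hr
      have hx'c := frontier_subset_closure hx'
      have hxne : x ≠ x' := fun h => hx.2 (h ▸ hx'c)
      have h1 : cNormal c D w x = {y'} := hr.2 x (left_mem_segment ℝ _ _) hxne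
      have hyy : y' = yb x := by
        rw [hcn] at h1
        exact (singleton_eq_singleton_iff.1 h1).symm
      subst hyy
      refine ⟨?_, rfl⟩
      set y := yb x with hy
      have hqne : cY c x y ≠ cY c x' y := fun h => hxne (S.snd.inj y hyc h)
      have hcont : Tendsto (fun s : ℝ => cY c x' y + s • (cY c x y - cY c x' y)) (𝓝[>] 0)
          (𝓝 (cY c x' y)) := by
        have : Continuous fun s : ℝ => cY c x' y + s • (cY c x y - cY c x' y) := by fun_prop
        simpa using (this.tendsto 0).mono_left nhdsWithin_le_nhds
      have hcont2 : Tendsto (fun s : ℝ => X (y, cY c x' y + s • (cY c x y - cY c x' y)))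
          (𝓝[>] 0) (𝓝 x') := by
        have := ((S.contDiff_X_slice y).continuous.tendsto (cY c x' y)).comp hcont
        rwa [S.X_cY hx'c hyc] at this
      -- uniqueness of the base point: `w - c(·, y)` is constant along a ray, so by continuity the
      -- end point
      -- of the ray is a contact point of `y`
      have hval : Continuous fun z => w z - c z y :=
        hwc.sub (S.continuous_cost.comp (contDiff_mk_left (k := 0) y).continuous)
      have hlim := (hval.tendsto x').comp hcont2
      have hconst : ∀ᶠ s : ℝ in 𝓝[>] 0,
          ((fun z => w z - c z y) ∘ fun s : ℝ => X (y, cY c x' y + s • (cY c x y - cY c x' y))) s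
            = contactValue c (closure Ω) u y := by
        filter_upwards [hcont.eventually (S.eventually_cY_X hx'c hyc), Icc_mem_nhdsGT,
          self_mem_nhdsWithin] with s hs1 hs2 hs3
        set z := X (y, cY c x' y + s • (cY c x y - cY c x' y)) with hz
        have hs3' : (0 : ℝ) < s := hs3
        have hzseg : z ∈ cSegment c y x x' := by
          refine ⟨s, 1 - s, hs2.1, by linarith [hs2.2], by ring, ?_⟩
          rw [hs1]; module
        have hzne : z ≠ x' := by
          intro h
          rw [h] at hs1
          have h2 : s • (cY c x y - cY c x' y) = 0 := by simpa using hs1.symm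
          exact hqne (sub_eq_zero.1 ((smul_eq_zero.1 h2).resolve_left hs3'.ne'))
        have h2 : y ∈ cNormal c D w z := by rw [hr.2 z hzseg hzne]; exact mem_singleton _
        have h3 : y ∈ cNormal c D w x := by rw [hcn]; exact mem_singleton _
        have h4 := h2 x hx.1
        have h5 := h3 z (hr.1 hzseg)
        simp only [Function.comp_apply]
        linarith
      have hlim2 := tendsto_nhds_unique hlim
        ((tendsto_congr' hconst).2 tendsto_const_nhds)
      have h6 : w x' = u x' := S.hullEnvelope_eq hu hx'c
      refine S.isMinimizer_unique hu hyc (S.gradient_ne_of_mem_frontier hu hyf)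
        ⟨hx'c, fun z hz => ?_⟩ hm
      have h7 := contactValue_le S.continuous_cost S.isCompact_fst S.nonempty_fst hucont y hz
      simp only [h6] at hlim2
      linarith
  · intro r hr hrδ
    set M := frontier (Metric.thickening r Ω) with hM
    have hrδ₁ : r < δ₁ := hrδ.trans_le (hδle.trans (min_le_left _ _))
    have hMr : ∀ x ∈ M, Metric.infDist x Ω = r := by
      intro x hx
      have h1 := Metric.frontier_thickening_subset Ω hx
      change Metric.infEDist x Ω = ENNReal.ofReal r at h1
      rw [Metric.infDist, h1, ENNReal.toReal_ofReal hr.le]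
    have hMD : ∀ x ∈ M, x ∈ D \ closure Ω := fun x hx =>
      ⟨hmemD.2 (by rw [hMr x hx]; exact hrδ), fun h => by
        rw [hinf0, hMr x hx] at h
        exact hr.ne' h⟩
    have hinv : ∀ x ∈ M, Z (yb x, τ (yb x, r)) = x := by
      intro x hx
      obtain ⟨hyf, -, ⟨t, ht, hxt⟩, -⟩ := houter x (hMD x hx)
      have h1 := ((hray (yb x) hyf).2.2.2.2.2.2 t ⟨ht.1.le, ht.2.le⟩).2.2
      rw [← hxt, hMr x hx] at h1
      rw [h1, ← hxt]
    have hybG : ∀ y ∈ frontier Ωs, yb (G y) = y := by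
      intro y hy
      obtain ⟨-, -, hZ0, -, -, -, hZt⟩ := hray y hy
      rw [← hZ0, (hZt 0 ⟨le_rfl, ht₁.le⟩).2.1]
    have hbij : BijOn yb M (frontier Ωs) := by
      refine ⟨fun x hx => (houter x (hMD x hx)).1, fun x hx x' hx' he => ?_, fun y hy => ?_⟩
      · rw [← hinv x hx, he, hinv x' hx']
      · obtain ⟨-, hGf, hZ0, hmono, hge, -, hZt⟩ := hray y hy
        have hcont : Continuous fun t => Metric.infDist (Z (y, t)) Ω :=
          (Metric.continuous_infDist_pt Ω).comp
            (hZ.continuous.comp (contDiff_mk_right (k := 0) y).continuous)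
        have h0 : Metric.infDist (Z (y, 0)) Ω = 0 := by
          rw [hZ0]; exact hinf0.1 (frontier_subset_closure hGf)
        obtain ⟨t, ht, hte⟩ := intermediate_value_Icc ht₁.le hcont.continuousOn
          (show r ∈ Icc _ _ from ⟨by rw [h0]; exact hr.le, hrδ₁.le.trans hge⟩)
        simp only at hte
        have ht0 : 0 < t := lt_of_le_of_ne ht.1 fun h => by
          rw [← h, h0] at hte
          exact hr.ne hte
        refine ⟨Z (y, t), ?_, (hZt t ht).2.1⟩
        rw [hM, Metric.isOpen_thickening.frontier_eq]
        refine ⟨?_, fun h => ?_⟩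
        · have hlim : Tendsto (fun s => Z (y, s)) (𝓝[<] t) (𝓝 (Z (y, t))) :=
            ((hZ.continuous.comp (contDiff_mk_right (k := 0) y).continuous).tendsto t).mono_left
              nhdsWithin_le_nhds
          refine mem_closure_of_tendsto hlim ?_
          filter_upwards [Ioo_mem_nhdsLT ht0] with s hs
          rw [Metric.mem_thickening_iff_infDist_lt hne, ← hte]
          exact hmono ⟨hs.1.le, hs.2.le.trans ht.2⟩ ht hs.2
        · rw [Metric.mem_thickening_iff_infDist_lt hne, hte] at h
          exact lt_irrefl _ h
    have hZr : ContDiff ℝ 3 fun y => Z (y, τ (y, r)) :=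
      hZ.comp (contDiff_id.prodMk (hτ.comp (contDiff_mk_left r)))
    have h23 : ((2 : ℕ∞) : WithTop ℕ∞) ≤ 3 := by
      change ((2 : ℕ∞) : WithTop ℕ∞) ≤ ((3 : ℕ∞) : WithTop ℕ∞)
      exact WithTop.coe_le_coe.2 (by norm_num)
    refine ⟨⟨hGbij.comp hbij, ⟨fun x => G (yb x), (hG.comp hyb).of_le h23, fun x _ => rfl⟩,
      fun x => Z (yb x, τ (yb x, r)), (hZr.comp hyb).of_le h23, fun x hx => ?_⟩,
      ⟨hbij, ⟨yb, hyb.of_le h23, fun x _ => rfl⟩, fun y => Z (y, τ (y, r)), hZr.of_le h23, hinv⟩⟩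
    simp only [hybG _ (houter x (hMD x hx)).1]
    exact hinv x hx

end Setup

/-! ### Convexity of images from the curvature condition -/

section LocalDefining

variable {n : ℕ}

theorem eventually_nonpos_of_local {D : Set (E n)} {ψ : E n → ℝ} (hψ : Continuous ψ) {x : E n}
    (h : ∀ᶠ z in 𝓝 x, (z ∈ D ↔ ψ z < 0)) : ∀ᶠ z in 𝓝 x, z ∈ closure D → ψ z ≤ 0 := by
  filter_upwards [eventually_eventually_nhds.2 h] with z hz hmem
  by_contra hpos
  have h1 : ∀ᶠ w in 𝓝 z, w ∉ D := by
    filter_upwards [hz, hψ.continuousAt.eventually (lt_mem_nhds (not_le.1 hpos))] with w h2 h3 h4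
    exact lt_asymm h3 (h2.1 h4)
  exact (mem_closure_iff_frequently.1 hmem) h1

end LocalDefining

namespace Setup

variable {n : ℕ} {c : E n → E n → ℝ} {Ω Ωs : Set (E n)} {φ φs : E n → ℝ}
  {X Y : E n × E n → E n} (S : Setup c Ω Ωs φ φs X Y)

include S

/-- A domain whose boundary is strictly convex in the coordinates `c_y(x, y)` has a convex image
in them: the pairs of points joined by a `c`-segment inside form a clopen set. -/
theorem convex_image_of_curv {D : Set (E n)} (hD : IsOpen D) (hconn : IsConnected D)
    (hDΩ : closure D ⊆ closure Ω) {ψ : E n → ℝ} (hψ : ContDiff ℝ 2 ψ)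
    (hloc : ∀ x ∈ frontier D, ∀ᶠ z in 𝓝 x, (z ∈ D ↔ ψ z < 0)) {y : E n} (hy : y ∈ closure Ωs)
    (hcurv : ∀ x ∈ frontier D, ∀ v, v ≠ 0 → fderiv ℝ ψ x (vel X y (cY c x y) v) = 0 →
      0 < sndDeriv ψ x (vel X y (cY c x y) v) + fderiv ℝ ψ x (acc X y (cY c x y) v)) :
    Convex ℝ ((fun x => cY c x y) '' D) := by
  set b : E n → E n := fun x => cY c x y with hb
  have hbc : Continuous b := (continuous_cY S.hc).comp (contDiff_mk_left (k := 0) y).continuous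
  have hbi : Function.Injective b := S.snd.inj y hy
  set A := b '' D with hA
  have hXc := (S.contDiff_X_slice y).continuous
  have hAo : IsOpen A := by
    rw [isOpen_iff_mem_nhds]
    rintro _ ⟨x, hx, rfl⟩
    have hx' := hDΩ (subset_closure hx)
    have h1 : ∀ᶠ q in 𝓝 (b x), X (y, q) ∈ D := by
      refine hXc.continuousAt.eventually (hD.mem_nhds ?_)
      simp only [hb, S.X_cY hx' hy]
      exact hx
    filter_upwards [h1, S.eventually_cY_X hx' hy] with q h2 h3
    exact ⟨_, h2, h3⟩
  have hcomp : IsCompact (b '' closure D) :=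
    (S.isCompact_fst.of_isClosed_subset isClosed_closure hDΩ).image hbc
  -- the pairs of points whose joining segment stays in the image of `D`
  set w : Set (E n × E n) := {z | (z.1 ∈ D ∧ z.2 ∈ D) ∧
    ∀ t ∈ Icc (0 : ℝ) 1, b z.1 + t • (b z.2 - b z.1) ∈ A} with hw
  have hseg : Continuous fun z : (E n × E n) × ℝ => b z.1.1 + z.2 • (b z.1.2 - b z.1.1) := by
    fun_prop
  have hwo : IsOpen w := by
    rw [isOpen_iff_mem_nhds]
    rintro ⟨x, x'⟩ ⟨⟨hx, hx'⟩, hs⟩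
    have h1 : ∀ᶠ z : E n × E n in 𝓝 (x, x'), ∀ t ∈ Icc (0 : ℝ) 1,
        b z.1 + t • (b z.2 - b z.1) ∈ A := by
      refine isCompact_Icc.eventually_forall_of_forall_eventually fun t ht => ?_
      exact hseg.continuousAt.eventually (hAo.mem_nhds (hs t ht))
    filter_upwards [h1, (hD.prod hD).mem_nhds (show (x, x') ∈ D ×ˢ D from ⟨hx, hx'⟩)] with z h2 h3
    exact ⟨h3, h2⟩
  have hwcl : closure w ∩ D ×ˢ D ⊆ w := by
    rintro ⟨x, x'⟩ ⟨hcl, hx, hx'⟩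
    refine ⟨⟨hx, hx'⟩, fun t ht => ?_⟩
    have hall : ∀ t ∈ Icc (0 : ℝ) 1, b x + t • (b x' - b x) ∈ b '' closure D := by
      intro t ht
      have hc' : IsClosed {z : E n × E n | b z.1 + t • (b z.2 - b z.1) ∈ b '' closure D} :=
        hcomp.isClosed.preimage (by fun_prop)
      have hsub : w ⊆ {z : E n × E n | b z.1 + t • (b z.2 - b z.1) ∈ b '' closure D} :=
        fun z hz => image_mono subset_closure (hz.2 t ht)
      exact closure_minimal hsub hc' hcl
    obtain ⟨z, hz, hze⟩ := hall t ht
    by_cases hzD : z ∈ D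
    · exact ⟨z, hzD, hze⟩
    exfalso
    have hzf : z ∈ frontier D := by rw [hD.frontier_eq]; exact ⟨hz, hzD⟩
    have hzc : z ∈ closure Ω := hDΩ hz
    set v := b x' - b x with hv
    have hv0 : v ≠ 0 := by
      intro h0
      rw [h0, smul_zero, add_zero] at hze
      exact hzD (hbi hze ▸ hx)
    have ht0 : t ≠ 0 := by
      rintro rfl
      rw [zero_smul, add_zero] at hze
      exact hzD (hbi hze ▸ hx)
    have ht1 : t ≠ 1 := by
      rintro rfl
      rw [one_smul, hv, add_sub_cancel] at hze
      exact hzD (hbi hze ▸ hx')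
    have htI : t ∈ Ioo (0 : ℝ) 1 := ⟨lt_of_le_of_ne ht.1 (Ne.symm ht0), lt_of_le_of_ne ht.2 ht1⟩
    have hf : ContDiff ℝ 2 fun q => ψ (X (y, q)) := S.contDiff_comp_X hψ y
    set j : ℝ → ℝ := fun s => ψ (X (y, b x + s • v)) with hj
    have hj1 : ∀ s, HasDerivAt j _ s := fun s =>
      hasDerivAt_line (fun q => ψ (X (y, q))) (hf.differentiable (by norm_num)) (b x) v s
    have hj2 := fun s => hasDerivAt_fderiv_line hf (b x) v s
    have hXz : X (y, b x + t • v) = z := by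
      rw [← hze]; exact S.X_cY hzc hy
    -- a limit segment touches the boundary from inside, at an inner point of the segment
    have hmax : IsLocalMax j t := by
      have h1 : ∀ᶠ s in 𝓝 t, s ∈ Icc (0 : ℝ) 1 := Icc_mem_nhds htI.1 htI.2
      have h2 : Tendsto (fun s => X (y, b x + s • v)) (𝓝 t) (𝓝 z) := by
        rw [← hXz]
        have : Continuous fun s : ℝ => X (y, b x + s • v) := hXc.comp (by fun_prop)
        exact this.tendsto t
      have h0 : ψ z = 0 := by
        refine le_antisymm ((eventually_nonpos_of_local hψ.continuous (hloc z hzf)).self_of_nhds hz)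
          ?_
        by_contra hlt
        exact hzD ((hloc z hzf).self_of_nhds.2 (not_le.1 hlt))
      filter_upwards [h1, h2.eventually (eventually_nonpos_of_local hψ.continuous (hloc z hzf))]
        with s hs1 hs2
      obtain ⟨z', hz', hze'⟩ := hall s hs1
      have h3 : X (y, b x + s • v) = z' := by rw [← hze']; exact S.X_cY (hDΩ hz') hy
      simp only [hj, hXz, h0]
      exact hs2 (h3 ▸ hz')
    have hd0 := hmax.hasDerivAt_eq_zero (hj1 t)
    have hze' : cY c z y = b x + t • v := hze
    have hsnd : 0 < sndDeriv (fun q => ψ (X (y, q))) (b x + t • v) v := by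
      rw [← hze', S.fderiv_comp_X (f := ψ) hψ hzc hy] at hd0
      rw [← hze', S.sndDeriv_comp_X hψ hzc hy]
      exact hcurv z hzf v hv0 hd0
    have hdj : deriv j = fun s => fderiv ℝ (fun q => ψ (X (y, q))) (b x + s • v) v :=
      funext fun s => (hj1 s).deriv
    have hmin : IsLocalMin j t := by
      refine isLocalMin_of_deriv_deriv_pos ?_ ?_ (hj1 t).continuousAt
      · rw [hdj, (hj2 t).deriv]
        exact hsnd
      · rw [hdj]; exact hd0
    have hconst : j =ᶠ[𝓝 t] fun _ => j t := by
      filter_upwards [hmax, hmin] with s h1 h2 using le_antisymm h1 h2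
    have h4 := hconst.deriv.deriv_eq
    rw [hdj, (hj2 t).deriv] at h4
    simp at h4
    exact hsnd.ne' h4
  obtain ⟨x₀, hx₀⟩ := hconn.nonempty
  have hDD : D ×ˢ D ⊆ w := by
    refine (hconn.isPreconnected.prod hconn.isPreconnected).subset_of_closure_inter_subset hwo
      ⟨(x₀, x₀), ⟨hx₀, hx₀⟩, ⟨hx₀, hx₀⟩, fun t _ => ?_⟩ hwcl
    simp only [sub_self, smul_zero, add_zero]
    exact mem_image_of_mem _ hx₀
  rintro _ ⟨x, hx, rfl⟩ _ ⟨x', hx', rfl⟩ a a' ha ha' haa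
  have h1 := (hDD (show (x, x') ∈ D ×ˢ D from ⟨hx, hx'⟩)).2 a' ⟨ha', by linarith⟩
  have h2 : a • b x + a' • b x' = b x + a' • (b x' - b x) := by
    have : a = 1 - a' := by linarith
    rw [this]; module
  rw [← h2] at h1
  exact h1

/-- A subdomain with a local defining function of positive second fundamental form is uniformly
`c`-convex. -/
theorem isUnifCConvexDomainWith_of_curv {D : Set (E n)} (hD : IsOpen D) (hconn : IsConnected D)
    (hDΩ : closure D ⊆ closure Ω) {ψ : E n → ℝ} (hψ : ContDiff ℝ 2 ψ)
    (hloc : ∀ x ∈ frontier D, ∀ᶠ z in 𝓝 x, (z ∈ D ↔ ψ z < 0))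
    (hne : ∀ x ∈ frontier D, fderiv ℝ ψ x ≠ 0) {δ : ℝ} (hδ : 0 < δ)
    (hcurv : ∀ x ∈ frontier D, ∀ y ∈ closure Ωs, ∀ v,
      fderiv ℝ ψ x (vel X y (cY c x y) v) = 0 →
        δ * ‖gradient ψ x‖ * ‖vel X y (cY c x y) v‖ ^ 2 ≤
          sndDeriv ψ x (vel X y (cY c x y) v) + fderiv ℝ ψ x (acc X y (cY c x y) v)) :
    IsUnifCConvexDomainWith δ c D Ωs := by
  have hgne : ∀ x ∈ frontier D, gradient ψ x ≠ 0 := by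
    intro x hx h
    refine hne x hx (ContinuousLinearMap.ext fun v => ?_)
    rw [← inner_gradient, h]; simp
  have hg : ContDiff ℝ 1 (gradient ψ) := contDiff_gradient (k := 1) hψ
  have hcf : IsCompact (frontier D) := S.isCompact_fst.of_isClosed_subset isClosed_frontier
    (frontier_subset_closure.trans hDΩ)
  refine ⟨fun y hy => ?_, fun x hx => ⟨ψ, hψ, hne x hx, hloc x hx⟩, ?_⟩
  · have hy' := subset_closure hy
    refine S.convex_image_of_curv hD hconn hDΩ hψ hloc hy' fun x hx v hv h0 => ?_
    refine lt_of_lt_of_le ?_ (hcurv x hx y hy' v h0)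
    have h1 : 0 < ‖gradient ψ x‖ := norm_pos_iff.2 (hgne x hx)
    have h2 : 0 < ‖vel X y (cY c x y) v‖ := norm_pos_iff.2 fun h =>
      hv (S.swap.vel_eq_zero hy' (hDΩ (frontier_subset_closure hx)) h)
    positivity
  -- the normal field, extended from a neighbourhood of the boundary
  · obtain ⟨γ, hγ, O', hO'o, hKO', hO'O, hγe⟩ := exists_contDiff_eqOn_nhds (k := 1) (W := E n)
      (f := fun x => ‖gradient ψ x‖⁻¹ • gradient ψ x) hcf
      (hg.continuous.isOpen_preimage {0}ᶜ isOpen_compl_singleton) (fun x hx => hgne x hx)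
      (fun x hx => (((hg.contDiffAt (x := x)).norm ℝ hx).inv (norm_ne_zero_iff.2 hx)).smul
        hg.contDiffAt)
    refine ⟨γ, hγ, fun x hx => ?_, fun x hx y hy τ hτ hτγ => ?_⟩
    · have hγx : γ x = ‖gradient ψ x‖⁻¹ • gradient ψ x := hγe (hKO' hx)
      have hn : 0 < ‖gradient ψ x‖ := norm_pos_iff.2 (hgne x hx)
      have hψ0 : ψ x = 0 := by
        rw [hD.frontier_eq] at hx
        have hx' : x ∈ frontier D := by rw [hD.frontier_eq]; exact hx
        refine le_antisymm ((eventually_nonpos_of_local hψ.continuous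
          (hloc x hx')).self_of_nhds hx.1) ?_
        by_contra hlt
        exact hx.2 ((hloc x hx').self_of_nhds.2 (not_le.1 hlt))
      have hcont : ∀ v : E n, Tendsto (fun t : ℝ => x + t • v) (𝓝[>] 0) (𝓝 x) := by
        intro v
        have : Continuous fun t : ℝ => x + t • v := by fun_prop
        simpa using (this.tendsto 0).mono_left nhdsWithin_le_nhds
      have hder : ∀ v : E n, HasDerivAt (fun t : ℝ => ψ (x + t • v)) (fderiv ℝ ψ x v) 0 := by
        intro v
        simpa using hasDerivAt_line ψ (hψ.differentiable (by norm_num)) x v 0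
      have hin : ∀ v, inner ℝ v (γ x) = ‖gradient ψ x‖⁻¹ * fderiv ℝ ψ x v := by
        intro v
        rw [hγx, inner_smul_right, real_inner_comm, inner_gradient]
      refine ⟨by rw [hγx, norm_smul]; simp [hn.ne'], fun v => ⟨fun hv => ?_, fun hv => ?_⟩⟩
      · rw [hin] at hv
        have hv' : fderiv ℝ ψ x v < 0 := by
          by_contra h
          have := mul_nonneg (inv_pos.2 hn).le (not_lt.1 h)
          linarith
        filter_upwards [eventually_lt_of_deriv_neg (hder v) hv', (hcont v).eventually (hloc x hx)]
          with t h1 h2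
        rw [zero_smul, add_zero, hψ0] at h1
        exact h2.2 h1
      · rw [hin] at hv
        have hv' : -fderiv ℝ ψ x v < 0 := by
          by_contra h
          have := mul_nonneg (inv_pos.2 hn).le (neg_nonneg.1 (not_lt.1 h) |> neg_nonneg.2)
          linarith
        filter_upwards [eventually_lt_of_deriv_neg (hder v).fun_neg hv', (hcont v).eventually
          (eventually_nonpos_of_local hψ.continuous (hloc x hx))] with t h1 h2 h3
        rw [zero_smul, add_zero, hψ0] at h1
        linarith [h2 h3]
    · have hxc := hDΩ (frontier_subset_closure hx)
      have hyc := subset_closure hy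
      have hn : 0 < ‖gradient ψ x‖ := norm_pos_iff.2 (hgne x hx)
      have hγev : γ =ᶠ[𝓝 x] fun x => ‖gradient ψ x‖⁻¹ • gradient ψ x := by
        filter_upwards [hO'o.mem_nhds (hKO' hx)] with z hz using hγe hz
      have hγx : γ x = ‖gradient ψ x‖⁻¹ • gradient ψ x := hγev.self_of_nhds
      have htan : fderiv ℝ ψ x τ = 0 := by
        rw [hγx, inner_smul_right, real_inner_comm, inner_gradient] at hτγ
        exact (mul_eq_zero.1 hτγ).resolve_left (inv_pos.2 hn).ne'
      have hvel : vel X y (cY c x y) (cXY (swapCost c) y x τ) = τ := S.swap.vel_cXY hyc hxc τ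
      have hγ' : inner ℝ (fderiv ℝ γ x τ) τ = ‖gradient ψ x‖⁻¹ * sndDeriv ψ x τ := by
        rw [hγev.fderiv_eq]
        have h1 : DifferentiableAt ℝ (fun x => ‖gradient ψ x‖⁻¹) x :=
          (((hg.contDiffAt (x := x)).norm ℝ (hgne x hx)).inv hn.ne').differentiableAt (by norm_num)
        have h2 := h1.hasFDerivAt.smul (hg.differentiable (by norm_num) x).hasFDerivAt
        have h3 : fderiv ℝ (fun x => ‖gradient ψ x‖⁻¹ • gradient ψ x) x = _ := h2.fderiv
        rw [h3]
        simp only [add_apply, smul_apply, ContinuousLinearMap.smulRight_apply, inner_add_left,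
          inner_smul_left, inner_gradient, htan, mul_zero, add_zero, RCLike.conj_to_real]
        rw [← inner_hess_self hψ]
        rfl
      have h1 := S.curvature_eq hxc hyc hγx (v := cXY (swapCost c) y x τ) (by rw [hvel, hγ'])
      have h2 := hcurv x hx y hyc (cXY (swapCost c) y x τ) (by rw [hvel, htan])
      rw [hvel] at h1 h2
      rw [h1]
      rw [hτ] at h2
      calc δ = ‖gradient ψ x‖⁻¹ * (δ * ‖gradient ψ x‖ * 1 ^ 2) := by field_simp
        _ ≤ _ := mul_le_mul_of_nonneg_left h2 (inv_pos.2 hn).le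

end Setup

/-! ### Strict subsolutions and their images -/

/-- `u` has gradients in `c_x(x, Ω*)` and is elliptic, on the closure of `Ω`. -/
structure IsStrictSubsolution {n : ℕ} (c : E n → E n → ℝ) (Ω Ωs : Set (E n)) (u : E n → ℝ) :
    Prop where
  smooth : ContDiff ℝ 4 u
  touch : ∀ x ∈ closure Ω, ∃ y ∈ Ωs, gradient u x = cX c x y ∧
    ∀ ξ, ξ ≠ 0 → sndDeriv (fun z => c z y) x ξ < sndDeriv u x ξ

theorem IsStrictSubsolution.isSubsolution {n : ℕ} {c : E n → E n → ℝ} {Ω Ωs : Set (E n)}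
    {u : E n → ℝ} (hu : IsStrictSubsolution c Ω Ωs u) : IsSubsolution c Ω Ωs u := by
  refine ⟨hu.smooth, fun x hx => ?_⟩
  obtain ⟨y, hy, h1, h2⟩ := hu.touch x hx
  refine ⟨y, hy, h1, fun ξ => ?_⟩
  rcases eq_or_ne ξ 0 with rfl | hξ
  · rw [sndDeriv_zero, sndDeriv_zero]
  · exact (h2 ξ hξ).le

namespace Setup

variable {n : ℕ} {c : E n → E n → ℝ} {Ω Ωs : Set (E n)} {φ φs : E n → ℝ}
  {X Y : E n × E n → E n} (S : Setup c Ω Ωs φ φs X Y) {u : E n → ℝ}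

include S

variable (hu : IsStrictSubsolution c Ω Ωs u)

include hu

theorem Y_gradient {x : E n} (hx : x ∈ closure Ω) : Y (x, gradient u x) ∈ Ωs ∧
    gradient u x = cX c x (Y (x, gradient u x)) ∧
    ∀ ξ, ξ ≠ 0 → sndDeriv (fun z => c z (Y (x, gradient u x))) x ξ < sndDeriv u x ξ := by
  obtain ⟨y, hy, h1, h2⟩ := hu.touch x hx
  have h3 : Y (x, gradient u x) = y := by rw [h1, S.Y_cX hx (subset_closure hy)]
  rw [h3]
  exact ⟨hy, h1, h2⟩

theorem Tmap_eq {x : E n} (hx : x ∈ closure Ω) : Tmap c u x = Y (x, gradient u x) := by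
  obtain ⟨y, hy, h1, -⟩ := hu.touch x hx
  rw [Tmap, h1, S.Y_cX hx (subset_closure hy)]
  exact Function.leftInverse_invFun (S.fst.inj x hx) y

theorem isCConvexOn_of_strict : IsCConvexOn c Ω u := by
  refine ⟨hu.smooth.continuous.continuousOn, fun x hx => ?_⟩
  have hx' := subset_closure hx
  obtain ⟨h1, h2, -⟩ := S.Y_gradient hu hx'
  have hm := S.isMinimizer_of_gradient_eq hu.isSubsolution hx' (subset_closure h1) h2
  refine ⟨Y (x, gradient u x), fun z hz => ?_⟩
  have := hm.2 z (subset_closure hz)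
  linarith

theorem isEllipticOn_of_strict : IsEllipticOn c (closure Ω) u := by
  intro x hx ξ hξ
  obtain ⟨h1, h2, h3⟩ := S.Y_gradient hu hx
  have h4 : Amat c x (gradient u x) = cXX c x (Y (x, gradient u x)) := by
    unfold Amat
    congr 1
    exact S.Tmap_eq hu hx
  rw [h4, sub_apply, inner_sub_left, inner_hess_self (hu.smooth.of_le two_le_four), cXX,
    inner_hess_self ((contDiff_slice S.hc _).of_le two_le_four)]
  linarith [h3 ξ hξ]

theorem contDiff_T : ContDiff ℝ 3 (fun x => Y (x, gradient u x)) :=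
  S.fst.smoothY.comp (contDiff_id.prodMk (contDiff_gradient (k := 3) hu.smooth))

/-- `Tu` is injective for a strict subsolution. -/
theorem injOn_T : InjOn (fun x => Y (x, gradient u x)) (closure Ω) := by
  intro x hx x' hx' he
  obtain ⟨h1, h2, h3⟩ := S.Y_gradient hu hx
  obtain ⟨h1', h2', -⟩ := S.Y_gradient hu hx'
  simp only at he
  rw [← he] at h1' h2'
  set y := Y (x, gradient u x) with hy
  have hyc : y ∈ closure Ωs := subset_closure h1
  by_contra hne
  have hm := S.isMinimizer_of_gradient_eq hu.isSubsolution hx hyc h2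
  have hm' := S.isMinimizer_of_gradient_eq hu.isSubsolution hx' hyc h2'
  set v := cY c x' y - cY c x y with hv
  have hv0 : v ≠ 0 := fun h => hne (S.snd.inj y hyc (sub_eq_zero.1 h)).symm
  have hf : ContDiff ℝ 2 (fun x => u x - c x y) := contDiff_sub_cost S.hc hu.smooth y
  have hg : ContDiff ℝ 2 (fun q => u (X (y, q)) - c (X (y, q)) y) := S.contDiff_comp_X hf y
  have hd0 : ∀ w, fderiv ℝ (fun q => u (X (y, q)) - c (X (y, q)) y) (cY c x y) w = 0 := by
    intro w
    have h := S.fderiv_comp_X hf hx hyc w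
    rw [fderiv_sub_cost S.hc hu.smooth, h2, sub_self, inner_zero_left] at h
    exact h
  have hmono := S.monotoneOn_cSegment hu.isSubsolution hx hx' hyc (hd0 _).ge
  set j : ℝ → ℝ := fun t => u (X (y, cY c x y + t • v)) - c (X (y, cY c x y + t • v)) y with hj
  have hj0 : j 0 = u x - c x y := by simp [hj, S.X_cY hx hyc]
  have hj1 : j 1 = u x' - c x' y := by simp [hj, hv, S.X_cY hx' hyc]
  have heq : j 0 = j 1 := by
    rw [hj0, hj1]
    exact le_antisymm (hm.2 x' hx') (hm'.2 x hx)
  -- `u - c(·, y)` is constant along the `c`-segment, while its second derivative at `x` is positive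
  have hconst : ∀ t ∈ Icc (0 : ℝ) 1, j t = j 0 := fun t ht =>
    le_antisymm (heq ▸ hmono ht (right_mem_Icc.2 zero_le_one) ht.2)
      (hmono (left_mem_Icc.2 zero_le_one) ht ht.1)
  have hjd : ∀ t, HasDerivAt j _ t := fun t => hasDerivAt_line
    (fun q => u (X (y, q)) - c (X (y, q)) y) (hg.differentiable (by norm_num)) (cY c x y) v t
  have hz : ∀ t ∈ Ioo (0 : ℝ) 1, fderiv ℝ (fun q => u (X (y, q)) - c (X (y, q)) y)
      (cY c x y + t • v) v = 0 := by
    intro t ht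
    refine (hjd t).unique ((hasDerivAt_const t (j 0)).congr_of_eventuallyEq ?_)
    filter_upwards [Icc_mem_nhds ht.1 ht.2] with s hs using hconst s hs
  have hjdd := hasDerivAt_fderiv_line hg (cY c x y) v 0
  rw [zero_smul, add_zero] at hjdd
  have hsnd : 0 < sndDeriv (fun q => u (X (y, q)) - c (X (y, q)) y) (cY c x y) v := by
    have h := S.sndDeriv_comp_X hf hx hyc v
    rw [fderiv_sub_cost S.hc hu.smooth, h2, sub_self, inner_zero_left, add_zero,
      sndDeriv_sub_cost S.hc hu.smooth] at h
    have hvel : vel X y (cY c x y) v ≠ 0 := fun h0 => hv0 (S.swap.vel_eq_zero hyc hx h0)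
    have := h3 _ hvel
    change sndDeriv (fun q => u (X (y, q)) - c (X (y, q)) y) (cY c x y) v = _ at h
    rw [h]
    linarith
  have hev := eventually_lt_of_deriv_neg hjdd.fun_neg (neg_lt_zero.2 hsnd)
  obtain ⟨t, ht, ht1⟩ := (hev.and (Ioo_mem_nhdsGT (zero_lt_one (α := ℝ)))).exists
  rw [hz t ht1, zero_smul, add_zero, hd0] at ht
  exact lt_irrefl _ ht

/-- Differentiation of `c_x(x, Tu(x)) = Du(x)`. -/
theorem inner_cXY_fderiv_T {x : E n} (hx : x ∈ closure Ω) (ξ η : E n) :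
    inner ℝ (cXY c x (Y (x, gradient u x)) (fderiv ℝ (fun x => Y (x, gradient u x)) x ξ)) η =
      inner ℝ (hess u x ξ) η - inner ℝ (fderiv ℝ (fun z : E n × E n => cX c z.1 z.2)
        (x, Y (x, gradient u x)) (ξ, 0)) η := by
  obtain ⟨h1, h2, -⟩ := S.Y_gradient hu hx
  have hF := ((S.contDiff_T hu).differentiable (by norm_num) x).hasFDerivAt
  have hgu : ContDiff ℝ 3 (gradient u) := contDiff_gradient (k := 3) hu.smooth
  set F : E n → E n := fun x => Y (x, gradient u x) with hFdef
  have hev : (fun z => cX c z (F z)) =ᶠ[𝓝 x] gradient u := by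
    have hcont : Tendsto (fun z => (z, gradient u z)) (𝓝 x) (𝓝 (x, cX c x (F x))) := by
      rw [← h2]
      exact (continuous_id.prodMk hgu.continuous).tendsto x
    exact hcont.eventually (S.fst.rightInv x hx _ (subset_closure h1))
  have had : HasFDerivAt (fun z : E n × E n => cX c z.1 z.2) _ (x, F x) :=
    ((contDiff_cX S.hc).differentiable (by norm_num) (x, F x)).hasFDerivAt
  have hcomp : HasFDerivAt (fun z => cX c z (F z)) _ x :=
    HasFDerivAt.comp (g := fun z : E n × E n => cX c z.1 z.2) (f := fun z => (z, F z)) x had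
      ((hasFDerivAt_id x).prodMk hF)
  have heq := hcomp.unique ((hgu.differentiable (by norm_num) x).hasFDerivAt.congr_of_eventuallyEq
    hev)
  have h3 := congrArg (fun L : E n →L[ℝ] E n => L ξ) heq
  simp only [ContinuousLinearMap.comp_apply, ContinuousLinearMap.prod_apply,
    ContinuousLinearMap.id_apply, fderiv_gradient] at h3
  have h4 : (ξ, fderiv ℝ F x ξ) = (ξ, (0 : E n)) + (0, fderiv ℝ F x ξ) := by simp
  rw [h4, map_add, ← cXY_eq S.hc] at h3
  rw [← h3, inner_add_left]
  ring

theorem inner_cXY_fderiv_T_pos {x : E n} (hx : x ∈ closure Ω) {ξ : E n} (hξ : ξ ≠ 0) :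
    0 < inner ℝ (cXY c x (Y (x, gradient u x))
      (fderiv ℝ (fun x => Y (x, gradient u x)) x ξ)) ξ := by
  rw [S.inner_cXY_fderiv_T hu hx, inner_hess_self (hu.smooth.of_le two_le_four),
    inner_fderiv_cX S.hc]
  linarith [(S.Y_gradient hu hx).2.2 ξ hξ]

/-- The image of `Ω` under `Tu` is a domain; near its boundary it is the sublevel set of the
transported defining function. -/
theorem image_T_properties : ∃ Φ : E n → ℝ,
    IsOpen ((fun x => Y (x, gradient u x)) '' Ω) ∧
    IsConnected ((fun x => Y (x, gradient u x)) '' Ω) ∧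
    closure ((fun x => Y (x, gradient u x)) '' Ω) ⊆ Ωs ∧
    frontier ((fun x => Y (x, gradient u x)) '' Ω) =
      (fun x => Y (x, gradient u x)) '' frontier Ω ∧ ContDiff ℝ 1 Φ ∧
    ∀ x ∈ frontier Ω,
      (∀ᶠ z in 𝓝 (Y (x, gradient u x)),
        (z ∈ (fun x => Y (x, gradient u x)) '' Ω ↔ Φ z < 0)) ∧
      0 < fderiv ℝ Φ (Y (x, gradient u x)) (vel Y x (gradient u x) (gradient φ x)) ∧
      ∀ P : E n → Prop, (∀ᶠ a in 𝓝 x, P a) → ∀ᶠ z in 𝓝 (Y (x, gradient u x)),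
        Φ z = 0 → ∃ a, P a ∧ φ a = 0 ∧ z = Y (a, gradient u a) := by
  set F : E n → E n := fun x => Y (x, gradient u x) with hF
  have hFc : ContDiff ℝ 3 F := S.contDiff_T hu
  have hker : ∀ x ∈ closure Ω, ∀ v, fderiv ℝ F x v = 0 → v = 0 := by
    intro x hx v hv
    by_contra hne
    have := S.inner_cXY_fderiv_T_pos hu hx hne
    rw [show fderiv ℝ (fun x => Y (x, gradient u x)) x v = 0 from hv, map_zero,
      inner_zero_left] at this
    exact lt_irrefl _ this
  -- the inverse of the map transports the defining function
  obtain ⟨G, hG, O, hO, hKO, hGl, hFO⟩ := exists_contDiff_leftInverse (k := 3) (by norm_num) hFc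
    S.isCompact_fst (S.injOn_T hu) hker rfl
  have hGc := hG.continuous
  -- `F` is open on `O`
  have hopen : ∀ x ∈ O, ∀ P : E n → Prop, (∀ᶠ a in 𝓝 x, P a) →
      ∀ᶠ z in 𝓝 (F x), ∃ a ∈ O, P a ∧ F a = z ∧ G z = a := by
    intro x hx P hP
    have h1 : Tendsto G (𝓝 (F x)) (𝓝 x) := by
      have := hGc.tendsto (F x)
      rwa [hGl x hx] at this
    filter_upwards [hFO.mem_nhds (mem_image_of_mem F hx), h1.eventually hP] with z hz hPz
    obtain ⟨a, ha, rfl⟩ := hz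
    rw [hGl a ha] at hPz
    exact ⟨a, ha, hPz, rfl, hGl a ha⟩
  have hΩO : Ω ⊆ O := subset_closure.trans hKO
  have hDo : IsOpen (F '' Ω) := by
    rw [isOpen_iff_mem_nhds]
    rintro _ ⟨x, hx, rfl⟩
    filter_upwards [hopen x (hΩO hx) (· ∈ Ω) (S.fst.isOpen.eventually_mem hx)] with z hz
    obtain ⟨a, -, ha, h1, -⟩ := hz
    exact ⟨a, ha, h1⟩
  have hcl : closure (F '' Ω) = F '' closure Ω := by
    refine subset_antisymm (closure_minimal (image_mono subset_closure)
      (S.isCompact_fst.image hFc.continuous).isClosed) ?_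
    exact image_closure_subset_closure_image hFc.continuous
  have hfr : frontier (F '' Ω) = F '' frontier Ω := by
    rw [hDo.frontier_eq, hcl, S.fst.isOpen.frontier_eq]
    ext z
    constructor
    · rintro ⟨⟨x, hx, rfl⟩, h⟩
      exact ⟨x, ⟨hx, fun hxo => h (mem_image_of_mem F hxo)⟩, rfl⟩
    · rintro ⟨x, ⟨hx, hxo⟩, rfl⟩
      refine ⟨mem_image_of_mem F hx, ?_⟩
      rintro ⟨x', hx', he⟩
      exact hxo (S.injOn_T hu (subset_closure hx') hx he ▸ hx')
  have hφ3 : ContDiff ℝ 3 φ := S.fst.defining.smooth.of_le (by norm_num)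
  refine ⟨fun z => φ (G z), hDo, S.fst.isConnected.image F hFc.continuous.continuousOn, ?_, hfr,
    (hφ3.comp hG).of_le (by norm_num), fun x hx => ?_⟩
  · rw [hcl]
    rintro _ ⟨x, hx, rfl⟩
    exact (S.Y_gradient hu hx).1
  have hxc := frontier_subset_closure hx
  have hxO := hKO hxc
  refine ⟨?_, ?_, ?_⟩
  · filter_upwards [hopen x hxO _ (S.fst.defining.eventually x hx)] with z hz
    obtain ⟨a, haO, ha, h1, h2⟩ := hz
    rw [h2, ← ha]
    refine ⟨?_, fun h => ⟨a, h, h1⟩⟩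
    rintro ⟨a', ha', h3⟩
    have h4 : G (F a') = a' := hGl a' (hΩO ha')
    change F a' = z at h3
    rw [h3, h2] at h4
    rwa [h4]
  · change 0 < fderiv ℝ (fun z => φ (G z)) (F x) _
    obtain ⟨h1, h2, -⟩ := S.Y_gradient hu hxc
    set e := vel Y x (gradient u x) (gradient φ x) with he
    have hsurj : Function.Surjective (fderiv ℝ F x) := by
      have hinj : Function.Injective (fderiv ℝ F x) := by
        intro a b hab
        exact sub_eq_zero.1 (hker x hxc _ (by rw [map_sub, hab, sub_self]))
      exact LinearMap.injective_iff_surjective.1 hinj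
    obtain ⟨ζ, hζ⟩ := hsurj e
    have hGF : fderiv ℝ G (F x) (fderiv ℝ F x ζ) = ζ := by
      have h3 : HasFDerivAt (fun z => G (F z)) _ x :=
        (hG.differentiable (by norm_num) (F x)).hasFDerivAt.comp x
          (hFc.differentiable (by norm_num) x).hasFDerivAt
      have h4 : (fun z => G (F z)) =ᶠ[𝓝 x] fun z => z := by
        filter_upwards [hO.mem_nhds hxO] with z hz using hGl z hz
      have h5 := h3.unique ((hasFDerivAt_id x).congr_of_eventuallyEq h4)
      exact congrArg (fun L : E n →L[ℝ] E n => L ζ) h5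
    have h3 : HasFDerivAt (fun z => φ (G z)) ((fderiv ℝ φ (G (F x))).comp (fderiv ℝ G (F x)))
        (F x) := (S.fst.defining.differentiable _).hasFDerivAt.comp (F x)
          (hG.differentiable (by norm_num) (F x)).hasFDerivAt
    rw [h3.fderiv, ContinuousLinearMap.comp_apply, ← hζ, hGF, hGl x hxO, ← inner_gradient]
    have h4 : cXY c x (F x) (fderiv ℝ F x ζ) = gradient φ x := by
      have h5 := S.cXY_vel hxc (subset_closure h1) (gradient φ x)
      rw [← h2] at h5
      rw [hζ]
      exact h5
    have hζ0 : ζ ≠ 0 := by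
      rintro rfl
      rw [map_zero, map_zero] at h4
      exact S.gradient_ne_zero hx h4.symm
    -- the derivative in the direction `e` is the quadratic form of ellipticity at `ζ`
    rw [← h4]
    exact S.inner_cXY_fderiv_T_pos hu hxc hζ0
  · intro P hP
    filter_upwards [hopen x hxO P hP] with z hz h0
    obtain ⟨a, -, ha, h1, h2⟩ := hz
    refine ⟨a, ha, ?_, h1.symm⟩
    rw [← h2]; exact h0

end Setup

section SameSublevel

variable {V : Type*} [NormedAddCommGroup V] [NormedSpace ℝ V]

/-- Two functions increasing in a common direction have the same local sublevel set at a point as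
soon as the second vanishes where the first does. -/
theorem eventually_neg_iff_of_zero {Φ ψ : V → ℝ} (hΦ : ContDiff ℝ 1 Φ) (hψ : ContDiff ℝ 1 ψ)
    {y e : V} (h0 : Φ y = 0) (hΦe : 0 < fderiv ℝ Φ y e) (hψe : 0 < fderiv ℝ ψ y e)
    (hz : ∀ᶠ z in 𝓝 y, Φ z = 0 → ψ z = 0) : ∀ᶠ z in 𝓝 y, (Φ z < 0 ↔ ψ z < 0) := by
  set a := fderiv ℝ Φ y e / 2 with ha
  have ha0 : 0 < a := by positivity
  have hdc : ∀ {f : V → ℝ}, ContDiff ℝ 1 f → Continuous fun z => fderiv ℝ f z e := fun hf =>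
    (hf.continuous_fderiv (by norm_num)).clm_apply continuous_const
  have hgood : ∀ᶠ z in 𝓝 y, (a < fderiv ℝ Φ z e ∧ 0 < fderiv ℝ ψ z e) ∧ (Φ z = 0 → ψ z = 0) :=
    (((hdc hΦ).tendsto y).eventually (lt_mem_nhds (by rw [ha]; linarith)) |>.and
      (((hdc hψ).tendsto y).eventually (lt_mem_nhds hψe))).and hz
  have hline : Tendsto (fun z : V × ℝ => z.1 + z.2 • e) (𝓝 (y, 0)) (𝓝 y) := by
    have : Continuous fun z : V × ℝ => z.1 + z.2 • e := by fun_prop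
    simpa using this.tendsto (y, (0 : ℝ))
  have h1 := hline.eventually hgood
  rw [nhds_prod_eq, (nhds_basis_opens y).prod (Metric.nhds_basis_ball) |>.eventually_iff] at h1
  obtain ⟨⟨A, r⟩, ⟨⟨hyA, hA⟩, hr⟩, hball⟩ := h1
  have hr' : (0 : ℝ) < r := hr
  have hsmall : ∀ᶠ z in 𝓝 y, |Φ z| < a * (r / 2) := by
    have : Tendsto (fun z => |Φ z|) (𝓝 y) (𝓝 0) := by
      simpa [h0] using hΦ.continuous.abs.tendsto y
    exact this.eventually (gt_mem_nhds (by positivity))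
  filter_upwards [hA.mem_nhds hyA, hsmall] with z hzA hzs
  have hP : ∀ t : ℝ, |t| < r → (a < fderiv ℝ Φ (z + t • e) e ∧ 0 < fderiv ℝ ψ (z + t • e) e) ∧
      (Φ (z + t • e) = 0 → ψ (z + t • e) = 0) := fun t ht =>
    hball (show (z, t) ∈ A ×ˢ Metric.ball 0 r from ⟨hzA, by simpa using ht⟩)
  have hΦd := fun t => hasDerivAt_line Φ (hΦ.differentiable (by norm_num)) z e t
  have hψd := fun t => hasDerivAt_line ψ (hψ.differentiable (by norm_num)) z e t
  have hIr : ∀ t ∈ Icc (-(r / 2)) (r / 2), |t| < r := fun t ht => by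
    rw [abs_lt]; constructor <;> linarith [ht.1, ht.2]
  have hmono : StrictMonoOn (fun t : ℝ => Φ (z + t • e) - a * t) (Icc (-(r / 2)) (r / 2)) := by
    have hd : ∀ t, HasDerivAt (fun t : ℝ => Φ (z + t • e) - a * t)
        (fderiv ℝ Φ (z + t • e) e - a * 1) t := fun t =>
      (hΦd t).sub ((hasDerivAt_id t).const_mul a)
    refine strictMonoOn_of_deriv_pos (convex_Icc _ _)
      (fun t _ => (hd t).continuousAt.continuousWithinAt) fun t ht => ?_
    rw [(hd t).deriv]
    have := (hP t (hIr t (interior_subset ht))).1.1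
    linarith
  have hψm : StrictMonoOn (fun t : ℝ => ψ (z + t • e)) (Icc (-(r / 2)) (r / 2)) := by
    refine strictMonoOn_of_deriv_pos (convex_Icc _ _)
      (fun t _ => (hψd t).continuousAt.continuousWithinAt) fun t ht => ?_
    rw [(hψd t).deriv]
    exact (hP t (hIr t (interior_subset ht))).1.2
  have hm0 : (0 : ℝ) ∈ Icc (-(r / 2)) (r / 2) := ⟨by linarith, by linarith⟩
  have hml : -(r / 2) ∈ Icc (-(r / 2)) (r / 2) := ⟨le_rfl, by linarith⟩
  have hmr : r / 2 ∈ Icc (-(r / 2)) (r / 2) := ⟨by linarith, le_rfl⟩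
  have hΦc : Continuous fun t : ℝ => Φ (z + t • e) := hΦ.continuous.comp (by fun_prop)
  have hr1 := hmono.monotoneOn hm0 hmr hm0.2
  have hl1 := hmono.monotoneOn hml hm0 hm0.1
  simp only [zero_smul, add_zero, mul_zero, sub_zero] at hr1 hl1
  rw [abs_lt] at hzs
  -- the zero of `Φ` on the line through `z`; it is also the only zero of `ψ` there
  obtain ⟨t, ht, hte⟩ := intermediate_value_Icc (by linarith : -(r / 2) ≤ r / 2) hΦc.continuousOn
    (show (0 : ℝ) ∈ Icc _ _ from ⟨by nlinarith, by nlinarith⟩)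
  simp only at hte
  have hψt := (hP t (hIr t ht)).2 hte
  have hΦmono : ∀ s ∈ Icc (-(r / 2)) (r / 2), ∀ s' ∈ Icc (-(r / 2)) (r / 2), s < s' →
      Φ (z + s • e) < Φ (z + s' • e) := by
    intro s hs s' hs' hlt
    have := hmono hs hs' hlt
    simp only at this
    nlinarith
  have hz0 : z + (0 : ℝ) • e = z := by simp
  rcases lt_trichotomy t 0 with h | h | h
  · have k1 := hΦmono t ht 0 hm0 h
    have k2 := hψm ht hm0 h
    simp only [hte, hψt, hz0] at k1 k2
    constructor <;> intro <;> linarith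
  · subst h
    rw [hz0] at hte hψt
    rw [hte, hψt]
  · have k1 := hΦmono 0 hm0 t ht h
    have k2 := hψm hm0 ht h
    simp only [hte, hψt, hz0] at k1 k2
    exact ⟨fun _ => k2, fun _ => k1⟩

end SameSublevel

/-! ### Mollification -/

section Mollify

open MeasureTheory

/-- A smooth kernel of integral one, supported in the unit ball. -/
theorem exists_mollifier (n : ℕ) : ∃ ρ : E n → ℝ, ContDiff ℝ ∞ ρ ∧ HasCompactSupport ρ ∧
    (∀ z, ρ z ≠ 0 → ‖z‖ < 1) ∧ ∫ z, ρ z = 1 := by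
  let b : ContDiffBump (0 : E n) := ⟨1 / 2, 1, by norm_num, by norm_num⟩
  refine ⟨b.normed volume, b.contDiff_normed, b.hasCompactSupport_normed, fun z hz => ?_,
    b.integral_normed⟩
  have h : z ∈ Function.support (b.normed volume) := hz
  rw [b.support_normed_eq] at h
  simpa using h

variable {n : ℕ} {P W : Type*} [NormedAddCommGroup P] [NormedSpace ℝ P]
  [NormedAddCommGroup W] [NormedSpace ℝ W] {ρ : E n → ℝ}

theorem contDiff_integral_smul (hρ : ContDiff ℝ ∞ ρ) (hc : HasCompactSupport ρ) {k : ℕ}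
    {g : P × E n → W} (hg : ContDiff ℝ k g) :
    ContDiff ℝ k (fun p => ∫ z, ρ z • g (p, z)) := by
  have hk : IsCompact ((fun z : E n => -z) '' tsupport ρ) := hc.isCompact.image continuous_neg
  have h1 := contDiffOn_convolution_right_with_param_comp (μ := (volume : Measure (E n)))
    (n := (k : ℕ∞)) (ContinuousLinearMap.lsmul ℝ ℝ : ℝ →L[ℝ] W →L[ℝ] W) (s := (univ : Set P))
    (v := fun _ => (0 : E n)) contDiffOn_const (f := fun _ => (1 : ℝ))
    (g := fun p z => ρ (-z) • g (p, -z)) isOpen_univ hk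
    (by
      intro p z _ hz
      have : ρ (-z) = 0 := by
        by_contra h0
        exact hz ⟨-z, subset_tsupport _ h0, neg_neg z⟩
      rw [this, zero_smul])
    (locallyIntegrable_const 1)
    (by
      refine ContDiff.contDiffOn ?_
      have h2 : ContDiff ℝ k (fun q : P × E n => ρ (-q.2)) :=
        (hρ.of_le (by exact_mod_cast le_top)).comp contDiff_snd.neg
      exact h2.smul (hg.comp (contDiff_fst.prodMk contDiff_snd.neg)))
  rw [contDiffOn_univ] at h1
  have h3 : (fun p => ∫ z, ρ z • g (p, z)) = fun p => convolution (fun _ => (1 : ℝ))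
      (fun z => ρ (-z) • g (p, -z)) (ContinuousLinearMap.lsmul ℝ ℝ : ℝ →L[ℝ] W →L[ℝ] W)
      volume 0 := by
    ext p
    rw [convolution_def]
    simp
  rw [h3]
  exact h1

theorem hasFDerivAt_integral_smul {V : Type*} [NormedAddCommGroup V] [NormedSpace ℝ V]
    [ProperSpace V] (hρ : Continuous ρ) (hc : HasCompactSupport ρ)
    {g : V × E n → W} (hg : ContDiff ℝ 1 g) (x : V) :
    HasFDerivAt (fun x => ∫ z, ρ z • g (x, z))
      (∫ z, ρ z • fderiv ℝ (fun x => g (x, z)) x) x := by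
  have hgd : Differentiable ℝ g := hg.differentiable (by norm_num)
  have hfd : ∀ z : E n × V, fderiv ℝ (fun x => g (x, z.1)) z.2 =
      (fderiv ℝ g (z.2, z.1)).comp (ContinuousLinearMap.inl ℝ V (E n)) := by
    intro z
    ext v
    rw [fderiv_slice_left hgd]; simp
  have hfc : Continuous fun z : E n × V => fderiv ℝ (fun x => g (x, z.1)) z.2 := by
    rw [funext hfd]
    exact (((hg.continuous_fderiv (by norm_num)).comp
      (continuous_snd.prodMk continuous_fst)).clm_comp continuous_const)
  obtain ⟨M, hM⟩ := (hc.isCompact.prod (isCompact_closedBall x 1)).exists_bound_of_continuousOn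
    (f := fun z : E n × V => fderiv ℝ (fun x => g (x, z.1)) z.2) hfc.continuousOn
  refine hasFDerivAt_integral_of_dominated_of_fderiv_le (𝕜 := ℝ) (s := Metric.ball x 1)
    (F := fun x z => ρ z • g (x, z)) (F' := fun x z => ρ z • fderiv ℝ (fun x => g (x, z)) x)
    (bound := fun z => ‖ρ z‖ * |M|) (Metric.ball_mem_nhds x one_pos) ?_ ?_ ?_ ?_ ?_ ?_
  · exact Eventually.of_forall fun y => (hρ.smul (hg.continuous.comp
      (contDiff_mk_right (k := 0) y).continuous)).aestronglyMeasurable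
  · exact (hρ.smul (hg.continuous.comp
      (contDiff_mk_right (k := 0) x).continuous)).integrable_of_hasCompactSupport hc.smul_right
  · exact (hρ.smul (hfc.comp (continuous_id.prodMk continuous_const))).aestronglyMeasurable
  · refine Eventually.of_forall fun z y hy => ?_
    by_cases hz : ρ z = 0
    · simp [hz]
    · rw [norm_smul]
      gcongr
      exact (hM (z, y) ⟨subset_tsupport _ hz, Metric.ball_subset_closedBall hy⟩).trans
        (le_abs_self M)
  · exact (hρ.norm.integrable_of_hasCompactSupport hc.norm).mul_const _
  · refine Eventually.of_forall fun z y _ => ?_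
    have h1 : Differentiable ℝ fun x => g (x, z) :=
      hgd.comp ((contDiff_mk_left z).differentiable one_ne_zero)
    exact (h1 y).hasFDerivAt.const_smul (ρ z)

/-- The mollification of `f` at scale `h`. -/
noncomputable def mollify (ρ : E n → ℝ) (f : E n → W) (x : E n) (h : ℝ) : W :=
  ∫ z, ρ z • f (x - h • z)

theorem contDiff_mollify (hρ : ContDiff ℝ ∞ ρ) (hc : HasCompactSupport ρ) {k : ℕ}
    {f : P → E n → W} (hf : ContDiff ℝ k (Function.uncurry f)) :
    ContDiff ℝ k (fun q : P × E n × ℝ => mollify ρ (f q.1) q.2.1 q.2.2) := by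
  refine contDiff_integral_smul hρ hc (P := P × E n × ℝ)
    (g := fun q => f q.1.1 (q.1.2.1 - q.1.2.2 • q.2)) ?_
  exact hf.comp (contDiff_fst.fst.prodMk (contDiff_fst.snd.fst.sub
    (contDiff_fst.snd.snd.smul contDiff_snd)))

theorem mollify_zero [CompleteSpace W] (h1 : ∫ z, ρ z = 1) (f : E n → W) (x : E n) :
    mollify ρ f x 0 = f x := by
  unfold mollify
  simp only [zero_smul, sub_zero]
  rw [integral_smul_const, h1, one_smul]

theorem mollify_congr (hs : ∀ z, ρ z ≠ 0 → ‖z‖ < 1) {f g : E n → W} {x : E n} {h : ℝ}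
    (hfg : ∀ z : E n, ‖z‖ < 1 → f (x - h • z) = g (x - h • z)) :
    mollify ρ f x h = mollify ρ g x h := by
  unfold mollify
  congr 1
  ext z
  by_cases hz : ρ z = 0
  · simp [hz]
  · rw [hfg z (hs z hz)]

theorem hasFDerivAt_mollify (hρ : Continuous ρ) (hc : HasCompactSupport ρ) {f : E n → W}
    (hf : ContDiff ℝ 1 f) (x : E n) (h : ℝ) :
    HasFDerivAt (fun x => mollify ρ f x h) (mollify ρ (fderiv ℝ f) x h) x := by
  have h1 := hasFDerivAt_integral_smul hρ hc (g := fun q : E n × E n => f (q.1 - h • q.2))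
    (hf.comp (contDiff_fst.sub (contDiff_snd.const_smul h))) x
  have h2 : ∀ z, fderiv ℝ (fun x => f (x - h • z)) x = fderiv ℝ f (x - h • z) := fun z => by
    rw [fderiv_comp_sub]
  simp only [h2] at h1
  exact h1

theorem gradient_mollify (hρ : Continuous ρ) (hc : HasCompactSupport ρ) {f : E n → ℝ}
    (hf : ContDiff ℝ 1 f) (x : E n) (h : ℝ) :
    gradient (fun x => mollify ρ f x h) x = mollify ρ (gradient f) x h := by
  rw [eq_gradient_iff]
  intro v
  rw [(hasFDerivAt_mollify hρ hc hf x h).fderiv]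
  have hcf : Continuous fun z => fderiv ℝ f (x - h • z) :=
    (hf.continuous_fderiv (by norm_num)).comp (by fun_prop)
  have hint : Integrable (fun z => ρ z • fderiv ℝ f (x - h • z)) volume :=
    (hρ.smul hcf).integrable_of_hasCompactSupport hc.smul_right
  have hcg : Continuous fun z => gradient f (x - h • z) := by
    unfold gradient
    exact (InnerProductSpace.toDual ℝ (E n)).symm.continuous.comp hcf
  have hint' : Integrable (fun z => ρ z • gradient f (x - h • z)) volume :=
    (hρ.smul hcg).integrable_of_hasCompactSupport hc.smul_right
  unfold mollify
  rw [ContinuousLinearMap.integral_apply hint, real_inner_comm, ← integral_inner hint']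
  congr 1
  ext z
  rw [inner_smul_right, real_inner_comm, inner_gradient]
  simp

/-- At positive scales the mollification is smooth. -/
theorem contDiff_mollify_of_ne_zero (hρ : ContDiff ℝ ∞ ρ) (hc : HasCompactSupport ρ)
    {f : E n → ℝ} (hf : Continuous f) {h : ℝ} (hh : h ≠ 0) :
    ContDiff ℝ ∞ (fun x => mollify ρ f x h) := by
  have hρh : HasCompactSupport fun t => ρ (h⁻¹ • t) :=
    hc.comp_isClosedEmbedding (Homeomorph.smulOfNeZero h⁻¹ (inv_ne_zero hh)).isClosedEmbedding
  have h1 : ContDiff ℝ ∞ (convolution (fun t => ρ (h⁻¹ • t)) f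
      (ContinuousLinearMap.lsmul ℝ ℝ : ℝ →L[ℝ] ℝ →L[ℝ] ℝ) volume) :=
    hρh.contDiff_convolution_left (n := ⊤) _ (hρ.comp (contDiff_const_smul h⁻¹))
      hf.locallyIntegrable
  have h2 : ∀ x, mollify ρ f x h = |h ^ Module.finrank ℝ (E n)|⁻¹ * convolution
      (fun t => ρ (h⁻¹ • t)) f (ContinuousLinearMap.lsmul ℝ ℝ : ℝ →L[ℝ] ℝ →L[ℝ] ℝ) volume x := by
    intro x
    have h3 := Measure.integral_comp_inv_smul (volume : Measure (E n))
      (fun z => ρ z • f (x - h • z)) h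
    simp only [smul_inv_smul₀ hh] at h3
    rw [convolution_def]
    simp only [ContinuousLinearMap.lsmul_apply]
    rw [h3, smul_eq_mul, ← mul_assoc, inv_mul_cancel₀ (by positivity), one_mul]
    rfl
  rw [funext h2]
  exact contDiff_const.mul h1

end Mollify

/-! ### The c-cone -/

section Quadratic

variable {V : Type*} [NormedAddCommGroup V] [NormedSpace ℝ V]

/-- A null direction of a nonnegative Hessian is in its kernel. -/
theorem fderiv_fderiv_eq_zero_of_nonneg {f : V → ℝ} (hf : ContDiff ℝ 2 f) {x ξ : V}
    (h : ∀ η, 0 ≤ sndDeriv f x η) (h0 : sndDeriv f x ξ = 0) (η : V) :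
    fderiv ℝ (fderiv ℝ f) x ξ η = 0 := by
  have hq : ∀ t : ℝ, 0 ≤ 2 * t * fderiv ℝ (fderiv ℝ f) x ξ η + t ^ 2 * sndDeriv f x η := by
    intro t
    have h1 := h (ξ + t • η)
    unfold sndDeriv at h1 h0 ⊢
    simp only [map_add, map_smul, add_apply, smul_apply, smul_eq_mul, h0] at h1
    rw [fderiv_fderiv_comm hf x η ξ] at h1
    linarith
  set b := fderiv ℝ (fderiv ℝ f) x ξ η
  set a := sndDeriv f x η
  have ha : 0 ≤ a := h η
  -- the minimum over `t` up to the summand `1`, which avoids division by zero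
  have h1 := hq (-b / (a + 1))
  have h2 : 2 * (-b / (a + 1)) * b + (-b / (a + 1)) ^ 2 * a =
      -(b ^ 2 * (a + 2) / (a + 1) ^ 2) := by field_simp; ring
  rw [h2] at h1
  have h3 : 0 ≤ b ^ 2 * (a + 2) / (a + 1) ^ 2 := by positivity
  have h4 : b ^ 2 * (a + 2) / (a + 1) ^ 2 = 0 := by linarith
  rcases div_eq_zero_iff.1 h4 with h5 | h5
  · rcases mul_eq_zero.1 h5 with h6 | h6
    · exact pow_eq_zero_iff (two_ne_zero) |>.1 h6
    · linarith
  · have : (a + 1) ^ 2 ≠ 0 := by positivity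
    exact absurd h5 this

end Quadratic

/-- The excess over `c(·, y₀) - c(x₀, y₀)` of the `c`-cone with vertex `x₀`, that is, of the
supremum over `y` in the closure of `Ω*` of `c(·, y) - c(x₀, y)`. -/
noncomputable def coneExcess {n : ℕ} (c : E n → E n → ℝ) (Ωs : Set (E n)) (x₀ y₀ x : E n) : ℝ :=
  -contactValue (swapCost c) (closure Ωs) (fun y => c x₀ y) x - c x y₀ + c x₀ y₀

namespace Setup

variable {n : ℕ} {c : E n → E n → ℝ} {Ω Ωs : Set (E n)} {φ φs : E n → ℝ}
  {X Y : E n × E n → E n} (S : Setup c Ω Ωs φ φs X Y) {x₀ y₀ : E n}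

include S

theorem isSubsolution_cost (hx₀ : x₀ ∈ Ω) :
    IsSubsolution (swapCost c) Ωs Ω (fun y => c x₀ y) :=
  ⟨contDiff_slice (contDiff_swapCost S.hc) x₀, fun _ _ => ⟨x₀, hx₀, rfl, fun _ => le_rfl⟩⟩

theorem continuous_cost_left (x : E n) : Continuous fun y => c x y :=
  S.continuous_cost.comp (contDiff_mk_right (k := 0) x).continuous

theorem continuous_cost_right (y : E n) : Continuous fun x => c x y :=
  S.continuous_cost.comp (contDiff_mk_left (k := 0) y).continuous

theorem continuous_coneExcess (x₀ y₀ : E n) : Continuous (coneExcess c Ωs x₀ y₀) := by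
  unfold coneExcess
  exact ((continuous_contactValue S.swap.continuous_cost S.isCompact_snd
    (S.continuous_cost_left x₀)).neg.sub (S.continuous_cost_right y₀)).add continuous_const

theorem le_coneExcess (x₀ y₀ x : E n) {y : E n} (hy : y ∈ closure Ωs) :
    c x y - c x₀ y - c x y₀ + c x₀ y₀ ≤ coneExcess c Ωs x₀ y₀ x := by
  have := contactValue_le S.swap.continuous_cost S.isCompact_snd S.nonempty_snd
    (S.continuous_cost_left x₀) x hy
  simp only [swapCost] at this
  unfold coneExcess
  linarith

theorem coneExcess_eq {x y : E n} (h : IsMinimizer (swapCost c) (closure Ωs) (fun y => c x₀ y) x y) :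
    coneExcess c Ωs x₀ y₀ x = c x y - c x₀ y - c x y₀ + c x₀ y₀ := by
  unfold coneExcess
  rw [contactValue_eq S.swap.continuous_cost S.isCompact_snd S.nonempty_snd
    (S.continuous_cost_left x₀) h]
  simp only [swapCost]
  ring

theorem coneExcess_self (x₀ y₀ : E n) : coneExcess c Ωs x₀ y₀ x₀ = 0 := by
  obtain ⟨y, hy⟩ := S.nonempty_snd
  rw [S.coneExcess_eq (y := y) ⟨hy, fun z _ => by simp [swapCost]⟩]
  ring

/-- The cone touches `c(·, y₀)` only at its vertex, as `y₀` is an interior point of `Ω*`. -/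
theorem coneExcess_pos (hy₀ : y₀ ∈ Ωs) {x : E n} (hne : x ≠ x₀) :
    0 < coneExcess c Ωs x₀ y₀ x := by
  by_contra hle
  have hmax : IsLocalMax (fun y => c x y - c x₀ y) y₀ := by
    filter_upwards [S.snd.isOpen.mem_nhds hy₀] with y hy
    have := S.le_coneExcess x₀ y₀ x (subset_closure hy)
    linarith [not_lt.1 hle]
  have h1 := hmax.fderiv_eq_zero
  have hd : ∀ x, DifferentiableAt ℝ (fun y => c x y) y₀ := fun x =>
    (contDiff_slice (contDiff_swapCost S.hc) x).differentiable (by norm_num) y₀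
  rw [fderiv_fun_sub (hd x) (hd x₀)] at h1
  refine hne (S.snd.inj y₀ (subset_closure hy₀) ?_)
  change gradient (fun y => c x y) y₀ = gradient (fun y => c x₀ y) y₀
  unfold gradient
  rw [sub_eq_zero.1 h1]

/-- The `c`-cone with vertex `x₀`, away from the vertex: its focus map `y₁` takes values on
`∂Ω*`. -/
theorem exists_cone (hx₀ : x₀ ∈ Ω) (hy₀ : y₀ ∈ Ωs) {r : ℝ} (hr : 0 < r)
    (hrΩ : Metric.closedBall x₀ r ⊆ Ω) : ∃ (y₁ : E n → E n) (f : E n → ℝ),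
    ContDiff ℝ 3 y₁ ∧ ContDiff ℝ 3 f ∧
    (∀ x ∈ closure Ω \ Metric.ball x₀ r, y₁ x ∈ frontier Ωs ∧ f x = coneExcess c Ωs x₀ y₀ x ∧
      ∀ᶠ z in 𝓝 x, φs (y₁ z) = 0 ∧ gradient f z = cX c z (y₁ z) - cX c z y₀) ∧
    (∀ x ∈ closure Ω \ Metric.closedBall x₀ r, ∀ ξ,
      0 ≤ sndDeriv f x ξ + sndDeriv (fun z => c z y₀) x ξ - sndDeriv (fun z => c z (y₁ x)) x ξ ∧
      (ξ ≠ 0 → 0 < sndDeriv f x ξ + sndDeriv (fun z => c z y₀) x ξ -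
        sndDeriv (fun z => c z (y₁ x)) x ξ + inner ℝ (cX c x (y₁ x) - cX c x y₀) ξ ^ 2)) ∧
    InjOn y₁ (frontier Ω) ∧ ∀ a ∈ frontier Ω,
      (∀ α, fderiv ℝ φ a α = 0 → fderiv ℝ y₁ a α = 0 → α = 0) ∧
      0 < fderiv ℝ φs (y₁ a) (vel Y a (cX c a (y₁ a)) (gradient φ a)) := by
  have hsub := S.isSubsolution_cost hx₀
  set M := closure Ω \ Metric.ball x₀ r with hM
  have hMc : IsCompact M := S.isCompact_fst.diff Metric.isOpen_ball
  have hMne : ∀ x ∈ M, x ≠ x₀ := fun x hx h => hx.2 (h ▸ Metric.mem_ball_self hr)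
  have hfM : frontier Ω ⊆ M := by
    intro x hx
    refine ⟨frontier_subset_closure hx, fun hb => ?_⟩
    rw [S.fst.isOpen.frontier_eq] at hx
    exact hx.2 (hrΩ (Metric.ball_subset_closedBall hb))
  obtain ⟨y₁, σ, hy₁, hσ, hmin, hev⟩ := S.swap.exists_contact_map hsub hMc (fun x hx => hx.1)
    (fun x hx y hy h => hMne x hx (S.snd.inj y hy h).symm)
  have hcon : ∀ x ∈ M, ∀ᶠ z in 𝓝 x, φs (y₁ z) = 0 ∧
      cY c z (y₁ z) = cY c x₀ (y₁ z) + σ z • gradient φs (y₁ z) := hev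
  have hφs3 : ContDiff ℝ 3 φs := S.snd.defining.smooth.of_le (by norm_num)
  have hy₁d : Differentiable ℝ y₁ := hy₁.differentiable (by norm_num)
  set g : E n → ℝ := fun z => c z (y₁ z) - c x₀ (y₁ z) with hg
  have hcu3 : ContDiff ℝ 3 (Function.uncurry c) := S.hc.of_le (by norm_num)
  have hg3 : ContDiff ℝ 3 g := (hcu3.comp (contDiff_id.prodMk hy₁)).sub
    (hcu3.comp (contDiff_const.prodMk hy₁))
  -- `φs(y₁) = 0` is constant, so the derivative of `y₁` does not contribute to the gradient of `g`
  have hggrad : ∀ x ∈ M, ∀ᶠ z in 𝓝 x, gradient g z = cX c z (y₁ z) := by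
    intro x hx
    filter_upwards [eventually_eventually_nhds.2 (hcon x hx)] with z hz
    rw [eq_gradient_iff]
    intro v
    have hcd := hcu3.differentiable (by norm_num)
    have h1 : HasFDerivAt (fun z => Function.uncurry c (z, y₁ z)) _ z :=
      HasFDerivAt.comp (f := fun z => (z, y₁ z)) z (hcd (z, y₁ z)).hasFDerivAt
        ((hasFDerivAt_id z).prodMk (hy₁d z).hasFDerivAt)
    have h2 : HasFDerivAt (fun z => Function.uncurry c (x₀, y₁ z)) _ z :=
      HasFDerivAt.comp (f := fun z => (x₀, y₁ z)) z (hcd (x₀, y₁ z)).hasFDerivAt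
        ((hasFDerivAt_const x₀ z).prodMk (hy₁d z).hasFDerivAt)
    have h3 : fderiv ℝ g z v = fderiv ℝ (Function.uncurry c) (z, y₁ z) (v, fderiv ℝ y₁ z v) -
        fderiv ℝ (Function.uncurry c) (x₀, y₁ z) (0, fderiv ℝ y₁ z v) := by
      have h4 : HasFDerivAt g _ z := h1.sub h2
      rw [h4.fderiv]
      rfl
    have h5 : (v, fderiv ℝ y₁ z v) = (v, (0 : E n)) + (0, fderiv ℝ y₁ z v) := by simp
    rw [h3, h5, map_add, ← inner_cX S.hc, ← inner_cY S.hc, ← inner_cY S.hc,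
      hz.self_of_nhds.2, inner_add_left, inner_smul_left]
    have h6 : inner ℝ (gradient φs (y₁ z)) (fderiv ℝ y₁ z v) = 0 := by
      have h1 : HasFDerivAt (fun z => φs (y₁ z)) _ z :=
        (S.snd.defining.differentiable (y₁ z)).hasFDerivAt.comp z (hy₁d z).hasFDerivAt
      have h2 := h1.unique ((hasFDerivAt_const (0 : ℝ) z).congr_of_eventuallyEq
        (hz.mono fun z hz => hz.1))
      rw [inner_gradient]
      exact congrArg (fun L : E n →L[ℝ] ℝ => L v) h2
    rw [h6]
    ring
  set f : E n → ℝ := fun z => g z - c z y₀ + c x₀ y₀ with hf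
  have hcy : ∀ y, ContDiff ℝ 3 (fun z => c z y) := fun y =>
    (contDiff_slice S.hc y).of_le (by norm_num)
  have hf3 : ContDiff ℝ 3 f := (hg3.sub (hcy y₀)).add contDiff_const
  have hfgrad : ∀ z, gradient f z = gradient g z - cX c z y₀ := by
    intro z
    rw [eq_gradient_iff]
    intro v
    rw [hf, fderiv_add_const, fderiv_fun_sub (hg3.differentiable (by norm_num) z)
      ((hcy y₀).differentiable (by norm_num) z), inner_sub_left, inner_gradient, inner_cX']
    rfl
  have hfsnd : ∀ x ξ, sndDeriv f x ξ + sndDeriv (fun z => c z y₀) x ξ = sndDeriv g x ξ := by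
    intro x ξ
    have h1 := sndDeriv_add (f := f) (g := fun z => c z y₀) (hf3.of_le (by norm_num))
      ((hcy y₀).of_le (by norm_num)) x ξ
    rw [← h1]
    have h2 : (fun z => f z + c z y₀) = fun z => g z + (fun _ => c x₀ y₀) z := by
      ext z; simp only [hf]; ring
    rw [h2, sndDeriv_add (hg3.of_le (by norm_num)) contDiff_const, sndDeriv_const, add_zero]
  have hfM' : ∀ x ∈ M, f x = coneExcess c Ωs x₀ y₀ x := by
    intro x hx
    rw [S.coneExcess_eq (hmin x hx).1]
  have hg2 : ContDiff ℝ 2 g := hg3.of_le (by norm_num)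
  -- `g` is a supremum of functions among which `c(·, y₁(x)) - c(x₀, y₁(x))` is maximal at `x`
  have hQ0 : ∀ x ∈ closure Ω \ Metric.closedBall x₀ r, ∀ ξ,
      0 ≤ sndDeriv g x ξ - sndDeriv (fun z => c z (y₁ x)) x ξ := by
    intro x hx ξ
    have hcont : Continuous fun x => sndDeriv g x ξ - sndDeriv (fun z => c z (y₁ x)) x ξ := by
      refine ((continuous_sndDeriv hg2).comp (contDiff_mk_left (k := 0) ξ).continuous).sub ?_
      exact (contDiff_sndDeriv_cost S.hc).continuous.comp
        (continuous_const.prodMk (continuous_id.prodMk hy₁.continuous))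
    have hcl : closure (Ω \ Metric.closedBall x₀ r) ⊆
        {x | 0 ≤ sndDeriv g x ξ - sndDeriv (fun z => c z (y₁ x)) x ξ} := by
      refine closure_minimal (fun x hx => ?_) (isClosed_le continuous_const hcont)
      have hxM : x ∈ M := ⟨subset_closure hx.1, fun h => hx.2 (Metric.ball_subset_closedBall h)⟩
      have hopen : ∀ᶠ z in 𝓝 x, z ∈ Ω \ Metric.closedBall x₀ r :=
        (S.fst.isOpen.sdiff Metric.isClosed_closedBall).mem_nhds hx
      have hd2 : ContDiff ℝ 2 fun z => g z - c z (y₁ x) := hg2.sub ((hcy _).of_le (by norm_num))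
      have hlm : IsLocalMin (fun z => g z - c z (y₁ x)) x := by
        filter_upwards [hopen] with z hz
        have hzM : z ∈ M := ⟨subset_closure hz.1, fun h => hz.2 (Metric.ball_subset_closedBall h)⟩
        have h1 := (hmin z hzM).1.2 (y₁ x) (frontier_subset_closure (hmin x hxM).2.1)
        simp only [swapCost] at h1
        simp only [hg]
        linarith
      change 0 ≤ sndDeriv g x ξ - sndDeriv (fun z => c z (y₁ x)) x ξ
      rw [← sndDeriv_sub hg2 ((hcy _).of_le (by norm_num))]
      -- along the line in direction `ξ`
      by_contra hneg
      have hjd := hasDerivAt_fderiv_line hd2 x ξ 0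
      rw [zero_smul, add_zero] at hjd
      have h1 := eventually_lt_of_deriv_neg hjd (not_le.1 hneg)
      rw [zero_smul, add_zero, hlm.fderiv_eq_zero] at h1
      obtain ⟨ε, hε, hεlt⟩ : ∃ ε > (0 : ℝ), ∀ t ∈ Ioo 0 ε,
          fderiv ℝ (fun z => g z - c z (y₁ x)) (x + t • ξ) ξ < 0 := by
        rw [eventually_nhdsWithin_iff, Metric.eventually_nhds_iff] at h1
        obtain ⟨ε, hε, h⟩ := h1
        exact ⟨ε, hε, fun t ht => h (by rw [Real.dist_eq, sub_zero, abs_of_pos ht.1]; exact ht.2)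
          ht.1⟩
      have hjl := fun t => hasDerivAt_line (fun z => g z - c z (y₁ x))
        (hd2.differentiable (by norm_num)) x ξ t
      have hanti : StrictAntiOn (fun t : ℝ => g (x + t • ξ) - c (x + t • ξ) (y₁ x))
          (Icc 0 (ε / 2)) := by
        refine strictAntiOn_of_deriv_neg (convex_Icc _ _)
          (fun t _ => (hjl t).continuousAt.continuousWithinAt) fun t ht => ?_
        rw [interior_Icc] at ht
        rw [(hjl t).deriv]
        exact hεlt t ⟨ht.1, by linarith [ht.2]⟩
      have htend : Tendsto (fun t : ℝ => x + t • ξ) (𝓝[>] 0) (𝓝 x) := by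
        have : Continuous fun t : ℝ => x + t • ξ := by fun_prop
        simpa using (this.tendsto 0).mono_left nhdsWithin_le_nhds
      obtain ⟨t, ht1, ht2⟩ := ((htend.eventually hlm).and
        (Ioo_mem_nhdsGT (show (0 : ℝ) < ε / 2 by positivity))).exists
      have h2 := hanti (left_mem_Icc.2 (by positivity)) ⟨ht2.1.le, ht2.2.le⟩ ht2.1
      simp only [zero_smul, add_zero] at h2
      linarith
    refine hcl ?_
    rw [mem_closure_iff_nhds]
    intro V hV
    obtain ⟨z, hz1, hz2⟩ := mem_closure_iff_nhds.1 hx.1 _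
      (inter_mem hV (Metric.isClosed_closedBall.isOpen_compl.mem_nhds hx.2))
    exact ⟨z, hz1.1, hz2, hz1.2⟩
  -- kernel of the derivative of `y₁`
  have hker : ∀ x ∈ M, ∀ ξ, fderiv ℝ y₁ x ξ = 0 → ∃ s : ℝ,
      ξ = s • vel X (y₁ x) (cY c x (y₁ x)) (gradient φs (y₁ x)) := by
    intro x hx ξ hξ
    have hgφs : ContDiff ℝ 3 (gradient φs) := contDiff_gradient (k := 3) S.snd.defining.smooth
    have hyc := frontier_subset_closure (hmin x hx).2.1
    have had : ∀ x, HasFDerivAt (fun z : E n × E n => cY c z.1 z.2) _ (x, y₁ x) := fun x =>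
      ((contDiff_cY S.hc).differentiable (by norm_num) (x, y₁ x)).hasFDerivAt
    have had₀ : HasFDerivAt (fun y => cY c x₀ y) (fderiv ℝ (fun y => cY c x₀ y) (y₁ x)) (y₁ x) :=
      (((contDiff_cY S.hc).comp (contDiff_mk_right x₀)).differentiable
        (by norm_num) (y₁ x)).hasFDerivAt
    have hyd := (hy₁d x).hasFDerivAt
    have h1 : HasFDerivAt (fun z => cY c z (y₁ z)) _ x :=
      HasFDerivAt.comp (g := fun z : E n × E n => cY c z.1 z.2) (f := fun z => (z, y₁ z)) x
        (had x) ((hasFDerivAt_id x).prodMk hyd)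
    have h2 : HasFDerivAt (fun z => cY c x₀ (y₁ z)) _ x := HasFDerivAt.comp x had₀ hyd
    have h3 : HasFDerivAt (fun z => gradient φs (y₁ z)) _ x :=
      HasFDerivAt.comp (g := gradient φs) x (hgφs.differentiable (by norm_num) _).hasFDerivAt hyd
    have h4 := h2.add (HasFDerivAt.smul (hσ.differentiable (by norm_num) x).hasFDerivAt h3)
    have h5 := h1.unique (h4.congr_of_eventuallyEq ((hcon x hx).mono fun z hz => hz.2))
    have h6 := congrArg (fun L : E n →L[ℝ] E n => L ξ) h5
    simp only [ContinuousLinearMap.comp_apply, ContinuousLinearMap.prod_apply, hξ, map_zero,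
      add_apply, smul_apply, smul_zero, zero_add, ContinuousLinearMap.smulRight_apply,
      ContinuousLinearMap.id_apply] at h6
    refine ⟨fderiv ℝ σ x ξ, ?_⟩
    have h7 : cXY (swapCost c) (y₁ x) x ξ = fderiv ℝ σ x ξ • gradient φs (y₁ x) := by
      rw [← h6]
      exact fderiv_slice_left (F := fun z : E n × E n => cY c z.1 z.2)
        ((contDiff_cY S.hc).differentiable (by norm_num)) x ξ (y₁ x)
    have h8 : vel X (y₁ x) (cY c x (y₁ x)) (cXY (swapCost c) (y₁ x) x ξ) = ξ :=
      S.swap.vel_cXY hyc hx.1 ξ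
    rw [h7] at h8
    refine h8.symm.trans ?_
    unfold vel
    rw [map_smul]
  refine ⟨y₁, f, hy₁, hf3, fun x hx => ⟨(hmin x hx).2.1, hfM' x hx, ?_⟩, fun x hx ξ => ?_, ?_,
    fun a ha => ⟨fun α h1 h2 => ?_, ?_⟩⟩
  · filter_upwards [hcon x hx, hggrad x hx] with z h1 h2
    exact ⟨h1.1, by rw [hfgrad, h2]⟩
  · rw [hfsnd]
    refine ⟨hQ0 x hx ξ, fun hξ => ?_⟩
    have hQ := hQ0 x hx ξ
    refine lt_of_le_of_ne (by positivity) fun h0 => hξ ?_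
    have hxM : x ∈ M := ⟨hx.1, fun h => hx.2 (Metric.ball_subset_closedBall h)⟩
    have hyf := (hmin x hxM).2.1
    have hyc := frontier_subset_closure hyf
    have hw0 : inner ℝ (cX c x (y₁ x) - cX c x y₀) ξ = 0 := by
      have : inner ℝ (cX c x (y₁ x) - cX c x y₀) ξ ^ 2 = 0 := by
        linarith [sq_nonneg (inner ℝ (cX c x (y₁ x) - cX c x y₀) ξ : ℝ)]
      exact pow_eq_zero_iff (two_ne_zero) |>.1 this
    have hQz : sndDeriv g x ξ - sndDeriv (fun z => c z (y₁ x)) x ξ = 0 := by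
      linarith [sq_nonneg (inner ℝ (cX c x (y₁ x) - cX c x y₀) ξ : ℝ)]
    have hc2 : ContDiff ℝ 2 fun z => c z (y₁ x) := (hcy _).of_le (by norm_num)
    have hd2 : ContDiff ℝ 2 fun z => g z - c z (y₁ x) := hg2.sub hc2
    rw [← sndDeriv_sub hg2 hc2] at hQz
    have hzero := fderiv_fderiv_eq_zero_of_nonneg hd2 (x := x) (fun η => by
      rw [sndDeriv_sub hg2 hc2]; exact hQ0 x hx η) hQz
    -- the Hessian of `g - c(·, y₁(x))` is `c_xy D y₁`
    have hD : fderiv ℝ y₁ x ξ = 0 := by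
      refine S.fst.nondeg x hx.1 _ hyc _ (ext_inner_right ℝ fun η => ?_)
      rw [inner_zero_left]
      have had : HasFDerivAt (fun z : E n × E n => cX c z.1 z.2) _ (x, y₁ x) :=
        ((contDiff_cX S.hc).differentiable (by norm_num) (x, y₁ x)).hasFDerivAt
      have h1 : HasFDerivAt (fun z => cX c z (y₁ z)) _ x :=
        HasFDerivAt.comp (g := fun z : E n × E n => cX c z.1 z.2) (f := fun z => (z, y₁ z)) x
          had ((hasFDerivAt_id x).prodMk (hy₁d x).hasFDerivAt)
      have h2 := (h1.congr_of_eventuallyEq (hggrad x hxM)).fderiv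
      have h3 := congrArg (fun L : E n →L[ℝ] E n => inner ℝ (L ξ) η) h2
      simp only [ContinuousLinearMap.comp_apply, ContinuousLinearMap.prod_apply,
        ContinuousLinearMap.id_apply] at h3
      have h4 : (ξ, fderiv ℝ y₁ x ξ) = (ξ, (0 : E n)) + (0, fderiv ℝ y₁ x ξ) := by simp
      rw [h4, map_add, ← cXY_eq S.hc, inner_add_left,
        ← fderiv_slice_left ((contDiff_cX S.hc).differentiable (by norm_num))] at h3
      have h5 : inner ℝ (fderiv ℝ (gradient g) x ξ) η = fderiv ℝ (fderiv ℝ g) x ξ η :=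
        inner_hess hg2 x ξ η
      have h6 : inner ℝ (fderiv ℝ (fun z => cX c z (y₁ x)) x ξ) η =
          fderiv ℝ (fderiv ℝ fun z => c z (y₁ x)) x ξ η := inner_hess hc2 x ξ η
      rw [h5, h6] at h3
      have h7 : fderiv ℝ (fderiv ℝ fun z => g z - c z (y₁ x)) x =
          fderiv ℝ (fderiv ℝ g) x - fderiv ℝ (fderiv ℝ fun z => c z (y₁ x)) x := by
        have h8 : (fderiv ℝ fun z => g z - c z (y₁ x)) =
            fun z => fderiv ℝ g z - fderiv ℝ (fun z => c z (y₁ x)) z := by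
          ext1 z
          exact fderiv_fun_sub (hg2.differentiable (by norm_num) z)
            (hc2.differentiable (by norm_num) z)
        rw [h8]
        exact fderiv_fun_sub (differentiable_fderiv hg2 x) (differentiable_fderiv hc2 x)
      have h8 := hzero η
      rw [h7, sub_apply, sub_apply] at h8
      linarith
    obtain ⟨s, hs⟩ := hker x hxM ξ hD
    have htr := S.swap.fderiv_comp_X_neg hyf hy₀ hx.1
    have h1 : inner ℝ (cX c x (y₁ x) - cX c x y₀)
        (vel X (y₁ x) (cY c x (y₁ x)) (gradient φs (y₁ x))) ≠ 0 := by
      intro h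
      rw [real_inner_comm, S.inner_vel_vel hx.1 hyc, inner_gradient, ← neg_sub] at h
      have h2 : vel Y x (cX c x (y₁ x)) (-(cX c x y₀ - cX c x (y₁ x))) =
        -vel Y x (cX c x (y₁ x)) (cX c x y₀ - cX c x (y₁ x)) := by unfold vel; rw [map_neg]
      rw [h2, map_neg, neg_eq_zero] at h
      exact htr.ne h
    rw [hs, inner_smul_right] at hw0
    rw [hs, (mul_eq_zero.1 hw0).resolve_right h1, zero_smul]
  · intro a ha a' ha' he
    have h1 := (hcon a (hfM ha)).self_of_nhds.2
    have h2 := (hcon a' (hfM ha')).self_of_nhds.2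
    have hyc := frontier_subset_closure (hmin a (hfM ha)).2.1
    rw [← he] at h2
    exact S.swap.focus_unique hsub hyc ha ha' (hmin a (hfM ha)).2.2 (hmin a' (hfM ha')).2.2 h1 h2
  · obtain ⟨s, hs⟩ := hker a (hfM ha) α h2
    have hyc := frontier_subset_closure (hmin a (hfM ha)).2.1
    have h3 := S.swap.fderiv_vel_gradient_pos hsub hyc ha (hmin a (hfM ha)).2.2
      (hcon a (hfM ha)).self_of_nhds.2
    rw [hs, map_smul, smul_eq_mul] at h1
    rw [hs, (mul_eq_zero.1 h1).resolve_right h3.ne', zero_smul]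
  · have hyc := frontier_subset_closure (hmin a (hfM ha)).2.1
    exact S.swap.fderiv_vel_gradient_pos' hsub hyc ha (hmin a (hfM ha)).2.2
      (hcon a (hfM ha)).self_of_nhds.2

end Setup

/-! ### Hypersurfaces near the boundary of the target -/

namespace Setup

variable {n : ℕ} {c : E n → E n → ℝ} {Ω Ωs : Set (E n)} {φ φs : E n → ℝ}
  {X Y : E n × E n → E n} (S : Setup c Ω Ωs φ φs X Y)

include S

/-- Hypersurfaces `T(∂Ω, m)` close to `∂Ω*` have defining functions close to that of `Ω*`, hence
the same convexity. -/
theorem exists_perturbed_defining {y₁ : E n → E n}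
    (hyf : ∀ a ∈ frontier Ω, y₁ a ∈ frontier Ωs)
    (hy0 : ∀ a ∈ frontier Ω, ∀ᶠ z in 𝓝 a, φs (y₁ z) = 0) (hy₁ : ContDiff ℝ 3 y₁)
    (hinj : InjOn y₁ (frontier Ω))
    (hker : ∀ a ∈ frontier Ω, ∀ α, fderiv ℝ φ a α = 0 → fderiv ℝ y₁ a α = 0 → α = 0)
    (htr : ∀ a ∈ frontier Ω, 0 < fderiv ℝ φs (y₁ a) (vel Y a (cX c a (y₁ a)) (gradient φ a)))
    {T : E n × (ℝ × ℝ) → E n} (hT : ContDiff ℝ 2 T)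
    (hT0 : ∀ a ∈ frontier Ω, ∀ᶠ z in 𝓝 a, T (z, 0) = y₁ z) :
    ∃ (δ : ℝ) (ψ : E n × (ℝ × ℝ) → ℝ), 0 < δ ∧ ContDiff ℝ 2 ψ ∧
      ∀ᶠ m in 𝓝 (0 : ℝ × ℝ), ∀ a ∈ frontier Ω,
        (∀ᶠ z in 𝓝 a, φ z = 0 → ψ (T (z, m), m) = 0) ∧
        0 < fderiv ℝ (fun y => ψ (y, m)) (T (a, m))
          (vel Y a (cX c a (T (a, m))) (gradient φ a)) ∧
        ∀ x ∈ closure Ω, ∀ v,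
          fderiv ℝ (fun y => ψ (y, m)) (T (a, m)) (vel Y x (cX c x (T (a, m))) v) = 0 →
          δ * ‖gradient (fun y => ψ (y, m)) (T (a, m))‖ *
              ‖vel Y x (cX c x (T (a, m))) v‖ ^ 2 ≤
            sndDeriv (fun y => ψ (y, m)) (T (a, m)) (vel Y x (cX c x (T (a, m))) v) +
              fderiv ℝ (fun y => ψ (y, m)) (T (a, m)) (acc Y x (cX c x (T (a, m))) v) := by
  have hgφs : ContDiff ℝ 3 (gradient φs) := contDiff_gradient (k := 3) S.snd.defining.smooth
  have hgφ : ContDiff ℝ 3 (gradient φ) := contDiff_gradient (k := 3) S.fst.defining.smooth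
  have hφ2 : ContDiff ℝ 2 φ := S.fst.defining.smooth.of_le two_le_four
  have hφs2 : ContDiff ℝ 2 φs := S.snd.defining.smooth.of_le two_le_four
  have hT0' : ∀ a ∈ frontier Ω, T (a, 0) = y₁ a := fun a ha => (hT0 a ha).self_of_nhds
  set N : E n → E n := fun a => gradient φs (y₁ a) with hN
  have hNc : ContDiff ℝ 2 N := (hgφs.comp hy₁).of_le (by norm_num)
  set H : E n × ℝ × (ℝ × ℝ) → E n × ℝ × (ℝ × ℝ) :=
    fun z => (T (z.1, z.2.2) + z.2.1 • N z.1, φ z.1, z.2.2) with hH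
  have hTz : ContDiff ℝ 2 fun z : E n × ℝ × (ℝ × ℝ) => T (z.1, z.2.2) :=
    hT.comp (contDiff_fst.prodMk contDiff_snd.snd)
  have hHc : ContDiff ℝ 2 H := (hTz.add (contDiff_snd.fst.smul (hNc.comp contDiff_fst))).prodMk
    ((hφ2.comp contDiff_fst).prodMk contDiff_snd.snd)
  set K : Set (E n × ℝ × (ℝ × ℝ)) := frontier Ω ×ˢ {0} with hK
  have hKc : IsCompact K := S.isCompact_frontier.prod isCompact_singleton
  obtain ⟨G, hG, O, hO, hKO, hGl, hHO⟩ := exists_contDiff_leftInverse (k := 2) (by norm_num) hHc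
    hKc
    (by
      rintro ⟨a, z⟩ ⟨ha, hz⟩ ⟨a', z'⟩ ⟨ha', hz'⟩ he
      simp only [mem_singleton_iff] at hz hz' ha ha'
      subst hz; subst hz'
      have h1 : T (a, 0) + (0 : ℝ) • N a = T (a', 0) + (0 : ℝ) • N a' := congrArg Prod.fst he
      rw [zero_smul, zero_smul, add_zero, add_zero, hT0' a ha, hT0' a' ha'] at h1
      rw [hinj ha ha' h1])
    (by
      rintro ⟨a, z⟩ ⟨ha, hz⟩ ⟨α, τ, μ⟩ hw
      simp only [mem_singleton_iff] at hz ha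
      subst hz
      have hd1 : HasFDerivAt (fun z : E n × ℝ × (ℝ × ℝ) => T (z.1, z.2.2))
          (fderiv ℝ (fun z : E n × ℝ × (ℝ × ℝ) => T (z.1, z.2.2)) (a, 0)) (a, 0) :=
        (hTz.differentiable (by norm_num) _).hasFDerivAt
      have hfst : HasFDerivAt (𝕜 := ℝ) (fun z : E n × ℝ × (ℝ × ℝ) => z.1)
        (ContinuousLinearMap.fst ℝ (E n) (ℝ × (ℝ × ℝ))) (a, 0) := hasFDerivAt_fst
      have hsnd : HasFDerivAt (𝕜 := ℝ) (fun z : E n × ℝ × (ℝ × ℝ) => z.2)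
        (ContinuousLinearMap.snd ℝ (E n) (ℝ × (ℝ × ℝ))) (a, 0) := hasFDerivAt_snd
      have hd2 : HasFDerivAt (fun z : E n × ℝ × (ℝ × ℝ) => N z.1) _ (a, 0) :=
        HasFDerivAt.comp (g := N) (a, (0 : ℝ × (ℝ × ℝ)))
          (hNc.differentiable (by norm_num) a).hasFDerivAt hfst
      have hd3 : HasFDerivAt (fun z : E n × ℝ × (ℝ × ℝ) => φ z.1) _ (a, 0) :=
        HasFDerivAt.comp (g := φ) (a, (0 : ℝ × (ℝ × ℝ)))
          (S.fst.defining.differentiable a).hasFDerivAt hfst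
      have hHd := (hd1.add (HasFDerivAt.smul hsnd.fst hd2)).prodMk (hd3.prodMk hsnd.snd)
      have hw' := congrArg (fun L => L ((α, τ, μ) : E n × ℝ × (ℝ × ℝ))) hHd.fderiv
      have hw0 : fderiv ℝ H (a, 0) (α, τ, μ) = 0 := hw
      replace hw' := hw0.symm.trans hw'
      have e1 := congrArg Prod.fst hw'
      have e2 := congrArg (fun z => z.2.1) hw'
      have e3 := congrArg (fun z => z.2.2) hw'
      simp at e1 e2 e3
      subst e3
      have hTa : fderiv ℝ (fun z : E n × ℝ × (ℝ × ℝ) => T (z.1, z.2.2)) (a, 0) (α, τ, 0) =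
          fderiv ℝ y₁ a α := by
        have hcur : HasFDerivAt (fun z : E n × ℝ × (ℝ × ℝ) => (z.1, z.2.2))
            ((ContinuousLinearMap.fst ℝ (E n) (ℝ × (ℝ × ℝ))).prod
              ((ContinuousLinearMap.snd ℝ ℝ (ℝ × ℝ)).comp
                (ContinuousLinearMap.snd ℝ (E n) (ℝ × (ℝ × ℝ))))) (a, 0) :=
          hfst.prodMk hsnd.snd
        have h1 : HasFDerivAt (fun z : E n × ℝ × (ℝ × ℝ) => T (z.1, z.2.2)) _ (a, 0) :=
          HasFDerivAt.comp (g := T) (a, (0 : ℝ × (ℝ × ℝ)))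
            (hT.differentiable (by norm_num) _).hasFDerivAt hcur
        rw [h1.fderiv]
        have h2 := fderiv_slice_left (hT.differentiable (by norm_num)) a α (0 : ℝ × ℝ)
        rw [Filter.EventuallyEq.fderiv_eq (hT0 a ha)] at h2
        rw [h2]
        rfl
      rw [hTa] at e1
      have htan : inner ℝ (N a) (fderiv ℝ y₁ a α) = 0 := by
        have h1 : HasFDerivAt (fun z => φs (y₁ z)) _ a :=
          (S.snd.defining.differentiable (y₁ a)).hasFDerivAt.comp a
            (hy₁.differentiable (by norm_num) a).hasFDerivAt
        have h2 := h1.unique ((hasFDerivAt_const (0 : ℝ) a).congr_of_eventuallyEq (hy0 a ha))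
        rw [hN, inner_gradient]
        exact congrArg (fun L : E n →L[ℝ] ℝ => L α) h2
      have h3 := congrArg (inner ℝ (N a)) e1
      rw [inner_add_right, htan, inner_smul_right, zero_add, real_inner_self_eq_norm_sq,
        inner_zero_right] at h3
      have h4 : ‖N a‖ ^ 2 ≠ 0 := by
        have := norm_pos_iff.2 (S.snd.defining.gradient_ne (hyf a ha))
        positivity
      have hτ : τ = 0 := (mul_eq_zero.1 h3.symm).resolve_right h4
      rw [hτ, zero_smul, add_zero] at e1
      rw [hker a ha α e2.symm e1.symm, hτ]
      rfl)
    rfl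
  -- `φs` corrected by its values at the foot points on `T(∂Ω, m)`, along the normals of `∂Ω*`
  set ψ : E n × (ℝ × ℝ) → ℝ := fun z => φs z.1 - φs (T ((G (z.1, 0, z.2)).1, z.2)) with hψ
  have hψc : ContDiff ℝ 2 ψ := by
    refine (hφs2.comp contDiff_fst).sub (hφs2.comp (hT.comp (ContDiff.prodMk ?_ contDiff_snd)))
    exact (hG.comp (contDiff_fst.prodMk (contDiff_const.prodMk contDiff_snd))).fst
  have hψT : ∀ a m, (a, 0, m) ∈ O → φ a = 0 → ψ (T (a, m), m) = 0 := by
    intro a m hO' h0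
    have h1 := hGl _ hO'
    simp only [hH, zero_smul, add_zero, h0] at h1
    simp only [hψ, h1, sub_self]
  have hψ0 : ∀ a ∈ frontier Ω, ∀ᶠ y in 𝓝 (y₁ a), ψ (y, 0) = φs y := by
    intro a ha
    have hamem : (a, (0 : ℝ × (ℝ × ℝ))) ∈ O := hKO (mk_mem_prod ha (mem_singleton _))
    have hHa : H (a, 0) = (y₁ a, 0, 0) := by
      simp [hH, hT0' a ha, S.fst.defining.eq_zero S.fst.isOpen ha]
    have hcont : Continuous fun y : E n => ((y, 0, 0) : E n × ℝ × (ℝ × ℝ)) := by fun_prop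
    have h1 : ∀ᶠ y in 𝓝 (y₁ a), ((y, 0, 0) : E n × ℝ × (ℝ × ℝ)) ∈ H '' O :=
      hcont.continuousAt.eventually (hHO.mem_nhds ⟨_, hamem, hHa⟩)
    have h2 : Tendsto (fun y : E n => (G (y, 0, 0)).1) (𝓝 (y₁ a)) (𝓝 a) := by
      have h3 := ((continuous_fst.comp (hG.continuous.comp hcont)).tendsto (y₁ a))
      have h4 : G (y₁ a, 0, 0) = (a, 0) := by rw [← hHa, hGl _ hamem]
      simp only [Function.comp_apply, h4] at h3
      exact h3
    filter_upwards [h1, h2.eventually (hT0 a ha), h2.eventually (hy0 a ha)] with y hy hy1 hy2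
    simp only [hψ]
    rw [hy1, hy2, sub_zero]
  -- continuity of the quantities involved
  have hψd := hψc.differentiable (by norm_num)
  have hcT := hT.continuous
  set A := E n × E n × E n with hA
  have hyy : Continuous fun z : A × (ℝ × ℝ) => T (z.1.1, z.2) :=
    hcT.comp (continuous_fst.fst.prodMk continuous_snd)
  have hpp : Continuous fun z : A × (ℝ × ℝ) => cX c z.1.2.1 (T (z.1.1, z.2)) :=
    (continuous_cX S.hc).comp (continuous_fst.snd.fst.prodMk hyy)
  have hvv : Continuous fun z : A × (ℝ × ℝ) =>
      vel Y z.1.2.1 (cX c z.1.2.1 (T (z.1.1, z.2))) z.1.2.2 :=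
    S.continuous_vel.comp (continuous_fst.snd.fst.prodMk (hpp.prodMk continuous_fst.snd.snd))
  have haa : Continuous fun z : A × (ℝ × ℝ) =>
      acc Y z.1.2.1 (cX c z.1.2.1 (T (z.1.1, z.2))) z.1.2.2 :=
    S.continuous_acc.comp (continuous_fst.snd.fst.prodMk (hpp.prodMk continuous_fst.snd.snd))
  have hDψ : ∀ {w : A × (ℝ × ℝ) → E n}, Continuous w → Continuous fun z : A × (ℝ × ℝ) =>
      fderiv ℝ (fun y => ψ (y, z.2)) (T (z.1.1, z.2)) (w z) := by
    intro w hw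
    have h1 : (fun z : A × (ℝ × ℝ) => fderiv ℝ (fun y => ψ (y, z.2)) (T (z.1.1, z.2)) (w z)) =
        fun z => fderiv ℝ ψ (T (z.1.1, z.2), z.2) (w z, 0) := by
      ext z
      rw [fderiv_slice_left hψd]
    rw [h1]
    exact ((hψc.continuous_fderiv (by norm_num)).comp (hyy.prodMk continuous_snd)).clm_apply
      (hw.prodMk continuous_const)
  have hDDψ : Continuous fun z : A × (ℝ × ℝ) => sndDeriv (fun y => ψ (y, z.2)) (T (z.1.1, z.2))
      (vel Y z.1.2.1 (cX c z.1.2.1 (T (z.1.1, z.2))) z.1.2.2) := by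
    simp only [sndDeriv_slice_left hψc]
    exact (continuous_sndDeriv hψc).comp ((hyy.prodMk continuous_snd).prodMk
      (hvv.prodMk continuous_const))
  have hgψ : Continuous fun z : A × (ℝ × ℝ) =>
      gradient (fun y => ψ (y, z.2)) (T (z.1.1, z.2)) := by
    have h1 : (fun z : A × (ℝ × ℝ) => gradient (fun y => ψ (y, z.2)) (T (z.1.1, z.2))) =
        fun z => (InnerProductSpace.toDual ℝ (E n)).symm
          ((fderiv ℝ ψ (T (z.1.1, z.2), z.2)).comp (ContinuousLinearMap.inl ℝ (E n) (ℝ × ℝ))) := by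
      ext1 z
      unfold gradient
      congr 1
      ext v
      rw [fderiv_slice_left hψd]
      simp
    rw [h1]
    exact (InnerProductSpace.toDual ℝ (E n)).symm.continuous.comp
      (((hψc.continuous_fderiv (by norm_num)).comp (hyy.prodMk continuous_snd)).clm_comp
        continuous_const)
  -- the limit values
  obtain ⟨κ, hκ, hcurv⟩ := S.convSnd.curv
  have hfd0 : ∀ a ∈ frontier Ω, fderiv ℝ (fun y => ψ (y, 0)) (T (a, 0)) = fderiv ℝ φs (y₁ a) := by
    intro a ha
    rw [hT0' a ha]
    exact Filter.EventuallyEq.fderiv_eq (hψ0 a ha)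
  have hsd0 : ∀ a ∈ frontier Ω, ∀ v,
      sndDeriv (fun y => ψ (y, 0)) (T (a, 0)) v = sndDeriv φs (y₁ a) v := by
    intro a ha v
    rw [hT0' a ha]
    exact sndDeriv_congr (hψ0 a ha) v
  have hcA : IsCompact (frontier Ω ×ˢ (closure Ω ×ˢ Metric.sphere (0 : E n) 1)) :=
    S.isCompact_frontier.prod (S.isCompact_fst.prod (isCompact_sphere _ _))
  obtain ⟨B, hB⟩ := hcA.exists_bound_of_continuousOn (f := fun z : A =>
      ‖gradient (fun y => ψ (y, 0)) (T (z.1, 0))‖ *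
        ‖vel Y z.2.1 (cX c z.2.1 (T (z.1, 0))) z.2.2‖ ^ 2) (by
    have h1 : Continuous fun z : A => (z, (0 : ℝ × ℝ)) := by fun_prop
    exact ((hgψ.comp h1).norm.mul ((hvv.comp h1).norm.pow 2)).continuousOn)
  set B' := |B| + 1 with hB'
  have hB'0 : 0 < B' := by positivity
  -- on the compact set of unit vectors, tangency fails or the curvature is at least half its limit
  have hev1 : ∀ᶠ m in 𝓝 (0 : ℝ × ℝ), ∀ z ∈ frontier Ω ×ˢ (closure Ω ×ˢ Metric.sphere (0 : E n) 1),
      ((fderiv ℝ (fun y => ψ (y, m)) (T (z.1, m)) (vel Y z.2.1 (cX c z.2.1 (T (z.1, m))) z.2.2) ≠ 0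
        ∨ κ / 2 < sndDeriv (fun y => ψ (y, m)) (T (z.1, m))
            (vel Y z.2.1 (cX c z.2.1 (T (z.1, m))) z.2.2) +
          fderiv ℝ (fun y => ψ (y, m)) (T (z.1, m))
            (acc Y z.2.1 (cX c z.2.1 (T (z.1, m))) z.2.2)) ∧
        ‖gradient (fun y => ψ (y, m)) (T (z.1, m))‖ *
          ‖vel Y z.2.1 (cX c z.2.1 (T (z.1, m))) z.2.2‖ ^ 2 < B') := by
    refine hcA.eventually_forall_of_forall_eventually ?_
    rintro ⟨a, x, v⟩ ⟨ha, hx, hv⟩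
    have ha' : a ∈ frontier Ω := ha
    have hx' : x ∈ closure Ω := hx
    have hv1 : ‖v‖ = 1 := by simpa using hv
    have hyc := frontier_subset_closure (hyf a ha')
    have hsw : Continuous fun z : (ℝ × ℝ) × A => (z.2, z.1) := continuous_swap
    have c1 := (hDψ hvv).comp hsw
    have c2 := (hDDψ.comp hsw).add ((hDψ haa).comp hsw)
    have c3 := (hgψ.comp hsw).norm.mul ((hvv.comp hsw).norm.pow 2)
    refine Eventually.and ?_ ?_
    · by_cases h0 : fderiv ℝ φs (y₁ a) (vel Y x (cX c x (y₁ a)) v) = 0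
      · have h1 : κ * ‖v‖ ^ 2 ≤ sndDeriv φs (y₁ a) (vel Y x (cX c x (y₁ a)) v) +
            fderiv ℝ φs (y₁ a) (acc Y x (cX c x (y₁ a)) v) := by
          have h2 := hcurv (y₁ a) (hyf a ha') x hx' v
          have h3 := S.swap.fderiv_comp_X hφs2 hyc hx' v
          have h4 := S.swap.sndDeriv_comp_X hφs2 hyc hx' v
          rw [h3, h4] at h2
          exact h2 h0
        rw [hv1] at h1
        refine (c2.continuousAt.eventually (lt_mem_nhds (a := κ / 2) ?_)).mono
          fun z hz => Or.inr hz
        change κ / 2 < sndDeriv (fun y => ψ (y, 0)) (T (a, 0)) (vel Y x (cX c x (T (a, 0))) v) +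
          fderiv ℝ (fun y => ψ (y, 0)) (T (a, 0)) (acc Y x (cX c x (T (a, 0))) v)
        rw [hsd0 a ha', hfd0 a ha', hT0' a ha']
        linarith
      · refine (c1.continuousAt.eventually_ne ?_).mono fun z hz => Or.inl hz
        change fderiv ℝ (fun y => ψ (y, 0)) (T (a, 0)) (vel Y x (cX c x (T (a, 0))) v) ≠ 0
        rw [hfd0 a ha', hT0' a ha']
        exact h0
    · refine c3.continuousAt.eventually (gt_mem_nhds ?_)
      have := hB (a, x, v) ⟨ha, hx, hv⟩
      rw [Real.norm_eq_abs] at this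
      have h5 := (le_abs_self _).trans (this.trans (le_abs_self B))
      simp only [Function.comp_apply]
      rw [hB']
      exact lt_of_le_of_lt h5 (lt_add_one _)
  have hev2 : ∀ᶠ m in 𝓝 (0 : ℝ × ℝ), ∀ a ∈ frontier Ω, (a, 0, m) ∈ O ∧
      0 < fderiv ℝ (fun y => ψ (y, m)) (T (a, m))
          (vel Y a (cX c a (T (a, m))) (gradient φ a)) := by
    refine S.isCompact_frontier.eventually_forall_of_forall_eventually fun a ha => ?_
    have hc1 : Continuous fun z : (ℝ × ℝ) × E n => ((z.2, 0, z.1) : E n × ℝ × (ℝ × ℝ)) := by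
      fun_prop
    have hc2 : Continuous fun z : (ℝ × ℝ) × E n =>
        (((z.2, z.2, gradient φ z.2), z.1) : A × (ℝ × ℝ)) := by
      have := hgφ.continuous
      fun_prop
    refine (hc1.continuousAt.eventually (hO.mem_nhds ?_)).and
      (((hDψ hvv).comp hc2).continuousAt.eventually (lt_mem_nhds (a := 0) ?_))
    · exact hKO (mk_mem_prod ha (mem_singleton _))
    · simp only [Function.comp_apply]
      rw [hfd0 a ha, hT0' a ha]
      exact htr a ha
  refine ⟨κ / (2 * B'), ψ, by positivity, hψc, ?_⟩
  filter_upwards [hev1, hev2] with m hm1 hm2 a ha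
  refine ⟨?_, (hm2 a ha).2, fun x hx v hv => ?_⟩
  · have hc1 : Continuous fun z : E n => ((z, 0, m) : E n × ℝ × (ℝ × ℝ)) := by fun_prop
    filter_upwards [hc1.continuousAt.eventually (hO.mem_nhds (hm2 a ha).1)] with z hz hz0
    exact hψT z m hz hz0
  · rcases eq_or_ne v 0 with rfl | hv0
    · have h1 : vel Y x (cX c x (T (a, m))) 0 = 0 := by unfold vel; rw [map_zero]
      have h2 : acc Y x (cX c x (T (a, m))) 0 = 0 := by unfold acc; rw [sndDeriv_zero]
      rw [h1, h2, sndDeriv_zero, map_zero]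
      simp
    · have hn : 0 < ‖v‖ := norm_pos_iff.2 hv0
      set w := ‖v‖⁻¹ • v with hw
      have hvw : v = ‖v‖ • w := by rw [hw, smul_smul, mul_inv_cancel₀ hn.ne', one_smul]
      have hw1 : ‖w‖ = 1 := by rw [hw, norm_smul]; simp [hn.ne']
      obtain ⟨h1, h2⟩ := hm1 (a, x, w) ⟨ha, hx, by simp [hw1]⟩
      simp only at h1 h2
      rw [hvw] at hv ⊢
      rw [vel_smul, map_smul, smul_eq_mul] at hv
      have h3 := h1.resolve_left (fun h => h ((mul_eq_zero.1 hv).resolve_left hn.ne'))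
      rw [vel_smul, acc_smul, sndDeriv_smul, map_smul, norm_smul, norm_norm, smul_eq_mul,
        smul_eq_mul, ← mul_add]
      set q := sndDeriv (fun y => ψ (y, m)) (T (a, m)) (vel Y x (cX c x (T (a, m))) w) +
        fderiv ℝ (fun y => ψ (y, m)) (T (a, m)) (acc Y x (cX c x (T (a, m))) w)
      set g := ‖gradient (fun y => ψ (y, m)) (T (a, m))‖
      set l := ‖vel Y x (cX c x (T (a, m))) w‖
      calc κ / (2 * B') * g * (‖v‖ * l) ^ 2 = ‖v‖ ^ 2 * (κ / (2 * B') * (g * l ^ 2)) := by ring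
        _ ≤ ‖v‖ ^ 2 * (κ / (2 * B') * B') := by gcongr
        _ = ‖v‖ ^ 2 * (κ / 2) := by field_simp
        _ ≤ _ := by gcongr

end Setup

/-! ### A smooth profile -/

theorem hasDerivAt_max_zero_sq (s : ℝ) :
    HasDerivAt (fun s : ℝ => max s 0 ^ 2) (2 * max s 0) s := by
  rcases lt_trichotomy s 0 with h | rfl | h
  · rw [max_eq_right h.le, mul_zero]
    refine (hasDerivAt_const s (0 : ℝ)).congr_of_eventuallyEq ?_
    filter_upwards [Iio_mem_nhds h] with t ht
    rw [max_eq_right (le_of_lt ht)]; norm_num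
  · rw [max_self, mul_zero, hasDerivAt_iff_isLittleO_nhds_zero]
    simp only [zero_add, max_self, smul_zero, sub_zero]
    refine Asymptotics.IsLittleO.of_bound fun ε hε => ?_
    filter_upwards [Metric.ball_mem_nhds (0 : ℝ) hε] with t ht
    rw [mem_ball_zero_iff, Real.norm_eq_abs] at ht
    have h1 : |max t 0| ≤ |t| := by
      rcases le_total t 0 with h | h
      · rw [max_eq_right h]; simp
      · rw [max_eq_left h]
    have h2 : ‖max t 0 ^ 2 - 0 ^ 2‖ = |max t 0| ^ 2 := by simp
    rw [h2, Real.norm_eq_abs]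
    nlinarith [abs_nonneg t, abs_nonneg (max t 0)]
  · rw [max_eq_left h.le]
    refine ((hasDerivAt_pow 2 s).congr_of_eventuallyEq ?_).congr_deriv (by norm_num)
    filter_upwards [Ioi_mem_nhds h] with t ht
    rw [max_eq_left (le_of_lt ht)]

/-- The profile along which two functions are joined: its slope `θ` increases from `0` to `1`, fast
enough on the scale of `θ (1 - θ)`. -/
theorem exists_profile {k Λ : ℝ} (hk : 0 < k) (hΛ : k ^ 2 / 4 ≤ Λ) : ∃ F θ θ' : ℝ → ℝ,
    ContDiff ℝ 2 F ∧ (∀ s, HasDerivAt F (θ s) s) ∧ (∀ s, HasDerivAt θ (θ' s) s) ∧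
    (∀ s, s ≤ 0 → F s = 0) ∧ (∀ s, 0 < s → θ s = 1 - Real.exp (-(Λ * s ^ 2))) ∧
    (∀ s, 0 < s → 0 < θ s) ∧
    ∀ s, 0 ≤ θ s ∧ θ s < 1 ∧ k * (θ s * (1 - θ s)) ≤ θ' s := by
  have hΛ0 : 0 < Λ := lt_of_lt_of_le (by positivity) hΛ
  set θ : ℝ → ℝ := fun s => 1 - Real.exp (-(Λ * max s 0 ^ 2)) with hθ
  set θ' : ℝ → ℝ := fun s => Real.exp (-(Λ * max s 0 ^ 2)) * (Λ * (2 * max s 0)) with hθ'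
  have hd : ∀ s, HasDerivAt θ (θ' s) s := fun s =>
    (((hasDerivAt_max_zero_sq s).const_mul Λ).neg.exp.const_sub 1).congr_deriv (by
      simp only [hθ', Pi.neg_apply]; ring)
  have hθc : Continuous θ := continuous_iff_continuousAt.2 fun s => (hd s).continuousAt
  have hθ'c : Continuous θ' := by fun_prop
  set F : ℝ → ℝ := fun s => ∫ t in (0 : ℝ)..s, θ t with hF
  have hFd : ∀ s, HasDerivAt F (θ s) s := fun s =>
    intervalIntegral.integral_hasDerivAt_right (hθc.intervalIntegrable _ _)
      (hθc.stronglyMeasurableAtFilter _ _) hθc.continuousAt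
  have hθ0 : ∀ s, s ≤ 0 → θ s = 0 := by
    intro s hs
    simp [hθ, max_eq_right hs]
  refine ⟨F, θ, θ', ?_, hFd, hd, fun s hs => ?_, fun s hs => ?_, fun s hs => ?_, fun s => ?_⟩
  · have h1 : deriv F = θ := funext fun s => (hFd s).deriv
    have h2 : deriv θ = θ' := funext fun s => (hd s).deriv
    rw [show (2 : WithTop ℕ∞) = 1 + 1 by norm_num, contDiff_succ_iff_deriv, h1,
      contDiff_one_iff_deriv, h2]
    exact ⟨fun s => (hFd s).differentiableAt, by simp, fun s => (hd s).differentiableAt, hθ'c⟩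
  · have h1 : EqOn θ (fun _ => 0) (uIcc 0 s) := by
      intro t ht
      rw [uIcc_of_ge hs] at ht
      exact hθ0 t ht.2
    simp only [hF]
    rw [intervalIntegral.integral_congr h1]
    simp
  · simp [hθ, max_eq_left hs.le]
  · simp only [hθ, max_eq_left hs.le, sub_pos, Real.exp_lt_one_iff]
    have : 0 < Λ * s ^ 2 := by positivity
    linarith
  · have hm : 0 ≤ max s 0 := le_max_right _ _
    set m := max s 0 with hm'
    have he1 : Real.exp (-(Λ * m ^ 2)) ≤ 1 := Real.exp_le_one_iff.2 (by
      have : 0 ≤ Λ * m ^ 2 := by positivity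
      linarith)
    have he0 := Real.exp_pos (-(Λ * m ^ 2))
    have he2 : 1 - Real.exp (-(Λ * m ^ 2)) ≤ Λ * m ^ 2 := by
      have := Real.add_one_le_exp (-(Λ * m ^ 2))
      linarith
    have hθs : θ s = 1 - Real.exp (-(Λ * m ^ 2)) := rfl
    have hθs' : θ' s = Real.exp (-(Λ * m ^ 2)) * (Λ * (2 * m)) := rfl
    rw [hθs, hθs']
    set e := Real.exp (-(Λ * m ^ 2))
    refine ⟨by linarith, by linarith, ?_⟩
    have key : k * (1 - e) ≤ Λ * (2 * m) := by
      rcases le_total (k * m) 2 with h | h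
      · calc k * (1 - e) ≤ k * (Λ * m ^ 2) := by gcongr
          _ = (Λ * m) * (k * m) := by ring
          _ ≤ (Λ * m) * 2 := by gcongr
          _ = _ := by ring
      · have h1 : k * k ≤ k * (Λ * (2 * m)) := by
          calc k * k ≤ 4 * Λ := by nlinarith
            _ ≤ (2 * Λ) * (k * m) := by nlinarith
            _ = _ := by ring
        have h2 : k ≤ Λ * (2 * m) := le_of_mul_le_mul_left h1 hk
        nlinarith
    nlinarith

section Touching

variable {n : ℕ}

theorem gradient_real_comp {F : ℝ → ℝ} {θ : ℝ} {f : E n → ℝ} {x : E n}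
    (hF : HasDerivAt F θ (f x)) (hf : DifferentiableAt ℝ f x) :
    gradient (fun z => F (f z)) x = θ • gradient f x := by
  rw [eq_gradient_iff]
  intro v
  have h := hF.comp_hasFDerivAt x hf.hasFDerivAt
  rw [show (fun z => F (f z)) = F ∘ f from rfl, h.fderiv, inner_smul_left, inner_gradient]
  simp

theorem sndDeriv_real_comp {F θ θ' : ℝ → ℝ} (hF : ContDiff ℝ 2 F)
    (h1 : ∀ s, HasDerivAt F (θ s) s) (h2 : ∀ s, HasDerivAt θ (θ' s) s) {f : E n → ℝ}
    (hf : ContDiff ℝ 2 f) (x ξ : E n) :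
    sndDeriv (fun z => F (f z)) x ξ =
      θ' (f x) * inner ℝ (gradient f x) ξ ^ 2 + θ (f x) * sndDeriv f x ξ := by
  rw [sndDeriv_comp hF hf, sndDeriv_eq_fderiv hF]
  have h3 : (fun z => fderiv ℝ F z (fderiv ℝ f x ξ)) = fun z => θ z * fderiv ℝ f x ξ := by
    ext z
    rw [(h1 z).hasFDerivAt.fderiv]
    simp [mul_comm]
  rw [h3, ((h2 (f x)).mul_const _).hasFDerivAt.fderiv, (h1 (f x)).hasFDerivAt.fderiv,
    inner_gradient]
  simp
  ring

theorem gradient_add_smul {u G : E n → ℝ} {x : E n} (hu : DifferentiableAt ℝ u x)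
    (hG : DifferentiableAt ℝ G x) (η : ℝ) :
    gradient (fun z => u z + η • G z) x = gradient u x + η • gradient G x := by
  rw [eq_gradient_iff]
  intro v
  have h : HasFDerivAt (fun z => u z + η • G z) _ x := hu.hasFDerivAt.add (hG.hasFDerivAt.const_smul η)
  rw [h.fderiv, inner_add_left, inner_smul_left,
    inner_gradient, inner_gradient]
  simp

theorem sndDeriv_add_smul {u G : E n → ℝ} (hu : ContDiff ℝ 2 u) (hG : ContDiff ℝ 2 G) (η : ℝ)
    (x ξ : E n) :
    sndDeriv (fun z => u z + η • G z) x ξ = sndDeriv u x ξ + η * sndDeriv G x ξ := by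
  rw [sndDeriv_add hu (hG.const_smul η), sndDeriv_const_smul hG, smul_eq_mul]

theorem continuous_gradient {u : E n → ℝ} (hu : ContDiff ℝ 1 u) : Continuous (gradient u) :=
  (contDiff_gradient (k := 0) hu).continuous

namespace Setup

variable {c : E n → E n → ℝ} {Ω Ωs : Set (E n)} {φ φs : E n → ℝ}
  {X Y : E n × E n → E n} (S : Setup c Ω Ωs φ φs X Y)

include S

theorem continuous_Aform : Continuous fun z : E n × E n × E n => Aform c Y z.2.1 z.1 z.2.2 :=
  S.contDiff_Aform.continuous

theorem fderiv_Aform_eq (x ξ p w : E n) : fderiv ℝ (Aform c Y x ξ) p w =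
    fderiv ℝ (fun z : E n × E n × E n => Aform c Y z.2.1 z.1 z.2.2) (ξ, x, p) (0, 0, w) := by
  have h0 : HasFDerivAt (𝕜 := ℝ) (fun p : E n => ((x, p) : E n × E n)) _ p :=
    (hasFDerivAt_const x p).prodMk (hasFDerivAt_id p)
  have h1 : HasFDerivAt (𝕜 := ℝ) (fun p : E n => ((ξ, x, p) : E n × E n × E n)) _ p :=
    (hasFDerivAt_const ξ p).prodMk h0
  have h2 := HasFDerivAt.comp (g := fun z : E n × E n × E n => Aform c Y z.2.1 z.1 z.2.2) p
    (S.contDiff_Aform.differentiable (by norm_num) _).hasFDerivAt h1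
  have h3 : Aform c Y x ξ = (fun z : E n × E n × E n => Aform c Y z.2.1 z.1 z.2.2) ∘
      fun p : E n => ((ξ, x, p) : E n × E n × E n) := rfl
  rw [h3, h2.fderiv]
  simp

theorem continuous_fderiv_Aform : Continuous fun z : E n × E n × E n × E n =>
    fderiv ℝ (Aform c Y z.1 z.2.1) z.2.2.1 z.2.2.2 := by
  simp only [S.fderiv_Aform_eq]
  exact ((S.contDiff_Aform.continuous_fderiv (by norm_num)).comp
    (continuous_snd.fst.prodMk (continuous_fst.prodMk continuous_snd.snd.fst))).clm_apply
    (continuous_const.prodMk (continuous_const.prodMk continuous_snd.snd.snd))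

/-- Strict ellipticity, together with the condition that `Tu` has values in `Ω*`, is stable under
perturbation in a family whose gradients depend continuously on the parameter. -/
theorem eventually_touch {A : Set ℝ} {U : ℝ → E n → ℝ}
    (hU : Continuous fun z : ℝ × E n => gradient (U z.1) z.2)
    (hx : ∀ x ∈ closure Ω, ∃ y ∈ Ωs, gradient (U 0) x = cX c x y)
    (hsnd : ∀ x ∈ closure Ω, ∀ ξ : E n, ‖ξ‖ = 1 → ∀ᶠ z : ℝ × (E n × E n) in 𝓝 (0, (x, ξ)),
      z.1 ∈ A → z.2.1 ∈ closure Ω → Aform c Y z.2.1 z.2.2 (gradient (U z.1) z.2.1) <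
        sndDeriv (U z.1) z.2.1 z.2.2) :
    ∀ᶠ m in 𝓝 (0 : ℝ), m ∈ A → ∀ x ∈ closure Ω, ∃ y ∈ Ωs, gradient (U m) x = cX c x y ∧
      ∀ ξ, ξ ≠ 0 → sndDeriv (fun z => c z y) x ξ < sndDeriv (U m) x ξ := by
  have h1 : ∀ᶠ m in 𝓝 (0 : ℝ), ∀ z ∈ closure Ω ×ˢ Metric.sphere (0 : E n) 1,
      m ∈ A → z.1 ∈ closure Ω → Aform c Y z.1 z.2 (gradient (U m) z.1) <
        sndDeriv (U m) z.1 z.2 := by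
    refine (S.isCompact_fst.prod (isCompact_sphere _ _)).eventually_forall_of_forall_eventually ?_
    rintro ⟨x, ξ⟩ ⟨hx, hξ⟩
    exact hsnd x hx ξ (by simpa using hξ)
  have h2 : ∀ᶠ m in 𝓝 (0 : ℝ), ∀ x ∈ closure Ω,
      cX c x (Y (x, gradient (U m) x)) = gradient (U m) x ∧ Y (x, gradient (U m) x) ∈ Ωs := by
    refine S.isCompact_fst.eventually_forall_of_forall_eventually fun x hx' => ?_
    obtain ⟨y, hy, hyx⟩ := hx x hx'
    have hc : Tendsto (fun z : ℝ × E n => (z.2, gradient (U z.1) z.2)) (𝓝 (0, x))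
        (𝓝 (x, cX c x y)) := by
      have := (continuous_snd.prodMk hU).tendsto ((0, x) : ℝ × E n)
      simp only [hyx] at this
      exact this
    have h3 : ∀ᶠ p in 𝓝 (x, cX c x y), Y p ∈ Ωs := by
      refine S.fst.smoothY.continuous.continuousAt.eventually (S.snd.isOpen.mem_nhds ?_)
      rw [S.Y_cX hx' (subset_closure hy)]
      exact hy
    exact hc.eventually ((S.fst.rightInv x hx' y (subset_closure hy)).and h3)
  filter_upwards [h1, h2] with m hm1 hm2 hmA x hx'
  obtain ⟨h3, h4⟩ := hm2 x hx'
  refine ⟨_, h4, h3.symm, fun ξ hξ => ?_⟩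
  have hξ' : 0 < ‖ξ‖ := norm_pos_iff.2 hξ
  have h5 := hm1 (x, ‖ξ‖⁻¹ • ξ) ⟨hx', by simp [norm_smul, hξ'.ne']⟩ hmA hx'
  simp only [Aform_smul, sndDeriv_smul, smul_eq_mul] at h5
  exact lt_of_mul_lt_mul_left h5 (by positivity)

/-- A degenerate subsolution becomes strict upon addition of a small multiple of a function which
is strictly elliptic, to first order, where the subsolution is degenerate. -/
theorem eventually_touch_add_smul {u G : E n → ℝ} (hu : ContDiff ℝ 2 u) (hG : ContDiff ℝ 2 G)
    (h : ∀ x ∈ closure Ω, ∃ y ∈ Ωs, gradient u x = cX c x y ∧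
      ∀ ξ, sndDeriv (fun z => c z y) x ξ ≤ sndDeriv u x ξ ∧
      (ξ ≠ 0 → sndDeriv (fun z => c z y) x ξ < sndDeriv u x ξ ∨
        fderiv ℝ (Aform c Y x ξ) (cX c x y) (gradient G x) < sndDeriv G x ξ)) :
    ∀ᶠ η in 𝓝 (0 : ℝ), η ∈ Ioi (0 : ℝ) → ∀ x ∈ closure Ω, ∃ y ∈ Ωs,
      gradient (fun z => u z + η • G z) x = cX c x y ∧
      ∀ ξ, ξ ≠ 0 → sndDeriv (fun z => c z y) x ξ < sndDeriv (fun z => u z + η • G z) x ξ := by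
  have hu1 : ContDiff ℝ 1 u := hu.of_le (by norm_num)
  have hG1 : ContDiff ℝ 1 G := hG.of_le (by norm_num)
  have hud := hu.differentiable (by norm_num)
  have hGd := hG.differentiable (by norm_num)
  have hcu := continuous_gradient hu1
  have hcG := continuous_gradient hG1
  have hg : ∀ η x, gradient (fun z => u z + η • G z) x = gradient u x + η • gradient G x :=
    fun η x => gradient_add_smul (hud x) (hGd x) η
  refine S.eventually_touch (U := fun η z => u z + η • G z) ?_ ?_ ?_
  · simp only [hg]
    exact (hcu.comp continuous_snd).add (continuous_fst.smul (hcG.comp continuous_snd))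
  · intro x hx
    obtain ⟨y, hy, h1, -⟩ := h x hx
    exact ⟨y, hy, by rw [hg, zero_smul, add_zero, h1]⟩
  intro x hx ξ hξ
  obtain ⟨y, hy, h1, h2⟩ := h x hx
  have hy' := subset_closure hy
  simp only [hg, sndDeriv_add_smul hu hG]
  have hξ0 : ξ ≠ 0 := by rintro rfl; simp at hξ
  set p : ℝ × (E n × E n) → E n := fun z => gradient u z.2.1 + z.1 • gradient G z.2.1 with hp
  have hpc : Continuous p := by
    simp only [hp]; fun_prop
  have hsu := continuous_sndDeriv hu
  have hsG := continuous_sndDeriv hG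
  have hp0 : p (0, (x, ξ)) = cX c x y := by simp [hp, h1]
  -- where `u` is strict the inequality is stable; elsewhere it improves with `η`, to first order
  rcases (h2 ξ).2 hξ0 with h3 | h3
  · have c1 : Continuous fun z : ℝ × (E n × E n) => Aform c Y z.2.1 z.2.2 (p z) :=
      S.continuous_Aform.comp (continuous_snd.snd.prodMk (continuous_snd.fst.prodMk hpc))
    have c2 : Continuous fun z : ℝ × (E n × E n) =>
        sndDeriv u z.2.1 z.2.2 + z.1 * sndDeriv G z.2.1 z.2.2 :=
      (hsu.comp continuous_snd).add (continuous_fst.mul (hsG.comp continuous_snd))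
    refine ((c1.tendsto _).eventually_lt (c2.tendsto _) ?_).mono fun z hz _ _ => hz
    simp only [hp0, zero_mul, add_zero]
    rwa [Aform_of_eq (S.Y_cX hx hy')]
  · have c1 : Continuous fun z : ℝ × (E n × E n) =>
        fderiv ℝ (Aform c Y z.2.1 z.2.2) (p z) (gradient G z.2.1) :=
      S.continuous_fderiv_Aform.comp (continuous_snd.fst.prodMk (continuous_snd.snd.prodMk
        (hpc.prodMk (hcG.comp continuous_snd.fst))))
    have c2 : Continuous fun z : ℝ × (E n × E n) => sndDeriv G z.2.1 z.2.2 :=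
      hsG.comp continuous_snd
    have h4 : ∀ᶠ z in 𝓝 ((0, (x, ξ)) : ℝ × (E n × E n)),
        fderiv ℝ (Aform c Y z.2.1 z.2.2) (p z) (gradient G z.2.1) < sndDeriv G z.2.1 z.2.2 :=
      (c1.tendsto _).eventually_lt (c2.tendsto _) (by simp only [hp0]; exact h3)
    obtain ⟨ε, hε, hball⟩ := Metric.eventually_nhds_iff_ball.1 h4
    filter_upwards [Metric.ball_mem_nhds _ hε] with z hz hz0 hzΩ
    obtain ⟨η, x', ξ'⟩ := z
    simp only [mem_Ioi] at hz0 hzΩ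
    set q := gradient u x' with hq
    set w := gradient G x' with hw
    have hA2 := S.contDiff_Aform_slice x' ξ'
    have hd : ∀ t : ℝ, HasDerivAt
        (fun t => sndDeriv u x' ξ' + t * sndDeriv G x' ξ' - Aform c Y x' ξ' (q + t • w))
        (sndDeriv G x' ξ' - fderiv ℝ (Aform c Y x' ξ') (q + t • w) w) t := fun t => by
      have e1 := hasDerivAt_line (Aform c Y x' ξ') (hA2.differentiable (by norm_num)) q w t
      exact (((hasDerivAt_id t).mul_const (sndDeriv G x' ξ')).const_add
        (sndDeriv u x' ξ')).sub e1 |>.congr_deriv (by simp)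
    have hmono := strictMonoOn_of_deriv_pos (convex_Icc 0 η)
      (continuousOn_of_forall_continuousAt fun t _ => (hd t).continuousAt) (fun t ht => by
        rw [interior_Icc] at ht
        rw [(hd t).deriv, sub_pos]
        have hmem : ((t, (x', ξ')) : ℝ × (E n × E n)) ∈ Metric.ball ((0 : ℝ), (x, ξ)) ε := by
          rw [Metric.mem_ball, Prod.dist_eq, max_lt_iff] at hz ⊢
          refine ⟨?_, hz.2⟩
          have := hz.1
          simp only [Real.dist_eq, sub_zero] at this ⊢
          rw [abs_of_pos ht.1]
          rw [abs_of_pos hz0] at this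
          linarith [ht.2]
        exact hball _ hmem)
    have h5 := hmono (left_mem_Icc.2 hz0.le) (right_mem_Icc.2 hz0.le) hz0
    obtain ⟨y', hy2, h6, h7⟩ := h x' hzΩ
    have h8 := (h7 ξ').1
    rw [← Aform_of_eq (Y := Y) (p := q) (by rw [hq, h6, S.Y_cX hzΩ (subset_closure hy2)])] at h8
    simp only [zero_mul, zero_smul, add_zero] at h5
    show Aform c Y x' ξ' (q + η • w) < sndDeriv u x' ξ' + η * sndDeriv G x' ξ'
    linarith

omit S in
theorem contDiff_mollify_slice {W : Type*} [NormedAddCommGroup W] [NormedSpace ℝ W] [CompleteSpace W]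
    {ρ : E n → ℝ} (hρ : ContDiff ℝ ∞ ρ) (hc : HasCompactSupport ρ) {f : E n → W} {k : ℕ}
    (hf : ContDiff ℝ k f) : ContDiff ℝ k fun z : ℝ × E n => mollify ρ f z.2 z.1 := by
  have h := contDiff_mollify hρ hc (P := ℝ) (f := fun _ => f) (k := k)
    (hf.comp contDiff_snd)
  exact h.comp (contDiff_const (c := (0 : ℝ)) |>.prodMk (contDiff_snd.prodMk contDiff_fst))

/-- Strict subsolutions of class `C²` remain strict under mollification. -/
theorem eventually_touch_mollify {ρ : E n → ℝ} (hρ : ContDiff ℝ ∞ ρ) (hc : HasCompactSupport ρ)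
    (h1 : ∫ z, ρ z = 1) {u : E n → ℝ} (hu : ContDiff ℝ 2 u)
    (h : ∀ x ∈ closure Ω, ∃ y ∈ Ωs, gradient u x = cX c x y ∧
      ∀ ξ, ξ ≠ 0 → sndDeriv (fun z => c z y) x ξ < sndDeriv u x ξ) :
    ∀ᶠ m in 𝓝 (0 : ℝ), ∀ x ∈ closure Ω, ∃ y ∈ Ωs,
      gradient (fun x => mollify ρ u x m) x = cX c x y ∧
      ∀ ξ, ξ ≠ 0 → sndDeriv (fun z => c z y) x ξ < sndDeriv (fun x => mollify ρ u x m) x ξ := by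
  have hu1 : ContDiff ℝ 1 u := hu.of_le (by norm_num)
  have hgu : ContDiff ℝ 1 (gradient u) := contDiff_gradient (k := 1) hu
  set V : ℝ × E n → E n := fun z => mollify ρ (gradient u) z.2 z.1 with hV
  have hVc : ContDiff ℝ 1 V := contDiff_mollify_slice hρ hc (k := 1) hgu
  have hg : ∀ m x, gradient (fun x => mollify ρ u x m) x = V (m, x) := fun m x =>
    gradient_mollify hρ.continuous hc hu1 x m
  have hU2 : ∀ m, ContDiff ℝ 2 fun x => mollify ρ u x m := fun m =>
    (contDiff_mollify_slice hρ hc (k := 2) hu).comp (contDiff_mk_right m)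
  have hs : ∀ m x ξ, sndDeriv (fun x => mollify ρ u x m) x ξ =
      inner ℝ (fderiv ℝ V (m, x) (0, ξ)) ξ := by
    intro m x ξ
    rw [← inner_hess_self (hU2 m), hess]
    have e1 : gradient (fun x => mollify ρ u x m) = fun x => V (m, x) := funext fun x => hg m x
    rw [e1, fderiv_slice_right (hVc.differentiable (by norm_num))]
  have hm0 : (fun x => mollify ρ u x 0) = u := funext fun x => mollify_zero h1 u x
  have key := S.eventually_touch (A := univ) (U := fun m x => mollify ρ u x m) ?_ ?_ ?_
  · exact key.mono fun m hm => hm (mem_univ _)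
  · simp only [hg]
    exact hVc.continuous
  · intro x hx
    obtain ⟨y, hy, h2, -⟩ := h x hx
    refine ⟨y, hy, ?_⟩
    simp only [hm0]
    exact h2
  · intro x hx ξ hξ
    obtain ⟨y, hy, h2, h3⟩ := h x hx
    have hξ0 : ξ ≠ 0 := by rintro rfl; simp at hξ
    have h4 := h3 ξ hξ0
    rw [← Aform_of_eq (Y := Y) (p := gradient u x) (by rw [h2, S.Y_cX hx (subset_closure hy)]),
      ← hm0] at h4
    simp only [hg] at h4 ⊢
    have c1 : Continuous fun z : ℝ × (E n × E n) => Aform c Y z.2.1 z.2.2 (V (z.1, z.2.1)) :=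
      S.continuous_Aform.comp (continuous_snd.snd.prodMk (continuous_snd.fst.prodMk
        (hVc.continuous.comp (continuous_fst.prodMk continuous_snd.fst))))
    have c2 : Continuous fun z : ℝ × (E n × E n) =>
        sndDeriv (fun x => mollify ρ u x z.1) z.2.1 z.2.2 := by
      simp only [hs]
      exact Continuous.inner (((hVc.continuous_fderiv (by norm_num)).comp
        (continuous_fst.prodMk continuous_snd.fst)).clm_apply
        (continuous_const.prodMk continuous_snd.snd)) continuous_snd.snd
    exact ((c1.tendsto _).eventually_lt (c2.tendsto _) h4).mono fun z hz _ _ => hz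

/-- Points of the open `c`-segment from an interior point to a boundary point are interior. -/
theorem exists_cX_segment_mem {x y₀ y₁ : E n} (hx : x ∈ closure Ω) (h0 : y₀ ∈ Ωs)
    (h1 : y₁ ∈ closure Ωs) {t : ℝ} (ht : t ∈ Ico (0 : ℝ) 1) :
    ∃ y ∈ Ωs, cX c x y = cX c x y₀ + t • (cX c x y₁ - cX c x y₀) := by
  obtain ⟨y, hy, he⟩ := S.exists_cX_segment hx (subset_closure h0) h1 ⟨ht.1, ht.2.le⟩
  by_cases hyΩ : y ∈ Ωs
  · exact ⟨y, hyΩ, he⟩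
  exfalso
  have hyf : y ∈ frontier Ωs := by
    rw [S.snd.isOpen.frontier_eq]; exact ⟨hy, hyΩ⟩
  have h2 := S.swap.fderiv_comp_X_neg hyf h0 hx
  have h3 := S.swap.fderiv_comp_X_nonpos hyf h1 hx
  rw [S.swap.fderiv_comp_X (S.snd.defining.smooth.of_le two_le_four) hy hx] at h3
  change fderiv ℝ φs y (vel Y x (cX c x y) (cX c x y₀ - cX c x y)) < 0 at h2
  change fderiv ℝ φs y (vel Y x (cX c x y) (cX c x y₁ - cX c x y)) ≤ 0 at h3
  have e1 : (1 - t) • (cX c x y₀ - cX c x y) = -(t • (cX c x y₁ - cX c x y)) := by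
    rw [he]; module
  have e2 : (1 - t) * fderiv ℝ φs y (vel Y x (cX c x y) (cX c x y₀ - cX c x y)) =
      -(t * fderiv ℝ φs y (vel Y x (cX c x y) (cX c x y₁ - cX c x y))) := by
    have := congrArg (fun w => fderiv ℝ φs y (vel Y x (cX c x y) w)) e1
    unfold vel at this ⊢
    simpa using this
  have e3 : 0 < 1 - t := by linarith [ht.2]
  nlinarith [mul_neg_of_pos_of_neg e3 h2, mul_nonneg ht.1 (neg_nonneg.2 h3)]

end Setup

end Touching

/-! ### Joining a cost function to the c-cone -/

/-- The elementary inequality behind the ellipticity of the joined function. -/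
theorem ellipticity_of_profile {K k μ θ θ' Q t s B : ℝ} (hμ : 0 < μ)
    (hk : k = 1 + K ^ 2 / (2 * μ)) (hθ0 : 0 ≤ θ) (hθ1 : θ < 1) (hθ' : k * (θ * (1 - θ)) ≤ θ')
    (hQ : 0 ≤ Q) (hQμ : μ * s ^ 2 ≤ Q + t ^ 2) (hB : -(K * |t| * s * (θ * (1 - θ))) ≤ B) :
    θ * (1 - θ) * (μ / 2 * s ^ 2) ≤ B + θ * Q + θ' * t ^ 2 := by
  have he : 0 ≤ θ * (1 - θ) := mul_nonneg hθ0 (by linarith)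
  have h1 : θ * (1 - θ) * Q ≤ θ * Q := by
    have : θ * (1 - θ) ≤ θ := by nlinarith
    gcongr
  have h2 : k * (θ * (1 - θ)) * t ^ 2 ≤ θ' * t ^ 2 := by gcongr
  have h3 : 0 ≤ Q + k * t ^ 2 - K * |t| * s - μ / 2 * s ^ 2 := by
    have h4 : (1 / (2 * μ)) * (K * |t| - μ * s) ^ 2 =
        K ^ 2 / (2 * μ) * t ^ 2 - K * |t| * s + μ / 2 * s ^ 2 := by
      rw [← sq_abs t]; field_simp; ring
    have h5 : 0 ≤ (1 / (2 * μ)) * (K * |t| - μ * s) ^ 2 := by positivity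
    rw [h4] at h5
    rw [hk]
    nlinarith
  nlinarith [mul_nonneg he h3]

section Joining

variable {n : ℕ}

theorem gradient_congr {f g : E n → ℝ} {x : E n} (h : f =ᶠ[𝓝 x] g) : gradient f x = gradient g x := by
  unfold gradient
  rw [Filter.EventuallyEq.fderiv_eq h]

theorem contDiff_half_norm_sq (x₀ : E n) {k : WithTop ℕ∞} :
    ContDiff ℝ k fun x : E n => ‖x - x₀‖ ^ 2 / 2 :=
  ((contDiff_id.sub contDiff_const).norm_sq ℝ).div_const 2

theorem gradient_half_norm_sq (x₀ x : E n) : gradient (fun x : E n => ‖x - x₀‖ ^ 2 / 2) x = x - x₀ := by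
  rw [eq_gradient_iff]
  intro v
  have h1 : HasFDerivAt (fun x : E n => x - x₀) (ContinuousLinearMap.id ℝ (E n)) x :=
    (hasFDerivAt_id x).sub_const x₀
  have h2 : HasFDerivAt (fun x : E n => (2 : ℝ)⁻¹ • ‖x - x₀‖ ^ 2) _ x :=
    h1.norm_sq.const_smul (2 : ℝ)⁻¹
  have h3 : (fun x : E n => ‖x - x₀‖ ^ 2 / 2) = fun x : E n => (2 : ℝ)⁻¹ • ‖x - x₀‖ ^ 2 := by
    ext z; rw [smul_eq_mul]; ring
  rw [h3, h2.fderiv]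
  simp [inner_sub_left]

theorem sndDeriv_half_norm_sq (x₀ x ξ : E n) :
    sndDeriv (fun x : E n => ‖x - x₀‖ ^ 2 / 2) x ξ = ‖ξ‖ ^ 2 := by
  rw [← inner_hess_self (contDiff_half_norm_sq x₀), hess]
  have h1 : gradient (fun x : E n => ‖x - x₀‖ ^ 2 / 2) = fun x => x - x₀ :=
    funext fun x => gradient_half_norm_sq x₀ x
  have h2 : HasFDerivAt (fun x : E n => x - x₀) (ContinuousLinearMap.id ℝ (E n)) x :=
    (hasFDerivAt_id x).sub_const x₀
  rw [h1, h2.fderiv]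
  simp

namespace Setup

variable {c : E n → E n → ℝ} {Ω Ωs : Set (E n)} {φ φs : E n → ℝ}
  {X Y : E n × E n → E n} (S : Setup c Ω Ωs φ φs X Y)

include S

/-- A function supported near `x₀` which to first order makes `c(·, y₀)` strictly elliptic near
`x₀`. -/
theorem exists_local_bump {x₀ y₀ : E n} (hx₀ : x₀ ∈ Ω) : ∃ (r R : ℝ) (G : E n → ℝ), 0 < r ∧ r ≤ R ∧
    Metric.closedBall x₀ R ⊆ Ω ∧ ContDiff ℝ 2 G ∧
    (∀ x, x ∉ Metric.closedBall x₀ R → gradient G x = 0) ∧ gradient G x₀ = 0 ∧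
    ∀ x ∈ Metric.ball x₀ r, ∀ ξ, ξ ≠ 0 →
      fderiv ℝ (Aform c Y x ξ) (cX c x y₀) (gradient G x) < sndDeriv G x ξ := by
  obtain ⟨R, hR, hRΩ⟩ := Metric.nhds_basis_closedBall.mem_iff.1 (S.fst.isOpen.mem_nhds hx₀)
  have hev : ∀ᶠ x in 𝓝 x₀, ∀ ξ ∈ Metric.sphere (0 : E n) 1,
      fderiv ℝ (Aform c Y x ξ) (cX c x y₀) (x - x₀) < 1 := by
    refine (isCompact_sphere _ _).eventually_forall_of_forall_eventually fun ξ hξ => ?_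
    have hc : Continuous fun z : E n × E n =>
        fderiv ℝ (Aform c Y z.1 z.2) (cX c z.1 y₀) (z.1 - x₀) :=
      S.continuous_fderiv_Aform.comp (continuous_fst.prodMk (continuous_snd.prodMk
        (((continuous_cX S.hc).comp (continuous_fst.prodMk continuous_const)).prodMk
          (continuous_fst.sub continuous_const))))
    refine (hc.tendsto (x₀, ξ)).eventually (gt_mem_nhds ?_)
    simp
  obtain ⟨r₁, hr₁, hball⟩ := Metric.eventually_nhds_iff_ball.1 hev
  set r := min r₁ (R / 2) with hr
  have hr0 : 0 < r := lt_min hr₁ (by linarith)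
  have hrR : r < R := lt_of_le_of_lt (min_le_right _ _) (by linarith)
  let b : ContDiffBump x₀ := ⟨r, R, hr0, hrR⟩
  set G : E n → ℝ := fun x => b x * (‖x - x₀‖ ^ 2 / 2) with hG
  have hGin : ∀ x ∈ Metric.ball x₀ r, G =ᶠ[𝓝 x] fun x => ‖x - x₀‖ ^ 2 / 2 := by
    intro x hx
    filter_upwards [Metric.isOpen_ball.mem_nhds hx] with z hz
    have : b z = 1 := b.one_of_mem_closedBall (Metric.ball_subset_closedBall hz)
    simp [hG, this]
  refine ⟨r, R, G, hr0, hrR.le, hRΩ, b.contDiff.mul (contDiff_half_norm_sq x₀), fun x hx => ?_, ?_,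
    fun x hx ξ hξ => ?_⟩
  · have h1 : G =ᶠ[𝓝 x] fun _ => 0 := by
      filter_upwards [Metric.isClosed_closedBall.isOpen_compl.mem_nhds hx] with z hz
      have : b z = 0 := b.zero_of_le_dist (by
        have : ¬ dist z x₀ ≤ R := hz
        exact (not_le.1 this).le)
      simp [hG, this]
    rw [gradient_congr h1, eq_gradient_iff]
    simp
  · rw [gradient_congr (hGin x₀ (Metric.mem_ball_self hr0)), gradient_half_norm_sq, sub_self]
  · rw [gradient_congr (hGin x hx), sndDeriv_congr (hGin x hx), gradient_half_norm_sq,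
      sndDeriv_half_norm_sq]
    have hξ' : 0 < ‖ξ‖ := norm_pos_iff.2 hξ
    have h1 := hball x (Metric.ball_subset_ball (min_le_left _ _) hx) (‖ξ‖⁻¹ • ξ)
      (by simp [norm_smul, hξ'.ne'])
    rw [Aform_smul, fderiv_fun_const_smul
      ((S.contDiff_Aform_slice x ξ).differentiable (by norm_num) _)] at h1
    simp only [_root_.smul_apply, smul_eq_mul] at h1
    rw [inv_pow, inv_mul_lt_iff₀ (by positivity), mul_one] at h1
    exact h1

/-- A uniform lower bound for the curvature of the `c`-cone, its radial direction included. -/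
theorem exists_cone_bound {y₀ : E n} {y₁ : E n → E n} {f : E n → ℝ} (hy₁ : Continuous y₁)
    (hf : ContDiff ℝ 2 f) {M : Set (E n)} (hM : IsCompact M)
    (h : ∀ x ∈ M, ∀ ξ, ξ ≠ 0 → 0 < sndDeriv f x ξ + sndDeriv (fun z => c z y₀) x ξ -
        sndDeriv (fun z => c z (y₁ x)) x ξ + inner ℝ (cX c x (y₁ x) - cX c x y₀) ξ ^ 2) :
    ∃ μ : ℝ, 0 < μ ∧ ∀ x ∈ M, ∀ ξ, μ * ‖ξ‖ ^ 2 ≤ sndDeriv f x ξ +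
      sndDeriv (fun z => c z y₀) x ξ - sndDeriv (fun z => c z (y₁ x)) x ξ +
      inner ℝ (cX c x (y₁ x) - cX c x y₀) ξ ^ 2 := by
  have hcs : ∀ {y : E n → E n}, Continuous y → Continuous fun z : E n × E n =>
      sndDeriv (fun w => c w (y z.1)) z.1 z.2 := fun hy =>
    (contDiff_sndDeriv_cost S.hc).continuous.comp (continuous_snd.prodMk
      (continuous_fst.prodMk (hy.comp continuous_fst)))
  have hca : ∀ {y : E n → E n}, Continuous y → Continuous fun z : E n × E n =>
      cX c z.1 (y z.1) := fun hy =>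
    (continuous_cX S.hc).comp (continuous_fst.prodMk (hy.comp continuous_fst))
  have hcont : Continuous fun z : E n × E n => sndDeriv f z.1 z.2 +
      sndDeriv (fun w => c w y₀) z.1 z.2 - sndDeriv (fun w => c w (y₁ z.1)) z.1 z.2 +
      inner ℝ (cX c z.1 (y₁ z.1) - cX c z.1 y₀) z.2 ^ 2 :=
    (((continuous_sndDeriv hf).add (hcs (y := fun _ => y₀) continuous_const)).sub
      (hcs hy₁)).add ((((hca hy₁).sub (hca (y := fun _ => y₀) continuous_const)).inner
        continuous_snd).pow 2)
  obtain ⟨μ, hμ, hle⟩ := (hM.prod (isCompact_sphere (0 : E n) 1)).exists_forall_le'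
    hcont.continuousOn (a := 0) (fun z hz => h z.1 hz.1 z.2 (by
      rintro h0
      have := hz.2
      rw [h0] at this
      simp at this))
  refine ⟨μ, hμ, fun x hx ξ => ?_⟩
  rcases eq_or_ne ξ 0 with rfl | hξ
  · simp [sndDeriv_zero]
  have hξ' : 0 < ‖ξ‖ := norm_pos_iff.2 hξ
  have h1 := hle (x, ‖ξ‖⁻¹ • ξ) ⟨hx, by simp [norm_smul, hξ'.ne']⟩
  simp only [sndDeriv_smul, smul_eq_mul, inner_smul_right] at h1
  have h2 := mul_le_mul_of_nonneg_right h1 (sq_nonneg ‖ξ‖)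
  refine h2.trans (le_of_eq ?_)
  field_simp

/-- The functions joining `c(·, y₀)` near `x₀` to the `c`-cone with vertex `x₀` near the boundary:
strict subsolutions whose gradient near the boundary is the member `g(·, τ)` of a smooth family
with `g(·, 0)` the gradient of the cone. -/
theorem exists_joined_family {x₀ y₀ : E n} (hx₀ : x₀ ∈ Ω) (hy₀ : y₀ ∈ Ωs) :
    ∃ (y₁ : E n → E n) (g : ℝ × E n → E n) (O : Set (E n)),
    ContDiff ℝ 3 y₁ ∧ ContDiff ℝ 3 g ∧ IsOpen O ∧ frontier Ω ⊆ O ∧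
    (∀ a ∈ frontier Ω, y₁ a ∈ frontier Ωs) ∧ (∀ a ∈ frontier Ω, ∀ᶠ z in 𝓝 a, φs (y₁ z) = 0) ∧
    InjOn y₁ (frontier Ω) ∧
    (∀ a ∈ frontier Ω, ∀ α, fderiv ℝ φ a α = 0 → fderiv ℝ y₁ a α = 0 → α = 0) ∧
    (∀ a ∈ frontier Ω, 0 < fderiv ℝ φs (y₁ a) (vel Y a (cX c a (y₁ a)) (gradient φ a))) ∧
    (∀ z, g (0, z) = cX c z (y₁ z)) ∧
    ∀ᶠ τ in 𝓝[>] (0 : ℝ), ∃ u : E n → ℝ, ContDiff ℝ 2 u ∧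
      (∀ x ∈ closure Ω, ∃ y ∈ Ωs, gradient u x = cX c x y ∧
        ∀ ξ, ξ ≠ 0 → sndDeriv (fun z => c z y) x ξ < sndDeriv u x ξ) ∧
      (∀ x ∈ O, gradient u x = g (τ, x)) ∧ gradient u x₀ = cX c x₀ y₀ := by
  obtain ⟨r₂, R, G, hr₂, hrR, hRΩ, hG, hG0, hGx₀, hGell⟩ := S.exists_local_bump (y₀ := y₀) hx₀
  have hcE := S.continuous_coneExcess x₀ y₀
  obtain ⟨s₂, hs₂, hs₂le⟩ := (S.isCompact_fst.diff (Metric.isOpen_ball (x := x₀)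
    (ε := r₂))).exists_forall_le' hcE.continuousOn (a := 0) (fun x hx => S.coneExcess_pos hy₀ (by
      rintro rfl
      exact hx.2 (Metric.mem_ball_self hr₂)))
  -- the level `s₁` at which the two functions are joined: `σ > 0` outside the ball of radius `r₂`,
  -- and
  -- `σ < 0` in a ball of radius more than `3r`
  set s₁ := s₂ / 2 with hs₁
  have hs₁0 : 0 < s₁ := by positivity
  obtain ⟨r', hr', hr'lt⟩ := Metric.eventually_nhds_iff_ball.1 (hcE.continuousAt.eventually
    (gt_mem_nhds (show coneExcess c Ωs x₀ y₀ x₀ < s₁ by rwa [S.coneExcess_self])))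
  set r := min r' r₂ / 4 with hr
  have hm : 0 < min r' r₂ := lt_min hr' hr₂
  have hr0 : 0 < r := by positivity
  have h3r' : 3 * r < r' := by have := min_le_left r' r₂; rw [hr]; linarith
  have h3r₂ : 3 * r < r₂ := by have := min_le_right r' r₂; rw [hr]; linarith
  have h3Ω : Metric.ball x₀ (3 * r) ⊆ Ω := (Metric.ball_subset_closedBall.trans
    (Metric.closedBall_subset_closedBall (by linarith))).trans hRΩ
  obtain ⟨y₁, f, hy₁, hf, hcone, hQ, hinj, hcr⟩ := S.exists_cone hx₀ hy₀ hr0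
    ((Metric.closedBall_subset_closedBall (by linarith)).trans hRΩ)
  have hfR : ∀ a ∈ frontier Ω, a ∉ Metric.closedBall x₀ R := by
    intro a ha hb
    rw [S.fst.isOpen.frontier_eq] at ha
    exact ha.2 (hRΩ hb)
  have hfr : ∀ a ∈ frontier Ω, a ∈ closure Ω \ Metric.ball x₀ r := fun a ha =>
    ⟨frontier_subset_closure ha, fun hb => hfR a ha (Metric.ball_subset_closedBall.trans
      (Metric.closedBall_subset_closedBall (by linarith)) hb)⟩
  have hfr₂ : ∀ a ∈ frontier Ω, a ∈ closure Ω \ Metric.ball x₀ r₂ := fun a ha =>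
    ⟨frontier_subset_closure ha, fun hb => hfR a ha (Metric.ball_subset_closedBall.trans
      (Metric.closedBall_subset_closedBall (by linarith)) hb)⟩
  set σ : E n → ℝ := fun x => f x - s₁ with hσ
  have hσc : ContDiff ℝ 3 σ := hf.sub contDiff_const
  have hσpos : ∀ x ∈ closure Ω \ Metric.ball x₀ r₂, 0 < σ x := by
    intro x hx
    have h1 := hs₂le x hx
    have h2 := (hcone x ⟨hx.1, fun hb => hx.2 (Metric.ball_subset_ball (by linarith) hb)⟩).2.1
    simp only [hσ, h2, hs₁]
    linarith
  set w : E n → E n := fun z => cX c z (y₁ z) - cX c z y₀ with hw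
  have hp1 : ContDiff ℝ 3 fun z => cX c z (y₁ z) :=
    (contDiff_cX S.hc).comp (contDiff_id.prodMk hy₁)
  have hp0 : ContDiff ℝ 3 fun z => cX c z y₀ :=
    (contDiff_cX S.hc).comp (contDiff_id.prodMk contDiff_const)
  have hwc : ContDiff ℝ 3 w := hp1.sub hp0
  -- `m = σ⁻²` near `∂Ω`, so that `expNegInvGlue (τ m) = exp(-σ² / τ)`, smooth up to `τ = 0`
  obtain ⟨m, hmc, O', hO', hfO', hO'σ, hmO'⟩ := exists_contDiff_eqOn_nhds (k := 3)
    (f := fun x => (σ x ^ 2)⁻¹) S.isCompact_frontier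
    (isOpen_lt continuous_const hσc.continuous) (fun a ha => hσpos a (hfr₂ a ha))
    (fun x hx => by
      have hx' : 0 < σ x := hx
      exact (hσc.contDiffAt.pow 2).inv (by positivity))
  set g : ℝ × E n → E n := fun z => cX c z.2 y₀ + (1 - expNegInvGlue (z.1 * m z.2)) • w z.2 with hg
  have hgc : ContDiff ℝ 3 g := by
    have he : ContDiff ℝ 3 expNegInvGlue := expNegInvGlue.contDiff (n := 3)
    exact (hp0.comp contDiff_snd).add ((contDiff_const.sub
      (he.comp (contDiff_fst.mul (hmc.comp contDiff_snd)))).smul (hwc.comp contDiff_snd))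
  set O₁ := interior {z | gradient f z = w z} with hO₁
  have hMO₁ : ∀ x ∈ closure Ω \ Metric.ball x₀ r, x ∈ O₁ := fun x hx => by
    rw [hO₁, mem_interior_iff_mem_nhds]
    exact (hcone x hx).2.2.mono fun z hz => hz.2
  refine ⟨y₁, g, O' ∩ O₁ ∩ (Metric.closedBall x₀ R)ᶜ, hy₁, hgc,
    (hO'.inter isOpen_interior).inter Metric.isClosed_closedBall.isOpen_compl,
    fun a ha => ⟨⟨hfO' ha, hMO₁ a (hfr a ha)⟩, hfR a ha⟩, fun a ha => (hcone a (hfr a ha)).1,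
    fun a ha => (hcone a (hfr a ha)).2.2.mono fun z hz => hz.1, hinj, fun a ha => (hcr a ha).1,
    fun a ha => (hcr a ha).2, fun z => ?_, ?_⟩
  · simp [hg, hw, expNegInvGlue.zero_of_nonpos le_rfl]
  -- the constants of the profile
  have hf2 : ContDiff ℝ 2 f := hf.of_le (by norm_num)
  have hσ2 : ContDiff ℝ 2 σ := hσc.of_le (by norm_num)
  have hout : ∀ x ∈ closure Ω \ Metric.ball x₀ (2 * r), x ∈ closure Ω \ Metric.closedBall x₀ r :=
    fun x hx => ⟨hx.1, fun hb => hx.2 (Metric.closedBall_subset_ball (by linarith) hb)⟩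
  obtain ⟨μ, hμ, hμle⟩ := S.exists_cone_bound hy₁.continuous hf2
    (S.isCompact_fst.diff (Metric.isOpen_ball (x := x₀) (ε := 2 * r)))
    (fun x hx ξ hξ => (hQ x (hout x hx) ξ).2 hξ)
  obtain ⟨K, hK, hsemi⟩ := S.exists_Aform_semiconvex
  set k := 1 + K ^ 2 / (2 * μ) with hk
  have hk0 : 0 < k := by positivity
  have hτ : ∀ᶠ τ in 𝓝[>] (0 : ℝ), τ ∈ Ioo 0 (4 / k ^ 2) :=
    Ioo_mem_nhdsGT (by positivity)
  filter_upwards [hτ] with τ hτ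
  obtain ⟨F, θ, θ', hF, hFd, hθd, hF0, hθeq, hθpos, hθ⟩ := exists_profile (Λ := τ⁻¹) hk0 (by
    rw [le_inv_comm₀ (by positivity) hτ.1, inv_div]; exact hτ.2.le)
  -- `F(σ)`, extended by zero across the vertex of the cone, where `f` is not the cone excess
  set Ft : E n → ℝ := (Metric.ball x₀ (2 * r)).indicator 0 + (Metric.ball x₀ (2 * r))ᶜ.indicator
    (fun x => F (σ x)) with hFt
  have hFtin : ∀ x ∈ Metric.ball x₀ (3 * r), Ft =ᶠ[𝓝 x] fun _ => 0 := by
    intro x hx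
    filter_upwards [Metric.isOpen_ball.mem_nhds hx] with z hz
    by_cases hzb : z ∈ Metric.ball x₀ (2 * r)
    · simp [hFt, hzb]
    · have h1 : σ z < 0 := by
        simp only [hσ]
        rw [(hcone z ⟨subset_closure (h3Ω hz), fun hb => hzb
          (Metric.ball_subset_ball (by linarith) hb)⟩).2.1]
        have := hr'lt z (Metric.ball_subset_ball h3r'.le hz)
        linarith
      simp [hFt, hzb, hF0 _ h1.le]
  have hFtout : ∀ x, x ∉ Metric.ball x₀ (3 * r) → Ft =ᶠ[𝓝 x] fun x => F (σ x) := by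
    intro x hx
    have h1 : x ∈ (Metric.closedBall x₀ (2 * r))ᶜ := fun hb =>
      hx (Metric.closedBall_subset_ball (by linarith) hb)
    filter_upwards [Metric.isClosed_closedBall.isOpen_compl.mem_nhds h1] with z hz
    have hzb : z ∉ Metric.ball x₀ (2 * r) := fun hb => hz (Metric.ball_subset_closedBall hb)
    simp [hFt, hzb]
  have hFtc : ContDiff ℝ 2 Ft := contDiff_iff_contDiffAt.2 fun x => by
    by_cases hx : x ∈ Metric.ball x₀ (3 * r)
    · exact contDiffAt_const.congr_of_eventuallyEq (hFtin x hx)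
    · exact (hF.comp hσ2).contDiffAt.congr_of_eventuallyEq (hFtout x hx)
  have hcy : ContDiff ℝ 2 fun z => c z y₀ := (contDiff_slice S.hc y₀).of_le two_le_four
  set ut : E n → ℝ := fun z => c z y₀ + Ft z with hut
  have hutc : ContDiff ℝ 2 ut := hcy.add hFtc
  have hutg : ∀ x, gradient ut x = cX c x y₀ + gradient Ft x := by
    intro x
    have h := gradient_add_smul ((hcy.differentiable (by norm_num)) x)
      ((hFtc.differentiable (by norm_num)) x) 1
    simp only [one_smul] at h
    exact h
  have huts : ∀ x ξ, sndDeriv ut x ξ = sndDeriv (fun z => c z y₀) x ξ + sndDeriv Ft x ξ :=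
    fun x ξ => sndDeriv_add hcy hFtc x ξ
  have hin : ∀ x ∈ Metric.ball x₀ (3 * r), gradient ut x = cX c x y₀ ∧
      ∀ ξ, sndDeriv ut x ξ = sndDeriv (fun z => c z y₀) x ξ := by
    intro x hx
    have h0 : gradient (fun _ : E n => (0 : ℝ)) x = 0 := by rw [eq_gradient_iff]; simp
    refine ⟨by rw [hutg, gradient_congr (hFtin x hx), h0, add_zero], fun ξ => ?_⟩
    rw [huts, sndDeriv_congr (hFtin x hx), sndDeriv_const, add_zero]
  have hσg : ∀ x, gradient σ x = gradient f x := by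
    intro x
    unfold gradient
    simp only [hσ, fderiv_sub_const]
  have hσs : ∀ x ξ, sndDeriv σ x ξ = sndDeriv f x ξ := by
    intro x ξ
    rw [hσ, sndDeriv_sub hf2 contDiff_const, sndDeriv_const, sub_zero]
  have hout' : ∀ x ∈ O₁, x ∉ Metric.ball x₀ (3 * r) →
      gradient ut x = cX c x y₀ + θ (σ x) • w x ∧
      ∀ ξ, sndDeriv ut x ξ = sndDeriv (fun z => c z y₀) x ξ +
        (θ' (σ x) * inner ℝ (w x) ξ ^ 2 + θ (σ x) * sndDeriv f x ξ) := by
    intro x hxO hx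
    have hfw : x ∈ {z | gradient f z = w z} := interior_subset hxO
    replace hfw : gradient f x = w x := hfw
    constructor
    · rw [hutg, gradient_congr (hFtout x hx), gradient_real_comp (hFd _)
        ((hσ2.differentiable (by norm_num)) x), hσg, hfw]
    · intro ξ
      rw [huts, sndDeriv_congr (hFtout x hx), sndDeriv_real_comp hF hFd hθd hσ2, hσg, hfw, hσs]
  have hutx₀ := (hin x₀ (Metric.mem_ball_self (by positivity))).1
  have htouch : ∀ x ∈ closure Ω, ∃ y ∈ Ωs, gradient ut x = cX c x y ∧
      ∀ ξ, sndDeriv (fun z => c z y) x ξ ≤ sndDeriv ut x ξ ∧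
      (ξ ≠ 0 → sndDeriv (fun z => c z y) x ξ < sndDeriv ut x ξ ∨
        fderiv ℝ (Aform c Y x ξ) (cX c x y) (gradient G x) < sndDeriv G x ξ) := by
    intro x hx
    by_cases hx3 : x ∈ Metric.ball x₀ (3 * r)
    · obtain ⟨h1, h2⟩ := hin x hx3
      exact ⟨y₀, hy₀, h1, fun ξ => ⟨(h2 ξ).ge, fun hξ => Or.inr
        (hGell x (Metric.ball_subset_ball h3r₂.le hx3) ξ hξ)⟩⟩
    have hxr : x ∈ closure Ω \ Metric.ball x₀ r :=
      ⟨hx, fun hb => hx3 (Metric.ball_subset_ball (by linarith) hb)⟩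
    have hx2r : x ∈ closure Ω \ Metric.ball x₀ (2 * r) :=
      ⟨hx, fun hb => hx3 (Metric.ball_subset_ball (by linarith) hb)⟩
    obtain ⟨h1, h2⟩ := hout' x (hMO₁ x hxr) hx3
    obtain ⟨hθ0, hθ1, hθk⟩ := hθ (σ x)
    have hy1 := frontier_subset_closure (hcone x hxr).1
    obtain ⟨y, hy, hye⟩ := S.exists_cX_segment_mem hx hy₀ hy1 ⟨hθ0, hθ1⟩
    have key : ∀ ξ, θ (σ x) * (1 - θ (σ x)) * (μ / 2 * ‖ξ‖ ^ 2) ≤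
        sndDeriv ut x ξ - sndDeriv (fun z => c z y) x ξ := by
      intro ξ
      have h3 := hsemi x hx y₀ (subset_closure hy₀) (y₁ x) hy1 y (subset_closure hy) ξ (θ (σ x))
        ⟨hθ0, hθ1.le⟩ hye
      have h4 := ellipticity_of_profile hμ hk hθ0 hθ1 hθk ((hQ x (hout x hx2r) ξ).1)
        (hμle x hx2r ξ) h3
      rw [h2 ξ]
      refine h4.trans (le_of_eq ?_)
      simp only [hw]
      ring
    refine ⟨y, hy, by rw [h1, hye], fun ξ => ⟨?_, fun hξ => ?_⟩⟩
    · have h5 : 0 ≤ θ (σ x) * (1 - θ (σ x)) * (μ / 2 * ‖ξ‖ ^ 2) :=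
        mul_nonneg (mul_nonneg hθ0 (by linarith)) (by positivity)
      linarith [key ξ]
    · by_cases hxb : x ∈ Metric.ball x₀ r₂
      · rcases hθ0.eq_or_lt with h0 | h0
        · right
          have hyy : y = y₀ := S.fst.inj x hx (by rw [hye, ← h0, zero_smul, add_zero])
          rw [hyy]
          exact hGell x hxb ξ hξ
        · left
          have h5 : 0 < θ (σ x) * (1 - θ (σ x)) * (μ / 2 * ‖ξ‖ ^ 2) :=
            mul_pos (mul_pos h0 (by linarith)) (by have := norm_pos_iff.2 hξ; positivity)
          linarith [key ξ]
      · left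
        have h0 := hθpos _ (hσpos x ⟨hx, hxb⟩)
        have h5 : 0 < θ (σ x) * (1 - θ (σ x)) * (μ / 2 * ‖ξ‖ ^ 2) :=
          mul_pos (mul_pos h0 (by linarith)) (by have := norm_pos_iff.2 hξ; positivity)
        linarith [key ξ]
  -- the bump makes the function strict in the ball where it is equal to `c(·, y₀)`
  have hev := S.eventually_touch_add_smul hutc hG htouch
  obtain ⟨η, hη, hη0⟩ := ((eventually_nhdsWithin_iff.2 hev).and
    (self_mem_nhdsWithin (s := Ioi (0 : ℝ)) (a := 0))).exists
  have hug : ∀ x, gradient (fun z => ut z + η • G z) x = gradient ut x + η • gradient G x :=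
    fun x => gradient_add_smul (hutc.differentiable (by norm_num) x)
      (hG.differentiable (by norm_num) x) η
  refine ⟨fun z => ut z + η • G z, hutc.add (hG.const_smul η), hη, fun x hx => ?_, ?_⟩
  · obtain ⟨⟨hxO', hxO₁⟩, hxR⟩ := hx
    have hσx : 0 < σ x := hO'σ hxO'
    have hx3 : x ∉ Metric.ball x₀ (3 * r) := fun hb => hxR (Metric.ball_subset_closedBall.trans
      (Metric.closedBall_subset_closedBall (by linarith)) hb)
    have hpos : 0 < τ * (σ x ^ 2)⁻¹ := by have := hτ.1; positivity
    rw [hug, hG0 x hxR, smul_zero, add_zero, (hout' x hxO₁ hx3).1, hθeq _ hσx]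
    simp only [hg, hmO' hxO', expNegInvGlue, if_neg (not_le.2 hpos), mul_inv, inv_inv]
  · rw [hug, hGx₀, smul_zero, add_zero, hutx₀]

end Setup

end Joining

/-! ### Smooth functions with prescribed approximate image -/

/-- A bounded domain is approximated by compact connected subsets. -/
theorem _root_.IsOpen.exists_isCompact_isPreconnected_net {n : ℕ} {D : Set (E n)} (hD : IsOpen D)
    (hconn : IsConnected D) (hb : Bornology.IsBounded D) {y₀ : E n} (hy₀ : y₀ ∈ D) {ε : ℝ}
    (hε : 0 < ε) : ∃ P : Set (E n), IsCompact P ∧ IsPreconnected P ∧ P ⊆ D ∧ P ∈ 𝓝 y₀ ∧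
      D ⊆ Metric.thickening ε P := by
  obtain ⟨r, hr, hrD⟩ := Metric.nhds_basis_closedBall.mem_iff.1 (hD.mem_nhds hy₀)
  have hpath := (hD.isConnected_iff_isPathConnected).1 hconn
  have hK : ∀ y ∈ D, ∃ K : Set (E n), IsCompact K ∧ IsPreconnected K ∧ K ⊆ D ∧ y₀ ∈ K ∧ y ∈ K := by
    intro y hy
    obtain ⟨γ, hγ⟩ := hpath.joinedIn y₀ hy₀ y hy
    exact ⟨range γ, isCompact_range γ.continuous, isPreconnected_range γ.continuous,
      range_subset_iff.2 hγ, ⟨0, γ.source⟩, ⟨1, γ.target⟩⟩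
  choose! K hKc hKp hKD hK0 hK1 using hK
  obtain ⟨t, htD, htf, hcov⟩ := (hb.isCompact_closure.totallyBounded.subset
    subset_closure).exists_subset (Metric.dist_mem_uniformity hε)
  refine ⟨⋃₀ insert (Metric.closedBall y₀ r) (K '' t), ?_, ?_, ?_, ?_, ?_⟩
  · refine ((htf.image K).insert _).isCompact_sUnion ?_
    rintro s (rfl | ⟨y, hy, rfl⟩)
    exacts [isCompact_closedBall _ _, hKc y (htD hy)]
  · refine isPreconnected_sUnion y₀ _ ?_ ?_
    · rintro s (rfl | ⟨y, hy, rfl⟩)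
      exacts [Metric.mem_closedBall_self hr.le, hK0 y (htD hy)]
    · rintro s (rfl | ⟨y, hy, rfl⟩)
      exacts [(convex_closedBall _ _).isPreconnected, hKp y (htD hy)]
  · refine sUnion_subset ?_
    rintro s (rfl | ⟨y, hy, rfl⟩)
    exacts [hrD, hKD y (htD hy)]
  · exact mem_of_superset (Metric.closedBall_mem_nhds y₀ hr) (subset_sUnion_of_mem (mem_insert _ _))
  · intro y hy
    obtain ⟨z, hz, hyz⟩ := mem_iUnion₂.1 (hcov hy)
    exact Metric.mem_thickening_iff.2
      ⟨z, mem_sUnion.2 ⟨K z, mem_insert_of_mem _ (mem_image_of_mem K hz), hK1 z (htD hz)⟩, hyz⟩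

theorem eq_zero_of_eventually_iff_neg {n : ℕ} {D : Set (E n)} (hD : IsOpen D) {Φ : E n → ℝ}
    (hΦ : Continuous Φ) {y : E n} (hy : y ∈ frontier D)
    (h : ∀ᶠ z in 𝓝 y, (z ∈ D ↔ Φ z < 0)) : Φ y = 0 := by
  rw [hD.frontier_eq] at hy
  have h1 : ¬ Φ y < 0 := fun hlt => hy.2 (h.self_of_nhds.2 hlt)
  refine le_antisymm (not_lt.1 fun hgt => ?_) (not_lt.1 h1)
  obtain ⟨z, hzD, hz1, hz2⟩ := ((mem_closure_iff_frequently.1 hy.1).and_eventually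
    (h.and (hΦ.continuousAt.eventually (lt_mem_nhds hgt)))).exists
  exact lt_asymm hz2 (hz1.1 hzD)

namespace Setup

variable {n : ℕ} {c : E n → E n → ℝ} {Ω Ωs : Set (E n)} {φ φs : E n → ℝ}
  {X Y : E n × E n → E n} (S : Setup c Ω Ωs φ φs X Y)

include S

set_option maxHeartbeats 800000 in
/-- The target domain is approximated by uniformly convex images of smooth potentials. -/
theorem exists_approximation : ∃ δ : ℝ, 0 < δ ∧ ∀ ε : ℝ, 0 < ε →
    ∃ (D : Set (E n)) (u : E n → ℝ), IsBddDomain D ∧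
      IsUnifCConvexDomainWith δ (swapCost c) D Ω ∧
      D ⊆ Metric.thickening ε Ωs ∧ Ωs ⊆ Metric.thickening ε D ∧ ContDiff ℝ (⊤ : ℕ∞) u ∧
      IsCConvexOn c Ω u ∧ IsEllipticOn c (closure Ω) u ∧ Tmap c u '' Ω = D := by
  obtain ⟨x₀, hx₀⟩ := S.fst.isConnected.nonempty
  obtain ⟨y₀, hy₀⟩ := S.snd.isConnected.nonempty
  have hx₀' := subset_closure hx₀
  have hy₀' := subset_closure hy₀
  obtain ⟨y₁, g, O, hy₁, hg, hO, hfO, hyf, hy0, hinj, hker, htr, hg0, hfam⟩ :=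
    S.exists_joined_family hx₀ hy₀
  obtain ⟨ρ, hρ, hρc, hρs, hρ1⟩ := exists_mollifier n
  -- the family of maps near `∂Ω`, with parameters `τ = 1/Λ` and the radius of mollification
  set T : E n × (ℝ × ℝ) → E n := fun z => Y (z.1, mollify ρ (fun x => g (z.2.1, x)) z.1 z.2.2)
    with hT
  have hTc : ContDiff ℝ 2 T := by
    have h1 := contDiff_mollify hρ hρc (k := 3) (P := ℝ) (f := fun τ x => g (τ, x)) hg
    have h2 : ContDiff ℝ 3 fun z : E n × (ℝ × ℝ) => mollify ρ (fun x => g (z.2.1, x)) z.1 z.2.2 :=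
      h1.comp (contDiff_snd.fst.prodMk (contDiff_fst.prodMk contDiff_snd.snd))
    exact (S.fst.smoothY.comp (contDiff_fst.prodMk h2)).of_le (by norm_num)
  have hT0 : ∀ a ∈ frontier Ω, ∀ᶠ z in 𝓝 a, T (z, 0) = y₁ z := by
    intro a ha
    have h1 : Tendsto (fun z => (z, y₁ z)) (𝓝 a) (𝓝 (a, y₁ a)) :=
      (continuous_id.prodMk hy₁.continuous).tendsto a
    filter_upwards [h1.eventually (S.fst.leftInv a (frontier_subset_closure ha) (y₁ a)
      (frontier_subset_closure (hyf a ha)))] with z hz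
    simp only [hT, Prod.fst_zero, Prod.snd_zero, mollify_zero hρ1, hg0]
    exact hz
  obtain ⟨δ, ψ, hδ, hψ, hev⟩ := S.exists_perturbed_defining hyf hy0 hy₁ hinj hker htr hTc hT0
  refine ⟨δ, hδ, fun ε hε => ?_⟩
  -- a connected compact subset of `Ω*` close to all of it; the images will contain it, because
  -- their
  -- boundaries avoid it
  obtain ⟨P, hPc, hPp, hPΩ, hP0, hPε⟩ := S.snd.isOpen.exists_isCompact_isPreconnected_net
    S.snd.isConnected S.snd.isBounded hy₀ hε
  have hevP : ∀ᶠ m in 𝓝 (0 : ℝ × ℝ), ∀ a ∈ frontier Ω, T (a, m) ∉ P := by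
    refine S.isCompact_frontier.eventually_forall_of_forall_eventually fun a ha => ?_
    refine (hTc.continuous.comp continuous_swap).continuousAt.eventually
      (hPc.isClosed.isOpen_compl.mem_nhds ?_)
    change T (a, 0) ∉ P
    rw [(hT0 a ha).self_of_nhds]
    have h1 := hyf a ha
    rw [S.snd.isOpen.frontier_eq] at h1
    exact fun h => h1.2 (hPΩ h)
  obtain ⟨t, ht, htm⟩ := Metric.eventually_nhds_iff_ball.1 (hev.and hevP)
  have hbt : ∀ᶠ s in 𝓝 (0 : ℝ), s ∈ Metric.ball (0 : ℝ) t := Metric.ball_mem_nhds 0 ht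
  obtain ⟨τ, hτ, u, hu, hutouch, huO, hux₀⟩ := ((hbt.filter_mono nhdsWithin_le_nhds).and
    hfam).exists
  have hu1 : ContDiff ℝ 1 u := hu.of_le (by norm_num)
  have hgu : ContDiff ℝ 1 (gradient u) := contDiff_gradient (k := 1) hu
  have hgrad : ∀ h x, gradient (fun x => mollify ρ u x h) x = mollify ρ (gradient u) x h :=
    fun h x => gradient_mollify hρ.continuous hρc hu1 x h
  obtain ⟨s, hs, hsO⟩ := S.isCompact_frontier.exists_thickening_subset_open hO hfO
  have hev3 : ∀ᶠ h in 𝓝 (0 : ℝ), Y (x₀, mollify ρ (gradient u) x₀ h) ∈ P := by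
    have hcV : Continuous fun h : ℝ => Y (x₀, mollify ρ (gradient u) x₀ h) :=
      (S.contDiff_Y_slice x₀).continuous.comp ((contDiff_mollify_slice hρ hρc (k := 1) hgu).continuous.comp
        (continuous_id.prodMk continuous_const))
    refine hcV.continuousAt.eventually (p := fun y => y ∈ P) ?_
    have h0 : Y (x₀, mollify ρ (gradient u) x₀ 0) = y₀ := by
      rw [mollify_zero hρ1, hux₀, S.Y_cX hx₀' hy₀']
    change P ∈ 𝓝 (Y (x₀, mollify ρ (gradient u) x₀ 0))
    rw [h0]
    exact hP0
  have hbs : ∀ᶠ h in 𝓝 (0 : ℝ), h ∈ Metric.ball (0 : ℝ) (s / 2) :=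
    Metric.ball_mem_nhds 0 (half_pos hs)
  have hev4 := (hbt.and (S.eventually_touch_mollify hρ hρc hρ1 hu hutouch)).and (hev3.and hbs)
  obtain ⟨h, ⟨⟨hht, hstrict⟩, hhP, hhs⟩, hh0⟩ := ((hev4.filter_mono nhdsWithin_le_nhds).and
    (self_mem_nhdsWithin (s := Ioi (0 : ℝ)) (a := 0))).exists
  set m : ℝ × ℝ := (τ, h) with hm
  obtain ⟨hψm, hTP⟩ := htm m (by
    rw [mem_ball_zero_iff, hm, Prod.norm_def, max_lt_iff]
    exact ⟨mem_ball_zero_iff.1 hτ, mem_ball_zero_iff.1 hht⟩)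
  set U : E n → ℝ := fun x => mollify ρ u x h with hU
  have hUsmooth : ContDiff ℝ ∞ U := contDiff_mollify_of_ne_zero hρ hρc hu.continuous (ne_of_gt hh0)
  have hUs : IsStrictSubsolution c Ω Ωs U := ⟨contDiff_infty.1 hUsmooth 4, hstrict⟩
  obtain ⟨Φ, hDo, hDc, hDΩ, hDf, hΦ, hΦf⟩ := S.image_T_properties hUs
  set F : E n → E n := fun x => Y (x, gradient U x) with hF
  set D := F '' Ω with hD
  -- near the boundary the map is the member of the smooth family
  have hFT : ∀ a ∈ frontier Ω, ∀ᶠ z in 𝓝 a, F z = T (z, m) := by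
    intro a ha
    filter_upwards [Metric.ball_mem_nhds a (half_pos hs)] with z hz
    simp only [hF, hT, hm, hU, hgrad]
    rw [mollify_congr hρs (f := gradient u) (g := fun x => g (τ, x)) fun v hv => huO _ (hsO ?_)]
    refine Metric.mem_thickening_iff.2 ⟨a, ha, ?_⟩
    have h1 : dist (z - h • v) z < s / 2 := by
      rw [dist_eq_norm, sub_sub_cancel_left, norm_neg, norm_smul]
      have h2 : ‖h‖ < s / 2 := mem_ball_zero_iff.1 hhs
      nlinarith [norm_nonneg v, norm_nonneg h]
    have h3 := dist_triangle (z - h • v) z a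
    have h4 : dist z a < s / 2 := hz
    linarith
  have hFa : ∀ a ∈ frontier Ω, F a = T (a, m) := fun a ha => (hFT a ha).self_of_nhds
  have hgF : ∀ a ∈ frontier Ω, gradient U a = cX c a (T (a, m)) := by
    intro a ha
    rw [← hFa a ha]
    exact (S.Y_gradient hUs (frontier_subset_closure ha)).2.1
  have hψm2 : ContDiff ℝ 2 fun y => ψ (y, m) := hψ.comp (contDiff_mk_left m)
  have hDpos : ∀ a ∈ frontier Ω, 0 < fderiv ℝ (fun y => ψ (y, m)) (F a)
      (vel Y a (gradient U a) (gradient φ a)) := by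
    intro a ha
    rw [hFa a ha, hgF a ha]
    exact (hψm a ha).2.1
  have hDm : closure D ⊆ closure Ωs := hDΩ.trans subset_closure
  have hunif : IsUnifCConvexDomainWith δ (swapCost c) D Ω := by
    refine S.swap.isUnifCConvexDomainWith_of_curv hDo hDc hDm hψm2 ?_ ?_ hδ ?_
    · rw [hDf]
      rintro _ ⟨a, ha, rfl⟩
      obtain ⟨h1, h2, h3⟩ := hΦf a ha
      have hFf : F a ∈ frontier D := by rw [hDf]; exact mem_image_of_mem F ha
      have h4 := eq_zero_of_eventually_iff_neg hDo hΦ.continuous hFf h1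
      have h5 := eventually_neg_iff_of_zero hΦ (hψm2.of_le (by norm_num)) h4 h2 (hDpos a ha) (by
        filter_upwards [h3 _ ((hψm a ha).1.and (hFT a ha))] with z hz hz0
        obtain ⟨b, ⟨hb1, hb2⟩, hb0, rfl⟩ := hz hz0
        change ψ (F b, m) = 0
        rw [hb2]
        exact hb1 hb0)
      filter_upwards [h1, h5] with z hz1 hz2
      rw [hz1, hz2]
    · rw [hDf]
      rintro _ ⟨a, ha, rfl⟩ h0
      have := hDpos a ha
      rw [h0] at this
      exact lt_irrefl _ this
    · rw [hDf]
      rintro _ ⟨a, ha, rfl⟩ x hx v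
      rw [hFa a ha]
      exact (hψm a ha).2.2 x hx v
  have hDP : P ⊆ D := by
    refine hPp.subset_of_closure_inter_subset hDo ⟨F x₀, ?_, mem_image_of_mem F hx₀⟩ ?_
    · simp only [hF, hU, hgrad]
      exact hhP
    · rintro y ⟨hyD, hyP⟩
      by_contra hy
      have hyf : y ∈ frontier D := by rw [hDo.frontier_eq]; exact ⟨hyD, hy⟩
      rw [hDf] at hyf
      obtain ⟨a, ha, rfl⟩ := hyf
      rw [hFa a ha] at hyP
      exact hTP a ha hyP
  refine ⟨D, U, ⟨hDo, hDc, S.isCompact_snd.isBounded.subset (subset_closure.trans hDm)⟩, hunif,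
    (subset_closure.trans hDΩ).trans (Metric.self_subset_thickening hε _),
    hPε.trans (Metric.thickening_subset_of_subset _ hDP), hUsmooth, S.isCConvexOn_of_strict hUs,
    S.isEllipticOn_of_strict hUs, ?_⟩
  exact image_congr fun x hx => S.Tmap_eq hUs (subset_closure hx)

end Setup

/-! ### Defining functions and outer normals -/

section Normal

variable {n : ℕ} {Ω : Set (E n)}

/-- The gradient of a local defining function is a nonnegative multiple of the outer normal. -/
theorem IsOuterUnitNormal.gradient_eq {x ν : E n} (h : IsOuterUnitNormal Ω x ν) {φ : E n → ℝ}
    (hφ : DifferentiableAt ℝ φ x) (hloc : ∀ᶠ z in 𝓝 x, (z ∈ Ω ↔ φ z < 0)) (h0 : φ x = 0) :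
    gradient φ x = ‖gradient φ x‖ • ν := by
  have hνν : inner ℝ ν ν = 1 := by rw [real_inner_self_eq_norm_sq, h.1, one_pow]
  have hl : innerSL ℝ ν ≠ 0 := by
    intro h0
    have := congrArg (fun L : E n →L[ℝ] ℝ => L ν) h0
    simp only [innerSL_apply_apply, hνν] at this
    exact one_ne_zero this
  obtain ⟨s, hs, hm⟩ := exists_eq_neg_smul_of_nonneg (l := innerSL ℝ ν) (m := -fderiv ℝ φ x) hl (by
    intro v hv
    rw [innerSL_apply_apply, real_inner_comm] at hv
    have hd : HasDerivAt (fun t : ℝ => -φ (x + t • v)) (-fderiv ℝ φ x v) 0 := by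
      have h1 : HasDerivAt (fun t : ℝ => x + t • v) v 0 := by
        simpa using ((hasDerivAt_id (0 : ℝ)).smul_const v).const_add x
      have h2 : HasFDerivAt φ (fderiv ℝ φ x) (x + (0 : ℝ) • v) := by
        simpa using hφ.hasFDerivAt
      exact (h2.comp_hasDerivAt 0 h1).neg
    refine deriv_nonneg_of_eventually hd ?_
    have hc : Tendsto (fun t : ℝ => x + t • v) (𝓝[>] 0) (𝓝 x) := by
      have : Continuous fun t : ℝ => x + t • v := by fun_prop
      have h2 := this.tendsto 0
      simp only [zero_smul, add_zero] at h2
      exact h2.mono_left nhdsWithin_le_nhds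
    filter_upwards [(h.2 v).1 hv, hc.eventually hloc] with t h1 h2
    simp only [zero_smul, add_zero, h0]
    linarith [h2.1 h1])
  have hg : gradient φ x = s • ν := by
    rw [eq_gradient_iff]
    intro v
    have := congrArg (fun L : E n →L[ℝ] ℝ => L v) hm
    simp at this
    rw [inner_smul_left]
    simpa using this
  rw [hg, norm_smul, h.1, mul_one, Real.norm_of_nonneg hs]

/-- Local defining functions are glued to a global one. -/
theorem exists_isDefining (hΩ : IsOpen Ω) (hb : Bornology.IsBounded Ω)
    (h4 : HasBoundaryOfClass 4 Ω) {γ : E n → E n}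
    (hγ : ∀ x ∈ frontier Ω, IsOuterUnitNormal Ω x (γ x)) : ∃ φ, IsDefining Ω φ := by
  have hloc : ∀ x ∈ frontier Ω, ∃ (f χ : E n → ℝ) (N : Set (E n)), ContDiff ℝ 4 f ∧
      ContDiff ℝ 4 χ ∧ (∀ z, 0 ≤ χ z) ∧ IsOpen N ∧ x ∈ N ∧ (∀ z ∈ N, 0 < χ z) ∧
      ∀ z, χ z ≠ 0 → (∀ᶠ w in 𝓝 z, (w ∈ Ω ↔ f w < 0)) ∧ fderiv ℝ f z ≠ 0 := by
    intro x hx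
    obtain ⟨f, hf, hne, hev⟩ := h4 x hx
    have hf' : ContDiff ℝ 4 f := hf
    have h1 : ∀ᶠ z in 𝓝 x, (∀ᶠ w in 𝓝 z, (w ∈ Ω ↔ f w < 0)) ∧ fderiv ℝ f z ≠ 0 :=
      (eventually_eventually_nhds.2 hev).and
        ((hf'.continuous_fderiv (by norm_num)).continuousAt.eventually_ne hne)
    obtain ⟨R, hR, hball⟩ := Metric.eventually_nhds_iff_ball.1 h1
    let b : ContDiffBump x := ⟨R / 2, R, by positivity, by linarith⟩
    refine ⟨f, b, Metric.ball x R, hf', b.contDiff, fun z => b.nonneg, Metric.isOpen_ball,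
      Metric.mem_ball_self hR, fun z hz => b.pos_of_mem_ball hz, fun z hz => hball z ?_⟩
    have : z ∈ Function.support b := hz
    rwa [b.support_eq] at this
  choose! f χ N hf hχ hχ0 hN hxN hNχ hgood using hloc
  have hcomp : IsCompact (frontier Ω) :=
    hb.isCompact_closure.of_isClosed_subset isClosed_frontier frontier_subset_closure
  obtain ⟨t, ht, hcov⟩ := hcomp.elim_nhds_subcover N fun x hx => (hN x hx).mem_nhds (hxN x hx)
  set φ : E n → ℝ := fun z => ∑ i ∈ t, χ i z * f i z with hφ
  refine ⟨φ, ContDiff.sum fun i hi => (hχ i (ht i hi)).mul (hf i (ht i hi)), fun p hp => ?_,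
    fun p hp h0 => ?_⟩
  · obtain ⟨j, hj, hpj⟩ := mem_iUnion₂.1 (hcov hp)
    filter_upwards [(hN j (ht j hj)).mem_nhds hpj] with z hz
    have hzj := hNχ j (ht j hj) z hz
    have hiff : ∀ i ∈ t, χ i z ≠ 0 → (z ∈ Ω ↔ f i z < 0) := fun i hi h =>
      ((hgood i (ht i hi) z h).1).self_of_nhds
    constructor
    · intro hzΩ
      refine Finset.sum_neg' (fun i hi => ?_)
        ⟨j, hj, mul_neg_of_pos_of_neg hzj ((hiff j hj hzj.ne').1 hzΩ)⟩
      by_cases h : χ i z = 0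
      · rw [h, zero_mul]
      · exact mul_nonpos_of_nonneg_of_nonpos (hχ0 i (ht i hi) z) ((hiff i hi h).1 hzΩ).le
    · intro hneg
      by_contra hzΩ
      refine absurd hneg (not_lt.2 (Finset.sum_nonneg fun i hi => ?_))
      by_cases h : χ i z = 0
      · rw [h, zero_mul]
      · exact mul_nonneg (hχ0 i (ht i hi) z) (not_lt.1 fun hlt => hzΩ ((hiff i hi h).2 hlt))
  -- all gradients are nonnegative multiples of the outer normal, so they do not cancel
  · obtain ⟨j, hj, hpj⟩ := mem_iUnion₂.1 (hcov hp)
    have hχd : ∀ i ∈ t, DifferentiableAt ℝ (χ i) p := fun i hi =>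
      (hχ i (ht i hi)).differentiable (by norm_num) p
    have hfd : ∀ i ∈ t, DifferentiableAt ℝ (f i) p := fun i hi =>
      (hf i (ht i hi)).differentiable (by norm_num) p
    have hterm : ∀ i ∈ t, χ i p ≠ 0 → 0 < fderiv ℝ (f i) p (γ p) ∧ f i p = 0 := by
      intro i hi h
      obtain ⟨h1, h2⟩ := hgood i (ht i hi) p h
      have h3 := eq_zero_of_eventually_iff_neg hΩ (hf i (ht i hi)).continuous hp h1
      have h4 := (hγ p hp).gradient_eq (hfd i hi) h1 h3
      have h5 : gradient (f i) p ≠ 0 := fun h6 => h2 (ContinuousLinearMap.ext fun v => by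
        rw [← inner_gradient, h6]; simp)
      refine ⟨?_, h3⟩
      rw [← inner_gradient, h4, inner_smul_left, real_inner_self_eq_norm_sq, (hγ p hp).1]
      simpa using h5
    have hval : ∀ i ∈ t, fderiv ℝ (fun z => χ i z * f i z) p (γ p) =
        χ i p * fderiv ℝ (f i) p (γ p) := by
      intro i hi
      rw [fderiv_fun_mul (hχd i hi) (hfd i hi)]
      by_cases h : χ i p = 0
      · have hmin : IsLocalMin (χ i) p := Eventually.of_forall fun z => by
          rw [h]; exact hχ0 i (ht i hi) z
        simp [hmin.fderiv_eq_zero, h]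
      · simp [(hterm i hi h).2]
    have hsum : 0 < fderiv ℝ φ p (γ p) := by
      rw [hφ, fderiv_fun_sum (A := fun i z => χ i z * f i z) fun i hi => (hχd i hi).mul (hfd i hi),
        sum_apply]
      refine Finset.sum_pos' (fun i hi => ?_) ⟨j, hj, ?_⟩
      · rw [hval i hi]
        by_cases h : χ i p = 0
        · rw [h, zero_mul]
        · exact mul_nonneg (hχ0 i (ht i hi) p) (hterm i hi h).1.le
      · rw [hval j hj]
        have h := hNχ j (ht j hj) p hpj
        exact mul_pos h (hterm j hj h.ne').1
    rw [h0] at hsum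
    exact lt_irrefl _ hsum

/-- The tangential derivative of a field of unit normals of a level set is the normalised
Hessian of the defining function. -/
theorem inner_fderiv_normal {φ : E n → ℝ} {γ : E n → E n} {x : E n} (hφ : ContDiff ℝ 2 φ)
    (hγ : ContDiff ℝ 1 γ) (hx : φ x = 0) (hne : fderiv ℝ φ x ≠ 0)
    (h : ∀ᶠ z in 𝓝 x, φ z = 0 → gradient φ z = ‖gradient φ z‖ • γ z ∧ ‖γ z‖ = 1) {τ : E n}
    (hτ : fderiv ℝ φ x τ = 0) :
    inner ℝ (fderiv ℝ γ x τ) τ = ‖gradient φ x‖⁻¹ * sndDeriv φ x τ := by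
  have hg1 : ContDiff ℝ 1 (gradient φ) := contDiff_gradient (k := 1) hφ
  set Z : E n → ℝ := fun z => inner ℝ (gradient φ z) τ -
    inner ℝ (gradient φ z) (γ z) * inner ℝ (γ z) τ with hZ
  have hZc : ContDiff ℝ 1 Z := (hg1.inner ℝ contDiff_const).sub
    ((hg1.inner ℝ hγ).mul (hγ.inner ℝ contDiff_const))
  have hZ0 : ∀ z, gradient φ z = ‖gradient φ z‖ • γ z → ‖γ z‖ = 1 → Z z = 0 := by
    intro z h1 h2
    simp only [hZ]
    rw [h1, inner_smul_left, inner_smul_left, real_inner_self_eq_norm_sq, h2]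
    simp
  obtain ⟨hgx, hγx⟩ := h.self_of_nhds hx
  -- `Z` vanishes on the level set of `φ`, so its derivative is a multiple of that of `φ`
  have hext : IsLocalExtrOn Z {z | φ z = φ x} x := by
    left
    filter_upwards [mem_nhdsWithin_of_mem_nhds h, self_mem_nhdsWithin] with z h1 h2
    have h3 : φ z = 0 := by rw [← hx]; exact h2
    rw [hZ0 x hgx hγx, hZ0 z (h1 h3).1 (h1 h3).2]
  obtain ⟨a, b, hab, hlin⟩ := hext.exists_multipliers_of_hasStrictFDerivAt_1d
    (hφ.contDiffAt.hasStrictFDerivAt (by norm_num)) (hZc.contDiffAt.hasStrictFDerivAt (by norm_num))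
  have hb : b ≠ 0 := by
    rintro rfl
    rw [zero_smul, add_zero] at hlin
    rcases smul_eq_zero.1 hlin with h1 | h1
    · exact hab (by rw [h1]; rfl)
    · exact hne h1
  have h1 : a • fderiv ℝ φ x τ + b • fderiv ℝ Z x τ = 0 :=
    congrArg (fun L : E n →L[ℝ] ℝ => L τ) hlin
  rw [hτ, smul_zero, zero_add, smul_eq_mul] at h1
  replace h1 := (mul_eq_zero.1 h1).resolve_left hb
  have hgd := (hg1.differentiable (by norm_num) x).hasFDerivAt
  have hγd := (hγ.differentiable (by norm_num) x).hasFDerivAt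
  have hZd : HasFDerivAt Z _ x := (hgd.inner ℝ (hasFDerivAt_const τ x)).sub
    ((hgd.inner ℝ hγd).mul (hγd.inner ℝ (hasFDerivAt_const τ x)))
  have hgne : gradient φ x ≠ 0 := fun h6 => hne (ContinuousLinearMap.ext fun v => by
    rw [← inner_gradient, h6]; simp)
  have hpos : ‖gradient φ x‖ ≠ 0 := norm_ne_zero_iff.2 hgne
  have hγτ : inner ℝ (γ x) τ = 0 := by
    have h2 : ‖gradient φ x‖ * inner ℝ (γ x) τ = 0 := by
      rw [← hτ, ← inner_gradient]
      conv_rhs => rw [hgx, inner_smul_left]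
      simp
    exact (mul_eq_zero.1 h2).resolve_left hpos
  have hgγ : inner ℝ (gradient φ x) (γ x) = ‖gradient φ x‖ := by
    conv_lhs => rw [hgx, inner_smul_left, real_inner_self_eq_norm_sq, hγx]
    simp
  have hh : inner ℝ (fderiv ℝ (gradient φ) x τ) τ = sndDeriv φ x τ := inner_hess_self hφ x τ
  rw [hZd.fderiv] at h1
  simp [hγτ, hgγ, hh] at h1
  rw [sub_eq_zero.1 h1]
  field_simp

end Normal

/-! ### The inverse maps -/

/-- The solution map of `c_x(x, y) = p` near a compact set of solutions, as a globally defined map.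
-/
theorem exists_inverse_cX {n : ℕ} {c : E n → E n → ℝ} (hc : ContDiff ℝ 4 (Function.uncurry c))
    {K L : Set (E n)} (hK : IsCompact K) (hL : IsCompact L)
    (hinj : ∀ x ∈ K, Function.Injective (cX c x))
    (hnd : ∀ x ∈ K, ∀ y ∈ L, ∀ η, cXY c x y η = 0 → η = 0) :
    ∃ Y : E n × E n → E n, ContDiff ℝ 3 Y ∧
      (∀ x ∈ K, ∀ y ∈ L, ∀ᶠ z in 𝓝 (x, y), Y (z.1, cX c z.1 z.2) = z.2) ∧
      ∀ x ∈ K, ∀ y ∈ L, ∀ᶠ z in 𝓝 (x, cX c x y), cX c z.1 (Y z) = z.2 := by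
  set F : E n × E n → E n × E n := fun z => (z.1, cX c z.1 z.2) with hF
  have hcd := (contDiff_cX hc).differentiable (by norm_num)
  have hFc : ContDiff ℝ 3 F := contDiff_fst.prodMk (contDiff_cX hc)
  obtain ⟨G, hG, O, hO, hKO, hGl, hFO⟩ := exists_contDiff_leftInverse (k := 3) (by norm_num) hFc
    (hK.prod hL) (by
      rintro ⟨x, y⟩ ⟨hx, -⟩ ⟨x', y'⟩ - he
      have h1 : x = x' := congrArg Prod.fst he
      subst h1
      exact Prod.ext rfl (hinj x hx (congrArg Prod.snd he))) (by
      rintro ⟨x, y⟩ ⟨hx, hy⟩ ⟨a, b⟩ h0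
      have hd : HasFDerivAt F _ (x, y) := (hasFDerivAt_fst).prodMk (hcd (x, y)).hasFDerivAt
      have h1 := (congrArg (fun L => L ((a, b) : E n × E n)) hd.fderiv).symm.trans h0
      have ha : a = 0 := congrArg Prod.fst h1
      have hb : fderiv ℝ (fun z : E n × E n => cX c z.1 z.2) (x, y) (a, b) = 0 :=
        congrArg Prod.snd h1
      subst ha
      rw [hnd x hx y hy b ((fderiv_slice_right hcd x y b).trans hb)]
      rfl) rfl
  refine ⟨fun z => (G z).2, hG.snd, fun x hx y hy => ?_, fun x hx y hy => ?_⟩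
  · filter_upwards [hO.mem_nhds (hKO (mk_mem_prod hx hy))] with z hz
    have := hGl z hz
    simp only [hF] at this
    rw [this]
  · filter_upwards [hFO.mem_nhds (mem_image_of_mem F (hKO (mk_mem_prod hx hy)))] with z hz
    obtain ⟨w, hw, rfl⟩ := hz
    rw [hGl w hw]

/-! ### Mixed fourth derivatives of the cost -/

/-- `c_{ξξ,ηη}` does not depend on the order of the differentiations in `x` and `y`. -/
theorem sndDeriv_sndDeriv_comm {n : ℕ} {c : E n → E n → ℝ} (hc : ContDiff ℝ 4 (Function.uncurry c))
    (x y ξ η : E n) :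
    sndDeriv (fun y' => sndDeriv (fun z => c z y') x ξ) y η =
      sndDeriv (fun x' => sndDeriv (fun z => c x' z) y η) x ξ := by
  set C := Function.uncurry c with hC
  -- `D u f` is the directional derivative of `f`
  set D : E n × E n → (E n × E n → ℝ) → E n × E n → ℝ := fun u f z => fderiv ℝ f z u with hD
  have hDc : ∀ {f : E n × E n → ℝ} {k : ℕ} (u : E n × E n), ContDiff ℝ (k + 1 : ℕ) f →
      ContDiff ℝ k (D u f) := fun u hf => contDiff_fderiv_apply hf u
  have hcomm : ∀ {f : E n × E n → ℝ} (u v : E n × E n), ContDiff ℝ 2 f →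
      D u (D v f) = D v (D u f) := fun u v hf => funext fun z => fderiv_apply_comm hf z v u
  have hsnd : ∀ {f : E n × E n → ℝ} (u z : E n × E n), ContDiff ℝ 2 f →
      sndDeriv f z u = D u (D u f) z := fun u z hf => sndDeriv_eq_fderiv hf z u
  have hc2 : ContDiff ℝ 2 C := hc.of_le two_le_four
  set a : E n × E n := (ξ, 0) with ha
  set b : E n × E n := (0, η) with hb
  have h3 : ∀ u, ContDiff ℝ 3 (D u C) := fun u => hDc (k := 3) u hc
  have h3' : ∀ u, ContDiff ℝ 2 (D u C) := fun u => (h3 u).of_le (by norm_num)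
  have h2 : ∀ u v, ContDiff ℝ 2 (D u (D v C)) := fun u v => hDc (k := 2) u (h3 v)
  have e1 : (fun y' => sndDeriv (fun z => c z y') x ξ) = fun y' => D a (D a C) (x, y') := by
    ext y'
    rw [← hsnd a (x, y') hc2]
    exact sndDeriv_slice_left hc2 x ξ y'
  have e2 : (fun x' => sndDeriv (fun z => c x' z) y η) = fun x' => D b (D b C) (x', y) := by
    ext x'
    rw [← hsnd b (x', y) hc2]
    exact sndDeriv_slice_right hc2 x' y η
  rw [e1, e2, sndDeriv_slice_right (F := D a (D a C)) (h2 a a),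
    sndDeriv_slice_left (F := D b (D b C)) (h2 b b), hsnd b _ (h2 a a), hsnd a _ (h2 b b)]
  rw [hcomm b a (h3' a), hcomm b a hc2, hcomm b a (h2 a b), hcomm b a (h3' b)]

theorem isClosed_setOf_exists_mem {α β : Type*} [TopologicalSpace α] [TopologicalSpace β]
    {K : Set β} (hK : IsCompact K) {R : Set (α × β)} (hR : IsClosed R) :
    IsClosed {x | ∃ y ∈ K, (x, y) ∈ R} := by
  rw [← isOpen_compl_iff, isOpen_iff_mem_nhds]
  intro x hx
  have h1 : ∀ y ∈ K, (x, y) ∉ R := fun y hy hR => hx ⟨y, hy, hR⟩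
  have h2 : ∀ᶠ x' in 𝓝 x, ∀ y ∈ K, (x', y) ∉ R :=
    hK.eventually_forall_of_forall_eventually fun y hy => hR.isOpen_compl.mem_nhds (h1 y hy)
  filter_upwards [h2] with x' hx' ⟨y, hy, hR⟩
  exact hx' y hy hR

/-- Convexity of the images of `Ω` passes to the closures, in both variables. -/
theorem convex_image_closure {n : ℕ} {c : E n → E n → ℝ} (hc : ContDiff ℝ 4 (Function.uncurry c))
    {Ω Ωs : Set (E n)} (hb : Bornology.IsBounded Ω) (h : IsCConvexDomain c Ω Ωs) {y : E n}
    (hy : y ∈ closure Ωs) : Convex ℝ ((fun x => cY c x y) '' closure Ω) := by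
  rintro _ ⟨x, hx, rfl⟩ _ ⟨x', hx', rfl⟩ a b ha hb' hab
  have hcY := continuous_cY hc
  have hcl : IsClosed {z : E n × E n × E n | ∃ w ∈ closure Ω, (z, w) ∈
      {q : (E n × E n × E n) × E n |
        cY c q.2 q.1.1 = a • cY c q.1.2.1 q.1.1 + b • cY c q.1.2.2 q.1.1}} := by
    refine isClosed_setOf_exists_mem hb.isCompact_closure (isClosed_eq ?_ ?_)
    · exact hcY.comp (continuous_snd.prodMk continuous_fst.fst)
    · exact ((hcY.comp (continuous_fst.snd.fst.prodMk continuous_fst.fst)).const_smul a).add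
        ((hcY.comp (continuous_fst.snd.snd.prodMk continuous_fst.fst)).const_smul b)
  have hsub : Ωs ×ˢ (Ω ×ˢ Ω) ⊆ {z : E n × E n × E n | ∃ w ∈ closure Ω, (z, w) ∈
      {q : (E n × E n × E n) × E n |
        cY c q.2 q.1.1 = a • cY c q.1.2.1 q.1.1 + b • cY c q.1.2.2 q.1.1}} := by
    rintro ⟨y, x, x'⟩ ⟨hy, hx, hx'⟩
    obtain ⟨w, hw, he⟩ := h y hy (mem_image_of_mem _ hx) (mem_image_of_mem _ hx') ha hb' hab
    exact ⟨w, subset_closure hw, he⟩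
  have hmem : (y, x, x') ∈ closure (Ωs ×ˢ (Ω ×ˢ Ω)) := by
    rw [closure_prod_eq, closure_prod_eq]
    exact ⟨hy, hx, hx'⟩
  obtain ⟨w, hw, he⟩ := closure_minimal hsub hcl hmem
  exact ⟨w, hw, he⟩

namespace Base

variable {n : ℕ} {c : E n → E n → ℝ} {Ω Ωs : Set (E n)} {φ φs : E n → ℝ}
  {X Y : E n × E n → E n} (S : Base c Ω Ωs φ φs X Y)

include S

/-- The tensor in A3w is symmetric in the two variables of the cost. -/
theorem sndDeriv_Aform_symm {x y : E n} (hx : x ∈ closure Ω) (hy : y ∈ closure Ωs) (v w : E n) :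
    sndDeriv (Aform c Y x (vel X y (cY c x y) v)) (cX c x y) w =
      sndDeriv (Aform (swapCost c) X y (vel Y x (cX c x y) w)) (cY c x y) v := by
  have hA : ∀ {c : E n → E n → ℝ} (_ : ContDiff ℝ 4 (Function.uncurry c)) (x ξ : E n),
      ContDiff ℝ 2 fun y' => sndDeriv (fun z => c z y') x ξ := fun hc x ξ =>
    (contDiff_sndDeriv_cost hc).comp (contDiff_const.prodMk (contDiff_const.prodMk contDiff_id))
  have h1 : sndDeriv (Aform c Y x (vel X y (cY c x y) v)) (cX c x y) w =
      sndDeriv (fun y' => sndDeriv (fun z => c z y') x (vel X y (cY c x y) v)) y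
        (vel Y x (cX c x y) w) - inner ℝ (cXY c x y (acc Y x (cX c x y) w))
          (acc X y (cY c x y) v) := by
    have h2 := S.swap.sndDeriv_comp_X (hA S.hc x (vel X y (cY c x y) v)) hy hx w
    have h3 := S.fderiv_sndDeriv_add_inner_acc hx hy v (acc Y x (cX c x y) w)
    refine h2.trans ?_
    change _ + fderiv ℝ _ y (acc Y x (cX c x y) w) = _
    rw [eq_sub_of_add_eq h3]
    change sndDeriv _ y (vel Y x (cX c x y) w) + _ = _
    ring
  have h1' : sndDeriv (Aform (swapCost c) X y (vel Y x (cX c x y) w)) (cY c x y) v =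
      sndDeriv (fun x' => sndDeriv (fun z => c x' z) y (vel Y x (cX c x y) w)) x
        (vel X y (cY c x y) v) - inner ℝ (cXY (swapCost c) y x (acc X y (cY c x y) v))
          (acc Y x (cX c x y) w) := by
    have h2 := S.sndDeriv_comp_X (hA S.snd.hc y (vel Y x (cX c x y) w)) hx hy v
    have h3 : fderiv ℝ (fun x' => sndDeriv (fun z => c x' z) y (vel Y x (cX c x y) w)) x
        (acc X y (cY c x y) v) + inner ℝ (cXY (swapCost c) y x (acc X y (cY c x y) v))
          (acc Y x (cX c x y) w) = 0 :=
      S.swap.fderiv_sndDeriv_add_inner_acc hy hx w (acc X y (cY c x y) v)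
    refine h2.trans ?_
    have h4 : fderiv ℝ (fun x' => sndDeriv (fun z => swapCost c z x') y (vel Y x (cX c x y) w)) x
        (acc X y (cY c x y) v) = _ := eq_sub_of_add_eq h3
    rw [h4]
    change sndDeriv (fun x' => sndDeriv (fun z => c x' z) y (vel Y x (cX c x y) w)) x _ + _ = _
    ring
  rw [h1, h1', sndDeriv_sndDeriv_comm S.hc, inner_cXY_swapCost S.hc]

/-- A3w on the open domains gives A3w up to the boundary. -/
theorem mtw_of_condA3w (h : CondA3w c Ω Ωs) : ∀ x ∈ closure Ω, ∀ y ∈ closure Ωs, ∀ ξ w : E n,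
    inner ℝ w ξ = 0 → 0 ≤ sndDeriv (Aform c Y x ξ) (cX c x y) w := by
  intro x hx y hy ξ w hwξ
  have hsl : ∀ x y, sndDeriv (Aform c Y x ξ) (cX c x y) w =
      sndDeriv (fun z : E n × E n × E n => Aform c Y z.2.1 z.1 z.2.2) (ξ, x, cX c x y)
        (0, 0, w) := by
    intro x y
    have h1 := sndDeriv_slice_right S.contDiff_Aform ξ (x, cX c x y) (0, w)
    have h2 := sndDeriv_slice_right (F := fun z : E n × E n => Aform c Y z.1 ξ z.2)
      (S.contDiff_Aform.comp (contDiff_mk_right ξ)) x (cX c x y) w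
    exact h2.trans h1
  have hcl : IsClosed {z : E n × E n | 0 ≤ sndDeriv (Aform c Y z.1 ξ) (cX c z.1 z.2) w} := by
    simp only [hsl]
    exact isClosed_le continuous_const ((continuous_sndDeriv S.contDiff_Aform).comp
      ((continuous_const.prodMk (continuous_fst.prodMk (continuous_cX S.hc))).prodMk
        continuous_const))
  have hsub : Ω ×ˢ Ωs ⊆ {z : E n × E n | 0 ≤ sndDeriv (Aform c Y z.1 ξ) (cX c z.1 z.2) w} := by
    rintro ⟨x, y⟩ ⟨hx, hy⟩
    have hx' := subset_closure hx
    have h1 := h x hx (cX c x y) (mem_image_of_mem _ hy) w ξ hwξ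
    rw [iteratedFDeriv_two_apply] at h1
    have h2 : (fun p' : E n => inner ℝ (Amat c x p' ξ) ξ) =ᶠ[𝓝 (cX c x y)] Aform c Y x ξ := by
      filter_upwards [S.eventually_cX_Y hx' (subset_closure hy)] with p hp
      have h3 : Ymap c x p = Y (x, p) := by
        conv_lhs => rw [← hp]
        exact Function.leftInverse_invFun (S.fst.inj x hx') _
      rw [Amat, h3, cXX, inner_hess_self ((contDiff_slice S.hc _).of_le two_le_four)]
      rfl
    have h4 := sndDeriv_congr h2 w
    unfold sndDeriv at h4
    change 0 ≤ sndDeriv (Aform c Y x ξ) (cX c x y) w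
    unfold sndDeriv
    rw [← h4]
    simpa using h1
  have hmem : (x, y) ∈ closure (Ω ×ˢ Ωs) := by rw [closure_prod_eq]; exact ⟨hx, hy⟩
  exact closure_minimal hsub hcl hmem

/-- A3w for the transposed cost. -/
theorem mtw_swap (h : ∀ x ∈ closure Ω, ∀ y ∈ closure Ωs, ∀ ξ w : E n,
    inner ℝ w ξ = 0 → 0 ≤ sndDeriv (Aform c Y x ξ) (cX c x y) w) :
    ∀ y ∈ closure Ωs, ∀ x ∈ closure Ω, ∀ ξ w : E n,
    inner ℝ w ξ = 0 → 0 ≤ sndDeriv (Aform (swapCost c) X y ξ) (cX (swapCost c) y x) w := by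
  intro y hy x hx ξ w hwξ
  have h1 := S.vel_cXY hx hy ξ
  have h2 := S.sndDeriv_Aform_symm hx hy w (cXY c x y ξ)
  rw [h1] at h2
  change 0 ≤ sndDeriv (Aform (swapCost c) X y ξ) (cY c x y) w
  rw [← h2]
  refine h x hx y hy _ _ ?_
  rw [real_inner_comm, S.inner_vel_vel hx hy, h1, hwξ]

/-- Uniform `c`-convexity in terms of the defining function, up to the boundary. -/
theorem curv_of_isUnif (h : IsUnifCConvexDomain c Ω Ωs) :
    ∃ κ : ℝ, 0 < κ ∧ ∀ x ∈ frontier Ω, ∀ y ∈ closure Ωs, ∀ v : E n,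
      fderiv ℝ (fun q => φ (X (y, q))) (cY c x y) v = 0 →
        κ * ‖v‖ ^ 2 ≤ sndDeriv (fun q => φ (X (y, q))) (cY c x y) v := by
  obtain ⟨δ, hδ, -, -, γ, hγ, hn, hcurv⟩ := h
  have hφ2 : ContDiff ℝ 2 φ := S.fst.defining.smooth.of_le two_le_four
  have hcf : IsCompact (frontier Ω) :=
    S.isCompact_fst.of_isClosed_subset isClosed_frontier frontier_subset_closure
  have hgrad : ∀ x ∈ frontier Ω, gradient φ x = ‖gradient φ x‖ • γ x := fun x hx =>
    (hn x hx).gradient_eq (S.fst.defining.differentiable x) (S.fst.defining.eventually x hx)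
      (S.fst.defining.eq_zero S.fst.isOpen hx)
  have hgpos : ∀ x ∈ frontier Ω, 0 < ‖gradient φ x‖ := fun x hx =>
    norm_pos_iff.2 (S.fst.defining.gradient_ne hx)
  -- near a boundary point the zeros of the defining function are boundary points
  have hzero : ∀ x ∈ frontier Ω, ∀ᶠ z in 𝓝 x, φ z = 0 →
      gradient φ z = ‖gradient φ z‖ • γ z ∧ ‖γ z‖ = 1 := by
    intro x hx
    have hne : ∀ᶠ z in 𝓝 x, gradient φ z ≠ 0 :=
      (continuous_gradient (hφ2.of_le (by norm_num))).continuousAt.eventually_ne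
        (S.fst.defining.gradient_ne hx)
    filter_upwards [eventually_eventually_nhds.2 (S.fst.defining.eventually x hx), hne]
      with z hz hzne hz0
    have hzf : z ∈ frontier Ω := by
      rw [S.fst.isOpen.frontier_eq]
      refine ⟨mem_closure_iff_frequently.2 fun hout => ?_, fun hzΩ =>
        absurd (hz.self_of_nhds.1 hzΩ) (by rw [hz0]; exact lt_irrefl 0)⟩
      have hmin : IsLocalMin φ z := by
        filter_upwards [hz, hout] with w h1 h2
        rw [hz0]
        exact not_lt.1 fun h3 => h2 (h1.2 h3)
      refine hzne (eq_gradient_iff.2 fun v => ?_)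
      rw [hmin.fderiv_eq_zero]
      simp
    exact ⟨hgrad z hzf, (hn z hzf).1⟩
  -- the condition on the normal field, for foci in the open domain, in terms of `φ`
  have hopen : ∀ x ∈ frontier Ω, ∀ y ∈ Ωs, ∀ v, ‖vel X y (cY c x y) v‖ = 1 →
      fderiv ℝ φ x (vel X y (cY c x y) v) = 0 →
      δ * ‖gradient φ x‖ ≤ sndDeriv φ x (vel X y (cY c x y) v) +
        fderiv ℝ φ x (acc X y (cY c x y) v) := by
    intro x hx y hy v hv1 hv0
    have hpos := hgpos x hx
    have hγx : γ x = ‖gradient φ x‖⁻¹ • gradient φ x := by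
      conv_rhs => rw [hgrad x hx]
      rw [norm_smul, (hn x hx).1, smul_smul]
      simp [hpos.ne']
    have h1 := S.curvature_eq (frontier_subset_closure hx) (subset_closure hy) hγx
      (inner_fderiv_normal hφ2 hγ (S.fst.defining.eq_zero S.fst.isOpen hx)
        (S.fst.defining.fderiv_ne x hx) (hzero x hx) hv0)
    have h2 := hcurv x hx y hy _ hv1 (by
      rw [hγx, inner_smul_right, real_inner_comm, inner_gradient, hv0, mul_zero])
    rw [h1] at h2
    have h3 := mul_le_mul_of_nonneg_right h2 hpos.le
    refine h3.trans (le_of_eq ?_)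
    field_simp
  -- for fixed tangent vector `τ` both sides are continuous in the focus
  have hclosed : ∀ x ∈ frontier Ω, ∀ y ∈ closure Ωs, ∀ v, ‖vel X y (cY c x y) v‖ = 1 →
      fderiv ℝ φ x (vel X y (cY c x y) v) = 0 →
      δ * ‖gradient φ x‖ ≤ sndDeriv φ x (vel X y (cY c x y) v) +
        fderiv ℝ φ x (acc X y (cY c x y) v) := by
    intro x hx y hy v hv1 hv0
    have hx' := frontier_subset_closure hx
    set τ := vel X y (cY c x y) v with hτ
    set W : E n → E n := fun y' => fderiv ℝ (fun z : E n × E n => cY c z.1 z.2) (x, y') (τ, 0)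
      with hW
    have hcYd := (contDiff_cY S.hc).differentiable (by norm_num)
    have hWeq : ∀ y', W y' = cXY (swapCost c) y' x τ := fun y' =>
      (fderiv_slice_left hcYd x τ y').symm
    have hWc : Continuous W := (((contDiff_cY S.hc).continuous_fderiv (by norm_num)).comp
      (contDiff_mk_right (k := 0) x).continuous).clm_apply continuous_const
    have hcl : IsClosed {y' | δ * ‖gradient φ x‖ ≤ sndDeriv φ x τ +
        fderiv ℝ φ x (acc X y' (cY c x y') (W y'))} := by
      refine isClosed_le continuous_const (continuous_const.add
        ((fderiv ℝ φ x).continuous.comp (S.swap.continuous_acc.comp (continuous_id.prodMk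
          (((continuous_cY S.hc).comp (contDiff_mk_right (k := 0) x).continuous).prodMk hWc)))))
    have hsub : Ωs ⊆ {y' | δ * ‖gradient φ x‖ ≤ sndDeriv φ x τ +
        fderiv ℝ φ x (acc X y' (cY c x y') (W y'))} := by
      intro y' hy'
      have h1 : vel X y' (cY c x y') (W y') = τ := by
        rw [hWeq]
        exact S.swap.vel_cXY (subset_closure hy') hx' τ
      have h2 := hopen x hx y' hy' (W y') (by rw [h1]; exact hv1) (by rw [h1]; exact hv0)
      rw [h1] at h2
      exact h2
    have h3 := closure_minimal hsub hcl hy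
    have h4 : W y = v := by
      rw [hWeq]
      exact S.swap.cXY_vel hy hx' v
    simp only [mem_ofPred_eq, h4] at h3
    exact h3
  obtain ⟨g₀, hg₀, hgle⟩ := hcf.exists_forall_le' (f := fun x => ‖gradient φ x‖)
    (continuous_gradient (hφ2.of_le (by norm_num))).norm.continuousOn (a := 0) hgpos
  have hvc : Continuous fun z : (E n × E n) × E n => ‖vel X z.1.2 (cY c z.1.1 z.1.2) z.2‖ :=
    (S.swap.continuous_vel.comp (continuous_fst.snd.prodMk
      (((continuous_cY S.hc).comp continuous_fst).prodMk continuous_snd))).norm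
  -- the velocity is uniformly bounded below on unit vectors
  obtain ⟨m₀, hm₀, hmle⟩ := ((hcf.prod S.isCompact_snd).prod
    (isCompact_sphere (0 : E n) 1)).exists_forall_le' hvc.continuousOn (a := 0) (by
      rintro ⟨⟨x, y⟩, v⟩ ⟨⟨hx, hy⟩, hv⟩
      refine norm_pos_iff.2 fun h0 => ?_
      have hv0 : v = 0 := S.swap.vel_eq_zero hy (frontier_subset_closure hx) h0
      rw [hv0] at hv
      simp at hv)
  refine ⟨δ * g₀ * m₀ ^ 2, by positivity, fun x hx y hy v hv => ?_⟩
  have hx' := frontier_subset_closure hx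
  rw [S.fderiv_comp_X hφ2 hx' hy] at hv
  rw [S.sndDeriv_comp_X hφ2 hx' hy]
  rcases eq_or_ne v 0 with rfl | hv0
  · simp [vel, acc, sndDeriv_zero]
  have hvn : 0 < ‖v‖ := norm_pos_iff.2 hv0
  have h1 := hmle ((x, y), ‖v‖⁻¹ • v) ⟨⟨hx, hy⟩, by simp [norm_smul, hvn.ne']⟩
  simp only [vel_smul, norm_smul, norm_inv, norm_norm] at h1
  set τ := vel X y (cY c x y) v with hτ
  have h2 : m₀ * ‖v‖ ≤ ‖τ‖ := by
    rw [inv_mul_eq_div, le_div_iff₀ hvn] at h1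
    exact h1
  have hτn : 0 < ‖τ‖ := lt_of_lt_of_le (by positivity) h2
  have h3 := hclosed x hx y hy (‖τ‖⁻¹ • v) (by
    rw [vel_smul, ← hτ, norm_smul]; simp [hτn.ne']) (by
    rw [vel_smul, ← hτ, map_smul, hv, smul_zero])
  rw [vel_smul, acc_smul, sndDeriv_smul, map_smul, ← hτ, smul_eq_mul, smul_eq_mul, ← mul_add,
    inv_pow, inv_mul_eq_div, le_div_iff₀ (by positivity)] at h3
  refine le_trans ?_ h3
  have h4 : (m₀ * ‖v‖) ^ 2 ≤ ‖τ‖ ^ 2 := by gcongr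
  calc δ * g₀ * m₀ ^ 2 * ‖v‖ ^ 2 = δ * g₀ * (m₀ * ‖v‖) ^ 2 := by ring
    _ ≤ δ * ‖gradient φ x‖ * ‖τ‖ ^ 2 := by
      gcongr
      exact hgle x hx

end Base

/-! ### The data of the problem from the hypotheses -/

section Hypotheses

variable {n : ℕ} {c : E n → E n → ℝ} {Ω Ωs : Set (E n)}

/-- The hypotheses on the cost and the domains provide defining functions and inverse maps. -/
theorem exists_setup {U : Set (E n)} (hc : ContDiff ℝ 4 (Function.uncurry c)) (hΩ : IsBddDomain Ω)
    (hΩ4 : HasBoundaryOfClass 4 Ω) (hΩs : IsBddDomain Ωs) (hΩs4 : HasBoundaryOfClass 4 Ωs)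
    (hΩU : closure Ω ⊆ U) (hA1 : CondA1 c U (closure Ωs)) (hA2 : CondA2 c Ω Ωs)
    (hA3w : CondA3w c Ω Ωs) (hconv : IsUnifCConvexDomain c Ω Ωs)
    (hconvs : IsUnifCConvexDomain (swapCost c) Ωs Ω) :
    ∃ (φ φs : E n → ℝ) (X Y : E n × E n → E n), Setup c Ω Ωs φ φs X Y := by
  have hcs : ContDiff ℝ 4 (Function.uncurry (swapCost c)) := contDiff_swapCost hc
  have hK := hΩ.2.2.isCompact_closure
  have hL := hΩs.2.2.isCompact_closure
  obtain ⟨φ, hφ⟩ : ∃ φ, IsDefining Ω φ := by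
    obtain ⟨_, -, -, -, γ, -, hn, -⟩ := hconv
    exact exists_isDefining hΩ.1 hΩ.2.2 hΩ4 hn
  obtain ⟨φs, hφs⟩ : ∃ φ, IsDefining Ωs φ := by
    obtain ⟨_, -, -, -, γ, -, hn, -⟩ := hconvs
    exact exists_isDefining hΩs.1 hΩs.2.2 hΩs4 hn
  have hinj : ∀ x ∈ closure Ω, Function.Injective (cX c x) := fun x hx y y' h =>
    (hA1.1 x (hΩU hx) (cX c x y')).unique h rfl
  have hinjs : ∀ y ∈ closure Ωs, Function.Injective (cX (swapCost c) y) := fun y hy x x' h =>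
    (hA1.2 y hy (cY c x' y)).unique h rfl
  have hequiv : ∀ x ∈ closure Ω, ∀ y ∈ closure Ωs, ∃ e : E n ≃L[ℝ] E n,
      ∀ v, e v = cXY c x y v := fun x hx y hy =>
    ⟨(cXY c x y).toContinuousLinearEquivOfDetNeZero (hA2 x hx y hy), fun v => rfl⟩
  have hnd : ∀ x ∈ closure Ω, ∀ y ∈ closure Ωs, ∀ η, cXY c x y η = 0 → η = 0 := by
    intro x hx y hy η h0
    obtain ⟨e, he⟩ := hequiv x hx y hy
    rw [← he] at h0
    exact (map_eq_zero_iff e e.injective).1 h0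
  have hnds : ∀ y ∈ closure Ωs, ∀ x ∈ closure Ω, ∀ η, cXY (swapCost c) y x η = 0 → η = 0 := by
    intro y hy x hx η h0
    obtain ⟨e, he⟩ := hequiv x hx y hy
    have h1 := inner_cXY_swapCost hc x y η (e.symm η)
    rw [h0, inner_zero_left, ← he, e.apply_symm_apply] at h1
    exact inner_self_eq_zero.1 h1.symm
  obtain ⟨Y, hY, hYl, hYr⟩ := exists_inverse_cX hc hK hL hinj hnd
  obtain ⟨X, hX, hXl, hXr⟩ := exists_inverse_cX hcs hL hK hinjs hnds
  have hB : Base c Ω Ωs φ φs X Y :=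
    ⟨⟨hc, hΩ.1, hΩ.2.1, hΩ.2.2, hφ, hinj, hnd, hY, hYl, hYr⟩,
      ⟨hcs, hΩs.1, hΩs.2.1, hΩs.2.2, hφs, hinjs, hnds, hX, hXl, hXr⟩⟩
  have hmtw := hB.mtw_of_condA3w hA3w
  refine ⟨φ, φs, X, Y, hB, ⟨hmtw, fun y hy => ?_, hB.curv_of_isUnif hconv⟩,
    ⟨hB.mtw_swap hmtw, fun x hx => ?_, hB.swap.curv_of_isUnif hconvs⟩⟩
  · obtain ⟨_, -, h, -⟩ := hconv
    exact convex_image_closure hc hΩ.2.2 h hy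
  · obtain ⟨_, -, h, -⟩ := hconvs
    exact convex_image_closure hcs hΩs.2.2 h hx

/-- The conditions on a start function extend to the boundary of `Ω`. -/
theorem IsStartFunction.isSubsolution {V : Set (E n)} {u : E n → ℝ}
    (hc : ContDiff ℝ 4 (Function.uncurry c)) (hΩs : IsBddDomain Ωs)
    (hA1 : CondA1 c V (closure Ωs)) (hΩV : closure Ω ⊆ V) (hu : IsStartFunction c Ω Ωs u) :
    IsSubsolution c Ω Ωs u := by
  have hu4 : ContDiff ℝ 4 u := contDiff_infty.1 hu.smooth 4
  have hu2 : ContDiff ℝ 2 u := hu4.of_le two_le_four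
  refine ⟨hu4, ?_⟩
  set K := closure (Tmap c u '' Ω) with hK
  have hKc : IsCompact K := hΩs.2.2.isCompact_closure.of_isClosed_subset isClosed_closure
    (hu.image_closure_subset.trans subset_closure)
  have hR : IsClosed {z : E n × E n | gradient u z.1 = cX c z.1 z.2 ∧
      ∀ ξ, sndDeriv (fun w => c w z.2) z.1 ξ ≤ sndDeriv u z.1 ξ} := by
    have h1 : IsClosed {z : E n × E n | gradient u z.1 = cX c z.1 z.2} :=
      isClosed_eq ((continuous_gradient (hu2.of_le (by norm_num))).comp continuous_fst)
        (continuous_cX hc)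
    have h2 : ∀ ξ, IsClosed {z : E n × E n |
        sndDeriv (fun w => c w z.2) z.1 ξ ≤ sndDeriv u z.1 ξ} := fun ξ =>
      isClosed_le ((contDiff_sndDeriv_cost hc).continuous.comp
        (continuous_const.prodMk (continuous_fst.prodMk continuous_snd)))
        ((continuous_sndDeriv hu2).comp (continuous_fst.prodMk continuous_const))
    have h3 := h1.inter (isClosed_iInter h2)
    convert h3 using 1
    ext z
    simp
  have hcl := isClosed_setOf_exists_mem hKc hR
  have hsub : Ω ⊆ {x | ∃ y ∈ K, (x, y) ∈ {z : E n × E n | gradient u z.1 = cX c z.1 z.2 ∧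
      ∀ ξ, sndDeriv (fun w => c w z.2) z.1 ξ ≤ sndDeriv u z.1 ξ}} := by
    intro x hx
    have hinv : cX c x (Tmap c u x) = gradient u x :=
      Function.invFun_eq (hA1.1 x (hΩV (subset_closure hx)) (gradient u x)).exists
    refine ⟨Tmap c u x, subset_closure (mem_image_of_mem _ hx), hinv.symm, fun ξ => ?_⟩
    rcases eq_or_ne ξ 0 with rfl | hξ
    · simp [sndDeriv_zero]
    have h1 := hu.elliptic x hx ξ hξ
    rw [_root_.sub_apply, inner_sub_left, inner_hess_self hu2, sub_pos, Amat, cXX,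
      inner_hess_self ((contDiff_slice hc _).of_le two_le_four)] at h1
    exact h1.le
  intro x hx
  obtain ⟨y, hy, h1, h2⟩ := closure_minimal hsub hcl hx
  exact ⟨y, hu.image_closure_subset hy, h1, h2⟩

end Hypotheses

end OptTrans

theorem lemma7p1 (n : ℕ) (c : OptTrans.E n → OptTrans.E n → ℝ)
    (hc : ContDiff ℝ 4 (Function.uncurry c))
    (Ω Ωs U : Set (OptTrans.E n))
    (hΩ : OptTrans.IsBddDomain Ω) (hΩ4 : OptTrans.HasBoundaryOfClass 4 Ω)
    (hΩs : OptTrans.IsBddDomain Ωs) (hΩs4 : OptTrans.HasBoundaryOfClass 4 Ωs)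
    (hU : IsOpen U) (hΩU : closure Ω ⊆ U)
    (hA1 : OptTrans.CondA1 c U (closure Ωs))
    (hA2 : OptTrans.CondA2 c Ω Ωs)
    (hA3w : OptTrans.CondA3w c Ω Ωs)
    (hconv : OptTrans.IsUnifCConvexDomain c Ω Ωs)
    (hconvs : OptTrans.IsUnifCConvexDomain (OptTrans.swapCost c) Ωs Ω) :
    -- the supremum `u₁` of `u₀` and the admissible `c`-functions
    (∀ u₀ : OptTrans.E n → ℝ, OptTrans.IsStartFunction c Ω Ωs u₀ →
      ∃ δ₀ : ℝ, 0 < δ₀ ∧ ∀ δ : ℝ, 0 < δ → δ ≤ δ₀ →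
        (∀ x ∈ Metric.thickening δ Ω,
          IsLUB (OptTrans.envelopeValues c Ω Ωs u₀ x) (OptTrans.envelope c Ω Ωs u₀ x)) ∧
        OptTrans.IsCConvexOn c (Metric.thickening δ Ω) (OptTrans.envelope c Ω Ωs u₀) ∧
        Set.EqOn (OptTrans.envelope c Ω Ωs u₀) u₀ (closure Ω) ∧
        (⋃ x ∈ Metric.thickening δ Ω,
          OptTrans.cNormal c (Metric.thickening δ Ω) (OptTrans.envelope c Ω Ωs u₀) x)
            = closure Ωs ∧
        ∃ xb yb : OptTrans.E n → OptTrans.E n,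
          (∀ x ∈ Metric.thickening δ Ω \ closure Ω,
            xb x ∈ frontier Ω ∧ yb x ∈ frontier Ωs ∧
            OptTrans.IsRayTo c (Metric.thickening δ Ω) (OptTrans.envelope c Ω Ωs u₀)
              x (xb x) (yb x) ∧
            ∀ x' ∈ frontier Ω, ∀ y' ∈ frontier Ωs,
              OptTrans.IsRayTo c (Metric.thickening δ Ω) (OptTrans.envelope c Ω Ωs u₀)
                x x' y' → x' = xb x ∧ y' = yb x) ∧
          ∀ r : ℝ, 0 < r → r < δ →
            OptTrans.IsDiffeoOn 2 xb (frontier (Metric.thickening r Ω)) (frontier Ω) ∧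
            OptTrans.IsDiffeoOn 2 yb (frontier (Metric.thickening r Ω)) (frontier Ωs)) ∧
    -- smooth uniformly `c`-convex functions for approximating target domains
    (∃ δ₁ : ℝ, 0 < δ₁ ∧ ∀ ε : ℝ, 0 < ε →
      ∃ (Ωε : Set (OptTrans.E n)) (u : OptTrans.E n → ℝ),
        OptTrans.IsBddDomain Ωε ∧
        OptTrans.IsUnifCConvexDomainWith δ₁ (OptTrans.swapCost c) Ωε Ω ∧
        Ωε ⊆ Metric.thickening ε Ωs ∧ Ωs ⊆ Metric.thickening ε Ωε ∧
        ContDiff ℝ (⊤ : ℕ∞) u ∧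
        OptTrans.IsCConvexOn c Ω u ∧
        OptTrans.IsEllipticOn c (closure Ω) u ∧
        OptTrans.Tmap c u '' Ω = Ωε) := by
  obtain ⟨φ, φs, X, Y, S⟩ :=
    OptTrans.exists_setup hc hΩ hΩ4 hΩs hΩs4 hΩU hA1 hA2 hA3w hconv hconvs
  exact ⟨fun u₀ hu₀ => S.envelope_properties (hu₀.isSubsolution hc hΩs hA1 hΩU) hU hΩU
    fun x hx y y' h => (hA1.1 x hx (OptTrans.cX c x y')).unique h rfl, S.exists_approximation⟩
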